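/- A metric space $X$ is said to satisfy the dual Andreev conditions if it is homeomorphic to the sphere $\mathbf{S}^2$ and admits a triangulation with the following properties. The triangulation is a finite simplicial complex (two distinct triangles are disjoint or meet exactly in a common vertex or a common edge), its triangles are nondegenerate convex spherical triangles (in the unit sphere) glued isometrically along their edges, the metric of $X$ is the induced intrinsic metric (the infimum of the lengths of broken lines), the triangulation is not the boundary of a tetrahedron, and: 1. all edge lengths lie in $[\pi/2,\pi)$; 2. every closed geodesic of $X$ that is composed of three or four edges of the triangulation has length $>2\pi$; 3. the following configuration does not occur: a vertex $v$ surrounded by exactly four triangles $vab$, $vbc$, $vcd$, $vda$, in which the four edges $ab,bc,cd,da$ and the two opposite edges $va,vc$ all have length $\pi/2$. Here a closed geodesic of length $L>0$ is a closed curve of length $L$, parametrized by arc length, that is locally distance-realizing: an $L$-periodic map $\gamma:\mathbf{R}\to X$ such that every $t\in\mathbf{R}$ has a neighbourhood on which $d(\gamma(s),\gamma(s'))=|s-s'|$. **Proposition.** If $X$ is a metric space satisfying the dual Andreev conditions, then every closed geodesic in $X$ has length $>2\pi$. -/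

import Mathlib

open Real Set
open scoped NNReal

/-- Euclidean 3-space, whose unit sphere is the model of the round sphere of curvature `1`. -/
abbrev E3 : Type := EuclideanSpace ℝ (Fin 3)

/-- The spherical convex hull of a set of vectors: the unit vectors that are nonnegative linear
combinations of elements of `s`.  For three linearly independent unit vectors this is the
(nondegenerate) convex spherical triangle with these vertices, for two of them it is the shortest
great-circle arc joining them. -/
def sphericalHull (s : Set E3) : Set E3 :=
  {x | ‖x‖ = 1 ∧ x ∈ Submodule.span ℝ≥0 s}

/-- The distance of two unit vectors on the unit sphere: the angle between them. -/
noncomputable def sphericalDist (x y : E3) : ℝ := InnerProductGeometry.angle x y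

open Classical in
/-- The combinatorial and geometric data that exhibit a space `X` as a closed surface glued from
finitely many convex spherical triangles.  The triangles are the cells of a finite simplicial
complex; a face is recorded by its three vertices, which are points of `X`. -/
structure SphericalGluing (X : Type*) where
  /-- The faces, each given by its set of vertices. -/
  faces : Finset (Finset X)
  /-- The closed triangle of `X` that belongs to a face. -/
  cell : Finset X → Set X
  /-- The identification of the closed triangle with a triangle of the unit sphere (only its
  values on `cell T` matter). -/
  chart : Finset X → X → E3
  card_face : ∀ T ∈ faces, T.card = 3
  vertex_mem_cell : ∀ T ∈ faces, (T : Set X) ⊆ cell T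
  norm_chart_vertex : ∀ T ∈ faces, ∀ v ∈ T, ‖chart T v‖ = 1
  linearIndependent_chart : ∀ T ∈ faces, LinearIndependent ℝ (fun v : T => chart T v)
  chart_bijOn : ∀ T ∈ faces,
    Set.BijOn (chart T) (cell T) (sphericalHull (chart T '' (T : Set X)))
  /-- The triangles cover the space. -/
  cover : ∀ x : X, ∃ T ∈ faces, x ∈ cell T
  /-- Two triangles meet exactly in the simplex spanned by their common vertices (in the empty set
  if there are none). -/
  cell_inter : ∀ T ∈ faces, ∀ T' ∈ faces, cell T ∩ cell T' =
    {x ∈ cell T | chart T x ∈ sphericalHull (chart T '' ((T : Set X) ∩ (T' : Set X)))}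
  /-- The triangles are glued isometrically along their common simplices. -/
  chart_compat : ∀ T ∈ faces, ∀ T' ∈ faces, ∀ x ∈ cell T ∩ cell T', ∀ y ∈ cell T ∩ cell T',
    sphericalDist (chart T x) (chart T y) = sphericalDist (chart T' x) (chart T' y)
  /-- Closed surface: the triangles are glued in pairs along their edges. -/
  edge_two : ∀ T ∈ faces, ∀ v ∈ T, ∀ w ∈ T, v ≠ w →
    (faces.filter (fun T' => v ∈ T' ∧ w ∈ T')).card = 2
  /-- Closed surface: the triangles around a vertex form a single cycle, that is, any two of them
  are connected through triangles at this vertex that successively share an edge. -/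
  star_connected : ∀ v : X, ∀ T ∈ faces, ∀ T' ∈ faces, v ∈ T → v ∈ T' →
    Relation.ReflTransGen
      (fun S S' : Finset X => S' ∈ faces ∧ v ∈ S' ∧ (S ∩ S').card = 2) T T'

namespace SphericalGluing

variable {X : Type*}

/-- `𝒯.IsChain x y ℓ`: there is a broken line of length `ℓ` from `x` to `y`, composed of finitely
many great-circle arcs, each contained in a single triangle. -/
inductive IsChain (𝒯 : SphericalGluing X) : X → X → ℝ → Prop
  | nil (x : X) : IsChain 𝒯 x x 0
  | cons (T : Finset X) (x y z : X) (ℓ : ℝ) (hT : T ∈ 𝒯.faces) (hx : x ∈ 𝒯.cell T)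
      (hy : y ∈ 𝒯.cell T) (h : IsChain 𝒯 y z ℓ) :
      IsChain 𝒯 x z (sphericalDist (𝒯.chart T x) (𝒯.chart T y) + ℓ)

/-- The metric of `X` is the intrinsic metric of the glued space: the distance of two points is the
infimum of the lengths of the broken lines joining them (in particular `X` is connected). -/
def IsIntrinsic (𝒯 : SphericalGluing X) [MetricSpace X] : Prop :=
  ∀ x y : X, IsGLB {ℓ : ℝ | 𝒯.IsChain x y ℓ} (dist x y)

/-- The edge of the face `T` with endpoints `v` and `w`, as a subset of `X`. -/
def edge (𝒯 : SphericalGluing X) (T : Finset X) (v w : X) : Set X :=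
  {x ∈ 𝒯.cell T | 𝒯.chart T x ∈ sphericalHull {𝒯.chart T v, 𝒯.chart T w}}

/-- `𝒯.EdgeLengthEq v w ℓ`: `v` and `w` are the endpoints of an edge of the triangulation, and this
edge has length `ℓ`. -/
def EdgeLengthEq (𝒯 : SphericalGluing X) (v w : X) (ℓ : ℝ) : Prop :=
  v ≠ w ∧ ∃ T ∈ 𝒯.faces, v ∈ T ∧ w ∈ T ∧ sphericalDist (𝒯.chart T v) (𝒯.chart T w) = ℓ

/-- The triangulation is the boundary of a tetrahedron. -/
def IsSimplex (𝒯 : SphericalGluing X) : Prop :=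
  ∃ s : Finset X, s.card = 4 ∧ 𝒯.faces = s.powersetCard 3

open Classical in
/-- The forbidden configuration: a vertex `v` with exactly four triangles `vab`, `vbc`, `vcd`, `vda`
around it, such that the four edges opposite to `v` and the two opposite edges `va`, `vc` all have
length `π / 2`. -/
def HasForbiddenConfiguration (𝒯 : SphericalGluing X) : Prop :=
  ∃ v a b c d : X, a ≠ c ∧ b ≠ d ∧
    𝒯.faces.filter (fun T => v ∈ T) = {{v, a, b}, {v, b, c}, {v, c, d}, {v, d, a}} ∧
    𝒯.EdgeLengthEq a b (π / 2) ∧ 𝒯.EdgeLengthEq b c (π / 2) ∧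
    𝒯.EdgeLengthEq c d (π / 2) ∧ 𝒯.EdgeLengthEq d a (π / 2) ∧
    𝒯.EdgeLengthEq v a (π / 2) ∧ 𝒯.EdgeLengthEq v c (π / 2)

/-- The closed curve `γ` of period `L` is composed of `k` successive edges of the triangulation. -/
def IsComposedOfEdges (𝒯 : SphericalGluing X) (k : ℕ) (γ : ℝ → X) (L : ℝ) : Prop :=
  ∃ t : ℕ → ℝ, t k = t 0 + L ∧ ∀ i < k, t i < t (i + 1) ∧
    ∃ T ∈ 𝒯.faces, ∃ v ∈ T, ∃ w ∈ T, v ≠ w ∧ γ (t i) = v ∧ γ (t (i + 1)) = w ∧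
      γ '' Icc (t i) (t (i + 1)) = 𝒯.edge T v w

end SphericalGluing

/-- A closed geodesic of length `L` in a metric space: a closed curve of length `L`, parametrized by
arc length, which is locally distance-realizing (also at its base point). -/
def IsClosedGeodesic {X : Type*} [MetricSpace X] (γ : ℝ → X) (L : ℝ) : Prop :=
  0 < L ∧ Function.Periodic γ L ∧
    ∀ t : ℝ, ∃ ε > 0, ∀ s ∈ Ioo (t - ε) (t + ε), ∀ s' ∈ Ioo (t - ε) (t + ε),
      dist (γ s) (γ s') = |s - s'|

/-- The dual Andreev conditions for a metric space `X` (a piecewise spherical metric on the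
2-sphere). -/
def SatisfiesDualAndreev (X : Type*) [MetricSpace X] : Prop :=
  Nonempty (X ≃ₜ Metric.sphere (0 : E3) 1) ∧
  ∃ 𝒯 : SphericalGluing X, 𝒯.IsIntrinsic ∧ ¬ 𝒯.IsSimplex ∧
    (∀ v w : X, ∀ ℓ : ℝ, 𝒯.EdgeLengthEq v w ℓ → π / 2 ≤ ℓ ∧ ℓ < π) ∧
    (∀ k : ℕ, k = 3 ∨ k = 4 → ∀ (γ : ℝ → X) (L : ℝ),
      IsClosedGeodesic γ L → 𝒯.IsComposedOfEdges k γ L → 2 * π < L) ∧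
    ¬ 𝒯.HasForbiddenConfiguration

open Filter Topology
open Classical


/-! ### Trigonometric inequalities -/

/-! All edges have length at least `π / 2`, so different vertices of a face have nonpositive inner
product. Two things follow: the open ball of radius `π / 2` around a vertex, its hemisphere, lies in
the open star of that vertex (`LongEdges.mem_of_ip_pos`), and the hemispheres cover `X`
(`exists_ip_pos`). Along a geodesic, the cosine of the distance to a vertex is locally a sinusoid
wherever it is positive. Hence each visit to a hemisphere occupies a parameter interval of length
exactly `π` around some center (`Arc`). Suppose a closed geodesic has length `L ≤ 2π`. Choosing
successively the interval with the last center leaves two essential cases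
(`two_pi_lt_of_isLocalGeodesic`): three vertices whose centers follow cyclically at distances less
than `π`, or `L = 2π` and four vertices whose centers follow at distances `t`, `π - t`, `t`, `π -
t`.

The first ingredient is that the total angle at every vertex exceeds `2π`
(`LinkCycle.two_pi_lt_total`). By the law of cosines every angle of a face is at least `π / 2`, so
only degrees three and four matter. In degree four a total of at most `2π` forces the forbidden
configuration. In degree three, either the triangulation is the boundary of a tetrahedron, or the
three neighbours form a cycle of edges longer than `2π`; the latter contradicts the perimeter
estimate `perimeter_le_of_angles_le` if the total is at most `2π`. Here, and again below, a cycle of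
three or four edges in which consecutive edges never share a face is a closed geodesic
(`Tri.onEdge_dist_corner`), hence longer than `2π` (`LongEdgeCycles.two_pi_lt`).

The second ingredient is a comparison with the sphere. The geodesic is developed onto a great
circle; a vertex sits at some height over it, and the edge to the next vertex projects to an arc
whose length is the difference of the two centers (`EdgeOver`). So `L` is the sum of the projected
lengths. The angles between edges and perpendiculars are controlled by the total angle at the
vertex, or by the number of faces between the two edges.

For three vertices that do not span a face, the cycle of edges is longer than `2π`, and this passes
to the projections (`two_pi_lt_of_not_face`). For three vertices of a face, the angle left outside
the face is large enough to force the same conclusion (`two_pi_lt_of_face`). For four vertices with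
no three in a common face, all four edges turn out to have length `π / 2`, so their cycle has length
`2π`, a contradiction. If two faces fill the quadrilateral, `false_of_two_faces` applies; if only
one face `v₁ v₂ v₃` is present, then `v₁ v₃ v₄` is a cycle with two edges of length `π / 2`, and the
third would have to be longer than `π`. -/

theorem cos_le_cos_add_of_sum_ge {x y z : ℝ} (hz0 : 0 ≤ z) (hz : z ≤ π) (hxy : π ≤ x + y)
    (h : x + y + z ≤ 2 * π) : cos (x + y) ≤ cos z := by
  rw [← cos_two_pi_sub (x + y)]
  exact cos_le_cos_of_nonneg_of_le_pi hz0 (by linarith) (by linarith)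

theorem cos_lt_cos_add_of_sum_gt {x y z : ℝ} (hz : z ≤ π) (hxy2 : x + y ≤ 2 * π)
    (h : 2 * π < x + y + z) : cos z < cos (x + y) := by
  rw [← cos_two_pi_sub (x + y)]
  exact cos_lt_cos_of_nonneg_of_le_pi (by linarith) hz (by linarith)

/-- Three unit vectors whose "horizontal parts" have lengths `cᵢ` and span angles of total at most
`2 π` have mutual distances of total at most `2 π`. -/
theorem perimeter_le_of_angles_le {c₁ c₂ c₃ k₁₂ k₂₃ k₃₁ t₁₂ t₂₃ t₃₁ d₁₂ d₂₃ d₃₁ : ℝ}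
    (hc₁ : 0 ≤ c₁) (hc₂ : 0 ≤ c₂)
    (hQ : ∀ x₁ x₂ x₃ : ℝ, 0 ≤ x₁ → 0 ≤ x₂ → 0 ≤ x₃ →
      0 ≤ (1 - c₁ ^ 2) * x₁ ^ 2 + (1 - c₂ ^ 2) * x₂ ^ 2 + (1 - c₃ ^ 2) * x₃ ^ 2
        + 2 * k₁₂ * x₁ * x₂ + 2 * k₂₃ * x₂ * x₃ + 2 * k₃₁ * x₃ * x₁)
    (e₁₂ : cos d₁₂ = c₁ * c₂ * cos t₁₂ + k₁₂) (e₂₃ : cos d₂₃ = c₂ * c₃ * cos t₂₃ + k₂₃)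
    (e₃₁ : cos d₃₁ = c₃ * c₁ * cos t₃₁ + k₃₁)
    (ht₀ : 0 ≤ t₁₂) (htπ : t₁₂ ≤ π) (ht : π ≤ t₂₃ + t₃₁) (hsum : t₁₂ + t₂₃ + t₃₁ ≤ 2 * π)
    (hd₁₂ : d₁₂ ≤ π) (hd₂₃ : π / 2 ≤ d₂₃) (hd₂₃' : d₂₃ < π) (hd₃₁ : π / 2 ≤ d₃₁)
    (hd₃₁' : d₃₁ < π) : d₁₂ + d₂₃ + d₃₁ ≤ 2 * π := by
  by_contra! hcon
  have hlt : cos d₁₂ < cos (d₂₃ + d₃₁) :=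
    cos_lt_cos_add_of_sum_gt hd₁₂ (by linarith) (by linarith)
  have hle : cos (t₂₃ + t₃₁) ≤ cos t₁₂ :=
    cos_le_cos_add_of_sum_ge ht₀ htπ ht (by linarith)
  have hx₁ : 0 < sin d₂₃ := sin_pos_of_pos_of_lt_pi (by linarith [pi_pos]) hd₂₃'
  have hx₂ : 0 < sin d₃₁ := sin_pos_of_pos_of_lt_pi (by linarith [pi_pos]) hd₃₁'
  have hx₃ : 0 ≤ - sin (d₂₃ + d₃₁) := by
    have : 0 ≤ sin (d₂₃ + d₃₁ - π) :=
      sin_nonneg_of_nonneg_of_le_pi (by linarith) (by linarith)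
    rwa [sin_sub_pi] at this
  have h0 := hQ _ _ _ hx₁.le hx₂.le hx₃
  set x₁ := sin d₂₃ with hx₁d
  set x₂ := sin d₃₁ with hx₂d
  -- The weights are the linear relation between three unit vectors on one great circle with
  -- distances `d₂₃`, `d₃₁` and `2π - d₂₃ - d₃₁`, so their Gram form vanishes at these weights.
  have hneg : x₁ ^ 2 + x₂ ^ 2 + (- sin (d₂₃ + d₃₁)) ^ 2 + 2 * x₁ * x₂ * cos (d₂₃ + d₃₁)
      + 2 * x₂ * (- sin (d₂₃ + d₃₁)) * cos d₂₃ + 2 * x₁ * (- sin (d₂₃ + d₃₁)) * cos d₃₁ = 0 := by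
    rw [sin_add, cos_add, ← hx₁d, ← hx₂d]
    have a1 : cos d₂₃ ^ 2 = 1 - x₁ ^ 2 := by rw [hx₁d]; exact cos_sq' _
    have a2 : cos d₃₁ ^ 2 = 1 - x₂ ^ 2 := by rw [hx₂d]; exact cos_sq' _
    ring_nf
    rw [a1, a2]; ring
  set x₃ := - sin (d₂₃ + d₃₁) with hx₃d
  -- The Gram form of three plane vectors of lengths `cᵢ * xᵢ` spanning the angles `t₂₃` and `t₃₁`.
  -- Replacing `t₂₃ + t₃₁` by `t₁₂` only increases it, while replacing `d₂₃ + d₃₁` by `d₁₂` strictly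
  -- decreases the vanishing form above.
  have hpos : 0 ≤ (c₁ * x₁) ^ 2 + (c₂ * x₂) ^ 2 + (c₃ * x₃) ^ 2
      + 2 * (c₁ * x₁) * (c₂ * x₂) * cos (t₂₃ + t₃₁)
      + 2 * (c₂ * x₂) * (c₃ * x₃) * cos t₂₃ + 2 * (c₁ * x₁) * (c₃ * x₃) * cos t₃₁ := by
    have e : (c₁ * x₁) ^ 2 + (c₂ * x₂) ^ 2 + (c₃ * x₃) ^ 2
      + 2 * (c₁ * x₁) * (c₂ * x₂) * cos (t₂₃ + t₃₁)
      + 2 * (c₂ * x₂) * (c₃ * x₃) * cos t₂₃ + 2 * (c₁ * x₁) * (c₃ * x₃) * cos t₃₁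
      = (c₃ * x₃ + c₁ * x₁ * cos t₃₁ + c₂ * x₂ * cos t₂₃) ^ 2
        + (c₁ * x₁ * sin t₃₁ - c₂ * x₂ * sin t₂₃) ^ 2 := by
      rw [cos_add]
      have a1 : sin t₂₃ ^ 2 = 1 - cos t₂₃ ^ 2 := sin_sq _
      have a2 : sin t₃₁ ^ 2 = 1 - cos t₃₁ ^ 2 := sin_sq _
      ring_nf
      rw [a1, a2]; ring
    rw [e]; positivity
  have h1 : 0 ≤ c₁ * x₁ * (c₂ * x₂) * (cos t₁₂ - cos (t₂₃ + t₃₁)) := by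
    apply mul_nonneg (by positivity); linarith
  have h2 : 0 < x₁ * x₂ * (cos (d₂₃ + d₃₁) - cos d₁₂) := by
    apply mul_pos (by positivity); linarith
  rw [e₁₂] at h2
  rw [e₂₃, e₃₁] at hneg
  nlinarith

/-- The relations between an edge of length `d` at a vertex at height `(c, s)` over a great circle,
the angle `a` of the edge with the perpendicular, the length `b` of its projection, and the height
`(cw, sw)` of the other endpoint. -/
structure EdgeOver (c s d a b cw : ℝ) : Prop where
  sin_eq : cw * sin b = sin d * sin a
  cos_eq : cw * cos b = c * cos d + s * sin d * cos a

/-- With `a` measured from the direction of decreasing height, `s * cos d - c * sin d * cos a` is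
the height of the far endpoint. Only its square is determined, since `cw` does not tell on which
side of the circle the endpoint lies. -/
theorem EdgeOver.sq_height {c s d a b cw : ℝ} (h : EdgeOver c s d a b cw) (hcs : c ^ 2 + s ^ 2 = 1) :
    1 - cw ^ 2 = (s * cos d - c * sin d * cos a) ^ 2 := by
  have h1 : cw ^ 2 = (cw * sin b) ^ 2 + (cw * cos b) ^ 2 := by
    have := sin_sq_add_cos_sq b
    linear_combination (-cw ^ 2) * this
  rw [h1, h.1, h.2, mul_pow, sin_sq a]
  have hd := sin_sq d
  have : s ^ 2 = 1 - c ^ 2 := by linarith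
  ring_nf
  rw [hd, this]; ring

theorem EdgeOver.product {c s d a b cw : ℝ} (h : EdgeOver c s d a b cw) (hcs : c ^ 2 + s ^ 2 = 1) :
    cos d - c * cw * cos b = s * (s * cos d - c * sin d * cos a) := by
  have := h.2
  linear_combination (-c) * this - cos d * hcs

/-- Addition formula for the projections of two edges at a common vertex. -/
theorem EdgeOver.sin_add {c s d a b cw d' a' b' cu : ℝ} (h : EdgeOver c s d a b cw)
    (h' : EdgeOver c s d' a' b' cu) :
    cw * cu * sin (b + b') = c * (sin d * sin a * cos d' + sin d' * sin a' * cos d)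
      + s * (sin d * sin d' * sin (a + a')) := by
  rw [Real.sin_add, Real.sin_add]
  have e : cw * cu * (sin b * cos b' + cos b * sin b')
    = (cw * sin b) * (cu * cos b') + (cw * cos b) * (cu * sin b') := by ring
  rw [e, h.1, h.2, h'.1, h'.2]; ring

/-- Both sides are the inner product of the two far endpoints when the edges are developed on
opposite sides of the perpendicular: once split into horizontal and vertical parts, once by the law
of cosines at the common vertex. -/
theorem EdgeOver.cos_add {c s d a b cw d' a' b' cu : ℝ} (h : EdgeOver c s d a b cw)
    (h' : EdgeOver c s d' a' b' cu) (hcs : c ^ 2 + s ^ 2 = 1) :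
    cw * cu * cos (b + b') + (s * cos d - c * sin d * cos a) * (s * cos d' - c * sin d' * cos a')
      = cos d * cos d' + sin d * sin d' * cos (a + a') := by
  rw [Real.cos_add, Real.cos_add]
  have e : cw * cu * (cos b * cos b' - sin b * sin b')
    = (cw * cos b) * (cu * cos b') - (cw * sin b) * (cu * sin b') := by ring
  rw [e, h.1, h.2, h'.1, h'.2]
  have : s ^ 2 = 1 - c ^ 2 := by linarith
  ring_nf
  rw [this]; ring

theorem cos_nonpos_of_edge {d : ℝ} (h : π / 2 ≤ d) (h' : d < π) : cos d ≤ 0 :=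
  cos_nonpos_of_pi_div_two_le_of_le h (by linarith [pi_pos])

theorem sin_pos_of_edge {d : ℝ} (h : π / 2 ≤ d) (h' : d < π) : 0 < sin d :=
  sin_pos_of_pos_of_lt_pi (by linarith [pi_pos]) h'

theorem sin_neg_of_mem {a : ℝ} (h : π < a) (h' : a < 2 * π) : sin a < 0 := by
  have : 0 < sin (a - π) := sin_pos_of_pos_of_lt_pi (by linarith) (by linarith)
  rw [sin_sub_pi] at this; linarith

theorem sin_nonpos_of_mem {a : ℝ} (h : π ≤ a) (h' : a < 2 * π) : sin a ≤ 0 := by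
  have : 0 ≤ sin (a - π) := sin_nonneg_of_nonneg_of_le_pi (by linarith) (by linarith)
  rw [sin_sub_pi] at this; linarith

/-- If the angle between two edges is at least `π`, then so is the length of their projection. -/
theorem EdgeOver.pi_le_add {c s d a b cw d' a' b' cu : ℝ} (h : EdgeOver c s d a b cw)
    (h' : EdgeOver c s d' a' b' cu) (hc : 0 ≤ c) (hs : 0 ≤ s) (hcw : 0 < cw) (hcu : 0 < cu)
    (hd : π / 2 ≤ d) (hdπ : d < π) (hd' : π / 2 ≤ d') (hdπ' : d' < π)
    (ha : 0 < a) (haπ : a < π) (ha' : 0 < a') (haπ' : a' < π) (hb : 0 < b) (hb' : 0 < b')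
    (haa : 0 < s → π ≤ a + a') : π ≤ b + b' := by
  by_contra! hcon
  have h1 := h.sin_add h'
  have h2 : 0 < cw * cu * sin (b + b') :=
    mul_pos (by positivity) (sin_pos_of_pos_of_lt_pi (by linarith) hcon)
  have h3 := mul_nonneg (mul_nonneg hc (mul_pos (sin_pos_of_edge hd hdπ)
    (sin_pos_of_pos_of_lt_pi ha haπ)).le) (neg_nonneg.2 (cos_nonpos_of_edge hd' hdπ'))
  have h4 := mul_nonneg (mul_nonneg hc (mul_pos (sin_pos_of_edge hd' hdπ')
    (sin_pos_of_pos_of_lt_pi ha' haπ')).le) (neg_nonneg.2 (cos_nonpos_of_edge hd hdπ))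
  have h5 : 0 ≤ - (s * (sin d * sin d' * sin (a + a'))) := by
    rcases hs.eq_or_lt with h0 | h0
    · rw [← h0]; simp
    · have := sin_nonpos_of_mem (haa h0) (by linarith)
      have := mul_nonneg (mul_pos h0 (mul_pos (sin_pos_of_edge hd hdπ)
        (sin_pos_of_edge hd' hdπ'))).le (neg_nonneg.2 this)
      linarith
  linarith

/-- If the angle is at least `π` and the projection has length exactly `π`, then both edges have
length `π / 2`. -/
theorem EdgeOver.eq_pi_div_two {c s d a b cw d' a' b' cu : ℝ} (h : EdgeOver c s d a b cw)
    (h' : EdgeOver c s d' a' b' cu) (hc : 0 < c) (hs : 0 ≤ s)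
    (hd : π / 2 ≤ d) (hdπ : d < π) (hd' : π / 2 ≤ d') (hdπ' : d' < π)
    (ha : 0 < a) (haπ : a < π) (ha' : 0 < a') (haπ' : a' < π) (hb : b + b' = π)
    (haa : 0 < s → π ≤ a + a') : d = π / 2 ∧ d' = π / 2 := by
  have h1 := h.sin_add h'
  rw [hb, sin_pi, mul_zero] at h1
  have h2 := mul_pos hc (mul_pos (sin_pos_of_edge hd hdπ) (sin_pos_of_pos_of_lt_pi ha haπ))
  have h2' := mul_pos hc (mul_pos (sin_pos_of_edge hd' hdπ') (sin_pos_of_pos_of_lt_pi ha' haπ'))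
  have h3 := mul_nonneg h2.le (neg_nonneg.2 (cos_nonpos_of_edge hd' hdπ'))
  have h4 := mul_nonneg h2'.le (neg_nonneg.2 (cos_nonpos_of_edge hd hdπ))
  have h5 : 0 ≤ - (s * (sin d * sin d' * sin (a + a'))) := by
    rcases hs.eq_or_lt with h0 | h0
    · rw [← h0]; simp
    · have := sin_nonpos_of_mem (haa h0) (by linarith)
      have := mul_nonneg (mul_pos h0 (mul_pos (sin_pos_of_edge hd hdπ)
        (sin_pos_of_edge hd' hdπ'))).le (neg_nonneg.2 this)
      linarith
  have key : ∀ {e x : ℝ}, π / 2 ≤ e → e < π → 0 < x → x * -cos e = 0 → e = π / 2 := by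
    intro e x he heπ hx h0
    have : cos e = cos (π / 2) := by
      rw [cos_pi_div_two]
      rcases mul_eq_zero.1 h0 with h | h <;> linarith
    exact injOn_cos ⟨by linarith [pi_pos], heπ.le⟩ ⟨by linarith [pi_pos], by linarith [pi_pos]⟩ this
  exact ⟨key hd hdπ h2' (by linarith), key hd' hdπ' h2 (by linarith)⟩

/-! ### Three vertices: from edge lengths and angles to projected lengths -/

theorem lt_pi_div_two_of_cos_pos {a : ℝ} (ha : 0 < a) (haπ : a < π) (h : 0 < cos a) : a < π / 2 := by
  by_contra! hcon
  linarith [cos_nonpos_of_edge hcon haπ]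

theorem le_pi_div_two_of_cos_nonneg {a : ℝ} (haπ : a < π) (h : 0 ≤ cos a) : a ≤ π / 2 := by
  by_contra! hcon
  linarith [cos_neg_of_pi_div_two_lt_of_lt hcon (by linarith [pi_pos])]

theorem neg_one_lt_cos {b : ℝ} (hb : 0 < b) (hbπ : b < π) : -1 < cos b := by
  rw [← cos_pi]; exact cos_lt_cos_of_nonneg_of_le_pi hb.le le_rfl hbπ

theorem EdgeOver.product_sq {c s d a b cw sw : ℝ} (h : EdgeOver c s d a b cw)
    (hcs : c ^ 2 + s ^ 2 = 1) (hcw : cw ^ 2 + sw ^ 2 = 1) :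
    (cos d - c * cw * cos b) ^ 2 = (s * sw) ^ 2 := by
  rw [h.product hcs, mul_pow, ← h.sq_height hcs]
  linear_combination (-s ^ 2) * hcw

/-- If an edge crosses the great circle and its first endpoint is not farther from the circle than
its second one, then the edge makes an acute angle with the perpendicular at its first endpoint. -/
theorem EdgeOver.acute_of_opposite {c s d a b cw sw : ℝ} (h : EdgeOver c s d a b cw)
    (hcs : c ^ 2 + s ^ 2 = 1) (hcw : cw ^ 2 + sw ^ 2 = 1) (hc : 0 < c) (hs : 0 ≤ s)
    (hcw0 : 0 < cw) (hsw : 0 ≤ sw) (hd : π / 2 ≤ d) (hdπ : d < π) (ha : 0 < a) (haπ : a < π)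
    (hb : 0 < b) (hbπ : b < π) (hneg : cos d - c * cw * cos b < 0) (hle : s * cw ≤ sw * c) :
    0 < s ∧ a < π / 2 := by
  have h1 : cos d - c * cw * cos b = - (s * sw) := by
    rcases sq_eq_sq_iff_eq_or_eq_neg.1 (h.product_sq hcs hcw) with h1 | h1
    · have := mul_nonneg hs hsw; linarith
    · exact h1
  have hs0 : 0 < s := by
    rcases hs.eq_or_lt with h0 | h0
    · rw [← h0] at h1; linarith
    · exact h0
  refine ⟨hs0, lt_pi_div_two_of_cos_pos ha haπ ?_⟩
  have h2 : s * (sin d * cos a) = s * (s * cw * cos b + c * sw) := by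
    have := h.2
    linear_combination (-(cw * cos b)) * hcs - c * h1 - this
  have h3 := mul_left_cancel₀ hs0.ne' h2
  have h4 : 0 < s * cw * (cos b + 1) := mul_pos (by positivity) (by linarith [neg_one_lt_cos hb hbπ])
  have h5 : 0 < sin d * cos a := by nlinarith
  exact (pos_iff_pos_of_mul_pos h5).1 (sin_pos_of_edge hd hdπ)

/-- Here heights are taken nonnegative, so the vertical part of each inner product is `± sᵢ sⱼ`, the
minus sign meaning that the edge crosses the circle. The three signs cannot all be negative; as soon
as one is positive, the vertical form is bounded below by a square, and `perimeter_le_of_angles_le`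
turns a projected perimeter of at most `2π` into an edge perimeter of at most `2π`. -/
theorem two_pi_lt_of_not_face {c₁ c₂ c₃ s₁ s₂ s₃ d₁₂ d₂₃ d₃₁ b₁₂ b₂₃ b₃₁ a₁₂ a₁₃ a₂₁ a₂₃ a₃₁ a₃₂ : ℝ}
    (hc₁ : 0 < c₁) (hc₂ : 0 < c₂) (hc₃ : 0 < c₃) (hs₁ : 0 ≤ s₁) (hs₂ : 0 ≤ s₂) (hs₃ : 0 ≤ s₃)
    (e₁ : c₁ ^ 2 + s₁ ^ 2 = 1) (e₂ : c₂ ^ 2 + s₂ ^ 2 = 1) (e₃ : c₃ ^ 2 + s₃ ^ 2 = 1)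
    (hd₁₂ : d₁₂ ∈ Ico (π / 2) π) (hd₂₃ : d₂₃ ∈ Ico (π / 2) π) (hd₃₁ : d₃₁ ∈ Ico (π / 2) π)
    (hb₁₂ : b₁₂ ∈ Ioo 0 π) (hb₂₃ : b₂₃ ∈ Ioo 0 π) (hb₃₁ : b₃₁ ∈ Ioo 0 π)
    (ha₁₂ : a₁₂ ∈ Ioo 0 π) (ha₁₃ : a₁₃ ∈ Ioo 0 π) (ha₂₁ : a₂₁ ∈ Ioo 0 π)
    (ha₂₃ : a₂₃ ∈ Ioo 0 π) (ha₃₁ : a₃₁ ∈ Ioo 0 π) (ha₃₂ : a₃₂ ∈ Ioo 0 π)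
    (r₁₂ : EdgeOver c₁ s₁ d₁₂ a₁₂ b₁₂ c₂) (r₁₃ : EdgeOver c₁ s₁ d₃₁ a₁₃ b₃₁ c₃)
    (r₂₁ : EdgeOver c₂ s₂ d₁₂ a₂₁ b₁₂ c₁) (r₂₃ : EdgeOver c₂ s₂ d₂₃ a₂₃ b₂₃ c₃)
    (r₃₁ : EdgeOver c₃ s₃ d₃₁ a₃₁ b₃₁ c₁) (r₃₂ : EdgeOver c₃ s₃ d₂₃ a₃₂ b₂₃ c₂)
    (h₁ : 0 < s₁ → π ≤ a₁₂ + a₁₃) (h₂ : 0 < s₂ → π ≤ a₂₁ + a₂₃) (h₃ : 0 < s₃ → π ≤ a₃₁ + a₃₂)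
    (hsum : 2 * π < d₁₂ + d₂₃ + d₃₁) : 2 * π < b₁₂ + b₂₃ + b₃₁ := by
  by_contra! hL
  have hb3 : π ≤ b₂₃ + b₃₁ := by
    have := r₃₁.pi_le_add r₃₂ hc₃.le hs₃ hc₁ hc₂ hd₃₁.1 hd₃₁.2 hd₂₃.1 hd₂₃.2 ha₃₁.1 ha₃₁.2 ha₃₂.1
      ha₃₂.2 hb₃₁.1 hb₂₃.1 h₃
    linarith
  have q₁₂ := r₁₂.product_sq e₁ e₂
  have q₂₃ := r₂₃.product_sq e₂ e₃
  have q₃₁ := r₃₁.product_sq e₃ e₁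
  set k₁₂ := cos d₁₂ - c₁ * c₂ * cos b₁₂ with hk₁₂
  set k₂₃ := cos d₂₃ - c₂ * c₃ * cos b₂₃ with hk₂₃
  set k₃₁ := cos d₃₁ - c₃ * c₁ * cos b₃₁ with hk₃₁
  have hsome : 0 ≤ k₁₂ ∨ 0 ≤ k₂₃ ∨ 0 ≤ k₃₁ := by
    by_contra! hcon
    obtain ⟨n₁₂, n₂₃, n₃₁⟩ := hcon
    have n₂₁ : cos d₁₂ - c₂ * c₁ * cos b₁₂ < 0 := by rw [mul_comm c₂]; exact n₁₂
    have n₃₂ : cos d₂₃ - c₃ * c₂ * cos b₂₃ < 0 := by rw [mul_comm c₃]; exact n₂₃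
    have n₁₃ : cos d₃₁ - c₁ * c₃ * cos b₃₁ < 0 := by rw [mul_comm c₁]; exact n₃₁
    have conv : ∀ {x y u w : ℝ}, 0 < y → 0 < w → x / y ≤ u / w → x * w ≤ u * y := by
      intro x y u w hy hw h
      rwa [div_le_div_iff₀ hy hw] at h
    -- If all three edges cross the circle, both edges at a vertex of least height are acute to the
    -- perpendicular there, contrary to the angle bound. `s / c` is the tangent of the height.
    have v1 : s₁ / c₁ ≤ s₂ / c₂ → s₁ / c₁ ≤ s₃ / c₃ → False := by
      intro hA hB
      obtain ⟨p, p'⟩ := r₁₂.acute_of_opposite e₁ e₂ hc₁ hs₁ hc₂ hs₂ hd₁₂.1 hd₁₂.2 ha₁₂.1 ha₁₂.2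
        hb₁₂.1 hb₁₂.2 n₁₂ (conv hc₁ hc₂ hA)
      obtain ⟨-, p''⟩ := r₁₃.acute_of_opposite e₁ e₃ hc₁ hs₁ hc₃ hs₃ hd₃₁.1 hd₃₁.2 ha₁₃.1 ha₁₃.2
        hb₃₁.1 hb₃₁.2 n₁₃ (conv hc₁ hc₃ hB)
      linarith [h₁ p]
    have v2 : s₂ / c₂ ≤ s₁ / c₁ → s₂ / c₂ ≤ s₃ / c₃ → False := by
      intro hA hB
      obtain ⟨p, p'⟩ := r₂₁.acute_of_opposite e₂ e₁ hc₂ hs₂ hc₁ hs₁ hd₁₂.1 hd₁₂.2 ha₂₁.1 ha₂₁.2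
        hb₁₂.1 hb₁₂.2 n₂₁ (conv hc₂ hc₁ hA)
      obtain ⟨-, p''⟩ := r₂₃.acute_of_opposite e₂ e₃ hc₂ hs₂ hc₃ hs₃ hd₂₃.1 hd₂₃.2 ha₂₃.1 ha₂₃.2
        hb₂₃.1 hb₂₃.2 n₂₃ (conv hc₂ hc₃ hB)
      linarith [h₂ p]
    have v3 : s₃ / c₃ ≤ s₁ / c₁ → s₃ / c₃ ≤ s₂ / c₂ → False := by
      intro hA hB
      obtain ⟨p, p'⟩ := r₃₁.acute_of_opposite e₃ e₁ hc₃ hs₃ hc₁ hs₁ hd₃₁.1 hd₃₁.2 ha₃₁.1 ha₃₁.2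
        hb₃₁.1 hb₃₁.2 n₃₁ (conv hc₃ hc₁ hA)
      obtain ⟨-, p''⟩ := r₃₂.acute_of_opposite e₃ e₂ hc₃ hs₃ hc₂ hs₂ hd₂₃.1 hd₂₃.2 ha₃₂.1 ha₃₂.2
        hb₂₃.1 hb₂₃.2 n₃₂ (conv hc₃ hc₂ hB)
      linarith [h₃ p]
    rcases le_total (s₁ / c₁) (s₂ / c₂) with A | A <;> rcases le_total (s₁ / c₁) (s₃ / c₃) with B | B
      <;> rcases le_total (s₂ / c₂) (s₃ / c₃) with C | C
    · exact v1 A B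
    · exact v1 A B
    · exact v3 B (B.trans A)
    · exact v3 B C
    · exact v2 A C
    · exact v3 (C.trans A) C
    · exact v2 A C
    · exact v3 B C
  have lower : ∀ {k x y : ℝ}, 0 ≤ x → 0 ≤ y → k ^ 2 = (x * y) ^ 2 → - (x * y) ≤ k := by
    intro k x y hx hy h
    exact (abs_le.1 (abs_le_of_sq_le_sq h.le (mul_nonneg hx hy))).1
  have upper : ∀ {k x y : ℝ}, 0 ≤ x → 0 ≤ y → k ^ 2 = (x * y) ^ 2 → 0 ≤ k → k = x * y := by
    intro k x y hx hy h hk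
    exact (sq_eq_sq₀ hk (mul_nonneg hx hy)).1 h
  have l₁₂ := lower hs₁ hs₂ q₁₂
  have l₂₃ := lower hs₂ hs₃ q₂₃
  have l₃₁ := lower hs₃ hs₁ q₃₁
  have := perimeter_le_of_angles_le (c₃ := c₃) (t₁₂ := b₁₂) (t₂₃ := b₂₃) (t₃₁ := b₃₁)
    (d₁₂ := d₁₂) (d₂₃ := d₂₃) (d₃₁ := d₃₁) (k₁₂ := k₁₂) (k₂₃ := k₂₃) (k₃₁ := k₃₁) hc₁.le hc₂.le
    (by
      intro x₁ x₂ x₃ hx₁ hx₂ hx₃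
      have f₁ : 1 - c₁ ^ 2 = s₁ ^ 2 := by linarith
      have f₂ : 1 - c₂ ^ 2 = s₂ ^ 2 := by linarith
      have f₃ : 1 - c₃ ^ 2 = s₃ ^ 2 := by linarith
      rw [f₁, f₂, f₃]
      have m₁₂ := mul_nonneg (sub_nonneg.2 l₁₂) (mul_nonneg hx₁ hx₂)
      have m₂₃ := mul_nonneg (sub_nonneg.2 l₂₃) (mul_nonneg hx₂ hx₃)
      have m₃₁ := mul_nonneg (sub_nonneg.2 l₃₁) (mul_nonneg hx₃ hx₁)
      rcases hsome with h | h | h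
      · rw [upper hs₁ hs₂ q₁₂ h]
        linarith [sq_nonneg (s₁ * x₁ + s₂ * x₂ - s₃ * x₃)]
      · rw [upper hs₂ hs₃ q₂₃ h]
        linarith [sq_nonneg (s₂ * x₂ + s₃ * x₃ - s₁ * x₁)]
      · rw [upper hs₃ hs₁ q₃₁ h]
        linarith [sq_nonneg (s₃ * x₃ + s₁ * x₁ - s₂ * x₂)])
    (by rw [hk₁₂]; ring) (by rw [hk₂₃]; ring) (by rw [hk₃₁]; ring) hb₁₂.1.le hb₁₂.2.le hb3 hL
    hd₁₂.2.le hd₂₃.1 hd₂₃.2 hd₃₁.1 hd₃₁.2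
  linarith

/-- The outcome at one vertex of a face enclosed by three arcs. -/
theorem cos_le_cos_add_of_angle_ge {c s d d' d'' a a' b b' b'' cw cu sw su α : ℝ}
    (r : EdgeOver c s d a b cw) (r' : EdgeOver c s d' a' b' cu)
    (hcs : c ^ 2 + s ^ 2 = 1)
    (o : sw = s * cos d - c * sin d * cos a) (o' : su = s * cos d' - c * sin d' * cos a')
    (hcos : cos d'' = cos d * cos d' + sin d * sin d' * cos α)
    (hd'' : cos d'' = cw * cu * cos b'' + sw * su)
    (hd : 0 < sin d) (hd' : 0 < sin d') (hcw : 0 < cw) (hcu : 0 < cu) (hα0 : 0 ≤ α) (hαπ : α ≤ π)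
    (haa : a + a' ≤ 2 * π) :
    (2 * π ≤ α + (a + a') → cos b'' ≤ cos (b + b')) ∧
    (2 * π < α + (a + a') → cos b'' < cos (b + b')) := by
  have h1 := r.cos_add r' hcs
  rw [← o, ← o'] at h1
  have h2 : cw * cu * (cos (b + b') - cos b'') = sin d * sin d' * (cos (a + a') - cos α) := by
    linear_combination h1 - hcos + hd''
  have hp : 0 < cw * cu := by positivity
  have hq : 0 < sin d * sin d' := by positivity
  constructor
  · intro h
    have : cos α ≤ cos (a + a') := by
      rw [← cos_two_pi_sub (a + a')]
      exact cos_le_cos_of_nonneg_of_le_pi (by linarith) hαπ (by linarith)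
    have h3 : 0 ≤ cw * cu * (cos (b + b') - cos b'') := by
      rw [h2]; exact mul_nonneg hq.le (by linarith)
    nlinarith
  · intro h
    have : cos α < cos (a + a') := by
      rw [← cos_two_pi_sub (a + a')]
      exact cos_lt_cos_of_nonneg_of_le_pi (by linarith) hαπ (by linarith)
    have h3 : 0 < cw * cu * (cos (b + b') - cos b'') := by
      rw [h2]; exact mul_pos hq (by linarith)
    nlinarith

theorem le_or_two_pi_le_of_cos_le {x y : ℝ} (hx : 0 ≤ x) (hxπ : x ≤ π) (hy : 0 ≤ y)
    (h : cos x ≤ cos y) : y ≤ x ∨ 2 * π ≤ x + y := by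
  by_contra! hcon
  rcases le_total y π with hy1 | hy1
  · linarith [cos_lt_cos_of_nonneg_of_le_pi hx hy1 hcon.1]
  · rw [← cos_two_pi_sub y] at h
    linarith [cos_lt_cos_of_nonneg_of_le_pi hx (y := 2 * π - y) (by linarith) (by linarith)]

/-- At each vertex the angle outside the face is at least `2π` minus the face angle. The law of
cosines then gives `cos` of the opposite projection at most `cos` of the sum of the two adjacent
ones. If the three projections had sum below `2π`, each would dominate the sum of the other two,
which is absurd for positive numbers; sum exactly `2π` needs the strict inequalities. -/
theorem two_pi_lt_of_face {c₁ c₂ c₃ s₁ s₂ s₃ d₁₂ d₂₃ d₃₁ b₁₂ b₂₃ b₃₁ a₁₂ a₁₃ a₂₁ a₂₃ a₃₁ a₃₂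
      α₁ α₂ α₃ : ℝ}
    (hc₁ : 0 < c₁) (hc₂ : 0 < c₂) (hc₃ : 0 < c₃)
    (e₁ : c₁ ^ 2 + s₁ ^ 2 = 1) (e₂ : c₂ ^ 2 + s₂ ^ 2 = 1) (e₃ : c₃ ^ 2 + s₃ ^ 2 = 1)
    (hd₁₂ : d₁₂ ∈ Ico (π / 2) π) (hd₂₃ : d₂₃ ∈ Ico (π / 2) π) (hd₃₁ : d₃₁ ∈ Ico (π / 2) π)
    (hb₁₂ : b₁₂ ∈ Ioo 0 π) (hb₂₃ : b₂₃ ∈ Ioo 0 π) (hb₃₁ : b₃₁ ∈ Ioo 0 π)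
    (ha₁₂ : a₁₂ ∈ Ioo 0 π) (ha₁₃ : a₁₃ ∈ Ioo 0 π) (ha₂₁ : a₂₁ ∈ Ioo 0 π)
    (ha₂₃ : a₂₃ ∈ Ioo 0 π) (ha₃₁ : a₃₁ ∈ Ioo 0 π) (ha₃₂ : a₃₂ ∈ Ioo 0 π)
    (r₁₂ : EdgeOver c₁ s₁ d₁₂ a₁₂ b₁₂ c₂) (r₁₃ : EdgeOver c₁ s₁ d₃₁ a₁₃ b₃₁ c₃)
    (r₂₁ : EdgeOver c₂ s₂ d₁₂ a₂₁ b₁₂ c₁) (r₂₃ : EdgeOver c₂ s₂ d₂₃ a₂₃ b₂₃ c₃)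
    (r₃₁ : EdgeOver c₃ s₃ d₃₁ a₃₁ b₃₁ c₁) (r₃₂ : EdgeOver c₃ s₃ d₂₃ a₃₂ b₂₃ c₂)
    (o₁₂ : s₂ = s₁ * cos d₁₂ - c₁ * sin d₁₂ * cos a₁₂)
    (o₁₃ : s₃ = s₁ * cos d₃₁ - c₁ * sin d₃₁ * cos a₁₃)
    (o₂₁ : s₁ = s₂ * cos d₁₂ - c₂ * sin d₁₂ * cos a₂₁)
    (o₂₃ : s₃ = s₂ * cos d₂₃ - c₂ * sin d₂₃ * cos a₂₃)
    (o₃₁ : s₁ = s₃ * cos d₃₁ - c₃ * sin d₃₁ * cos a₃₁)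
    (o₃₂ : s₂ = s₃ * cos d₂₃ - c₃ * sin d₂₃ * cos a₃₂)
    (hα₁ : α₁ ∈ Ioo 0 π) (hα₂ : α₂ ∈ Ioo 0 π) (hα₃ : α₃ ∈ Ioo 0 π)
    (l₁ : cos d₂₃ = cos d₁₂ * cos d₃₁ + sin d₁₂ * sin d₃₁ * cos α₁)
    (l₂ : cos d₃₁ = cos d₁₂ * cos d₂₃ + sin d₁₂ * sin d₂₃ * cos α₂)
    (l₃ : cos d₁₂ = cos d₃₁ * cos d₂₃ + sin d₃₁ * sin d₂₃ * cos α₃)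
    (h₁ : 2 * π ≤ α₁ + (a₁₂ + a₁₃)) (h₁' : 0 < s₁ → 2 * π < α₁ + (a₁₂ + a₁₃))
    (h₂ : 2 * π ≤ α₂ + (a₂₁ + a₂₃)) (h₂' : 0 < s₂ → 2 * π < α₂ + (a₂₁ + a₂₃))
    (h₃ : 2 * π ≤ α₃ + (a₃₁ + a₃₂)) (h₃' : 0 < s₃ → 2 * π < α₃ + (a₃₁ + a₃₂)) :
    2 * π < b₁₂ + b₂₃ + b₃₁ := by
  have p₁₂ := r₁₂.product e₁
  rw [← o₁₂] at p₁₂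
  have p₂₃ := r₂₃.product e₂
  rw [← o₂₃] at p₂₃
  have p₃₁ := r₃₁.product e₃
  rw [← o₃₁] at p₃₁
  have S₁₂ := sin_pos_of_edge hd₁₂.1 hd₁₂.2
  have S₂₃ := sin_pos_of_edge hd₂₃.1 hd₂₃.2
  have S₃₁ := sin_pos_of_edge hd₃₁.1 hd₃₁.2
  obtain ⟨w₁, w₁'⟩ := cos_le_cos_add_of_angle_ge r₁₂ r₁₃ e₁ o₁₂ o₁₃ l₁ (b'' := b₂₃) (by linarith)
    S₁₂ S₃₁ hc₂ hc₃ hα₁.1.le hα₁.2.le (by linarith [ha₁₂.2, ha₁₃.2])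
  obtain ⟨w₂, w₂'⟩ := cos_le_cos_add_of_angle_ge r₂₁ r₂₃ e₂ o₂₁ o₂₃ l₂ (b'' := b₃₁) (by linarith)
    S₁₂ S₂₃ hc₁ hc₃ hα₂.1.le hα₂.2.le (by linarith [ha₂₁.2, ha₂₃.2])
  obtain ⟨w₃, w₃'⟩ := cos_le_cos_add_of_angle_ge r₃₁ r₃₂ e₃ o₃₁ o₃₂ l₃ (b'' := b₁₂) (by linarith)
    S₃₁ S₂₃ hc₁ hc₂ hα₃.1.le hα₃.2.le (by linarith [ha₃₁.2, ha₃₂.2])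
  by_contra! hL
  have hge : 2 * π ≤ b₁₂ + b₂₃ + b₃₁ := by
    by_contra! hlt
    have := (le_or_two_pi_le_of_cos_le hb₂₃.1.le hb₂₃.2.le (by linarith [hb₁₂.1, hb₃₁.1])
      (w₁ h₁)).resolve_right (by linarith)
    have := (le_or_two_pi_le_of_cos_le hb₃₁.1.le hb₃₁.2.le (by linarith [hb₁₂.1, hb₂₃.1])
      (w₂ h₂)).resolve_right (by linarith)
    linarith [hb₁₂.1]
  have heq : b₁₂ + b₂₃ + b₃₁ = 2 * π := le_antisymm hL hge
  have fin : ∀ {x y : ℝ}, x + y = 2 * π → cos x < cos y → False := by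
    intro x y h h'
    rw [show y = 2 * π - x by linarith, cos_two_pi_sub] at h'
    exact lt_irrefl _ h'
  -- At total `2π` the two cosines agree, so no vertex has positive height. But if all heights are
  -- nonpositive, both angles at the first vertex are at most `π / 2`, too small next to a face
  -- angle below `π`.
  by_cases t₁ : 0 < s₁
  · exact fin (by linarith) (w₁' (h₁' t₁))
  by_cases t₂ : 0 < s₂
  · exact fin (by linarith) (w₂' (h₂' t₂))
  by_cases t₃ : 0 < s₃
  · exact fin (by linarith) (w₃' (h₃' t₃))
  have acute : ∀ {c s sw d a : ℝ}, 0 < c → ¬ 0 < s → ¬ 0 < sw → d ∈ Ico (π / 2) π → a < π →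
      sw = s * cos d - c * sin d * cos a → a ≤ π / 2 := by
    intro c s sw d a hc hs hsw hd ha ho
    refine le_pi_div_two_of_cos_nonneg ha ?_
    have h1 := mul_nonneg (neg_nonneg.2 (not_lt.1 hs)) (neg_nonneg.2 (cos_nonpos_of_edge hd.1 hd.2))
    have h2 : 0 ≤ c * sin d * cos a := by nlinarith [not_lt.1 hsw]
    exact nonneg_of_mul_nonneg_right h2 (mul_pos hc (sin_pos_of_edge hd.1 hd.2))
  have := acute hc₁ t₁ t₂ hd₁₂ ha₁₂.2 o₁₂
  have := acute hc₁ t₁ t₃ hd₃₁ ha₁₃.2 o₁₃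
  linarith [hα₁.2]

/-! ### Two adjacent faces passed by four arcs of total length `2π` -/

theorem EdgeOver.sin_mul_cos {c s d a b cw sw : ℝ} (h : EdgeOver c s d a b cw)
    (hcs : c ^ 2 + s ^ 2 = 1) (o : sw = s * cos d - c * sin d * cos a) :
    sin d * cos a = s * (cw * cos b) - c * sw := by
  rw [h.cos_eq, o]; linear_combination (-(sin d * cos a)) * hcs

/-- Two faces `v₁ v₂ v₃` and `v₁ v₃ v₄`, passed by four arcs of total length `2 π`: the situation at
the endpoint `v₁` of the diagonal. -/
theorem false_of_diagonal_endpoint {c₁ c₂ c₃ c₄ s₁ s₂ s₃ s₄ d₁₂ d₂₃ d₃₄ d₄₁ d₁₃ a₁₂ a₁₄ t α β : ℝ}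
    (hc₁ : 0 < c₁)
    (e₁ : c₁ ^ 2 + s₁ ^ 2 = 1) (e₃ : c₃ ^ 2 + s₃ ^ 2 = 1)
    (hd₁₂ : d₁₂ ∈ Ico (π / 2) π) (hd₄₁ : d₄₁ ∈ Ico (π / 2) π) (hd₁₃ : d₁₃ ∈ Ico (π / 2) π)
    (ha₁₂ : a₁₂ ∈ Ioo 0 π) (ha₁₄ : a₁₄ ∈ Ioo 0 π)
    (r₁₂ : EdgeOver c₁ s₁ d₁₂ a₁₂ t c₂) (r₁₄ : EdgeOver c₁ s₁ d₄₁ a₁₄ (π - t) c₄)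
    (o₁₂ : s₂ = s₁ * cos d₁₂ - c₁ * sin d₁₂ * cos a₁₂)
    (o₁₄ : s₄ = s₁ * cos d₄₁ - c₁ * sin d₄₁ * cos a₁₄)
    (p₂₃ : cos d₂₃ = - (c₂ * c₃ * cos t) + s₂ * s₃) (p₃₄ : cos d₃₄ = c₃ * c₄ * cos t + s₃ * s₄)
    (hα : α ∈ Ioo 0 π) (hβ : β ∈ Ioo 0 π)
    (l : cos d₂₃ = cos d₁₂ * cos d₁₃ + sin d₁₂ * sin d₁₃ * cos α)
    (l' : cos d₃₄ = cos d₄₁ * cos d₁₃ + sin d₄₁ * sin d₁₃ * cos β)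
    (hs₁ : 0 < s₁) (h₁ : 2 * π < α + β + (a₁₂ + a₁₄))
    (E : cos d₁₃ = - (c₁ * c₃) + s₁ * s₃ ∨
      d₁₂ = π / 2 ∧ d₂₃ = π / 2 ∧ d₃₄ = π / 2 ∧ d₄₁ = π / 2) : False := by
  have S₁₂ := sin_pos_of_edge hd₁₂.1 hd₁₂.2
  have S₄₁ := sin_pos_of_edge hd₄₁.1 hd₄₁.2
  have S₁₃ := sin_pos_of_edge hd₁₃.1 hd₁₃.2
  -- The two projections add up to `π`, so the left side of the sine addition formula vanishes. All
  -- terms on the right are nonpositive when the angle sum exceeds `π`, and the last one is strictly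
  -- negative.
  have hle : a₁₂ + a₁₄ ≤ π := by
    by_contra! hcon
    have h1 := r₁₂.sin_add r₁₄
    rw [show t + (π - t) = π by ring, sin_pi, mul_zero] at h1
    have h2 := sin_neg_of_mem hcon (by linarith [ha₁₂.2, ha₁₄.2])
    have h3 : 0 < s₁ * (sin d₁₂ * sin d₄₁ * - sin (a₁₂ + a₁₄)) :=
      mul_pos hs₁ (mul_pos (mul_pos S₁₂ S₄₁) (by linarith))
    have h4 := mul_nonneg (mul_pos hc₁ (mul_pos S₁₂ (sin_pos_of_pos_of_lt_pi ha₁₂.1 ha₁₂.2))).le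
      (neg_nonneg.2 (cos_nonpos_of_edge hd₄₁.1 hd₄₁.2))
    have h5 := mul_nonneg (mul_pos hc₁ (mul_pos S₄₁ (sin_pos_of_pos_of_lt_pi ha₁₄.1 ha₁₄.2))).le
      (neg_nonneg.2 (cos_nonpos_of_edge hd₁₂.1 hd₁₂.2))
    linarith
  rcases E with E | ⟨f₁₂, f₂₃, f₃₄, f₄₁⟩
  · have u₁₂ := r₁₂.sin_mul_cos e₁ o₁₂
    have u₁₄ := r₁₄.sin_mul_cos e₁ o₁₄
    rw [cos_pi_sub] at u₁₄
    have p₁₂ := r₁₂.product e₁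
    have p₁₄ := r₁₄.product e₁
    rw [← o₁₂] at p₁₂
    rw [← o₁₄, cos_pi_sub] at p₁₄
    -- In the development `v₁` and `v₃` project to antipodal points, so `w` is `± sin d₁₃`. One sign
    -- makes the face angles `α`, `β` the supplements of `a₁₂`, `a₁₄`, the other makes them equal to
    -- `a₁₂`, `a₁₄`; either way the angle sum is at most `2π`.
    set w := s₁ * c₃ + c₁ * s₃ with hw
    have hw2 : w ^ 2 = sin d₁₃ ^ 2 := by
      rw [sin_sq, E, hw]; linear_combination e₃ * (c₁ ^ 2 + s₁ ^ 2) + e₁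
    have k₁ : sin d₁₂ * (sin d₁₃ * cos α) = sin d₁₂ * (- (w * cos a₁₂)) := by
      have : sin d₁₂ * (sin d₁₃ * cos α) = cos d₂₃ - cos d₁₂ * cos d₁₃ := by rw [l]; ring
      rw [this, show sin d₁₂ * (- (w * cos a₁₂)) = - w * (sin d₁₂ * cos a₁₂) by ring, u₁₂, p₂₃,
        show cos d₁₂ = c₁ * c₂ * cos t + s₁ * s₂ by linarith, E, hw]
      linear_combination (s₂ * s₃ - c₂ * c₃ * cos t) * (-e₁)
    have k₂ : sin d₄₁ * (sin d₁₃ * cos β) = sin d₄₁ * (- (w * cos a₁₄)) := by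
      have : sin d₄₁ * (sin d₁₃ * cos β) = cos d₃₄ - cos d₄₁ * cos d₁₃ := by rw [l']; ring
      rw [this, show sin d₄₁ * (- (w * cos a₁₄)) = - w * (sin d₄₁ * cos a₁₄) by ring, u₁₄, p₃₄,
        show cos d₄₁ = - (c₁ * c₄ * cos t) + s₁ * s₄ by linarith, E, hw]
      linear_combination (s₃ * s₄ + c₃ * c₄ * cos t) * (-e₁)
    replace k₁ := mul_left_cancel₀ S₁₂.ne' k₁
    replace k₂ := mul_left_cancel₀ S₄₁.ne' k₂
    rcases sq_eq_sq_iff_eq_or_eq_neg.1 hw2 with hw' | hw'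
    · have key : ∀ {x y : ℝ}, x ∈ Ioo 0 π → y ∈ Ioo 0 π → sin d₁₃ * cos x = - (w * cos y) →
          x = π - y := by
        intro x y hx hy h
        rw [hw', ← mul_neg, ← cos_pi_sub] at h
        exact injOn_cos ⟨hx.1.le, hx.2.le⟩ ⟨by linarith [hy.2], by linarith [hy.1]⟩
          (mul_left_cancel₀ S₁₃.ne' h)
      linarith [key hα ha₁₂ k₁, key hβ ha₁₄ k₂]
    · have key : ∀ {x y : ℝ}, x ∈ Ioo 0 π → y ∈ Ioo 0 π → sin d₁₃ * cos x = - (w * cos y) →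
          x = y := by
        intro x y hx hy h
        rw [hw', neg_mul, neg_neg] at h
        exact injOn_cos ⟨hx.1.le, hx.2.le⟩ ⟨by linarith [hy.1], by linarith [hy.2]⟩
          (mul_left_cancel₀ S₁₃.ne' h)
      linarith [key hα ha₁₂ k₁, key hβ ha₁₄ k₂]
  · have key : ∀ {x : ℝ}, x ∈ Ioo 0 π → sin d₁₃ * cos x = 0 → x = π / 2 := by
      intro x hx h
      refine injOn_cos ⟨hx.1.le, hx.2.le⟩ ⟨by linarith [pi_pos], by linarith [pi_pos]⟩ ?_
      rw [cos_pi_div_two]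
      exact (mul_eq_zero.1 h).resolve_left S₁₃.ne'
    rw [f₁₂, f₂₃, cos_pi_div_two, sin_pi_div_two] at l
    rw [f₃₄, f₄₁, cos_pi_div_two, sin_pi_div_two] at l'
    linarith [key hα (by linarith), key hβ (by linarith)]

/-- At height zero the cosines of the two edges are positive multiples of `cos t` and `-cos t`;
neither may be positive, so both vanish. -/
theorem eq_pi_div_two_of_through {c₁ c₂ c₃ d₁₂ d₂₃ t a₂₁ a₂₃ : ℝ} (hc₁ : 0 < c₁) (hc₃ : 0 < c₃)
    (hd₁₂ : d₁₂ ∈ Ico (π / 2) π) (hd₂₃ : d₂₃ ∈ Ico (π / 2) π)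
    (e₂ : c₂ ^ 2 + (0 : ℝ) ^ 2 = 1) (hc₂ : 0 < c₂)
    (r₂₁ : EdgeOver c₂ 0 d₁₂ a₂₁ t c₁) (r₂₃ : EdgeOver c₂ 0 d₂₃ a₂₃ (π - t) c₃) :
    d₁₂ = π / 2 ∧ d₂₃ = π / 2 := by
  have hc : c₂ = 1 := by nlinarith
  subst hc
  have h1 := r₂₁.cos_eq
  have h2 := r₂₃.cos_eq
  rw [cos_pi_sub] at h2
  have n1 := cos_nonpos_of_edge hd₁₂.1 hd₁₂.2
  have n2 := cos_nonpos_of_edge hd₂₃.1 hd₂₃.2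
  have hcos : cos t = 0 := by
    apply le_antisymm
    · by_contra! h
      nlinarith [mul_pos hc₁ h]
    · by_contra! h
      nlinarith [mul_pos hc₃ (neg_pos.2 h)]
  rw [hcos] at h1 h2
  have key : ∀ {x : ℝ}, x ∈ Ico (π / 2) π → cos x = 0 → x = π / 2 := by
    intro x hx h
    refine injOn_cos ⟨by linarith [hx.1, pi_pos], hx.2.le⟩
      ⟨by linarith [pi_pos], by linarith [pi_pos]⟩ ?_
    rw [cos_pi_div_two, h]
  exact ⟨key hd₁₂ (by linarith), key hd₂₃ (by linarith)⟩

theorem nonpos_of_projection_pi {c₁ c₂ c₃ s₂ d₁₂ d₂₃ t a₂₁ a₂₃ α : ℝ} (hc₂ : 0 < c₂)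
    (hd₁₂ : d₁₂ ∈ Ico (π / 2) π) (hd₂₃ : d₂₃ ∈ Ico (π / 2) π)
    (ha₂₁ : a₂₁ ∈ Ioo 0 π) (ha₂₃ : a₂₃ ∈ Ioo 0 π) (hα : α < π)
    (r₂₁ : EdgeOver c₂ s₂ d₁₂ a₂₁ t c₁) (r₂₃ : EdgeOver c₂ s₂ d₂₃ a₂₃ (π - t) c₃)
    (h₂ : 2 * π ≤ α + (a₂₁ + a₂₃)) : s₂ ≤ 0 := by
  have S₁ := sin_pos_of_edge hd₁₂.1 hd₁₂.2
  have S₂ := sin_pos_of_edge hd₂₃.1 hd₂₃.2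
  by_contra! hs
  have h1 := r₂₁.sin_add r₂₃
  rw [show t + (π - t) = π by ring, sin_pi, mul_zero] at h1
  have h2 := sin_neg_of_mem (a := a₂₁ + a₂₃) (by linarith) (by linarith [ha₂₁.2, ha₂₃.2])
  have h3 : 0 < s₂ * (sin d₁₂ * sin d₂₃ * - sin (a₂₁ + a₂₃)) :=
    mul_pos hs (mul_pos (mul_pos S₁ S₂) (by linarith))
  have h4 := mul_nonneg (mul_pos hc₂ (mul_pos S₁ (sin_pos_of_pos_of_lt_pi ha₂₁.1 ha₂₁.2))).le
    (neg_nonneg.2 (cos_nonpos_of_edge hd₂₃.1 hd₂₃.2))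
  have h5 := mul_nonneg (mul_pos hc₂ (mul_pos S₂ (sin_pos_of_pos_of_lt_pi ha₂₃.1 ha₂₃.2))).le
    (neg_nonneg.2 (cos_nonpos_of_edge hd₁₂.1 hd₁₂.2))
  linarith

theorem height_pos_of_obtuse {c s sw d a : ℝ} (hc : 0 < c) (hs : s ≤ 0) (hd : d ∈ Ico (π / 2) π)
    (ha : π / 2 < a) (haπ : a < π) (ho : sw = s * cos d - c * sin d * cos a) : 0 < sw := by
  have h1 := mul_nonneg (neg_nonneg.2 hs) (neg_nonneg.2 (cos_nonpos_of_edge hd.1 hd.2))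
  have h2 := mul_pos (mul_pos hc (sin_pos_of_edge hd.1 hd.2))
    (neg_pos.2 (cos_neg_of_pi_div_two_lt_of_lt ha (by linarith [pi_pos])))
  linarith

/-- At `v₂` and `v₄` the projections of the two edges add up to `π`, which together with the angle
bound forces nonpositive height. At `v₁` or `v₃` the height is positive, so the angle sum there
strictly exceeds `2π`; `false_of_diagonal_endpoint` excludes this. -/
theorem false_of_two_faces {c₁ c₂ c₃ c₄ s₁ s₂ s₃ s₄ d₁₂ d₂₃ d₃₄ d₄₁ d₁₃
      a₁₂ a₁₄ a₂₁ a₂₃ a₃₂ a₃₄ a₄₁ a₄₃ t α₁ β₁ α₂ α₃ β₃ α₄ : ℝ}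
    (hc₁ : 0 < c₁) (hc₂ : 0 < c₂) (hc₃ : 0 < c₃) (hc₄ : 0 < c₄)
    (e₁ : c₁ ^ 2 + s₁ ^ 2 = 1) (e₂ : c₂ ^ 2 + s₂ ^ 2 = 1) (e₃ : c₃ ^ 2 + s₃ ^ 2 = 1)
    (e₄ : c₄ ^ 2 + s₄ ^ 2 = 1)
    (hd₁₂ : d₁₂ ∈ Ico (π / 2) π) (hd₂₃ : d₂₃ ∈ Ico (π / 2) π) (hd₃₄ : d₃₄ ∈ Ico (π / 2) π)
    (hd₄₁ : d₄₁ ∈ Ico (π / 2) π) (hd₁₃ : d₁₃ ∈ Ico (π / 2) π)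
    (ha₁₂ : a₁₂ ∈ Ioo 0 π) (ha₁₄ : a₁₄ ∈ Ioo 0 π) (ha₂₁ : a₂₁ ∈ Ioo 0 π) (ha₂₃ : a₂₃ ∈ Ioo 0 π)
    (ha₃₂ : a₃₂ ∈ Ioo 0 π) (ha₃₄ : a₃₄ ∈ Ioo 0 π) (ha₄₁ : a₄₁ ∈ Ioo 0 π) (ha₄₃ : a₄₃ ∈ Ioo 0 π)
    (r₁₂ : EdgeOver c₁ s₁ d₁₂ a₁₂ t c₂) (r₁₄ : EdgeOver c₁ s₁ d₄₁ a₁₄ (π - t) c₄)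
    (r₂₁ : EdgeOver c₂ s₂ d₁₂ a₂₁ t c₁) (r₂₃ : EdgeOver c₂ s₂ d₂₃ a₂₃ (π - t) c₃)
    (r₃₂ : EdgeOver c₃ s₃ d₂₃ a₃₂ (π - t) c₂) (r₃₄ : EdgeOver c₃ s₃ d₃₄ a₃₄ t c₄)
    (r₄₁ : EdgeOver c₄ s₄ d₄₁ a₄₁ (π - t) c₁) (r₄₃ : EdgeOver c₄ s₄ d₃₄ a₄₃ t c₃)
    (o₁₂ : s₂ = s₁ * cos d₁₂ - c₁ * sin d₁₂ * cos a₁₂)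
    (o₁₄ : s₄ = s₁ * cos d₄₁ - c₁ * sin d₄₁ * cos a₁₄)
    (o₂₁ : s₁ = s₂ * cos d₁₂ - c₂ * sin d₁₂ * cos a₂₁)
    (o₂₃ : s₃ = s₂ * cos d₂₃ - c₂ * sin d₂₃ * cos a₂₃)
    (o₃₂ : s₂ = s₃ * cos d₂₃ - c₃ * sin d₂₃ * cos a₃₂)
    (o₃₄ : s₄ = s₃ * cos d₃₄ - c₃ * sin d₃₄ * cos a₃₄)
    (o₄₁ : s₁ = s₄ * cos d₄₁ - c₄ * sin d₄₁ * cos a₄₁)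
    (o₄₃ : s₃ = s₄ * cos d₃₄ - c₄ * sin d₃₄ * cos a₄₃)
    (hα₁ : α₁ ∈ Ioo 0 π) (hβ₁ : β₁ ∈ Ioo 0 π) (hα₂ : α₂ ∈ Ioo 0 π) (hα₃ : α₃ ∈ Ioo 0 π)
    (hβ₃ : β₃ ∈ Ioo 0 π) (hα₄ : α₄ ∈ Ioo 0 π)
    (l₁ : cos d₂₃ = cos d₁₂ * cos d₁₃ + sin d₁₂ * sin d₁₃ * cos α₁)
    (m₁ : cos d₃₄ = cos d₄₁ * cos d₁₃ + sin d₄₁ * sin d₁₃ * cos β₁)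
    (l₂ : cos d₁₃ = cos d₁₂ * cos d₂₃ + sin d₁₂ * sin d₂₃ * cos α₂)
    (l₃ : cos d₄₁ = cos d₃₄ * cos d₁₃ + sin d₃₄ * sin d₁₃ * cos α₃)
    (m₃ : cos d₁₂ = cos d₂₃ * cos d₁₃ + sin d₂₃ * sin d₁₃ * cos β₃)
    (l₄ : cos d₁₃ = cos d₄₁ * cos d₃₄ + sin d₄₁ * sin d₃₄ * cos α₄)
    (h₁ : 0 < s₁ → 2 * π < α₁ + β₁ + (a₁₂ + a₁₄)) (h₃ : 0 < s₃ → 2 * π < α₃ + β₃ + (a₃₄ + a₃₂))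
    (h₂ : 2 * π ≤ α₂ + (a₂₁ + a₂₃)) (h₂' : s₂ < 0 → 2 * π = α₂ + (a₂₁ + a₂₃))
    (h₄ : 2 * π ≤ α₄ + (a₄₁ + a₄₃)) (h₄' : s₄ < 0 → 2 * π = α₄ + (a₄₁ + a₄₃)) : False := by
  have hs₂ := nonpos_of_projection_pi hc₂ hd₁₂ hd₂₃ ha₂₁ ha₂₃ hα₂.2 r₂₁ r₂₃ h₂
  have hs₄ : s₄ ≤ 0 := nonpos_of_projection_pi (t := π - t) hc₄ hd₄₁ hd₃₄ ha₄₁ ha₄₃ hα₄.2 r₄₁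
    (by rwa [sub_sub_cancel]) h₄
  have p₂₃ : cos d₂₃ = - (c₂ * c₃ * cos t) + s₂ * s₃ := by
    have := r₂₃.product e₂
    rw [← o₂₃, cos_pi_sub] at this; linarith
  have p₃₄ : cos d₃₄ = c₃ * c₄ * cos t + s₃ * s₄ := by
    have := r₃₄.product e₃
    rw [← o₃₄] at this; linarith
  have p₄₁ : cos d₄₁ = - (c₁ * c₄ * cos t) + s₁ * s₄ := by
    have := r₄₁.product e₄
    rw [← o₄₁, cos_pi_sub] at this; linarith
  have p₁₂ : cos d₁₂ = c₁ * c₂ * cos t + s₁ * s₂ := by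
    have := r₁₂.product e₁
    rw [← o₁₂] at this; linarith
  have E : cos d₁₃ = - (c₁ * c₃) + s₁ * s₃ ∨
      d₁₂ = π / 2 ∧ d₂₃ = π / 2 ∧ d₃₄ = π / 2 ∧ d₄₁ = π / 2 := by
    -- A vertex of negative height is passed on the inner side, where the angles add up to exactly
    -- `2π`. Its face is then developed faithfully, and the diagonal joins points whose projections
    -- are antipodal. If both heights vanish, the geodesic runs through both vertices and all four
    -- edges are quarter circles.
    rcases hs₂.lt_or_eq with h | h
    · left
      have k := r₂₁.cos_add r₂₃ e₂
      rw [← o₂₁, ← o₂₃, show t + (π - t) = π by ring, cos_pi,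
        show a₂₁ + a₂₃ = 2 * π - α₂ by linarith [h₂' h], cos_two_pi_sub, ← l₂] at k
      linarith
    rcases hs₄.lt_or_eq with h' | h'
    · left
      have k := r₄₁.cos_add r₄₃ e₄
      rw [← o₄₁, ← o₄₃, show π - t + t = π by ring, cos_pi,
        show a₄₁ + a₄₃ = 2 * π - α₄ by linarith [h₄' h'], cos_two_pi_sub, ← l₄] at k
      linarith
    · right
      rw [h] at r₂₁ r₂₃ e₂
      rw [h'] at r₄₁ r₄₃ e₄
      obtain ⟨A, B⟩ := eq_pi_div_two_of_through hc₁ hc₃ hd₁₂ hd₂₃ e₂ hc₂ r₂₁ r₂₃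
      obtain ⟨C, D⟩ := eq_pi_div_two_of_through (t := π - t) hc₁ hc₃ hd₄₁ hd₃₄ e₄ hc₄ r₄₁
        (by rwa [sub_sub_cancel])
      exact ⟨A, B, D, C⟩
  -- Since `α₂ < π`, the sum `a₂₁ + a₂₃` exceeds `π`. One of the two angles is obtuse, and that edge
  -- rises from `v₂` to a positive height.
  have hs : 0 < s₁ ∨ 0 < s₃ := by
    rcases lt_or_ge (π / 2) a₂₁ with h | h
    · exact Or.inl (height_pos_of_obtuse hc₂ hs₂ hd₁₂ h ha₂₁.2 o₂₁)
    · exact Or.inr (height_pos_of_obtuse hc₂ hs₂ hd₂₃ (by linarith [hα₂.2]) ha₂₃.2 o₂₃)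
  rcases hs with h | h
  · exact false_of_diagonal_endpoint hc₁ e₁ e₃ hd₁₂ hd₄₁ hd₁₃ ha₁₂ ha₁₄ r₁₂ r₁₄ o₁₂ o₁₄ p₂₃ p₃₄
      hα₁ hβ₁ l₁ m₁ h (h₁ h) E
  · refine false_of_diagonal_endpoint hc₃ e₃ e₁ hd₃₄ hd₂₃ hd₁₃ ha₃₄ ha₃₂ r₃₄ r₃₂ o₃₄ o₃₂
      (d₂₃ := d₄₁) (d₃₄ := d₁₂) ?_ ?_ hα₃ hβ₃ l₃ m₃ h (h₃ h) ?_
    · rw [p₄₁]; ring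
    · rw [p₁₂]
    · rcases E with E | ⟨A, B, C, D⟩
      · left; rw [E]; ring
      · exact Or.inr ⟨C, D, A, B⟩

/-! ### Sinusoids and great circles -/

theorem eq_zero_of_sinusoid_eventually_zero {A B m t : ℝ}
    (h : ∀ᶠ s in 𝓝 t, A * cos (s - m) + B * sin (s - m) = 0) : A = 0 ∧ B = 0 := by
  have h0 := h.self_of_nhds
  have hd : HasDerivAt (fun s => A * cos (s - m) + B * sin (s - m))
      (A * (-sin (t - m) * 1) + B * (cos (t - m) * 1)) t :=
    ((((hasDerivAt_id t).sub_const m).cos).const_mul A).add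
      ((((hasDerivAt_id t).sub_const m).sin).const_mul B)
  have hd0 : HasDerivAt (fun s => A * cos (s - m) + B * sin (s - m)) 0 t :=
    (hasDerivAt_const t (0 : ℝ)).congr_of_eventuallyEq h
  have h1 := hd.unique hd0
  have hsc := sin_sq_add_cos_sq (t - m)
  constructor
  · linear_combination (cos (t - m)) * h0 - (sin (t - m)) * h1 - A * hsc
  · linear_combination (sin (t - m)) * h0 + (cos (t - m)) * h1 - B * hsc

theorem exists_amplitude {A B t : ℝ} (h : 0 < A * cos t + B * sin t) :
    ∃ c m : ℝ, 0 < c ∧ |t - m| < π / 2 ∧ ∀ s, A * cos s + B * sin s = c * cos (s - m) := by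
  set g := A * cos t + B * sin t with hg
  set g' := - A * sin t + B * cos t with hg'
  set θ := arctan (g' / g) with hθ
  have hcos : 0 < cos θ := cos_arctan_pos _
  refine ⟨g / cos θ, t + θ, by positivity, ?_, fun s => ?_⟩
  · rw [show t - (t + θ) = -θ by ring, abs_neg, abs_lt]
    exact ⟨neg_pi_div_two_lt_arctan _, arctan_lt_pi_div_two _⟩
  · have h1 : g * tan θ = g' := by rw [hθ, tan_arctan]; field_simp
    have h2 : g / cos θ * cos (s - (t + θ)) = g * cos (s - t) + g' * sin (s - t) := by
      rw [← h1, tan_eq_sin_div_cos, show s - (t + θ) = (s - t) - θ by ring, cos_sub (s - t) θ]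
      field_simp
    rw [h2, hg, hg', cos_sub, sin_sub]
    have := sin_sq_add_cos_sq t
    linear_combination (- A * cos s - B * sin s) * this

/-- A continuous function that is a sinusoid (of frequency one) wherever it is positive consists of
bumps of length `π`. -/
theorem exists_bump {f : ℝ → ℝ} (hf : Continuous f)
    (hloc : ∀ t, 0 < f t → ∃ A B : ℝ, ∀ᶠ s in 𝓝 t, f s = A * cos s + B * sin s)
    {t : ℝ} (ht : 0 < f t) :
    ∃ c m : ℝ, 0 < c ∧ |t - m| < π / 2 ∧
      ∀ s ∈ Icc (m - π / 2) (m + π / 2), f s = c * cos (s - m) := by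
  obtain ⟨A, B, hAB⟩ := hloc t ht
  have h0 := hAB.self_of_nhds
  obtain ⟨c, m, hc, hm, hcm⟩ := exists_amplitude (A := A) (B := B) (t := t) (by rwa [← h0])
  refine ⟨c, m, hc, hm, ?_⟩
  have hpos : ∀ s ∈ Ioo (m - π / 2) (m + π / 2), 0 < c * cos (s - m) := fun s hs =>
    mul_pos hc (cos_pos_of_mem_Ioo ⟨by linarith [hs.1], by linarith [hs.2]⟩)
  have hcont : Continuous fun s => c * cos (s - m) := by fun_prop
  set S : Set ℝ := {s | ∀ᶠ s' in 𝓝 s, f s' = c * cos (s' - m)} with hS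
  have hSo : IsOpen S := by
    rw [isOpen_iff_mem_nhds]
    intro s hs
    exact eventually_eventually_nhds.2 hs
  have htS : t ∈ S := by
    filter_upwards [hAB] with s hs
    rw [hs, hcm]
  -- Unique continuation: at a limit point the value is still positive, so a local sinusoid exists
  -- there, and it must be the given one because the two agree on an open set.
  have key : ∀ s ∈ Ioo (m - π / 2) (m + π / 2), s ∈ closure S → s ∈ S := by
    intro s hs hcl
    have hfs : f s = c * cos (s - m) := by
      have : closure S ⊆ {s | f s = c * cos (s - m)} :=
        closure_minimal (fun x hx => hx.self_of_nhds) (isClosed_eq hf hcont)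
      exact this hcl
    obtain ⟨A', B', h'⟩ := hloc s (by rw [hfs]; exact hpos s hs)
    obtain ⟨U, hU, hUo, hsU⟩ := eventually_nhds_iff.1 h'
    obtain ⟨r, hrU, hrS⟩ := mem_closure_iff.1 hcl U hUo hsU
    have : ∀ᶠ x in 𝓝 r, (A' - A) * cos (x - 0) + (B' - B) * sin (x - 0) = 0 := by
      have hrS' : ∀ᶠ x in 𝓝 r, f x = c * cos (x - m) := hrS
      filter_upwards [hrS', hUo.mem_nhds hrU] with x hx hxU
      have e1 := hU x hxU
      rw [hx, ← hcm] at e1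
      rw [sub_zero]; linarith
    obtain ⟨hA, hB⟩ := eq_zero_of_sinusoid_eventually_zero this
    filter_upwards [h'] with x hx
    rw [hx, ← hcm, sub_eq_zero.1 hA, sub_eq_zero.1 hB]
  have hsub : Ioo (m - π / 2) (m + π / 2) ⊆ S := by
    refine isPreconnected_Ioo.subset_of_closure_inter_subset hSo ⟨t, ?_, htS⟩ ?_
    · rw [abs_lt] at hm; exact ⟨by linarith, by linarith⟩
    · rintro s ⟨hcl, hs⟩
      exact key s hs hcl
  have hcl : Icc (m - π / 2) (m + π / 2) ⊆ {s | f s = c * cos (s - m)} := by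
    rw [← closure_Ioo (by linarith [pi_pos])]
    exact closure_minimal (fun x hx => (hsub hx).self_of_nhds) (isClosed_eq hf hcont)
  exact hcl

/-- An orthonormal pair is made from two nearby points. Every other point has the inner products of
the expected combination with this pair, so the squared norm of the difference is zero. The base
parameter `m` is free so that the center of an arc can be inserted. -/
theorem exists_great_circle {E : Type*} [NormedAddCommGroup E] [InnerProductSpace ℝ E]
    {X : ℝ → E} {a b : ℝ} (hab : a < b)
    (h : ∀ s ∈ Ioo a b, ∀ s' ∈ Ioo a b, inner ℝ (X s) (X s') = cos (s - s')) (m : ℝ) :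
    ∃ P Q : E, inner ℝ P P = (1 : ℝ) ∧ inner ℝ Q Q = (1 : ℝ) ∧ inner ℝ P Q = (0 : ℝ) ∧
      ∀ s ∈ Ioo a b, X s = cos (s - m) • P + sin (s - m) • Q := by
  obtain ⟨s₀, hs₀⟩ := nonempty_Ioo.2 hab
  obtain ⟨s₁, hs₁, hs₁'⟩ := exists_between (lt_min hs₀.2 (show s₀ < s₀ + π by linarith [pi_pos]))
  have hs₁m : s₁ ∈ Ioo a b := ⟨hs₀.1.trans hs₁, hs₁'.trans_le (min_le_left _ _)⟩
  have hδ : 0 < sin (s₁ - s₀) := sin_pos_of_pos_of_lt_pi (by linarith)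
    (by linarith [hs₁'.trans_le (min_le_right _ _)])
  set δ := s₁ - s₀ with hδd
  set Q₀ : E := (sin δ)⁻¹ • (X s₁ - cos δ • X s₀) with hQ₀
  have i00 : inner ℝ (X s₀) (X s₀) = (1 : ℝ) := by rw [h _ hs₀ _ hs₀]; simp
  have iX : ∀ s ∈ Ioo a b, inner ℝ (X s) Q₀ = sin (s - s₀) := by
    intro s hs
    rw [hQ₀, inner_smul_right, inner_sub_right, inner_smul_right, h _ hs _ hs₁m, h _ hs _ hs₀,
      show s - s₁ = (s - s₀) - δ by rw [hδd]; ring, cos_sub]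
    field_simp; ring
  have iPQ : inner ℝ (X s₀) Q₀ = (0 : ℝ) := by rw [iX _ hs₀]; simp
  have iQQ : inner ℝ Q₀ Q₀ = (1 : ℝ) := by
    conv_lhs => rw [hQ₀]
    rw [inner_smul_left, inner_sub_left, inner_smul_left, iX _ hs₁m, iX _ hs₀]
    simp only [sub_self, sin_zero, mul_zero, sub_zero, RCLike.conj_to_real]
    exact inv_mul_cancel₀ hδ.ne'
  have main : ∀ s ∈ Ioo a b, X s = cos (s - s₀) • X s₀ + sin (s - s₀) • Q₀ := by
    intro s hs
    rw [← sub_eq_zero, ← inner_self_eq_zero (𝕜 := ℝ)]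
    simp only [inner_sub_left, inner_sub_right, inner_add_left, inner_add_right, inner_smul_left,
      inner_smul_right, RCLike.conj_to_real]
    rw [real_inner_comm (X s) (X s₀), real_inner_comm (X s) Q₀, real_inner_comm (X s₀) Q₀, iX s hs,
      iPQ, iQQ, i00, h s hs s₀ hs₀, h s hs s hs, sub_self, cos_zero]
    have := sin_sq_add_cos_sq (s - s₀)
    linear_combination (-1) * this
  refine ⟨cos (m - s₀) • X s₀ + sin (m - s₀) • Q₀, cos (m - s₀) • Q₀ - sin (m - s₀) • X s₀,
    ?_, ?_, ?_, ?_⟩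
  · simp only [inner_add_left, inner_add_right, inner_smul_left,
      inner_smul_right, RCLike.conj_to_real]
    rw [real_inner_comm (X s₀) Q₀, iPQ, iQQ, i00]
    linear_combination sin_sq_add_cos_sq (m - s₀)
  · simp only [inner_sub_left, inner_sub_right, inner_smul_left,
      inner_smul_right, RCLike.conj_to_real]
    rw [real_inner_comm (X s₀) Q₀, iPQ, iQQ, i00]
    linear_combination sin_sq_add_cos_sq (m - s₀)
  · simp only [inner_add_left, inner_sub_right, inner_smul_left,
      inner_smul_right, RCLike.conj_to_real]
    rw [real_inner_comm (X s₀) Q₀, iPQ, iQQ, i00]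
    ring
  · intro s hs
    rw [main s hs, show s - s₀ = (s - m) + (m - s₀) by ring, cos_add, sin_add]
    module

/-- The direction angle, as seen from a pole of the hemisphere, of a point moving along a great
circle at distance `arcsin σ` from the pole; `x` is the arc length from the point nearest to the
pole. -/
noncomputable def sweep (σ x : ℝ) : ℝ := arctan (tan x / σ)

theorem sweep_mem (σ x : ℝ) : sweep σ x ∈ Ioo (-(π / 2)) (π / 2) :=
  ⟨neg_pi_div_two_lt_arctan _, arctan_lt_pi_div_two _⟩

theorem sweep_polar {c σ x : ℝ} (hcσ : c ^ 2 + σ ^ 2 = 1) (hσ : 0 < σ) (hx : |x| < π / 2) :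
    √(1 - (c * cos x) ^ 2) * cos (sweep σ x) = σ * cos x ∧
    √(1 - (c * cos x) ^ 2) * sin (sweep σ x) = sin x := by
  rw [abs_lt] at hx
  have hcos : 0 < cos x := cos_pos_of_mem_Ioo hx
  have h1 : 1 - (c * cos x) ^ 2 = (σ * cos x) ^ 2 * (1 + (tan x / σ) ^ 2) := by
    rw [tan_eq_sin_div_cos]
    field_simp
    linear_combination (- cos x ^ 2) * hcσ - sin_sq_add_cos_sq x
  have h2 : 0 < √(1 + (tan x / σ) ^ 2) := by positivity
  have h3 : √(1 - (c * cos x) ^ 2) = σ * cos x * √(1 + (tan x / σ) ^ 2) := by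
    rw [h1, sqrt_mul (by positivity), sqrt_sq (by positivity)]
  rw [h3, sweep, cos_arctan, sin_arctan, tan_eq_sin_div_cos]
  constructor <;> field_simp

theorem continuousAt_sweep {σ x : ℝ} (hx : |x| < π / 2) : ContinuousAt (sweep σ) x := by
  rw [abs_lt] at hx
  have : ContinuousAt tan x := continuousAt_tan.2 (cos_pos_of_mem_Ioo hx).ne'
  exact continuous_arctan.continuousAt.comp (this.div_const σ)

theorem sweep_strictMono {σ x y : ℝ} (hσ : 0 < σ) (hx : |x| < π / 2) (hy : |y| < π / 2)
    (hxy : x < y) : sweep σ x < sweep σ y := by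
  rw [abs_lt] at hx hy
  exact arctan_strictMono (div_lt_div_of_pos_right (tan_lt_tan_of_lt_of_lt_pi_div_two hx.1 hy.2 hxy) hσ)

theorem eq_zero_of_cos_eq_one {x : ℝ} (hx : |x| < 2 * π) (h : cos x = 1) : x = 0 := by
  rw [abs_lt] at hx
  exact (cos_eq_one_iff_of_lt_of_lt hx.1 hx.2).1 h

/-- In polar coordinates around a point, a great circle is described by `sweep`. -/
theorem eventually_angle_eq_sweep {c σ m s₀ p₁ p₂ q₁ q₂ : ℝ} {φ : ℝ → ℝ}
    (hcσ : c ^ 2 + σ ^ 2 = 1) (hσ : 0 ≤ σ) (hs₀ : |s₀ - m| < π / 2)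
    (hρ : 0 < 1 - (c * cos (s₀ - m)) ^ 2)
    (hq : q₁ ^ 2 + q₂ ^ 2 = 1) (hpq : p₁ * q₁ + p₂ * q₂ = 0) (hp : p₁ ^ 2 + p₂ ^ 2 = σ ^ 2)
    (hφ : ∀ᶠ s in 𝓝 s₀, φ s ∈ Ioo (-π) π)
    (h₁ : ∀ᶠ s in 𝓝 s₀, √(1 - (c * cos (s - m)) ^ 2) * cos (φ s)
      = cos (s - m) * p₁ + sin (s - m) * q₁)
    (h₂ : ∀ᶠ s in 𝓝 s₀, √(1 - (c * cos (s - m)) ^ 2) * sin (φ s)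
      = cos (s - m) * p₂ + sin (s - m) * q₂) :
    ∃ ε : ℝ, (ε = 1 ∨ ε = -1) ∧
      ∀ᶠ s in 𝓝 s₀, φ s = φ s₀ + ε * (sweep σ (s - m) - sweep σ (s₀ - m)) := by
  have hcontρ : Continuous fun s => 1 - (c * cos (s - m)) ^ 2 := by fun_prop
  have hev : ∀ᶠ s in 𝓝 s₀, 0 < 1 - (c * cos (s - m)) ^ 2 :=
    hcontρ.continuousAt.eventually (lt_mem_nhds hρ)
  have hevx : ∀ᶠ s in 𝓝 s₀, |s - m| < π / 2 := by
    have : Continuous fun s => |s - m| := by fun_prop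
    exact this.continuousAt.eventually (gt_mem_nhds hs₀)
  -- `φ` is continuous at `s₀`
  have hφc : ContinuousAt φ s₀ := by
    -- `φ` is the argument of the horizontal part of the great circle, read as a complex number. As
    -- `φ` stays in the open interval, this number avoids the slit, where `arg` is continuous.
    set Z : ℝ → ℂ := fun s => ⟨cos (s - m) * p₁ + sin (s - m) * q₁,
      cos (s - m) * p₂ + sin (s - m) * q₂⟩ with hZ
    have hZc : Continuous Z := by
      have : Z = fun s => ((cos (s - m) * p₁ + sin (s - m) * q₁ : ℝ) : ℂ)
          + ((cos (s - m) * p₂ + sin (s - m) * q₂ : ℝ) : ℂ) * Complex.I := by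
        funext s; exact Complex.mk_eq_add_mul_I _ _
      rw [this]; fun_prop
    have hZφ : ∀ᶠ s in 𝓝 s₀, Z s = ((√(1 - (c * cos (s - m)) ^ 2) : ℝ) : ℂ)
        * (Complex.cos (φ s) + Complex.sin (φ s) * Complex.I) := by
      filter_upwards [h₁, h₂] with s e1 e2
      apply Complex.ext
      · simp [hZ, ← e1, Complex.cos_ofReal_re, Complex.sin_ofReal_im, ← Complex.ofReal_cos, ← Complex.ofReal_sin]
      · simp [hZ, ← e2, ← Complex.ofReal_cos, ← Complex.ofReal_sin]
    have harg : ∀ᶠ s in 𝓝 s₀, (Z s).arg = φ s := by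
      filter_upwards [hZφ, hφ, hev] with s e hs hpos
      rw [e]
      exact Complex.arg_mul_cos_add_sin_mul_I (sqrt_pos.2 hpos) ⟨hs.1, hs.2.le⟩
    have hslit : Z s₀ ∈ Complex.slitPlane := by
      rw [Complex.mem_slitPlane_iff_arg, harg.self_of_nhds]
      refine ⟨hφ.self_of_nhds.2.ne, ?_⟩
      have : ‖Z s₀‖ ≠ 0 := by
        rw [hZφ.self_of_nhds, norm_mul]
        simp only [Complex.norm_real, norm_eq_abs, Complex.norm_cos_add_sin_mul_I, mul_one]
        rw [abs_of_nonneg (sqrt_nonneg _)]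
        exact (sqrt_pos.2 hρ).ne'
      exact norm_ne_zero_iff.1 this
    have : ContinuousAt (fun s => (Z s).arg) s₀ :=
      (Complex.continuousAt_arg hslit).comp hZc.continuousAt
    exact this.congr harg
  have hAc : ContinuousAt (fun s => sweep σ (s - m)) s₀ :=
    ContinuousAt.comp (f := fun s => s - m) (continuousAt_sweep hs₀) (by fun_prop)
  -- reduction to trigonometric identities
  suffices hsuff : ∃ ε : ℝ, (ε = 1 ∨ ε = -1) ∧ ∀ᶠ s in 𝓝 s₀,
      cos (φ s - φ s₀) = cos (sweep σ (s - m) - sweep σ (s₀ - m)) ∧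
      sin (φ s - φ s₀) = ε * sin (sweep σ (s - m) - sweep σ (s₀ - m)) by
    obtain ⟨ε, hε, hev'⟩ := hsuff
    refine ⟨ε, hε, ?_⟩
    have hD : ContinuousAt (fun s => |φ s - φ s₀ - ε * (sweep σ (s - m) - sweep σ (s₀ - m))|) s₀ := by
      fun_prop
    have hD0 : ∀ᶠ s in 𝓝 s₀, |φ s - φ s₀ - ε * (sweep σ (s - m) - sweep σ (s₀ - m))| < 2 * π := by
      apply hD.eventually (gt_mem_nhds _)
      simp [pi_pos]
    filter_upwards [hev', hD0] with s hs hs'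
    have hε2 : ε * ε = 1 := by rcases hε with h | h <;> rw [h] <;> norm_num
    have : cos (φ s - φ s₀ - ε * (sweep σ (s - m) - sweep σ (s₀ - m))) = 1 := by
      rw [cos_sub, hs.1, hs.2]
      have hsc := sin_sq_add_cos_sq (sweep σ (s - m) - sweep σ (s₀ - m))
      rcases hε with h | h <;> rw [h]
      · simp only [one_mul]; linear_combination hsc
      · simp only [neg_mul, one_mul, cos_neg, sin_neg]; linear_combination hsc
    linarith [eq_zero_of_cos_eq_one hs' this]
  -- For `σ = 0` the circle passes through the pole and the direction is constant on each side of
  -- it. Division by zero makes `sweep 0` vanish, in agreement with this. Since `s₀` is not the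
  -- pole, `sin (s - m)` keeps its sign nearby.
  rcases hσ.eq_or_lt with h0 | hσ
  · refine ⟨1, Or.inl rfl, ?_⟩
    have hp1 : p₁ = 0 := by rw [← h0] at hp; nlinarith [sq_nonneg p₁, sq_nonneg p₂]
    have hp2 : p₂ = 0 := by rw [← h0] at hp; nlinarith [sq_nonneg p₁, sq_nonneg p₂]
    have hc2 : c ^ 2 = 1 := by rw [← h0] at hcσ; linarith
    have hρs : ∀ s, 1 - (c * cos (s - m)) ^ 2 = sin (s - m) ^ 2 := fun s => by
      rw [mul_pow, hc2, sin_sq]; ring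
    have hsin0 : sin (s₀ - m) ≠ 0 := fun h => by rw [hρs, h] at hρ; simp at hρ
    have hsame : ∀ᶠ s in 𝓝 s₀, 0 < sin (s - m) * sin (s₀ - m) := by
      have : Continuous fun s => sin (s - m) * sin (s₀ - m) := by fun_prop
      exact this.continuousAt.eventually (lt_mem_nhds (mul_self_pos.2 hsin0))
    filter_upwards [hsame, h₁, h₂] with s hs e1 e2
    have e1' := h₁.self_of_nhds
    have e2' := h₂.self_of_nhds
    rw [hp1, hρs, sqrt_sq_eq_abs] at e1 e1'
    rw [hp2, hρs, sqrt_sq_eq_abs] at e2 e2'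
    simp only [← h0, sweep, div_zero, arctan_zero, sub_self, cos_zero, sin_zero, mul_zero]
    simp only [mul_zero, zero_add] at e1 e2 e1' e2'
    have habs : |sin (s - m)| * |sin (s₀ - m)| = sin (s - m) * sin (s₀ - m) := by
      rw [← abs_mul, abs_of_pos hs]
    constructor
    · have : (sin (s - m) * sin (s₀ - m)) * cos (φ s - φ s₀) = (sin (s - m) * sin (s₀ - m)) * 1 := by
        rw [cos_sub (φ s) (φ s₀)]
        nth_rewrite 1 [← habs]
        calc _ = (|sin (s - m)| * cos (φ s)) * (|sin (s₀ - m)| * cos (φ s₀))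
              + (|sin (s - m)| * sin (φ s)) * (|sin (s₀ - m)| * sin (φ s₀)) := by ring
          _ = _ := by rw [e1, e2, e1', e2']; linear_combination (sin (s - m) * sin (s₀ - m)) * hq
      exact mul_left_cancel₀ hs.ne' this
    · have : (sin (s - m) * sin (s₀ - m)) * sin (φ s - φ s₀) = (sin (s - m) * sin (s₀ - m)) * 0 := by
        rw [sin_sub (φ s) (φ s₀)]
        nth_rewrite 1 [← habs]
        calc _ = (|sin (s - m)| * sin (φ s)) * (|sin (s₀ - m)| * cos (φ s₀))
              - (|sin (s - m)| * cos (φ s)) * (|sin (s₀ - m)| * sin (φ s₀)) := by ring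
          _ = _ := by rw [e1, e2, e1', e2']; ring
      exact mul_left_cancel₀ hs.ne' this
  · -- `p = ε σ (q₂, -q₁)`
    obtain ⟨ε, hε, hpε₁, hpε₂⟩ : ∃ ε : ℝ, (ε = 1 ∨ ε = -1) ∧ p₁ = ε * σ * q₂ ∧ p₂ = - (ε * σ * q₁) := by
      set u := p₁ * q₂ - p₂ * q₁ with hu
      have hu1 : p₁ = u * q₂ := by rw [hu]; linear_combination (-p₁) * hq + q₁ * hpq
      have hu2 : p₂ = - (u * q₁) := by rw [hu]; linear_combination (-p₂) * hq + q₂ * hpq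
      have hu3 : u ^ 2 = σ ^ 2 := by
        rw [← hp, hu1, hu2]; linear_combination (-u ^ 2) * hq
      rcases sq_eq_sq_iff_eq_or_eq_neg.1 hu3 with h | h
      · exact ⟨1, Or.inl rfl, by rw [hu1, h]; ring, by rw [hu2, h]; ring⟩
      · exact ⟨-1, Or.inr rfl, by rw [hu1, h]; ring, by rw [hu2, h]; ring⟩
    have hε2 : ε * ε = 1 := by rcases hε with h | h <;> rw [h] <;> norm_num
    have hcs : ∀ᶠ s in 𝓝 s₀, cos (φ s) = ε * cos (sweep σ (s - m)) * q₂ + sin (sweep σ (s - m)) * q₁ ∧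
        sin (φ s) = - (ε * cos (sweep σ (s - m)) * q₁) + sin (sweep σ (s - m)) * q₂ := by
      filter_upwards [h₁, h₂, hev, hevx] with s e1 e2 hpos hx
      obtain ⟨w1, w2⟩ := sweep_polar hcσ hσ hx
      have hne := (sqrt_pos.2 hpos).ne'
      constructor
      · apply mul_left_cancel₀ hne
        rw [e1, hpε₁]
        linear_combination (-(ε * q₂)) * w1 - q₁ * w2
      · apply mul_left_cancel₀ hne
        rw [e2, hpε₂]
        linear_combination (ε * q₁) * w1 - q₂ * w2
    refine ⟨ε, hε, ?_⟩
    obtain ⟨k1, k2⟩ := hcs.self_of_nhds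
    filter_upwards [hcs] with s hs
    obtain ⟨l1, l2⟩ := hs
    set C := cos (sweep σ (s - m))
    set S := sin (sweep σ (s - m))
    set C₀ := cos (sweep σ (s₀ - m))
    set S₀ := sin (sweep σ (s₀ - m))
    constructor
    · rw [cos_sub, cos_sub, l1, l2, k1, k2]
      linear_combination (ε * ε * C * C₀ + S * S₀) * hq + C * C₀ * hε2
    · rw [sin_sub, sin_sub, l1, l2, k1, k2]
      linear_combination (ε * (S * C₀ - C * S₀)) * hq

namespace SphericalGluing

/-! ### Spherical coordinates in a cell -/

variable {X : Type*} {𝒯 : SphericalGluing X} {S T : Finset X} {v w x y : X}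

theorem norm_chart (hT : T ∈ 𝒯.faces) (hx : x ∈ 𝒯.cell T) : ‖𝒯.chart T x‖ = 1 :=
  ((𝒯.chart_bijOn T hT).mapsTo hx).1

theorem inner_chart_self (hT : T ∈ 𝒯.faces) (hx : x ∈ 𝒯.cell T) :
    inner ℝ (𝒯.chart T x) (𝒯.chart T x) = (1 : ℝ) := by
  rw [real_inner_self_eq_norm_sq, norm_chart hT hx, one_pow]

theorem mem_cell_of_mem (hT : T ∈ 𝒯.faces) (hv : v ∈ T) : v ∈ 𝒯.cell T :=
  𝒯.vertex_mem_cell T hT hv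

theorem cos_sphericalDist {p q : E3} (hp : ‖p‖ = 1) (hq : ‖q‖ = 1) :
    cos (sphericalDist p q) = inner ℝ p q := by
  rw [sphericalDist, InnerProductGeometry.cos_angle, hp, hq]; simp

theorem sphericalDist_eq_arccos {p q : E3} (hp : ‖p‖ = 1) (hq : ‖q‖ = 1) :
    sphericalDist p q = arccos (inner ℝ p q) := by
  rw [sphericalDist, InnerProductGeometry.angle, hp, hq]; simp

theorem inner_chart_eq (hT : T ∈ 𝒯.faces) (hS : S ∈ 𝒯.faces) (hxT : x ∈ 𝒯.cell T)
    (hxS : x ∈ 𝒯.cell S) (hyT : y ∈ 𝒯.cell T) (hyS : y ∈ 𝒯.cell S) :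
    inner ℝ (𝒯.chart T x) (𝒯.chart T y) = (inner ℝ (𝒯.chart S x) (𝒯.chart S y) : ℝ) := by
  rw [← cos_sphericalDist (norm_chart hT hxT) (norm_chart hT hyT),
    ← cos_sphericalDist (norm_chart hS hxS) (norm_chart hS hyS),
    𝒯.chart_compat T hT S hS x ⟨hxT, hxS⟩ y ⟨hyT, hyS⟩]

theorem exists_sum_of_mem_span {s : Set X} (hs : s ⊆ T) {p : E3}
    (hp : p ∈ Submodule.span ℝ≥0 (𝒯.chart T '' s)) :
    ∃ c : X → ℝ, (∀ u, 0 ≤ c u) ∧ (∀ u, u ∉ s → c u = 0) ∧ p = ∑ u ∈ T, c u • 𝒯.chart T u := by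
  induction hp using Submodule.span_induction with
  | mem p hp =>
    obtain ⟨a, ha, rfl⟩ := hp
    refine ⟨fun u => if u = a then 1 else 0, fun u => by dsimp only; split_ifs <;> norm_num, ?_, ?_⟩
    · intro u hu
      change (if u = a then (1 : ℝ) else 0) = 0
      rw [if_neg]; rintro rfl; exact hu ha
    · have haT : a ∈ T := hs ha
      simp [haT]
  | zero => exact ⟨0, fun _ => le_rfl, fun _ _ => rfl, by simp⟩
  | add p q _ _ hp hq =>
    obtain ⟨c, h1, h2, rfl⟩ := hp
    obtain ⟨c', h1', h2', rfl⟩ := hq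
    refine ⟨c + c', fun u => add_nonneg (h1 u) (h1' u), fun u hu => ?_, ?_⟩
    · simp [h2 u hu, h2' u hu]
    · simp [add_smul, Finset.sum_add_distrib]
  | smul r p _ hp =>
    obtain ⟨c, h1, h2, rfl⟩ := hp
    refine ⟨fun u => r * c u, fun u => mul_nonneg r.2 (h1 u), fun u hu => ?_, ?_⟩
    · simp [h2 u hu]
    · simp [Finset.smul_sum, mul_smul, NNReal.smul_def]

theorem sum_mem_span {s : Set X} {c : X → ℝ} (h0 : ∀ u ∈ T, 0 ≤ c u)
    (hs : ∀ u ∈ T, u ∉ s → c u = 0) :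
    ∑ u ∈ T, c u • 𝒯.chart T u ∈ Submodule.span ℝ≥0 (𝒯.chart T '' s) := by
  refine Submodule.sum_mem _ fun u hu => ?_
  by_cases hus : u ∈ s
  · have := Submodule.smul_mem (Submodule.span ℝ≥0 (𝒯.chart T '' s)) ⟨c u, h0 u hu⟩
      (Submodule.subset_span (mem_image_of_mem _ hus))
    exact this
  · rw [hs u hu hus, zero_smul]; exact Submodule.zero_mem _

theorem eq_of_sum_eq (hT : T ∈ 𝒯.faces) {c c' : X → ℝ}
    (h : ∑ u ∈ T, c u • 𝒯.chart T u = ∑ u ∈ T, c' u • 𝒯.chart T u) : ∀ u ∈ T, c u = c' u := by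
  have hli := Fintype.linearIndependent_iff.1 (𝒯.linearIndependent_chart T hT)
    (fun u => c u - c' u) (by
      rw [Finset.sum_coe_sort T (fun u => (c u - c' u) • 𝒯.chart T u)]
      simp only [sub_smul, Finset.sum_sub_distrib, h, sub_self])
  intro u hu
  exact sub_eq_zero.1 (hli ⟨u, hu⟩)

variable (𝒯) in
/-- The coefficients of a point of a cell with respect to the vertices of the cell. -/
noncomputable def coord (T : Finset X) (x : X) : X → ℝ :=
  if h : ∃ c : X → ℝ, (∀ u, 0 ≤ c u) ∧ 𝒯.chart T x = ∑ u ∈ T, c u • 𝒯.chart T u then h.choose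
  else 0

theorem coord_spec (hT : T ∈ 𝒯.faces) (hx : x ∈ 𝒯.cell T) :
    (∀ u, 0 ≤ 𝒯.coord T x u) ∧ 𝒯.chart T x = ∑ u ∈ T, 𝒯.coord T x u • 𝒯.chart T u := by
  have h : ∃ c : X → ℝ, (∀ u, 0 ≤ c u) ∧ 𝒯.chart T x = ∑ u ∈ T, c u • 𝒯.chart T u := by
    obtain ⟨c, h1, -, h2⟩ := exists_sum_of_mem_span subset_rfl ((𝒯.chart_bijOn T hT).mapsTo hx).2
    exact ⟨c, h1, h2⟩
  rw [coord, dif_pos h]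
  exact h.choose_spec

theorem coord_nonneg (hT : T ∈ 𝒯.faces) (hx : x ∈ 𝒯.cell T) (u : X) : 0 ≤ 𝒯.coord T x u :=
  (coord_spec hT hx).1 u

theorem chart_eq_sum (hT : T ∈ 𝒯.faces) (hx : x ∈ 𝒯.cell T) :
    𝒯.chart T x = ∑ u ∈ T, 𝒯.coord T x u • 𝒯.chart T u :=
  (coord_spec hT hx).2

/-- The gluing condition in coordinates: a point of two faces is supported on their common vertices.
`mem_cell_of_coord` is the converse. -/
theorem coord_eq_zero (hT : T ∈ 𝒯.faces) (hx : x ∈ 𝒯.cell T) (hS : S ∈ 𝒯.faces)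
    (hxS : x ∈ 𝒯.cell S) {u : X} (hu : u ∈ T) (huS : u ∉ S) : 𝒯.coord T x u = 0 := by
  have h : x ∈ 𝒯.cell T ∩ 𝒯.cell S := ⟨hx, hxS⟩
  rw [𝒯.cell_inter T hT S hS] at h
  obtain ⟨c, -, h2, h3⟩ := exists_sum_of_mem_span (inter_subset_left) h.2.2
  rw [chart_eq_sum hT hx] at h3
  rw [eq_of_sum_eq hT h3 u hu]
  exact h2 u fun h => huS h.2

theorem mem_cell_of_coord (hT : T ∈ 𝒯.faces) (hx : x ∈ 𝒯.cell T) (hS : S ∈ 𝒯.faces)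
    (h : ∀ u ∈ T, u ∉ S → 𝒯.coord T x u = 0) : x ∈ 𝒯.cell S := by
  have : x ∈ 𝒯.cell T ∩ 𝒯.cell S := by
    rw [𝒯.cell_inter T hT S hS]
    refine ⟨hx, norm_chart hT hx, ?_⟩
    rw [chart_eq_sum hT hx]
    exact sum_mem_span (fun u _ => coord_nonneg hT hx u) fun u hu huS => h u hu fun h' => huS ⟨hu, h'⟩
  exact this.2

theorem exists_point (hT : T ∈ 𝒯.faces) {c : X → ℝ} (hc : ∀ u ∈ T, 0 ≤ c u)
    (hn : ‖∑ u ∈ T, c u • 𝒯.chart T u‖ = 1) :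
    ∃ x ∈ 𝒯.cell T, 𝒯.chart T x = ∑ u ∈ T, c u • 𝒯.chart T u ∧ ∀ u ∈ T, 𝒯.coord T x u = c u := by
  obtain ⟨x, hx, hxe⟩ := (𝒯.chart_bijOn T hT).surjOn
    ⟨hn, sum_mem_span (s := (T : Set X)) hc fun u hu hu' => absurd hu hu'⟩
  refine ⟨x, hx, hxe, eq_of_sum_eq hT ?_⟩
  rw [← chart_eq_sum hT hx, hxe]

theorem eq_of_chart_eq (hT : T ∈ 𝒯.faces) (hx : x ∈ 𝒯.cell T) (hy : y ∈ 𝒯.cell T)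
    (h : 𝒯.chart T x = 𝒯.chart T y) : x = y :=
  (𝒯.chart_bijOn T hT).injOn hx hy h

theorem eq_vertex_of_coord (hT : T ∈ 𝒯.faces) (hx : x ∈ 𝒯.cell T) (hv : v ∈ T)
    (h : ∀ u ∈ T, u ≠ v → 𝒯.coord T x u = 0) : x = v := by
  apply eq_of_chart_eq hT hx (mem_cell_of_mem hT hv)
  have h1 : 𝒯.chart T x = 𝒯.coord T x v • 𝒯.chart T v := by
    conv_lhs => rw [chart_eq_sum hT hx]
    rw [Finset.sum_eq_single_of_mem v hv]
    intro u hu huv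
    rw [h u hu huv, zero_smul]
  have h2 := norm_chart hT hx
  rw [h1, norm_smul, norm_chart hT (mem_cell_of_mem hT hv), mul_one, norm_eq_abs,
    abs_of_nonneg (coord_nonneg hT hx v)] at h2
  rw [h1, h2, one_smul]

variable (𝒯) in
/-- The cosine of the distance in the star of the vertex `v`. -/
noncomputable def ip (v x : X) : ℝ :=
  if h : ∃ T ∈ 𝒯.faces, v ∈ T ∧ x ∈ 𝒯.cell T then inner ℝ (𝒯.chart h.choose v) (𝒯.chart h.choose x)
  -- Away from the star the value `-1` keeps the bounds `-1 ≤ ip ≤ 1` true and the sign nonpositive.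
  else -1

theorem ip_eq (hT : T ∈ 𝒯.faces) (hv : v ∈ T) (hx : x ∈ 𝒯.cell T) :
    𝒯.ip v x = inner ℝ (𝒯.chart T v) (𝒯.chart T x) := by
  have h : ∃ T ∈ 𝒯.faces, v ∈ T ∧ x ∈ 𝒯.cell T := ⟨T, hT, hv, hx⟩
  rw [ip, dif_pos h]
  obtain ⟨h1, h2, h3⟩ := h.choose_spec
  exact inner_chart_eq h1 hT (mem_cell_of_mem h1 h2) (mem_cell_of_mem hT hv) h3 hx

theorem ip_comm (hT : T ∈ 𝒯.faces) (hv : v ∈ T) (hw : w ∈ T) : 𝒯.ip v w = 𝒯.ip w v := by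
  rw [ip_eq hT hv (mem_cell_of_mem hT hw), ip_eq hT hw (mem_cell_of_mem hT hv), real_inner_comm]

theorem ip_self (hT : T ∈ 𝒯.faces) (hv : v ∈ T) : 𝒯.ip v v = 1 := by
  rw [ip_eq hT hv (mem_cell_of_mem hT hv), inner_chart_self hT (mem_cell_of_mem hT hv)]

theorem ip_eq_sum (hT : T ∈ 𝒯.faces) (hv : v ∈ T) (hx : x ∈ 𝒯.cell T) :
    𝒯.ip v x = ∑ u ∈ T, 𝒯.coord T x u * 𝒯.ip v u := by
  rw [ip_eq hT hv hx]
  conv_lhs => rw [chart_eq_sum hT hx, inner_sum]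
  refine Finset.sum_congr rfl fun u hu => ?_
  rw [inner_smul_right, ip_eq hT hv (mem_cell_of_mem hT hu)]

theorem inner_chart_eq_sum (hT : T ∈ 𝒯.faces) (hx : x ∈ 𝒯.cell T) (hy : y ∈ 𝒯.cell T) :
    inner ℝ (𝒯.chart T x) (𝒯.chart T y) = ∑ u ∈ T, 𝒯.coord T x u * 𝒯.ip u y := by
  conv_lhs => rw [chart_eq_sum hT hx, sum_inner]
  refine Finset.sum_congr rfl fun u hu => ?_
  rw [inner_smul_left, ip_eq hT hu hy]
  rfl

theorem ip_le_one (v x : X) : 𝒯.ip v x ≤ 1 := by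
  by_cases h : ∃ T ∈ 𝒯.faces, v ∈ T ∧ x ∈ 𝒯.cell T
  · obtain ⟨T, hT, hv, hx⟩ := h
    rw [ip_eq hT hv hx]
    have := real_inner_le_norm (𝒯.chart T v) (𝒯.chart T x)
    rwa [norm_chart hT hx, norm_chart hT (mem_cell_of_mem hT hv), one_mul] at this
  · rw [ip, dif_neg h]; norm_num

theorem neg_one_le_ip (v x : X) : -1 ≤ 𝒯.ip v x := by
  by_cases h : ∃ T ∈ 𝒯.faces, v ∈ T ∧ x ∈ 𝒯.cell T
  · obtain ⟨T, hT, hv, hx⟩ := h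
    rw [ip_eq hT hv hx]
    have := neg_le_of_abs_le (abs_real_inner_le_norm (𝒯.chart T v) (𝒯.chart T x))
    rwa [norm_chart hT hx, norm_chart hT (mem_cell_of_mem hT hv), one_mul] at this
  · rw [ip, dif_neg h]

theorem sphericalDist_chart (hT : T ∈ 𝒯.faces) (hv : v ∈ T) (hx : x ∈ 𝒯.cell T) :
    sphericalDist (𝒯.chart T v) (𝒯.chart T x) = arccos (𝒯.ip v x) := by
  rw [ip_eq hT hv hx,
    sphericalDist_eq_arccos (norm_chart hT (mem_cell_of_mem hT hv)) (norm_chart hT hx)]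

theorem sphericalDist_comm (p q : E3) : sphericalDist p q = sphericalDist q p :=
  InnerProductGeometry.angle_comm _ _

variable (𝒯) in
/-- All edges are at least as long as a quarter of a great circle. -/
def LongEdges : Prop := ∀ v w : X, ∀ ℓ : ℝ, 𝒯.EdgeLengthEq v w ℓ → π / 2 ≤ ℓ ∧ ℓ < π

theorem LongEdges.arccos_mem (hE : 𝒯.LongEdges) (hT : T ∈ 𝒯.faces) (hv : v ∈ T) (hw : w ∈ T)
    (hvw : v ≠ w) : arccos (𝒯.ip v w) ∈ Ico (π / 2) π := by
  have := hE v w _ ⟨hvw, T, hT, hv, hw, rfl⟩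
  rwa [sphericalDist_chart hT hv (mem_cell_of_mem hT hw)] at this

theorem LongEdges.ip_nonpos (hE : 𝒯.LongEdges) (hT : T ∈ 𝒯.faces) (hv : v ∈ T) (hw : w ∈ T)
    (hvw : v ≠ w) : 𝒯.ip v w ≤ 0 := by
  by_contra! h
  linarith [arccos_lt_pi_div_two.2 h, (hE.arccos_mem hT hv hw hvw).1]

/-- In the expansion over the vertices the coordinate at `v` vanishes, and every other term is
nonpositive because edges are at least `π / 2` long. So the hemisphere of `v` does not leave the
open star of `v`. -/
theorem LongEdges.ip_nonpos_of_notMem (hE : 𝒯.LongEdges) (hS : S ∈ 𝒯.faces) (hx : x ∈ 𝒯.cell S)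
    (hv : v ∉ S) : 𝒯.ip v x ≤ 0 := by
  by_cases h : ∃ T ∈ 𝒯.faces, v ∈ T ∧ x ∈ 𝒯.cell T
  · obtain ⟨T, hT, hvT, hxT⟩ := h
    rw [ip_eq_sum hT hvT hxT]
    refine Finset.sum_nonpos fun u hu => ?_
    rcases eq_or_ne v u with rfl | huv
    · rw [coord_eq_zero hT hxT hS hx hvT hv, zero_mul]
    · exact mul_nonpos_of_nonneg_of_nonpos (coord_nonneg hT hxT u) (hE.ip_nonpos hT hvT hu huv)
  · rw [ip, dif_neg h]; norm_num

theorem LongEdges.mem_of_ip_pos (hE : 𝒯.LongEdges) (hS : S ∈ 𝒯.faces) (hx : x ∈ 𝒯.cell S)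
    (h : 0 < 𝒯.ip v x) : v ∈ S := by
  by_contra hv
  linarith [hE.ip_nonpos_of_notMem hS hx hv]

/-- Otherwise `1 = ⟨x, x⟩`, expanded with nonnegative coordinates, would be nonpositive. Hence the
hemispheres of the vertices cover the space. -/
theorem exists_ip_pos (x : X) : ∃ T ∈ 𝒯.faces, x ∈ 𝒯.cell T ∧ ∃ v ∈ T, 0 < 𝒯.ip v x := by
  obtain ⟨T, hT, hx⟩ := 𝒯.cover x
  refine ⟨T, hT, hx, ?_⟩
  by_contra! h
  have h1 := inner_chart_self hT hx
  rw [inner_chart_eq_sum hT hx hx] at h1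
  have : ∑ u ∈ T, 𝒯.coord T x u * 𝒯.ip u x ≤ 0 := Finset.sum_nonpos fun u hu =>
    mul_nonpos_of_nonneg_of_nonpos (coord_nonneg hT hx u) (h u hu)
  linarith

variable (𝒯) in
/-- The open star of the simplex spanned by `v` and `w`. -/
def edgeStar (v w : X) : Set X := {x | ∀ S ∈ 𝒯.faces, x ∈ 𝒯.cell S → v ∈ S ∧ w ∈ S}

theorem LongEdges.mem_edgeStar (hE : 𝒯.LongEdges) (hv : 0 < 𝒯.ip v x) (hw : 0 < 𝒯.ip w x) :
    x ∈ 𝒯.edgeStar v w := fun _ hS hx => ⟨hE.mem_of_ip_pos hS hx hv, hE.mem_of_ip_pos hS hx hw⟩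

theorem LongEdges.exists_mem_edgeStar (hE : 𝒯.LongEdges) (hv : 0 < 𝒯.ip v x) (hxv : x ≠ v) :
    ∃ w, w ≠ v ∧ x ∈ 𝒯.edgeStar v w := by
  obtain ⟨T, hT, hx⟩ := 𝒯.cover x
  have hvT := hE.mem_of_ip_pos hT hx hv
  by_contra! h
  apply hxv
  refine eq_vertex_of_coord hT hx hvT fun u hu huv => ?_
  have := h u huv
  simp only [edgeStar, mem_ofPred_eq, not_forall] at this
  obtain ⟨S, hS, hxS, h'⟩ := this
  exact coord_eq_zero hT hx hS hxS hu fun huS => h' ⟨hE.mem_of_ip_pos hS hxS hv, huS⟩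

/-! ### The metric -/

variable [MetricSpace X]

/-- A function that is 1-Lipschitz on each triangle is 1-Lipschitz for the intrinsic metric, by
telescoping along broken lines. This is the source of all global lower bounds for distances. -/
theorem IsIntrinsic.sub_le_dist (hI : 𝒯.IsIntrinsic) {f : X → ℝ}
    (hf : ∀ T ∈ 𝒯.faces, ∀ x ∈ 𝒯.cell T, ∀ y ∈ 𝒯.cell T,
      f x - f y ≤ sphericalDist (𝒯.chart T x) (𝒯.chart T y)) (x y : X) : f x - f y ≤ dist x y := by
  refine (hI x y).2 ?_
  intro ℓ hℓ
  induction hℓ with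
  | nil x => simp
  | cons T x y z ℓ hT hx hy h ih => linarith [hf T hT x hx y hy]

theorem IsIntrinsic.dist_le (hI : 𝒯.IsIntrinsic) (hT : T ∈ 𝒯.faces) (hx : x ∈ 𝒯.cell T)
    (hy : y ∈ 𝒯.cell T) : dist x y ≤ sphericalDist (𝒯.chart T x) (𝒯.chart T y) := by
  have := (hI x y).1 (IsChain.cons T x y y 0 hT hx hy (IsChain.nil y))
  rwa [add_zero] at this

theorem sphericalDist_triangle (p q r : E3) :
    sphericalDist p r ≤ sphericalDist p q + sphericalDist q r :=
  InnerProductGeometry.angle_le_angle_add_angle p q r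

/-- The truncated distance to `v` is 1-Lipschitz on every triangle: on triangles at `v` by the
triangle inequality on the sphere, on all others because it is constantly `π / 2` there. -/
theorem IsIntrinsic.min_arccos_le_dist (hI : 𝒯.IsIntrinsic) (hE : 𝒯.LongEdges) (hT : T ∈ 𝒯.faces)
    (hv : v ∈ T) (x : X) : min (arccos (𝒯.ip v x)) (π / 2) ≤ dist v x := by
  have := hI.sub_le_dist (f := fun x => min (arccos (𝒯.ip v x)) (π / 2)) ?_ x v
  · rw [ip_self hT hv, arccos_one, min_eq_left pi_div_two_pos.le, sub_zero, dist_comm] at this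
    exact this
  · intro S hS y hy z hz
    by_cases hvS : v ∈ S
    · rw [← sphericalDist_chart hS hvS hy, ← sphericalDist_chart hS hvS hz]
      have := sphericalDist_triangle (𝒯.chart S v) (𝒯.chart S z) (𝒯.chart S y)
      rw [sphericalDist_comm (𝒯.chart S z)] at this
      have h0 : 0 ≤ sphericalDist (𝒯.chart S y) (𝒯.chart S z) :=
        InnerProductGeometry.angle_nonneg _ _
      rcases min_cases (sphericalDist (𝒯.chart S v) (𝒯.chart S z)) (π / 2) with ⟨h, h'⟩ | ⟨h, h'⟩
      · rw [h]; linarith [min_le_left (sphericalDist (𝒯.chart S v) (𝒯.chart S y)) (π / 2)]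
      · rw [h]; linarith [min_le_right (sphericalDist (𝒯.chart S v) (𝒯.chart S y)) (π / 2)]
    · have h1 := hE.ip_nonpos_of_notMem hS hy hvS
      have h2 := hE.ip_nonpos_of_notMem hS hz hvS
      have e : ∀ r : ℝ, r ≤ 0 → min (arccos r) (π / 2) = π / 2 := fun r hr => min_eq_right (by
        by_contra! h; exact absurd (arccos_lt_pi_div_two.1 h) (by linarith))
      rw [e _ h1, e _ h2, sub_self]
      exact InnerProductGeometry.angle_nonneg _ _

theorem IsIntrinsic.dist_eq_arccos (hI : 𝒯.IsIntrinsic) (hE : 𝒯.LongEdges) (hT : T ∈ 𝒯.faces)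
    (hv : v ∈ T) (h : 0 < 𝒯.ip v x) : dist v x = arccos (𝒯.ip v x) := by
  have h1 := hI.min_arccos_le_dist hE hT hv x
  rw [min_eq_left (arccos_lt_pi_div_two.2 h).le] at h1
  refine le_antisymm ?_ h1
  obtain ⟨S, hS, hx⟩ := 𝒯.cover x
  have hvS := hE.mem_of_ip_pos hS hx h
  rw [← sphericalDist_chart hS hvS hx]
  exact hI.dist_le hS (mem_cell_of_mem hS hvS) hx

theorem IsIntrinsic.dist_lt_iff (hI : 𝒯.IsIntrinsic) (hE : 𝒯.LongEdges) (hT : T ∈ 𝒯.faces)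
    (hv : v ∈ T) : dist v x < π / 2 ↔ 0 < 𝒯.ip v x := by
  constructor
  · intro h
    have h1 := (hI.min_arccos_le_dist hE hT hv x).trans_lt h
    rw [min_lt_iff] at h1
    exact arccos_lt_pi_div_two.1 (h1.resolve_right (lt_irrefl _))
  · intro h
    rw [hI.dist_eq_arccos hE hT hv h]
    exact arccos_lt_pi_div_two.2 h

theorem IsIntrinsic.cos_min_dist (hI : 𝒯.IsIntrinsic) (hE : 𝒯.LongEdges) (hT : T ∈ 𝒯.faces)
    (hv : v ∈ T) (x : X) : cos (min (dist v x) (π / 2)) = max 0 (𝒯.ip v x) := by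
  by_cases h : 0 < 𝒯.ip v x
  · rw [max_eq_right h.le, min_eq_left ((hI.dist_lt_iff hE hT hv).2 h).le,
      hI.dist_eq_arccos hE hT hv h, cos_arccos (neg_one_le_ip _ _) (ip_le_one _ _)]
  · rw [max_eq_left (not_lt.1 h), min_eq_right, cos_pi_div_two]
    exact not_lt.1 fun h' => h ((hI.dist_lt_iff hE hT hv).1 h')

theorem IsIntrinsic.continuous_max_ip (hI : 𝒯.IsIntrinsic) (hE : 𝒯.LongEdges) (hT : T ∈ 𝒯.faces)
    (hv : v ∈ T) : Continuous fun x => max 0 (𝒯.ip v x) := by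
  simp_rw [← hI.cos_min_dist hE hT hv]
  fun_prop

theorem isClosed_sphericalHull (hT : T ∈ 𝒯.faces) :
    IsClosed (sphericalHull (𝒯.chart T '' (T : Set X))) := by
  have hli := 𝒯.linearIndependent_chart T hT
  set f : (T → ℝ) →ₗ[ℝ] E3 := Fintype.linearCombination ℝ (fun v : T => 𝒯.chart T v) with hf
  have hinj : LinearMap.ker f = ⊥ := by
    rw [LinearMap.ker_eq_bot]; exact hli.fintypeLinearCombination_injective
  have hcl := (LinearMap.isClosedEmbedding_of_injective hinj).isClosedMap _
    (isClosed_Ici (a := (0 : T → ℝ)))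
  have : sphericalHull (𝒯.chart T '' (T : Set X)) = Metric.sphere 0 1 ∩ f '' Ici 0 := by
    ext p
    simp only [sphericalHull, mem_ofPred_eq, mem_inter_iff, mem_sphere_zero_iff_norm, mem_image]
    refine and_congr_right fun _ => ⟨fun h => ?_, ?_⟩
    · obtain ⟨c, h1, -, rfl⟩ := exists_sum_of_mem_span subset_rfl h
      refine ⟨fun u => c u, fun u => h1 u, ?_⟩
      rw [hf, Fintype.linearCombination_apply]
      exact Finset.sum_coe_sort T (fun u => c u • 𝒯.chart T u)
    · rintro ⟨c, h1, rfl⟩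
      rw [hf, Fintype.linearCombination_apply]
      refine Submodule.sum_mem _ fun u _ => ?_
      have := Submodule.smul_mem (Submodule.span ℝ≥0 (𝒯.chart T '' (T : Set X))) ⟨c u, h1 u⟩
        (Submodule.subset_span (mem_image_of_mem _ u.2))
      exact this
  rw [this]
  exact Metric.isClosed_sphere.inter hcl

/-- The inverse chart does not increase distances, so the cell is a continuous image of a compact
spherical triangle. -/
theorem IsIntrinsic.isClosed_cell (hI : 𝒯.IsIntrinsic) (hT : T ∈ 𝒯.faces) :
    IsClosed (𝒯.cell T) := by
  rcases (𝒯.cell T).eq_empty_or_nonempty with h | ⟨x₀, hx₀⟩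
  · rw [h]; exact isClosed_empty
  have hne : Nonempty X := ⟨x₀⟩
  set H := sphericalHull (𝒯.chart T '' (T : Set X))
  have hb := 𝒯.chart_bijOn T hT
  have hH : IsCompact H := Metric.isCompact_of_isClosed_isBounded (isClosed_sphericalHull hT)
    (Metric.isBounded_sphere.subset fun p hp => by
      rw [mem_sphere_zero_iff_norm]; exact hp.1)
  set g := Function.invFunOn (𝒯.chart T) (𝒯.cell T)
  have hg : ∀ p ∈ H, g p ∈ 𝒯.cell T ∧ 𝒯.chart T (g p) = p := fun p hp => by
    have : ∃ x ∈ 𝒯.cell T, 𝒯.chart T x = p := hb.surjOn hp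
    exact ⟨Function.invFunOn_mem this, Function.invFunOn_eq this⟩
  have hc : ContinuousOn g H := by
    intro p hp
    rw [ContinuousWithinAt, tendsto_iff_dist_tendsto_zero]
    have h0 : p ≠ 0 := by rw [← norm_ne_zero_iff, hp.1]; norm_num
    have hang : ContinuousWithinAt (fun q => sphericalDist q p) H p := by
      have : ContinuousAt (fun q : E3 => InnerProductGeometry.angle q p) p :=
        (InnerProductGeometry.continuousAt_angle (x := (p, p)) h0 h0).comp
          (f := fun q : E3 => (q, p)) (by fun_prop)
      exact this.continuousWithinAt
    have h1 : Tendsto (fun q => sphericalDist q p) (𝓝[H] p) (𝓝 0) := by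
      have := hang.tendsto
      rwa [sphericalDist, InnerProductGeometry.angle_self h0] at this
    refine squeeze_zero' (Eventually.of_forall fun _ => dist_nonneg) ?_ h1
    filter_upwards [self_mem_nhdsWithin] with q hq
    have := hI.dist_le hT (hg q hq).1 (hg p hp).1
    rwa [(hg q hq).2, (hg p hp).2] at this
  have : 𝒯.cell T = g '' H := by
    apply subset_antisymm
    · intro x hx
      refine ⟨𝒯.chart T x, hb.mapsTo hx, ?_⟩
      exact eq_of_chart_eq hT (hg _ (hb.mapsTo hx)).1 hx (hg _ (hb.mapsTo hx)).2
    · rintro _ ⟨p, hp, rfl⟩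
      exact (hg p hp).1
  rw [this]
  exact (hH.image_of_continuousOn hc).isClosed

theorem IsIntrinsic.isOpen_edgeStar (hI : 𝒯.IsIntrinsic) (v w : X) : IsOpen (𝒯.edgeStar v w) := by
  have : 𝒯.edgeStar v w = (⋃ S ∈ 𝒯.faces.filter (fun S => ¬ (v ∈ S ∧ w ∈ S)), 𝒯.cell S)ᶜ := by
    ext x
    simp only [edgeStar, mem_ofPred_eq, mem_compl_iff, mem_iUnion, Finset.mem_filter, not_exists]
    exact ⟨fun h S hS hx => hS.2 (h S hS.1 hx), fun h S hS hx => by_contra fun h' => h S ⟨hS, h'⟩ hx⟩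
  rw [this, isOpen_compl_iff]
  exact Set.Finite.isClosed_biUnion (Finset.finite_toSet _) fun S hS =>
    hI.isClosed_cell (Finset.mem_filter.1 hS).1

end SphericalGluing

namespace SphericalGluing

/-! ### Polar coordinates in a triangle -/

variable {X : Type*} {𝒯 : SphericalGluing X} {S T : Finset X} {v w a b x y : X}

variable (𝒯) in
/-- `T` is the face with the three vertices `v`, `a`, `b`. -/
structure Tri (T : Finset X) (v a b : X) : Prop where
  mem : T ∈ 𝒯.faces
  eq : T = {v, a, b}
  va : v ≠ a
  vb : v ≠ b
  ab : a ≠ b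

namespace Tri

theorem swap (h : 𝒯.Tri T v a b) : 𝒯.Tri T v b a :=
  ⟨h.mem, by rw [h.eq]; ext; simp; tauto, h.vb, h.va, h.ab.symm⟩

theorem rotate (h : 𝒯.Tri T v a b) : 𝒯.Tri T a b v :=
  ⟨h.mem, by rw [h.eq]; ext; simp; tauto, h.ab, h.va.symm, h.vb.symm⟩

theorem mem_v (h : 𝒯.Tri T v a b) : v ∈ T := by rw [h.eq]; simp
theorem mem_a (h : 𝒯.Tri T v a b) : a ∈ T := by rw [h.eq]; simp
theorem mem_b (h : 𝒯.Tri T v a b) : b ∈ T := by rw [h.eq]; simp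

theorem cell_v (h : 𝒯.Tri T v a b) : v ∈ 𝒯.cell T := mem_cell_of_mem h.mem h.mem_v
theorem cell_a (h : 𝒯.Tri T v a b) : a ∈ 𝒯.cell T := mem_cell_of_mem h.mem h.mem_a
theorem cell_b (h : 𝒯.Tri T v a b) : b ∈ 𝒯.cell T := mem_cell_of_mem h.mem h.mem_b

theorem sum_eq {M : Type*} [AddCommMonoid M] (h : 𝒯.Tri T v a b) (f : X → M) :
    ∑ u ∈ T, f u = f v + f a + f b := by
  rw [h.eq, Finset.sum_insert (by simp [h.va, h.vb]), Finset.sum_pair h.ab, add_assoc]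

theorem forall_mem (h : 𝒯.Tri T v a b) {p : X → Prop} (hv : p v) (ha : p a) (hb : p b) :
    ∀ u ∈ T, p u := by
  rw [h.eq]; simp [hv, ha, hb]

theorem mem_iff (h : 𝒯.Tri T v a b) {u : X} : u ∈ T ↔ u = v ∨ u = a ∨ u = b := by
  rw [h.eq]; simp

end Tri

theorem exists_tri_of_mem_of_mem (hT : T ∈ 𝒯.faces) (hv : v ∈ T) (ha : a ∈ T) (hva : v ≠ a) :
    ∃ b, 𝒯.Tri T v a b := by
  have hc := 𝒯.card_face T hT
  have h2 : ((T.erase v).erase a).card = 1 := by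
    rw [Finset.card_erase_of_mem (by simp [ha, hva.symm]), Finset.card_erase_of_mem hv, hc]
  obtain ⟨b, hb⟩ := Finset.card_eq_one.1 h2
  have hb' : b ∈ (T.erase v).erase a := by rw [hb]; simp
  simp only [Finset.mem_erase] at hb'
  refine ⟨b, hT, ?_, hva, hb'.2.1.symm, hb'.1.symm⟩
  ext u
  have hu : u ∈ (T.erase v).erase a ↔ u = b := by rw [hb]; simp
  simp only [Finset.mem_erase] at hu
  simp only [Finset.mem_insert, Finset.mem_singleton]
  constructor
  · intro h
    by_cases h1 : u = v
    · exact Or.inl h1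
    by_cases h2 : u = a
    · exact Or.inr (Or.inl h2)
    exact Or.inr (Or.inr (hu.1 ⟨h2, h1, h⟩))
  · rintro (rfl | rfl | rfl)
    exacts [hv, ha, hb'.2.2]

theorem exists_tri_of_mem (hT : T ∈ 𝒯.faces) (hv : v ∈ T) : ∃ a b, 𝒯.Tri T v a b := by
  have hc := 𝒯.card_face T hT
  have h2 : (T.erase v).Nonempty := by
    rw [← Finset.card_pos, Finset.card_erase_of_mem hv, hc]; norm_num
  obtain ⟨a, ha⟩ := h2
  rw [Finset.mem_erase] at ha
  obtain ⟨b, hb⟩ := exists_tri_of_mem_of_mem hT hv ha.2 ha.1.symm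
  exact ⟨a, b, hb⟩

variable (𝒯) in
/-- The component of `x` in the direction from `v` to `a`. -/
noncomputable def dirc (v a x : X) : ℝ := (𝒯.ip a x - 𝒯.ip v a * 𝒯.ip v x) / √(1 - 𝒯.ip v a ^ 2)

variable (𝒯) in
/-- The component of `x` orthogonal to `v` and `a`, up to sign. -/
noncomputable def ht (v a x : X) : ℝ := √(1 - 𝒯.ip v x ^ 2 - 𝒯.dirc v a x ^ 2)

variable (𝒯) in
/-- The component of `x` orthogonal to `v`: the sine of the distance. -/
noncomputable def rad (v x : X) : ℝ := √(1 - 𝒯.ip v x ^ 2)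

variable (𝒯) in
/-- The angle at `v` between the directions to `a` and to `x`. -/
noncomputable def pa (v a x : X) : ℝ := arccos (𝒯.dirc v a x / 𝒯.rad v x)

theorem rad_nonneg : 0 ≤ 𝒯.rad v x := sqrt_nonneg _

theorem pa_nonneg : 0 ≤ 𝒯.pa v a x := arccos_nonneg _
theorem pa_le_pi : 𝒯.pa v a x ≤ π := arccos_le_pi _

theorem rad_sq : 𝒯.rad v x ^ 2 = 1 - 𝒯.ip v x ^ 2 := by
  rw [rad, sq_sqrt]
  have := neg_one_le_ip (𝒯 := 𝒯) v x
  have := ip_le_one (𝒯 := 𝒯) v x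
  nlinarith

namespace Tri

variable (h : 𝒯.Tri T v a b)
include h

theorem ip_eq_coord (hx : x ∈ 𝒯.cell T) :
    𝒯.ip v x = 𝒯.coord T x v + 𝒯.coord T x a * 𝒯.ip v a + 𝒯.coord T x b * 𝒯.ip v b := by
  rw [ip_eq_sum h.mem h.mem_v hx, h.sum_eq, ip_self h.mem h.mem_v, mul_one]

theorem neg_one_lt_ip (hx : x ∈ 𝒯.cell T) : -1 < 𝒯.ip v x := by
  refine lt_of_le_of_ne (neg_one_le_ip _ _) fun he => ?_
  have h1 : 𝒯.chart T x = - 𝒯.chart T v := by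
    have h2 := h.cell_v
    rw [← sub_eq_zero, ← inner_self_eq_zero (𝕜 := ℝ), sub_neg_eq_add, inner_add_add_self,
      inner_chart_self h.mem hx, inner_chart_self h.mem h2, real_inner_comm, ← ip_eq h.mem h.mem_v hx, ← he]
    norm_num
  have h3 : ∑ u ∈ T, 𝒯.coord T x u • 𝒯.chart T u =
      ∑ u ∈ T, (if u = v then (-1 : ℝ) else 0) • 𝒯.chart T u := by
    rw [← chart_eq_sum h.mem hx, h1]; simp [h.mem_v]
  have := eq_of_sum_eq h.mem h3 v h.mem_v
  rw [if_pos rfl] at this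
  linarith [coord_nonneg h.mem hx v]

theorem ip_lt_one (hx : x ∈ 𝒯.cell T) (hxv : x ≠ v) : 𝒯.ip v x < 1 := by
  refine lt_of_le_of_ne (ip_le_one _ _) fun he => hxv ?_
  refine eq_of_chart_eq h.mem hx h.cell_v ?_
  have h2 := h.cell_v
  rw [← sub_eq_zero, ← inner_self_eq_zero (𝕜 := ℝ), inner_sub_sub_self,
    inner_chart_self h.mem hx, inner_chart_self h.mem h2, real_inner_comm, ← ip_eq h.mem h.mem_v hx, he]
  norm_num

theorem rad_pos (hx : x ∈ 𝒯.cell T) (hxv : x ≠ v) : 0 < 𝒯.rad v x := by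
  apply sqrt_pos.2
  nlinarith [h.neg_one_lt_ip hx, h.ip_lt_one hx hxv]

theorem rad_a_pos : 0 < 𝒯.rad v a := h.rad_pos h.cell_a h.va.symm

theorem rad_comm : 𝒯.rad v a = 𝒯.rad a v := by
  rw [rad, rad, ip_comm h.mem h.mem_v h.mem_a]

theorem ip_a_eq (x : X) : 𝒯.ip a x = 𝒯.ip v a * 𝒯.ip v x + 𝒯.rad v a * 𝒯.dirc v a x := by
  have h1 := h.rad_a_pos
  rw [dirc, ← rad]
  field_simp
  ring

theorem dirc_eq_coord (hx : x ∈ 𝒯.cell T) :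
    𝒯.dirc v a x = 𝒯.coord T x a * 𝒯.rad v a + 𝒯.coord T x b * 𝒯.dirc v a b := by
  have h1 := h.rad_a_pos
  have e1 := h.ip_eq_coord hx
  have e2 := h.rotate.ip_eq_coord hx
  have e3 := h.ip_a_eq x
  have e4 := h.ip_a_eq b
  have e5 := rad_sq (𝒯 := 𝒯) (v := v) (x := a)
  rw [ip_comm h.mem h.mem_a h.mem_v] at e2
  apply mul_left_cancel₀ h1.ne'
  linear_combination (-1) * e3 + e2 - 𝒯.ip v a * e1 + 𝒯.coord T x b * e4 - 𝒯.coord T x a * e5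

/-- An orthonormal frame consists of `v`, the unit tangent at `v` towards `a`, and a normal; the
normal component of a point is its `b`-coordinate times that of `b`. -/
theorem inner_eq_coord (hx : x ∈ 𝒯.cell T) (hy : y ∈ 𝒯.cell T) :
    inner ℝ (𝒯.chart T x) (𝒯.chart T y) = 𝒯.ip v x * 𝒯.ip v y + 𝒯.dirc v a x * 𝒯.dirc v a y
      + 𝒯.coord T x b * 𝒯.coord T y b * (1 - 𝒯.ip v b ^ 2 - 𝒯.dirc v a b ^ 2) := by
  rw [inner_chart_eq_sum h.mem hx hy, h.sum_eq]
  have e1 := h.ip_eq_coord hx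
  have e2 := h.dirc_eq_coord hx
  have e3 := h.ip_a_eq y
  have e4 := h.rotate.rotate.ip_eq_coord hy
  have e5 := h.ip_eq_coord hy
  have e6 := h.dirc_eq_coord hy
  have e7 := h.ip_a_eq b
  rw [ip_comm h.mem h.mem_b h.mem_v, ip_comm h.mem h.mem_b h.mem_a] at e4
  rw [e3, e4, e1, e2, e6, e7, e5]
  ring

theorem ht_sq_pos : 0 < 1 - 𝒯.ip v b ^ 2 - 𝒯.dirc v a b ^ 2 := by
  have h1 := h.rad_a_pos
  -- Coefficients of the part of `b` orthogonal to `v` and `a`, by Gram–Schmidt. It is nonzero by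
  -- linear independence, and its squared norm is the claimed quantity.
  set c : X → ℝ := fun u => if u = v then - 𝒯.ip v b + 𝒯.dirc v a b / 𝒯.rad v a * 𝒯.ip v a
    else if u = a then - (𝒯.dirc v a b / 𝒯.rad v a) else 1 with hc
  have cv : c v = - 𝒯.ip v b + 𝒯.dirc v a b / 𝒯.rad v a * 𝒯.ip v a := by simp [hc]
  have ca : c a = - (𝒯.dirc v a b / 𝒯.rad v a) := by simp [hc, h.va.symm]
  have cb : c b = 1 := by simp [hc, h.vb.symm, h.ab.symm]
  set p := ∑ u ∈ T, c u • 𝒯.chart T u with hp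
  have hne : p ≠ 0 := fun h0 => by
    have : ∑ u ∈ T, c u • 𝒯.chart T u = ∑ u ∈ T, (0 : X → ℝ) u • 𝒯.chart T u := by
      rw [← hp, h0]; simp
    have := eq_of_sum_eq h.mem this b h.mem_b
    rw [cb] at this
    norm_num at this
  have hpos : 0 < inner ℝ p p := real_inner_self_pos.2 hne
  rw [hp, h.sum_eq] at hpos
  simp only [inner_add_left, inner_add_right, inner_smul_left, inner_smul_right,
    RCLike.conj_to_real] at hpos
  rw [inner_chart_self h.mem h.cell_v, inner_chart_self h.mem h.cell_a,
    inner_chart_self h.mem h.cell_b, ← ip_eq h.mem h.mem_v h.cell_a, ← ip_eq h.mem h.mem_v h.cell_b,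
    ← ip_eq h.mem h.mem_a h.cell_b, ← ip_eq h.mem h.mem_b h.cell_a, ← ip_eq h.mem h.mem_a h.cell_v,
    ← ip_eq h.mem h.mem_b h.cell_v, ip_comm h.mem h.mem_b h.mem_a, ip_comm h.mem h.mem_b h.mem_v,
    ip_comm h.mem h.mem_a h.mem_v, h.ip_a_eq b, cv, ca, cb] at hpos
  have e5 := rad_sq (𝒯 := 𝒯) (v := v) (x := a)
  set k := 𝒯.dirc v a b / 𝒯.rad v a with hk
  have e6 : 𝒯.dirc v a b = k * 𝒯.rad v a := by rw [hk]; field_simp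
  rw [e6] at hpos ⊢
  have e7 : 𝒯.ip v a ^ 2 = 1 - 𝒯.rad v a ^ 2 := by linarith
  have e8 : k ^ 2 * 𝒯.ip v a ^ 2 = k ^ 2 * (1 - 𝒯.rad v a ^ 2) := by rw [e7]
  linarith

theorem ht_b_pos : 0 < 𝒯.ht v a b := sqrt_pos.2 h.ht_sq_pos

theorem ht_eq_coord (hx : x ∈ 𝒯.cell T) : 𝒯.ht v a x = 𝒯.coord T x b * 𝒯.ht v a b := by
  have h1 := h.inner_eq_coord hx hx
  rw [inner_chart_self h.mem hx] at h1
  rw [ht, show 1 - 𝒯.ip v x ^ 2 - 𝒯.dirc v a x ^ 2 =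
    (𝒯.coord T x b) ^ 2 * (1 - 𝒯.ip v b ^ 2 - 𝒯.dirc v a b ^ 2) by linarith,
    sqrt_mul (sq_nonneg _), sqrt_sq (coord_nonneg h.mem hx b), ht]

theorem inner_eq (hx : x ∈ 𝒯.cell T) (hy : y ∈ 𝒯.cell T) :
    inner ℝ (𝒯.chart T x) (𝒯.chart T y) = 𝒯.ip v x * 𝒯.ip v y + 𝒯.dirc v a x * 𝒯.dirc v a y
      + 𝒯.ht v a x * 𝒯.ht v a y := by
  have : 𝒯.ht v a b ^ 2 = 1 - 𝒯.ip v b ^ 2 - 𝒯.dirc v a b ^ 2 := by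
    rw [ht, sq_sqrt h.ht_sq_pos.le]
  rw [h.inner_eq_coord hx hy, h.ht_eq_coord hx, h.ht_eq_coord hy, ← this]
  ring

theorem ht_sq (hx : x ∈ 𝒯.cell T) : 𝒯.ht v a x ^ 2 = 𝒯.rad v x ^ 2 - 𝒯.dirc v a x ^ 2 := by
  have h1 := h.inner_eq hx hx
  rw [inner_chart_self h.mem hx] at h1
  rw [rad_sq]
  linarith

theorem ht_comm (x : X) : 𝒯.ht v a x = 𝒯.ht a v x := by
  rw [ht, ht]
  congr 1
  have h1 := h.rad_a_pos
  have e5 := rad_sq (𝒯 := 𝒯) (v := v) (x := a)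
  have hr : √(1 - 𝒯.ip v a ^ 2) = 𝒯.rad v a := rfl
  rw [dirc, dirc, ip_comm h.mem h.mem_a h.mem_v, hr]
  have e7 : 𝒯.ip v a ^ 2 = 1 - 𝒯.rad v a ^ 2 := by linarith
  field_simp
  linear_combination (𝒯.ip a x ^ 2 - 𝒯.ip v x ^ 2) * e7

theorem ht_nonneg : 0 ≤ 𝒯.ht v a x := sqrt_nonneg _

theorem dirc_eq (hx : x ∈ 𝒯.cell T) : 𝒯.dirc v a x = 𝒯.rad v x * cos (𝒯.pa v a x) := by
  have h1 := h.ht_sq hx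
  have h2 : 𝒯.dirc v a x ^ 2 ≤ 𝒯.rad v x ^ 2 := by nlinarith [sq_nonneg (𝒯.ht v a x)]
  have h3 := abs_le_of_sq_le_sq' h2 rad_nonneg
  rcases (rad_nonneg (𝒯 := 𝒯) (v := v) (x := x)).eq_or_lt with h0 | h0
  · rw [← h0] at h3 ⊢; rw [zero_mul]; linarith [h3.1, h3.2]
  · rw [pa, cos_arccos]
    · field_simp
    · rw [le_div_iff₀ h0]; linarith [h3.1]
    · rw [div_le_one h0]; exact h3.2

theorem ht_eq (hx : x ∈ 𝒯.cell T) : 𝒯.ht v a x = 𝒯.rad v x * sin (𝒯.pa v a x) := by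
  have h1 := h.ht_sq hx
  rw [h.dirc_eq hx] at h1
  have hs : 0 ≤ sin (𝒯.pa v a x) := sin_nonneg_of_nonneg_of_le_pi pa_nonneg pa_le_pi
  refine (sq_eq_sq₀ h.ht_nonneg (mul_nonneg rad_nonneg hs)).1 ?_
  rw [h1]
  linear_combination (-(𝒯.rad v x ^ 2)) * (sin_sq_add_cos_sq (𝒯.pa v a x))

theorem ip_a_eq_cos (hx : x ∈ 𝒯.cell T) :
    𝒯.ip a x = 𝒯.ip v a * 𝒯.ip v x + 𝒯.rad v a * 𝒯.rad v x * cos (𝒯.pa v a x) := by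
  rw [h.ip_a_eq, h.dirc_eq hx]; ring

/-- The spherical law of cosines in a face. -/
theorem inner_eq_cos (hx : x ∈ 𝒯.cell T) (hy : y ∈ 𝒯.cell T) :
    inner ℝ (𝒯.chart T x) (𝒯.chart T y) =
      𝒯.ip v x * 𝒯.ip v y + 𝒯.rad v x * 𝒯.rad v y * cos (𝒯.pa v a x - 𝒯.pa v a y) := by
  rw [h.inner_eq hx hy, h.dirc_eq hx, h.dirc_eq hy, h.ht_eq hx, h.ht_eq hy, cos_sub]
  ring

/-- An acute angle would make the cosine of the opposite edge positive in the law of cosines,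
because the product of the cosines of the two adjacent edges is nonnegative. The upper bound is
nondegeneracy. -/
theorem angle_mem (hE : 𝒯.LongEdges) : 𝒯.pa v a b ∈ Ico (π / 2) π := by
  have h1 := h.rad_pos h.cell_b h.vb.symm
  constructor
  · by_contra! hlt
    have h2 : 0 < cos (𝒯.pa v a b) := cos_pos_of_mem_Ioo
      ⟨by linarith [pi_pos, pa_nonneg (𝒯 := 𝒯) (v := v) (a := a) (x := b)], hlt⟩
    have h3 := h.ip_a_eq_cos h.cell_b
    have h4 := hE.ip_nonpos h.mem h.mem_a h.mem_b h.ab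
    have h5 := hE.ip_nonpos h.mem h.mem_v h.mem_b h.vb
    have h6 := hE.ip_nonpos h.mem h.mem_v h.mem_a h.va
    have h7 := mul_pos (mul_pos h.rad_a_pos h1) h2
    nlinarith
  · refine lt_of_le_of_ne pa_le_pi fun he => ?_
    have := h.ht_b_pos
    rw [h.ht_eq h.cell_b, he, sin_pi, mul_zero] at this
    exact lt_irrefl _ this

theorem angle_pos (hE : 𝒯.LongEdges) : 0 < 𝒯.pa v a b :=
  lt_of_lt_of_le (by positivity) (h.angle_mem hE).1

theorem pa_le_angle (hE : 𝒯.LongEdges) (hx : x ∈ 𝒯.cell T) (hxv : x ≠ v) :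
    𝒯.pa v a x ≤ 𝒯.pa v a b := by
  by_contra! hlt
  have h1 := h.rad_pos hx hxv
  have h2 : sin (𝒯.pa v a x - 𝒯.pa v a b) > 0 := sin_pos_of_pos_of_lt_pi (by linarith)
    (by linarith [h.angle_pos hE, pa_le_pi (𝒯 := 𝒯) (v := v) (a := a) (x := x)])
  have h3 : 𝒯.rad v x * sin (𝒯.pa v a x - 𝒯.pa v a b) =
      - (𝒯.coord T x a * 𝒯.rad v a * sin (𝒯.pa v a b)) := by
    have e1 := h.dirc_eq_coord hx
    have e2 := h.ht_eq_coord hx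
    rw [h.dirc_eq hx, h.dirc_eq h.cell_b] at e1
    rw [h.ht_eq hx, h.ht_eq h.cell_b] at e2
    rw [sin_sub]
    linear_combination cos (𝒯.pa v a b) * e2 - sin (𝒯.pa v a b) * e1
  have h4 : 0 ≤ sin (𝒯.pa v a b) := sin_nonneg_of_nonneg_of_le_pi pa_nonneg pa_le_pi
  have h5 := mul_nonneg (mul_nonneg (coord_nonneg h.mem hx a) h.rad_a_pos.le) h4
  have h6 := mul_pos h1 h2
  linarith

theorem pa_lt_pi (hE : 𝒯.LongEdges) (hx : x ∈ 𝒯.cell T) (hxv : x ≠ v) : 𝒯.pa v a x < π :=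
  (h.pa_le_angle hE hx hxv).trans_lt (h.angle_mem hE).2

theorem pa_swap (hE : 𝒯.LongEdges) (hx : x ∈ 𝒯.cell T) (hxv : x ≠ v) :
    𝒯.pa v b x = 𝒯.pa v a b - 𝒯.pa v a x := by
  have h1 := h.rad_pos hx hxv
  have h2 := h.rad_pos h.cell_b h.vb.symm
  have e1 := h.swap.ip_a_eq_cos hx
  have e2 := h.inner_eq_cos h.cell_b hx
  rw [← ip_eq h.mem h.mem_b hx, e1] at e2
  have e3 : cos (𝒯.pa v b x) = cos (𝒯.pa v a b - 𝒯.pa v a x) := by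
    have := mul_pos h2 h1
    apply mul_left_cancel₀ this.ne'
    linarith
  exact injOn_cos ⟨pa_nonneg, pa_le_pi⟩ ⟨by linarith [h.pa_le_angle hE hx hxv],
    by linarith [pa_nonneg (𝒯 := 𝒯) (v := v) (a := a) (x := x), (h.angle_mem hE).2]⟩ e3

theorem angle_comm (hE : 𝒯.LongEdges) : 𝒯.pa v b a = 𝒯.pa v a b := by
  have : 𝒯.pa v a a = 0 := by
    have e := h.ip_a_eq a
    rw [ip_self h.mem h.mem_a] at e
    have h1 := h.rad_a_pos
    have e5 := rad_sq (𝒯 := 𝒯) (v := v) (x := a)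
    have : 𝒯.dirc v a a = 𝒯.rad v a := by
      apply mul_left_cancel₀ h1.ne'
      linarith
    rw [pa, this, div_self h1.ne', arccos_one]
  rw [h.pa_swap hE h.cell_a h.va.symm, this, sub_zero]

theorem pa_eq_zero_iff (hx : x ∈ 𝒯.cell T) (hxv : x ≠ v) (hE : 𝒯.LongEdges) :
    𝒯.pa v a x = 0 ↔ 𝒯.coord T x b = 0 := by
  have e2 := h.ht_eq_coord hx
  have h0 := h.ht_b_pos
  rw [h.ht_eq hx] at e2
  have h1 := h.rad_pos hx hxv
  constructor
  · intro h2
    rw [h2, sin_zero, mul_zero] at e2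
    exact (mul_eq_zero.1 e2.symm).resolve_right h0.ne'
  · intro h2
    rw [h2, zero_mul] at e2
    have h3 := (mul_eq_zero.1 e2).resolve_left h1.ne'
    by_contra h4
    have := sin_pos_of_pos_of_lt_pi (lt_of_le_of_ne pa_nonneg (Ne.symm h4)) (h.pa_lt_pi hE hx hxv)
    linarith

end Tri

end SphericalGluing

theorem exists_partial_sums (β : ℤ → ℝ) : ∃ B : ℤ → ℝ, B 0 = 0 ∧ ∀ i, B (i + 1) = B i + β i := by
  refine ⟨fun i => match i with
    | Int.ofNat n => ∑ j ∈ Finset.range n, β j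
    | Int.negSucc n => -∑ j ∈ Finset.range (n + 1), β (Int.negSucc j), by simp, ?_⟩
  rintro (n | n)
  · change ∑ j ∈ Finset.range (n + 1), β j = _
    rw [Finset.sum_range_succ]
    rfl
  · cases n with
    | zero =>
      change ∑ j ∈ Finset.range 0, β j = -∑ j ∈ Finset.range (0 + 1), β (Int.negSucc j) + β (Int.negSucc 0)
      simp
    | succ n =>
      change -∑ j ∈ Finset.range (n + 1), β (Int.negSucc j) =
        -∑ j ∈ Finset.range (n + 1 + 1), β (Int.negSucc j) + β (Int.negSucc (n + 1))
      rw [Finset.sum_range_succ _ (n + 1)]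
      ring

namespace SphericalGluing

/-! ### The link of a vertex -/

variable {X : Type*} {𝒯 : SphericalGluing X} {S T T' : Finset X} {v w a b c d x y : X}

theorem Tri.exists_next (h : 𝒯.Tri T v a b) : ∃ c, c ≠ a ∧ 𝒯.Tri {v, b, c} v b c := by
  have h2 := 𝒯.edge_two T h.mem v h.mem_v b h.mem_b h.vb
  have hT : T ∈ 𝒯.faces.filter (fun T' => v ∈ T' ∧ b ∈ T') := by
    simp [h.mem, h.mem_v, h.mem_b]
  obtain ⟨S, hS, hne⟩ := Finset.exists_mem_ne (by rw [h2]; norm_num) T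
  rw [Finset.mem_filter] at hS
  obtain ⟨c, hc⟩ := exists_tri_of_mem_of_mem hS.1 hS.2.1 hS.2.2 h.vb
  refine ⟨c, ?_, by rw [← hc.eq]; exact hc⟩
  rintro rfl
  exact hne (by rw [hc.swap.eq, h.eq])

theorem Tri.eq_or_eq (h : 𝒯.Tri S v a b) (h' : 𝒯.Tri T v a c) (hbc : b ≠ c) (hT' : T' ∈ 𝒯.faces)
    (hv : v ∈ T') (ha : a ∈ T') : T' = S ∨ T' = T := by
  have h2 := 𝒯.edge_two S h.mem v h.mem_v a h.mem_a h.va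
  have hST : S ≠ T := fun he => by
    have : b ∈ T := he ▸ h.mem_b
    rcases h'.mem_iff.1 this with h1 | h1 | h1
    exacts [h.vb h1.symm, h.ab h1.symm, hbc h1]
  have hsub : ({S, T} : Finset (Finset X)) ⊆ 𝒯.faces.filter (fun T' => v ∈ T' ∧ a ∈ T') := by
    intro R hR
    rw [Finset.mem_insert, Finset.mem_singleton] at hR
    rcases hR with rfl | rfl
    · simp [h.mem, h.mem_v, h.mem_a]
    · simp [h'.mem, h'.mem_v, h'.mem_a]
  have heq := Finset.eq_of_subset_of_card_le hsub (by rw [h2, Finset.card_pair hST])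
  have : T' ∈ 𝒯.faces.filter (fun T' => v ∈ T' ∧ a ∈ T') := by simp [hT', hv, ha]
  rw [← heq] at this
  simpa using this

theorem Tri.vertex_unique (h : 𝒯.Tri S v a b) (h' : 𝒯.Tri S v a c) : b = c := by
  rcases h'.mem_iff.1 h.mem_b with h1 | h1 | h1
  exacts [absurd h1.symm h.vb, absurd h1.symm h.ab, h1]

theorem Tri.eq_or_eq' (h : 𝒯.Tri S v a b) (h' : 𝒯.Tri T v a c) (hbc : b ≠ c)
    (hd : 𝒯.Tri T' v a d) : d = b ∨ d = c := by
  rcases h.eq_or_eq h' hbc hd.mem hd.mem_v hd.mem_a with rfl | rfl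
  · exact Or.inl (hd.vertex_unique h)
  · exact Or.inr (hd.vertex_unique h')

variable (𝒯) in
/-- The cyclically ordered triangles around a vertex; `B` are the partial sums of their angles. -/
structure LinkCycle (v : X) where
  w : ℤ → X
  k : ℕ
  three_le : 3 ≤ k
  tri : ∀ i, 𝒯.Tri {v, w i, w (i + 1)} v (w i) (w (i + 1))
  ne : ∀ i, w i ≠ w (i + 2)
  periodic : ∀ i, w (i + k) = w i
  dvd_of_eq : ∀ i j, w i = w j → (k : ℤ) ∣ i - j
  complete : ∀ T ∈ 𝒯.faces, v ∈ T → ∃ i, T = {v, w i, w (i + 1)}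
  B : ℤ → ℝ
  B_zero : B 0 = 0
  B_succ : ∀ i, B (i + 1) = B i + 𝒯.pa v (w i) (w (i + 1))

variable (𝒯) in
theorem finite_darts (v : X) : Finite {p : X × X // 𝒯.Tri {v, p.1, p.2} v p.1 p.2} := by
  apply Set.Finite.to_subtype
  refine ((𝒯.faces.biUnion id ×ˢ 𝒯.faces.biUnion id).finite_toSet).subset ?_
  intro p hp
  simp only [Finset.coe_product, mem_prod, Finset.mem_coe, Finset.mem_biUnion, id]
  exact ⟨⟨_, Tri.mem hp, Tri.mem_a hp⟩, ⟨_, Tri.mem hp, Tri.mem_b hp⟩⟩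

/-- Ordered pairs of neighbours spanning a face with `v` form a finite set. Passing across the
second edge is injective on it, since an edge lies in exactly two faces, so it is a permutation; the
sequence is an orbit and `k` its period. -/
theorem Tri.exists_sequence (h : 𝒯.Tri T v a b) : ∃ (w : ℤ → X) (k : ℕ), 0 < k ∧ w 0 = a ∧ w 1 = b ∧
    (∀ i, 𝒯.Tri {v, w i, w (i + 1)} v (w i) (w (i + 1))) ∧ (∀ i, w i ≠ w (i + 2)) ∧
    (∀ i, w (i + k) = w i) ∧ ∀ i j, w i = w j → w (i + 1) = w (j + 1) → (k : ℤ) ∣ i - j := by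
  set D := {p : X × X // 𝒯.Tri {v, p.1, p.2} v p.1 p.2}
  have : Finite D := finite_darts 𝒯 v
  choose nx hnx hnx' using fun p : D => p.2.exists_next
  set f : D → D := fun p => ⟨(p.1.2, nx p), hnx' p⟩ with hf
  have hinj : Function.Injective f := by
    rintro p q hpq
    have h1 : p.1.2 = q.1.2 := congrArg (fun r : D => r.1.1) hpq
    have h2 : nx p = nx q := congrArg (fun r : D => r.1.2) hpq
    have h3 := hnx' p
    have e1 : 𝒯.Tri _ v p.1.2 p.1.1 := p.2.swap
    have e2 : 𝒯.Tri _ v p.1.2 q.1.1 := h1 ▸ q.2.swap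
    rcases e1.eq_or_eq' h3 (hnx p).symm e2 with h5 | h5
    · exact Subtype.ext (Prod.ext h5.symm h1)
    · exact absurd (h5.trans h2).symm (hnx q)
  set σ : Equiv.Perm D := Equiv.ofBijective f (Finite.injective_iff_bijective.1 hinj) with hσ
  have hσf : ∀ p, σ p = f p := fun p => rfl
  have hT := h.eq
  subst hT
  set d0 : D := ⟨(a, b), h⟩ with hd0
  have hsucc : ∀ i : ℤ, (σ ^ (i + 1)) d0 = f ((σ ^ i) d0) := fun i => by
    rw [add_comm, zpow_add, zpow_one, Equiv.Perm.mul_apply, hσf]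
  have hw1 : ∀ i : ℤ, ((σ ^ (i + 1)) d0).1.1 = ((σ ^ i) d0).1.2 := fun i => by rw [hsucc]
  have hper : (fun x : D => σ • x) = σ := rfl
  have hdvd : ∀ i j : ℤ, (σ ^ i) d0 = (σ ^ j) d0 ↔
      (Function.minimalPeriod σ d0 : ℤ) ∣ i - j := fun i j => by
    have := MulAction.zpow_smul_eq_iff_minimalPeriod_dvd (a := σ) (b := d0) (n := i - j)
    rw [hper] at this
    rw [← this, Equiv.Perm.smul_def]
    conv_lhs => rw [show i = j + (i - j) by ring, zpow_add, Equiv.Perm.mul_apply]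
    exact (σ ^ j).injective.eq_iff
  refine ⟨fun i => ((σ ^ i) d0).1.1, Function.minimalPeriod σ d0, ?_, rfl, rfl, ?_, ?_, ?_, ?_⟩
  · apply Function.IsPeriodicPt.minimalPeriod_pos (orderOf_pos σ)
    rw [Function.IsPeriodicPt, ← Equiv.Perm.coe_pow, pow_orderOf_eq_one]
    rfl
  · intro i
    simp only [hw1]
    exact ((σ ^ i) d0).2
  · intro i
    have e : ((σ ^ (i + 2)) d0).1.1 = nx ((σ ^ i) d0) := by
      rw [show i + 2 = (i + 1) + 1 by ring, hw1, hsucc]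
    simp only [e]
    exact (hnx _).symm
  · intro i
    change ((σ ^ (i + _)) d0).1.1 = ((σ ^ i) d0).1.1
    rw [(hdvd (i + Function.minimalPeriod σ d0) i).2 (by simp)]
  · intro i j h1 h2
    simp only [hw1] at h1 h2
    exact (hdvd _ _).1 (Subtype.ext (Prod.ext h1 h2))

/-- The period of ordered pairs must be upgraded to one of neighbours. If a neighbour recurs without
its successor, the sequence runs backwards from there, and the reflection has a center at which it
contradicts the distinctness of nearby neighbours. Completeness is the connectedness of the star. -/
theorem Tri.exists_linkCycle (h : 𝒯.Tri T v a b) : ∃ C : 𝒯.LinkCycle v, C.w 0 = a ∧ C.w 1 = b := by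
  obtain ⟨w, k, hk, h0, h1, htri, hne, hper, hdvd⟩ := h.exists_sequence
  have hne1 : ∀ i, w i ≠ w (i + 1) := fun i => (htri i).ab
  have hprev : ∀ i, 𝒯.Tri {v, w (i - 1), w i} v (w (i - 1)) (w i) := fun i => by
    have := htri (i - 1); rwa [sub_add_cancel] at this
  have hnep : ∀ i, w (i - 1) ≠ w (i + 1) := fun i => by
    have := hne (i - 1); rwa [show i - 1 + 2 = i + 1 by ring] at this
  have hinj : ∀ i j, w i = w j → (k : ℤ) ∣ i - j := by
    intro i j hij
    by_contra hnd
    have hflip : ∀ n : ℕ, ∀ i j, w i = w j → w (i + 1) = w (j - 1) → w (i + n) = w (j - n) := by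
      intro n
      induction n with
      | zero => intro i j h1 _; simpa using h1
      | succ n ih =>
        intro i j h1 h2
        have h3 : w (i + 1 + 1) = w (j - 1 - 1) := by
          have e1 := htri (i + 1)
          have e2 := (hprev (j - 1)).swap
          rw [← h2] at e2
          have e3 := (hprev (i + 1)).swap
          rw [add_sub_cancel_right] at e3
          have hx := hnep (i + 1)
          rw [add_sub_cancel_right] at hx
          rcases e3.eq_or_eq' e1 hx e2 with h4 | h4
          · exfalso
            have hy := hnep (j - 1)
            rw [sub_add_cancel] at hy
            exact hy (h4.trans h1)
          · exact h4.symm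
        have := ih (i + 1) (j - 1) h2 h3
        push_cast
        rw [show i + ((n : ℤ) + 1) = i + 1 + n by ring, show j - ((n : ℤ) + 1) = j - 1 - n by ring]
        exact this
    have hrev : w (i + 1) = w (j - 1) := by
      have e1 := htri i
      have e2 := htri j
      rw [← hij] at e2
      have e3 := (hprev j).swap
      rw [← hij] at e3
      rcases e3.eq_or_eq' e2 (hnep j) e1 with h4 | h4
      · exact h4
      · exact absurd (hdvd i j hij h4) hnd
    have hkey : ∀ i j, i ≤ j → w i = w j → w (i + 1) = w (j - 1) → False := by
      intro i j hle h1 h2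
      -- Reflecting up to the middle identifies the two neighbours of the middle vertex if `j - i`
      -- is even, and two consecutive vertices if it is odd.
      obtain ⟨m, hm | hm⟩ := Int.even_or_odd' (j - i)
      · have := hflip (m - 1).toNat i j h1 h2
        by_cases hm0 : m = 0
        · subst hm0
          have : i = j := by linarith
          subst this
          exact hnep i h2.symm
        · have hm1 : ((m - 1).toNat : ℤ) = m - 1 := Int.toNat_of_nonneg (by omega)
          rw [hm1, show i + (m - 1) = i + m - 1 by ring, show j - (m - 1) = i + m + 1 by linarith] at this
          exact hnep _ this
      · have := hflip m.toNat i j h1 h2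
        have hm1 : (m.toNat : ℤ) = m := Int.toNat_of_nonneg (by omega)
        rw [hm1, show j - m = i + m + 1 by linarith] at this
        exact hne1 _ this
    rcases le_total i j with hle | hle
    · exact hkey i j hle hij hrev
    · refine hkey j i hle hij.symm ?_
      have e1 := (hprev i).swap
      have e2 := htri i
      have e3 := htri j
      rw [← hij] at e3
      rcases e1.eq_or_eq' e2 (hnep i) e3 with h4 | h4
      · exact h4
      · exact absurd (hdvd i j hij h4.symm) hnd
  obtain ⟨B, hB0, hB⟩ := exists_partial_sums fun i => 𝒯.pa v (w i) (w (i + 1))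
  have hk3 : 3 ≤ k := by
    by_contra! hlt
    interval_cases k
    · exact hne1 0 (by have := hper 0; simpa using this.symm)
    · exact hne 0 (by have := hper 0; simpa using this.symm)
  refine ⟨⟨w, k, hk3, htri, hne, hper, hinj, ?_, B, hB0, hB⟩, h0, h1⟩
  intro S hS hvS
  have hconn := 𝒯.star_connected v {v, w 0, w 1} (htri 0).mem S hS (htri 0).mem_v hvS
  induction hconn with
  | refl => exact ⟨0, by simp⟩
  | @tail P Q _ hPQ ih =>
    obtain ⟨hQ, hvQ, hcard⟩ := hPQ
    have hP : P ∈ 𝒯.faces ∧ v ∈ P := by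
      by_cases hP0 : P ∈ 𝒯.faces ∧ v ∈ P
      · exact hP0
      · exfalso
        rename_i hRT
        cases hRT with
        | refl => exact hP0 ⟨(htri 0).mem, (htri 0).mem_v⟩
        | tail _ h' => exact hP0 ⟨h'.1, h'.2.1⟩
    obtain ⟨i, hi⟩ := ih hP.1 hP.2
    have hti := htri i
    rw [← hi] at hti
    have hvPQ : v ∈ P ∩ Q := by
      rw [Finset.mem_inter]; exact ⟨hP.2, hvQ⟩
    obtain ⟨u, hu, huv⟩ := Finset.exists_mem_ne (by rw [hcard]; norm_num) v
    rw [Finset.mem_inter] at hu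
    rcases hti.mem_iff.1 hu.1 with h5 | h5 | h5
    · exact absurd h5 huv
    · subst h5
      rcases (hprev i).swap.eq_or_eq (htri i) (hnep i) hQ hvQ hu.2 with h6 | h6
      · exact ⟨i - 1, by rw [sub_add_cancel]; exact h6⟩
      · exact ⟨i, h6⟩
    · subst h5
      have e3 := (htri i).swap
      rcases e3.eq_or_eq (htri (i + 1)) (by
        have := hne i; rwa [show i + 2 = i + 1 + 1 by ring] at this) hQ hvQ hu.2 with h6 | h6
      · exact ⟨i, h6⟩
      · exact ⟨i + 1, h6⟩

end SphericalGluing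

namespace SphericalGluing

variable {X : Type*} {𝒯 : SphericalGluing X} {S T T' : Finset X} {v w a b c d u x y : X}

namespace LinkCycle

variable (C : 𝒯.LinkCycle v)

/-- The total angle around the vertex. -/
noncomputable def total : ℝ := C.B C.k

/-- The face between two consecutive neighbours of the vertex. -/
noncomputable def face (i : ℤ) : Finset X := {v, C.w i, C.w (i + 1)}

theorem tri_face (i : ℤ) : 𝒯.Tri (C.face i) v (C.w i) (C.w (i + 1)) := C.tri i

theorem tri_face_sub_one (i : ℤ) : 𝒯.Tri (C.face (i - 1)) v (C.w i) (C.w (i - 1)) := by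
  have := (C.tri_face (i - 1)).swap
  rwa [sub_add_cancel] at this

theorem B_lt (hE : 𝒯.LongEdges) (i : ℤ) : C.B i < C.B (i + 1) := by
  rw [C.B_succ]; linarith [(C.tri i).angle_pos hE]

theorem B_add_pi_div_two_le (hE : 𝒯.LongEdges) (i : ℤ) : C.B i + π / 2 ≤ C.B (i + 1) := by
  rw [C.B_succ]; linarith [((C.tri i).angle_mem hE).1]

theorem B_strictMono (hE : 𝒯.LongEdges) : StrictMono C.B := strictMono_int_of_lt_succ (C.B_lt hE)

theorem B_sub_B_ge (hE : 𝒯.LongEdges) (i : ℤ) (n : ℕ) : C.B i + n * (π / 2) ≤ C.B (i + n) := by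
  induction n with
  | zero => simp
  | succ n ih =>
    have := C.B_add_pi_div_two_le hE (i + n)
    push_cast
    rw [← add_assoc]
    linarith

theorem B_add_period (i : ℤ) : C.B (i + C.k) = C.B i + C.total := by
  have hstep : ∀ i, C.B (i + 1 + C.k) - C.B (i + 1) = C.B (i + C.k) - C.B i := fun i => by
    rw [show i + 1 + (C.k : ℤ) = i + C.k + 1 by ring, C.B_succ, C.B_succ, C.periodic,
      show i + C.k + 1 = (i + 1) + (C.k : ℤ) by ring, C.periodic]
    ring
  have : C.B (i + C.k) - C.B i = C.B (0 + C.k) - C.B 0 := by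
    induction i using Int.induction_on with
    | zero => rfl
    | succ i ih => rw [hstep, ih]
    | pred i ih => rw [← ih, ← hstep, sub_add_cancel]
  rw [C.B_zero, zero_add] at this
  rw [total]; linarith

theorem B_add_mul_period (i n : ℤ) : C.B (i + n * C.k) = C.B i + n * C.total := by
  induction n using Int.induction_on with
  | zero => simp
  | succ n ih =>
    rw [show i + ((n : ℤ) + 1) * C.k = i + n * C.k + C.k by ring, C.B_add_period, ih]
    push_cast; ring
  | pred n ih =>
    have := C.B_add_period (i + (-(n : ℤ) - 1) * C.k)
    rw [show i + (-(n : ℤ) - 1) * C.k + C.k = i + -(n : ℤ) * C.k by ring, ih] at this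
    push_cast at this ⊢
    linarith

theorem w_add_mul_period (i n : ℤ) : C.w (i + n * C.k) = C.w i := by
  induction n using Int.induction_on with
  | zero => simp
  | succ n ih =>
    rw [show i + ((n : ℤ) + 1) * C.k = i + n * C.k + C.k by ring, C.periodic, ih]
  | pred n ih =>
    have := C.periodic (i + (-(n : ℤ) - 1) * C.k)
    rw [show i + (-(n : ℤ) - 1) * C.k + C.k = i + -(n : ℤ) * C.k by ring, ih] at this
    exact this.symm

theorem exists_B_eq {i j : ℤ} (h : C.w i = C.w j) : ∃ n : ℤ, C.B i = C.B j + n * C.total := by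
  obtain ⟨n, hn⟩ := C.dvd_of_eq i j h
  refine ⟨n, ?_⟩
  rw [← C.B_add_mul_period, show i = j + n * C.k by linarith]

theorem total_pos (hE : 𝒯.LongEdges) : 0 < C.total := by
  have := C.B_strictMono hE (show (0 : ℤ) < C.k by have := C.three_le; omega)
  rwa [C.B_zero] at this

/-- `θ` is a direction angle of `x` as seen from `v`. -/
def Lift (x : X) (θ : ℝ) : Prop :=
  ∃ i, x ∈ 𝒯.cell (C.face i) ∧ θ = C.B i + 𝒯.pa v (C.w i) x

theorem exists_lift (hT : T ∈ 𝒯.faces) (hv : v ∈ T) (hx : x ∈ 𝒯.cell T) : ∃ θ, C.Lift x θ := by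
  obtain ⟨i, hi⟩ := C.complete T hT hv
  exact ⟨_, i, by rw [face, ← hi]; exact hx, rfl⟩

variable {C}

theorem Lift.add {θ : ℝ} (h : C.Lift x θ) (n : ℤ) : C.Lift x (θ + n * C.total) := by
  obtain ⟨i, hi, rfl⟩ := h
  refine ⟨i + n * C.k, ?_, ?_⟩
  · rw [face, show i + n * (C.k : ℤ) + 1 = (i + 1) + n * C.k by ring, C.w_add_mul_period,
      C.w_add_mul_period]
    exact hi
  · rw [C.B_add_mul_period, C.w_add_mul_period]; ring

/-- A lift of a point of the open star of an edge, relative to this edge. -/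
theorem Lift.edge (hE : 𝒯.LongEdges) {θ : ℝ} (h : C.Lift x θ) (hxv : x ≠ v) (huv : u ≠ v)
    (hu : ∀ i, x ∈ 𝒯.cell (C.face i) → u ∈ C.face i) :
    ∃ i, C.w i = u ∧ |θ - C.B i| = 𝒯.pa v u x ∧ (C.B i ≤ θ → x ∈ 𝒯.cell (C.face i)) ∧
      (θ ≤ C.B i → x ∈ 𝒯.cell (C.face (i - 1))) := by
  obtain ⟨j, hj, rfl⟩ := h
  have ht := C.tri_face j
  rcases ht.mem_iff.1 (hu j hj) with h1 | rfl | rfl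
  · exact absurd h1 huv
  · refine ⟨j, rfl, ?_, fun _ => hj, fun h => ?_⟩
    · rw [add_sub_cancel_left, abs_of_nonneg pa_nonneg]
    · have h0 : 𝒯.pa v (C.w j) x = 0 := le_antisymm (by linarith) pa_nonneg
      rw [ht.pa_eq_zero_iff hj hxv hE] at h0
      have ht' := C.tri_face_sub_one j
      refine mem_cell_of_coord ht.mem hj ht'.mem (ht.forall_mem ?_ ?_ ?_)
      exacts [fun h => absurd ht'.mem_v h, fun h => absurd ht'.mem_a h, fun _ => h0]
  · have e := ht.pa_swap hE hj hxv
    refine ⟨j + 1, rfl, ?_, fun h => ?_, fun _ => by rwa [add_sub_cancel_right]⟩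
    · rw [C.B_succ, show C.B j + 𝒯.pa v (C.w j) x - (C.B j + 𝒯.pa v (C.w j) (C.w (j + 1))) =
        - 𝒯.pa v (C.w (j + 1)) x by rw [e]; ring, abs_neg, abs_of_nonneg pa_nonneg]
    · rw [C.B_succ] at h
      have h0 : 𝒯.pa v (C.w (j + 1)) x = 0 := le_antisymm (by linarith) pa_nonneg
      rw [ht.swap.pa_eq_zero_iff hj hxv hE] at h0
      have ht' := C.tri_face (j + 1)
      refine mem_cell_of_coord ht.mem hj ht'.mem (ht.forall_mem ?_ ?_ ?_)
      exacts [fun h => absurd ht'.mem_v h, fun _ => h0, fun h => absurd ht'.mem_a h]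

/-- Two lifts use two faces containing the point. The faces agree, or share an edge at `v` that
contains the point and from which both angles vanish, or share only `v`, which is excluded. In each
case the partial sums match up to multiples of the total angle. -/
theorem Lift.unique (hE : 𝒯.LongEdges) {θ θ' : ℝ} (h : C.Lift x θ) (h' : C.Lift x θ') (hxv : x ≠ v) :
    ∃ n : ℤ, θ' = θ + n * C.total := by
  obtain ⟨i, hi, rfl⟩ := h
  obtain ⟨j, hj, rfl⟩ := h'
  have hti := C.tri_face i
  have htj := C.tri_face j
  -- the angle to the second neighbour
  have ei := hti.pa_swap hE hi hxv
  have ej := htj.pa_swap hE hj hxv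
  have hcommon : ∀ a b a' b' : X, 𝒯.Tri (C.face i) v a b → 𝒯.Tri (C.face j) v a' b' → b ∉ C.face j →
      a = a' → b ≠ b' → 𝒯.pa v a x = 0 ∧ 𝒯.pa v a' x = 0 := by
    rintro a b _ b' h1 h2 hb rfl hbb
    refine ⟨(h1.pa_eq_zero_iff hi hxv hE).2 (coord_eq_zero h1.mem hi h2.mem hj h1.mem_b hb), ?_⟩
    refine (h2.pa_eq_zero_iff hj hxv hE).2 (coord_eq_zero h2.mem hj h1.mem hi h2.mem_b fun hb' => ?_)
    rcases h1.mem_iff.1 hb' with h3 | h3 | h3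
    exacts [h2.vb h3.symm, h2.ab h3.symm, hbb h3.symm]
  by_cases hA : C.w i ∈ C.face j <;> by_cases hB : C.w (i + 1) ∈ C.face j
  · -- the same face
    rcases htj.mem_iff.1 hA with h1 | h1 | h1
    · exact absurd h1.symm hti.va
    · obtain ⟨n, hn⟩ := C.exists_B_eq h1.symm
      exact ⟨n, by rw [hn, h1]; ring⟩
    · rcases htj.mem_iff.1 hB with h2 | h2 | h2
      · exact absurd h2.symm hti.vb
      · exfalso
        obtain ⟨p, hp⟩ := C.dvd_of_eq _ _ h1
        obtain ⟨q, hq⟩ := C.dvd_of_eq _ _ h2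
        have h3 := C.three_le
        have h4 : (2 : ℤ) = C.k * (q - p) := by linarith
        have h5 : (C.k : ℤ) ∣ 2 := ⟨_, h4⟩
        have := Int.le_of_dvd (by norm_num) h5
        omega
      · exact absurd (h1.trans h2.symm) hti.ab
  · rcases htj.mem_iff.1 hA with h1 | h1 | h1
    · exact absurd h1.symm hti.va
    · obtain ⟨n, hn⟩ := C.exists_B_eq h1.symm
      exact ⟨n, by rw [hn, h1]; ring⟩
    · obtain ⟨h3, h4⟩ := hcommon _ _ _ _ hti htj.swap hB h1
        (fun h => hB (h ▸ htj.mem_a))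
      obtain ⟨n, hn⟩ := C.exists_B_eq h1.symm
      refine ⟨n, ?_⟩
      rw [C.B_succ] at hn
      rw [h4] at ej
      rw [h3]; linarith
  · rcases htj.mem_iff.1 hB with h1 | h1 | h1
    · exact absurd h1.symm hti.vb
    · obtain ⟨h3, h4⟩ := hcommon _ _ _ _ hti.swap htj hA h1
        (fun h => hA (h ▸ htj.mem_b))
      obtain ⟨n, hn⟩ := C.exists_B_eq h1.symm
      refine ⟨n, ?_⟩
      rw [C.B_succ] at hn
      rw [h3] at ei
      rw [h4]; linarith
    · obtain ⟨h3, h4⟩ := hcommon _ _ _ _ hti.swap htj.swap hA h1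
        (fun h => hA (h ▸ htj.mem_a))
      obtain ⟨n, hn⟩ := C.exists_B_eq h1.symm
      refine ⟨n, ?_⟩
      rw [C.B_succ, C.B_succ] at hn
      rw [h3] at ei
      rw [h4] at ej
      linarith
  · exfalso
    apply hxv
    refine eq_vertex_of_coord hti.mem hi hti.mem_v (hti.forall_mem (fun h => absurd rfl h) ?_ ?_)
    · exact fun _ => coord_eq_zero hti.mem hi htj.mem hj hti.mem_a hA
    · exact fun _ => coord_eq_zero hti.mem hi htj.mem hj hti.mem_b hB

end LinkCycle

/-! ### The development of two adjacent triangles -/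

variable (𝒯) in
/-- The coordinates of a point of the two triangles at the edge `v u`, one of which is `T`, developed
on the sphere. -/
noncomputable def dev (T : Finset X) (v u x : X) : E3 :=
  !₂[𝒯.ip v x, 𝒯.dirc v u x, if x ∈ 𝒯.cell T then 𝒯.ht v u x else - 𝒯.ht v u x]

theorem inner_e3 (a b : E3) : inner ℝ a b = a 0 * b 0 + a 1 * b 1 + a 2 * b 2 := by
  rw [PiLp.inner_apply, Fin.sum_univ_three]
  simp only [RCLike.inner_apply, conj_trivial]
  ring

section

variable (h : 𝒯.Tri T v u a) (h' : 𝒯.Tri T' v u b) (hab : a ≠ b)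
include h h' hab

theorem Tri.ht_eq_zero_of_mem (hx : x ∈ 𝒯.cell T) (hx' : x ∈ 𝒯.cell T') : 𝒯.ht v u x = 0 := by
  rw [h.ht_eq_coord hx, coord_eq_zero h.mem hx h'.mem hx' h.mem_b, zero_mul]
  intro ha
  rcases h'.mem_iff.1 ha with h1 | h1 | h1
  exacts [h.vb h1.symm, h.ab h1.symm, hab h1]

theorem Tri.mem_of_ht_eq_zero (hx : x ∈ 𝒯.cell T) (h0 : 𝒯.ht v u x = 0) : x ∈ 𝒯.cell T' := by
  rw [h.ht_eq_coord hx] at h0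
  refine mem_cell_of_coord h.mem hx h'.mem (h.forall_mem ?_ ?_ ?_)
  exacts [fun h => absurd h'.mem_v h, fun h => absurd h'.mem_a h,
    fun _ => (mul_eq_zero.1 h0).resolve_right h.ht_b_pos.ne']

theorem Tri.dev_two (hx : x ∈ 𝒯.cell T') : 𝒯.dev T v u x 2 = - 𝒯.ht v u x := by
  simp only [dev, PiLp.toLp_apply, Matrix.cons_val]
  split_ifs with hxT
  · rw [h.ht_eq_zero_of_mem h' hab hxT hx, neg_zero]
  · rfl

theorem Tri.inner_dev' (hx : x ∈ 𝒯.cell T') (hy : y ∈ 𝒯.cell T') :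
    inner ℝ (𝒯.dev T v u x) (𝒯.dev T v u y) = (inner ℝ (𝒯.chart T' x) (𝒯.chart T' y) : ℝ) := by
  rw [inner_e3, h.dev_two h' hab hx, h.dev_two h' hab hy, h'.inner_eq hx hy]
  simp [dev]

end

theorem Tri.inner_dev (h : 𝒯.Tri T v u a) (hx : x ∈ 𝒯.cell T) (hy : y ∈ 𝒯.cell T) :
    inner ℝ (𝒯.dev T v u x) (𝒯.dev T v u y) = (inner ℝ (𝒯.chart T x) (𝒯.chart T y) : ℝ) := by
  rw [inner_e3, h.inner_eq hx hy]
  simp [dev, hx, hy]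

end SphericalGluing

namespace SphericalGluing

variable {X : Type*} {𝒯 : SphericalGluing X} {S T T' : Finset X} {v w a b c d u x y : X}

section

variable (h : 𝒯.Tri T v u a) (h' : 𝒯.Tri T' v u b) (hab : a ≠ b)
include h h' hab

theorem Tri.norm_dev (hx : x ∈ 𝒯.cell T ∨ x ∈ 𝒯.cell T') : ‖𝒯.dev T v u x‖ = 1 := by
  have : inner ℝ (𝒯.dev T v u x) (𝒯.dev T v u x) = (1 : ℝ) := by
    rcases hx with hx | hx
    · rw [h.inner_dev hx hx, inner_chart_self h.mem hx]
    · rw [h.inner_dev' h' hab hx hx, inner_chart_self h'.mem hx]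
  rw [real_inner_self_eq_norm_sq] at this
  exact (pow_eq_one_iff_of_nonneg (norm_nonneg _) two_ne_zero).1 this

theorem Tri.sphericalDist_dev (hS : S ∈ 𝒯.faces) (hvS : v ∈ S) (huS : u ∈ S) (hx : x ∈ 𝒯.cell S)
    (hy : y ∈ 𝒯.cell S) : sphericalDist (𝒯.dev T v u x) (𝒯.dev T v u y) =
      sphericalDist (𝒯.chart S x) (𝒯.chart S y) := by
  rw [sphericalDist_eq_arccos (norm_chart hS hx) (norm_chart hS hy)]
  rcases h.eq_or_eq h' hab hS hvS huS with rfl | rfl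
  · rw [sphericalDist_eq_arccos (h.norm_dev h' hab (Or.inl hx)) (h.norm_dev h' hab (Or.inl hy)),
      h.inner_dev hx hy]
  · rw [sphericalDist_eq_arccos (h.norm_dev h' hab (Or.inr hx)) (h.norm_dev h' hab (Or.inr hy)),
      h.inner_dev' h' hab hx hy]

theorem Tri.mem_or_mem (hx : x ∈ 𝒯.edgeStar v u) : x ∈ 𝒯.cell T ∨ x ∈ 𝒯.cell T' := by
  obtain ⟨S, hS, hxS⟩ := 𝒯.cover x
  obtain ⟨h1, h2⟩ := hx S hS hxS
  rcases h.eq_or_eq h' hab hS h1 h2 with rfl | rfl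
  exacts [Or.inl hxS, Or.inr hxS]

/-- The arc joining the developed images of two points that lie in different triangles crosses the
common edge. -/
theorem Tri.exists_crossing (hx : x ∈ 𝒯.cell T) (hy : y ∈ 𝒯.cell T') (hx' : x ∉ 𝒯.cell T')
    (hy' : y ∉ 𝒯.cell T)
    (hαx : 0 < 𝒯.ip v x - 𝒯.ip v u * 𝒯.dirc v u x / 𝒯.rad v u) (hβx : 0 < 𝒯.dirc v u x)
    (hαy : 0 < 𝒯.ip v y - 𝒯.ip v u * 𝒯.dirc v u y / 𝒯.rad v u) (hβy : 0 < 𝒯.dirc v u y) :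
    ∃ z ∈ 𝒯.cell T ∩ 𝒯.cell T', sphericalDist (𝒯.dev T v u x) (𝒯.dev T v u y) =
      sphericalDist (𝒯.dev T v u x) (𝒯.dev T v u z) +
      sphericalDist (𝒯.dev T v u z) (𝒯.dev T v u y) := by
  have hr := h.rad_a_pos
  have hrsq := rad_sq (𝒯 := 𝒯) (v := v) (x := u)
  set r := 𝒯.rad v u
  set p := 𝒯.ip v u
  have hX : 0 < 𝒯.ht v u x := lt_of_le_of_ne h.ht_nonneg fun h0 =>
    hx' (h.mem_of_ht_eq_zero h' hab hx h0.symm)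
  have hY : 0 < 𝒯.ht v u y := lt_of_le_of_ne h.ht_nonneg fun h0 =>
    hy' (h'.mem_of_ht_eq_zero h hab.symm hy h0.symm)
  set ξ := 𝒯.ht v u x
  set η := 𝒯.ht v u y
  -- In the development `η • x + ξ • y` has no normal component, as `x` and `y` lie on opposite
  -- sides at heights `ξ` and `η`. `A` and `β` are its coordinates along `v` and `u`; being
  -- positive, they give a point of the edge after normalization.
  set A := η * (𝒯.ip v x - p * 𝒯.dirc v u x / r) + ξ * (𝒯.ip v y - p * 𝒯.dirc v u y / r) with hA
  set β := (η * 𝒯.dirc v u x + ξ * 𝒯.dirc v u y) / r with hβ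
  have hApos : 0 < A := by positivity
  have hβpos : 0 < β := by positivity
  have hbv := h.va
  -- the crossing point
  set c : X → ℝ := fun z => if z = v then A else if z = u then β else 0 with hc
  have cv : c v = A := by simp [hc]
  have cu : c u = β := by simp [hc, h.va.symm]
  have ca : c a = 0 := by simp [hc, h.vb.symm, h.ab.symm]
  set N := ‖∑ z ∈ T, c z • 𝒯.chart T z‖ with hN
  have hNpos : 0 < N := by
    rw [hN, norm_pos_iff]
    intro h0
    have : ∑ z ∈ T, c z • 𝒯.chart T z = ∑ z ∈ T, (0 : X → ℝ) z • 𝒯.chart T z := by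
      rw [h0]; simp
    have := eq_of_sum_eq h.mem this v h.mem_v
    rw [cv] at this
    exact hApos.ne' this
  obtain ⟨z, hz, -, hzc⟩ := exists_point h.mem (c := fun z => N⁻¹ * c z)
    (h.forall_mem (by rw [cv]; positivity) (by rw [cu]; positivity) (by rw [ca]; simp)) (by
      simp_rw [mul_smul, ← Finset.smul_sum, norm_smul]
      rw [← hN, norm_inv, norm_eq_abs, abs_of_pos hNpos, inv_mul_cancel₀ hNpos.ne'])
  have zv := hzc v h.mem_v
  have zu := hzc u h.mem_a
  have za := hzc a h.mem_b
  rw [cv] at zv; rw [cu] at zu; rw [ca, mul_zero] at za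
  have hz' : z ∈ 𝒯.cell T' := mem_cell_of_coord h.mem hz h'.mem (h.forall_mem
    (fun h => absurd h'.mem_v h) (fun h => absurd h'.mem_a h) (fun _ => za))
  refine ⟨z, ⟨hz, hz'⟩, ?_⟩
  have z1 : 𝒯.ip v z = N⁻¹ * (A + β * p) := by
    rw [h.ip_eq_coord hz, zv, zu, za]; ring
  have z2 : 𝒯.dirc v u z = N⁻¹ * (β * r) := by
    rw [h.dirc_eq_coord hz, zu, za]; ring
  have z3 : 𝒯.ht v u z = 0 := h.ht_eq_zero_of_mem h' hab hz hz'
  have hdz : 𝒯.dev T v u z = (N⁻¹ * η) • 𝒯.dev T v u x + (N⁻¹ * ξ) • 𝒯.dev T v u y := by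
    ext i
    fin_cases i
    · change 𝒯.ip v z = N⁻¹ * η * 𝒯.ip v x + N⁻¹ * ξ * 𝒯.ip v y
      rw [z1, hA, hβ]; field_simp; ring
    · change 𝒯.dirc v u z = N⁻¹ * η * 𝒯.dirc v u x + N⁻¹ * ξ * 𝒯.dirc v u y
      have hβr : β * r = η * 𝒯.dirc v u x + ξ * 𝒯.dirc v u y := by rw [hβ]; field_simp
      rw [z2, hβr]; ring
    · simp only [dev, PiLp.add_apply, PiLp.smul_apply, smul_eq_mul, Fin.reduceFinMk,
        Matrix.cons_val, if_pos hz, if_pos hx, if_neg hy', z3]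
      ring
  refine InnerProductGeometry.angle_eq_angle_add_add_angle_add_of_mem_span ?_ ?_
  · rw [← norm_ne_zero_iff, h.norm_dev h' hab (Or.inl hz)]; norm_num
  · rw [hdz, Submodule.mem_span_pair]
    exact ⟨⟨N⁻¹ * η, by positivity⟩, ⟨N⁻¹ * ξ, by positivity⟩, rfl⟩

end

variable [MetricSpace X]

/-- A broken line too short to leave the ball stays in the open star of the edge. Each of its
segments then lies in one of the two developed triangles and keeps its length. -/
theorem Tri.sphericalDist_le_of_isChain (h : 𝒯.Tri T v u a) (h' : 𝒯.Tri T' v u b) (hab : a ≠ b)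
    (hI : 𝒯.IsIntrinsic) {x₀ : X} {R : ℝ} (hR : Metric.ball x₀ R ⊆ 𝒯.edgeStar v u) {ℓ : ℝ}
    (hc : 𝒯.IsChain x y ℓ) (hℓ : dist x₀ x + ℓ < R) :
    sphericalDist (𝒯.dev T v u x) (𝒯.dev T v u y) ≤ ℓ := by
  have hnn : ∀ {x y : X} {ℓ : ℝ}, 𝒯.IsChain x y ℓ → 0 ≤ ℓ := by
    intro x y ℓ hc
    induction hc with
    | nil => rfl
    | cons T x y z ℓ _ _ _ _ ih => exact add_nonneg (InnerProductGeometry.angle_nonneg _ _) ih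
  induction hc with
  | nil x =>
    have hx : x ∈ 𝒯.edgeStar v u := hR (by rw [Metric.mem_ball']; linarith)
    have h0 : 𝒯.dev T v u x ≠ 0 := by
      rw [← norm_ne_zero_iff, h.norm_dev h' hab (h.mem_or_mem h' hab hx)]; norm_num
    rw [sphericalDist, InnerProductGeometry.angle_self h0]
  | cons S x y z ℓ hS hx hy hc ih =>
    have h0 := InnerProductGeometry.angle_nonneg (𝒯.chart S x) (𝒯.chart S y)
    have h1 := hnn hc
    have h2 := hI.dist_le hS hx hy
    rw [sphericalDist] at h2 hℓ
    have hx' : x ∈ 𝒯.edgeStar v u := hR (by rw [Metric.mem_ball']; linarith)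
    obtain ⟨hv, hu⟩ := hx' S hS hx
    have h3 := ih (by linarith [dist_triangle x₀ x y])
    rw [← h.sphericalDist_dev h' hab hS hv hu hx hy]
    linarith [sphericalDist_triangle (𝒯.dev T v u x) (𝒯.dev T v u y) (𝒯.dev T v u z)]

/-- The development of two adjacent triangles is a local isometry. -/
theorem Tri.eventually_dist_eq (h : 𝒯.Tri T v u a) (h' : 𝒯.Tri T' v u b) (hab : a ≠ b)
    (hI : 𝒯.IsIntrinsic) (hE : 𝒯.LongEdges) {x₀ : X} (hx₀ : x₀ ∈ 𝒯.edgeStar v u)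
    (hv : 0 < 𝒯.ip v x₀) (hne : x₀ ≠ v) :
    ∃ r > 0, Metric.ball x₀ r ⊆ 𝒯.edgeStar v u ∧ ∀ x ∈ Metric.ball x₀ r, ∀ y ∈ Metric.ball x₀ r,
      dist x y = sphericalDist (𝒯.dev T v u x) (𝒯.dev T v u y) := by
  obtain ⟨R, hRpos, hR⟩ := Metric.isOpen_iff.1 (hI.isOpen_edgeStar v u) x₀ hx₀
  -- Radius `R / 3` guarantees `dist x y < R - dist x₀ x`, so nearly shortest broken lines from `x`
  -- to `y` remain inside the ball of radius `R`.
  have lower : ∀ x ∈ Metric.ball x₀ (R / 3), ∀ y ∈ Metric.ball x₀ (R / 3),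
      sphericalDist (𝒯.dev T v u x) (𝒯.dev T v u y) ≤ dist x y := by
    intro x hx y hy
    rw [Metric.mem_ball'] at hx hy
    by_contra! hlt
    have hlt2 : dist x y < R - dist x₀ x := by
      linarith [dist_triangle_left x y x₀]
    obtain ⟨ℓ, hℓ, hℓ'⟩ : ∃ ℓ, 𝒯.IsChain x y ℓ ∧
        ℓ < min (sphericalDist (𝒯.dev T v u x) (𝒯.dev T v u y)) (R - dist x₀ x) := by
      by_contra! hcon
      have := (hI x y).2 (show _ ∈ lowerBounds _ from fun ℓ hℓ => hcon ℓ hℓ)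
      linarith [lt_min hlt hlt2]
    rw [lt_min_iff] at hℓ'
    have := h.sphericalDist_le_of_isChain h' hab hI hR hℓ (by linarith)
    linarith
  have same : ∀ x y, ∀ S ∈ 𝒯.faces, x ∈ 𝒯.edgeStar v u → x ∈ 𝒯.cell S → y ∈ 𝒯.cell S →
      dist x y ≤ sphericalDist (𝒯.dev T v u x) (𝒯.dev T v u y) := by
    intro x y S hS hxs hx hy
    obtain ⟨h1, h2⟩ := hxs S hS hx
    rw [h.sphericalDist_dev h' hab hS h1 h2 hx hy]
    exact hI.dist_le hS hx hy
  suffices hup : ∃ r > 0, r ≤ R / 3 ∧ ∀ x ∈ Metric.ball x₀ r, ∀ y ∈ Metric.ball x₀ r,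
      dist x y ≤ sphericalDist (𝒯.dev T v u x) (𝒯.dev T v u y) by
    obtain ⟨r, hr, hrR, hle⟩ := hup
    refine ⟨r, hr, fun x hx => hR (Metric.ball_subset_ball (by linarith) hx), fun x hx y hy => ?_⟩
    exact le_antisymm (hle x hx y hy) (lower x (Metric.ball_subset_ball hrR hx) y
      (Metric.ball_subset_ball hrR hy))
  by_cases hT : x₀ ∈ 𝒯.cell T
  swap
  · obtain ⟨r, hr, hsub⟩ := Metric.isOpen_iff.1 (hI.isClosed_cell h.mem).isOpen_compl x₀ hT
    refine ⟨min r (R / 3), by positivity, min_le_right _ _, fun x hx y hy => ?_⟩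
    have mem : ∀ x ∈ Metric.ball x₀ (min r (R / 3)), x ∈ 𝒯.edgeStar v u ∧ x ∈ 𝒯.cell T' := by
      intro x hx
      have hxR := hR (Metric.ball_subset_ball (show min r (R / 3) ≤ R by
        linarith [min_le_right r (R / 3)]) hx)
      exact ⟨hxR, (h.mem_or_mem h' hab hxR).resolve_left
        (hsub (Metric.ball_subset_ball (min_le_left _ _) hx))⟩
    exact same x y T' h'.mem (mem x hx).1 (mem x hx).2 (mem y hy).2
  by_cases hT' : x₀ ∈ 𝒯.cell T'
  swap
  · obtain ⟨r, hr, hsub⟩ := Metric.isOpen_iff.1 (hI.isClosed_cell h'.mem).isOpen_compl x₀ hT'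
    refine ⟨min r (R / 3), by positivity, min_le_right _ _, fun x hx y hy => ?_⟩
    have mem : ∀ x ∈ Metric.ball x₀ (min r (R / 3)), x ∈ 𝒯.edgeStar v u ∧ x ∈ 𝒯.cell T := by
      intro x hx
      have hxR := hR (Metric.ball_subset_ball (show min r (R / 3) ≤ R by
        linarith [min_le_right r (R / 3)]) hx)
      exact ⟨hxR, (h.mem_or_mem h' hab hxR).resolve_right
        (hsub (Metric.ball_subset_ball (min_le_left _ _) hx))⟩
    exact same x y T h.mem (mem x hx).1 (mem x hx).2 (mem y hy).2
  -- `x₀` lies on the edge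
  have hr := h.rad_a_pos
  have hc0 : 𝒯.coord T x₀ a = 0 := by
    have := h.ht_eq_zero_of_mem h' hab hT hT'
    rw [h.ht_eq_coord hT] at this
    exact (mul_eq_zero.1 this).resolve_right h.ht_b_pos.ne'
  have hip := h.ip_eq_coord hT
  have hdi := h.dirc_eq_coord hT
  rw [hc0, zero_mul, add_zero] at hip hdi
  have hcu : 0 < 𝒯.coord T x₀ u := by
    refine lt_of_le_of_ne (coord_nonneg h.mem hT u) fun h0 => hne ?_
    refine eq_vertex_of_coord h.mem hT h.mem_v (h.forall_mem (fun h => absurd rfl h) ?_ ?_)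
    exacts [fun _ => h0.symm, fun _ => hc0]
  have hcv : 0 < 𝒯.coord T x₀ v := by
    have := hE.ip_nonpos h.mem h.mem_v h.mem_a h.va
    nlinarith
  have hα0 : 0 < 𝒯.ip v x₀ - 𝒯.ip v u * 𝒯.dirc v u x₀ / 𝒯.rad v u := by
    rw [hip, hdi]; field_simp; linarith
  have hβ0 : 0 < 𝒯.dirc v u x₀ := by rw [hdi]; positivity
  -- continuity of the development at `x₀`
  have hcont : Tendsto (𝒯.dev T v u) (𝓝 x₀) (𝓝 (𝒯.dev T v u x₀)) := by
    rw [tendsto_iff_dist_tendsto_zero]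
    have hlim : Tendsto (fun x => √(2 - 2 * cos (dist x x₀))) (𝓝 x₀) (𝓝 0) := by
      have : Continuous fun x => √(2 - 2 * cos (dist x x₀)) := by fun_prop
      have := this.tendsto x₀
      simpa using this
    refine squeeze_zero' (Eventually.of_forall fun _ => dist_nonneg) ?_ hlim
    filter_upwards [Metric.ball_mem_nhds x₀ (show 0 < min (R / 3) π by positivity)] with x hx
    have hxR : x ∈ Metric.ball x₀ (R / 3) := Metric.ball_subset_ball (min_le_left _ _) hx
    have hxπ : dist x x₀ < π := lt_of_lt_of_le hx (min_le_right _ _)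
    have n1 := h.norm_dev h' hab (h.mem_or_mem h' hab
      (hR (Metric.ball_subset_ball (by linarith) hxR)))
    have n0 := h.norm_dev h' hab (Or.inl hT)
    have hle := lower x hxR x₀ (Metric.mem_ball_self (by positivity))
    have hcos : cos (dist x x₀) ≤ inner ℝ (𝒯.dev T v u x) (𝒯.dev T v u x₀) := by
      rw [← cos_sphericalDist n1 n0]
      exact cos_le_cos_of_nonneg_of_le_pi (InnerProductGeometry.angle_nonneg _ _) hxπ.le hle
    rw [dist_eq_norm]
    apply le_sqrt_of_sq_le
    rw [norm_sub_sq_real, n1, n0]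
    linarith
  have c0 : Tendsto (fun x => 𝒯.ip v x) (𝓝 x₀) (𝓝 (𝒯.ip v x₀)) :=
    ((PiLp.continuous_apply 2 (fun _ : Fin 3 => ℝ) 0).tendsto _).comp hcont
  have c1 : Tendsto (fun x => 𝒯.dirc v u x) (𝓝 x₀) (𝓝 (𝒯.dirc v u x₀)) :=
    ((PiLp.continuous_apply 2 (fun _ : Fin 3 => ℝ) 1).tendsto _).comp hcont
  have hev : ∀ᶠ x in 𝓝 x₀, 0 < 𝒯.ip v x - 𝒯.ip v u * 𝒯.dirc v u x / 𝒯.rad v u ∧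
      0 < 𝒯.dirc v u x :=
    ((c0.sub ((c1.const_mul (𝒯.ip v u)).div_const (𝒯.rad v u))).eventually (lt_mem_nhds hα0)).and
      (c1.eventually (lt_mem_nhds hβ0))
  obtain ⟨r, hrp, hrs⟩ := Metric.eventually_nhds_iff_ball.1 hev
  refine ⟨min r (R / 3), by positivity, min_le_right _ _, ?_⟩
  have aux : ∀ x ∈ Metric.ball x₀ (min r (R / 3)), ∀ y ∈ Metric.ball x₀ (min r (R / 3)),
      x ∈ 𝒯.cell T → dist x y ≤ sphericalDist (𝒯.dev T v u x) (𝒯.dev T v u y) := by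
    intro x hx y hy hxT
    have hsub : Metric.ball x₀ (min r (R / 3)) ⊆ 𝒯.edgeStar v u := fun x hx =>
      hR (Metric.ball_subset_ball (show min r (R / 3) ≤ R by linarith [min_le_right r (R / 3)]) hx)
    have hrr : Metric.ball x₀ (min r (R / 3)) ⊆ Metric.ball x₀ r :=
      Metric.ball_subset_ball (min_le_left _ _)
    by_cases hyT : y ∈ 𝒯.cell T
    · exact same x y T h.mem (hsub hx) hxT hyT
    have hyT' := (h.mem_or_mem h' hab (hsub hy)).resolve_left hyT
    by_cases hxT' : x ∈ 𝒯.cell T'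
    · exact same x y T' h'.mem (hsub hx) hxT' hyT'
    obtain ⟨z, ⟨hz, hz'⟩, hzd⟩ := h.exists_crossing h' hab hxT hyT' hxT' hyT (hrs x (hrr hx)).1
      (hrs x (hrr hx)).2 (hrs y (hrr hy)).1 (hrs y (hrr hy)).2
    have d1 := same x z T h.mem (hsub hx) hxT hz
    have d2 := same y z T' h'.mem (hsub hy) hyT' hz'
    rw [sphericalDist_comm (𝒯.dev T v u y), dist_comm] at d2
    linarith [dist_triangle x z y]
  intro x hx y hy
  by_cases hxT : x ∈ 𝒯.cell T
  · exact aux x hx y hy hxT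
  by_cases hyT : y ∈ 𝒯.cell T
  · rw [dist_comm, sphericalDist_comm]; exact aux y hy x hx hyT
  have hsub : Metric.ball x₀ (min r (R / 3)) ⊆ 𝒯.edgeStar v u := fun x hx =>
    hR (Metric.ball_subset_ball (show min r (R / 3) ≤ R by linarith [min_le_right r (R / 3)]) hx)
  exact same x y T' h'.mem (hsub hx) ((h.mem_or_mem h' hab (hsub hx)).resolve_left hxT)
    ((h.mem_or_mem h' hab (hsub hy)).resolve_left hyT)

end SphericalGluing

/-- A curve that is locally distance-realizing. -/
def IsLocalGeodesic {X : Type*} [MetricSpace X] (γ : ℝ → X) : Prop :=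
  ∀ t : ℝ, ∃ ε > 0, ∀ s ∈ Ioo (t - ε) (t + ε), ∀ s' ∈ Ioo (t - ε) (t + ε), dist (γ s) (γ s') = |s - s'|

theorem IsLocalGeodesic.continuous {X : Type*} [MetricSpace X] {γ : ℝ → X} (h : IsLocalGeodesic γ) :
    Continuous γ := by
  rw [continuous_iff_continuousAt]
  intro t
  obtain ⟨ε, hε, hd⟩ := h t
  rw [ContinuousAt, tendsto_iff_dist_tendsto_zero]
  have hlim : Tendsto (fun s => |s - t|) (𝓝 t) (𝓝 0) := by
    have : Continuous fun s : ℝ => |s - t| := by fun_prop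
    simpa using this.tendsto t
  refine hlim.congr' ?_
  filter_upwards [Ioo_mem_nhds (show t - ε < t by linarith) (show t < t + ε by linarith)] with s hs
  exact (hd s hs t ⟨by linarith, by linarith⟩).symm

/-! ### The hinge inequality around a vertex -/

namespace SphericalGluing

variable {X : Type*} {𝒯 : SphericalGluing X} {S T T' : Finset X} {v w a b c d u x y : X}

theorem exists_tri_pair (hx : x ∈ 𝒯.edgeStar v u) (huv : u ≠ v) :
    ∃ T T' a b, 𝒯.Tri T v u a ∧ 𝒯.Tri T' v u b ∧ a ≠ b := by
  obtain ⟨S, hS, hxS⟩ := 𝒯.cover x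
  obtain ⟨h1, h2⟩ := hx S hS hxS
  obtain ⟨a, ha⟩ := exists_tri_of_mem_of_mem hS h1 h2 huv.symm
  obtain ⟨b, hb, hb'⟩ := ha.swap.exists_next
  exact ⟨S, _, a, b, ha, hb', hb.symm⟩

/-- The point of an edge at a given distance of its endpoint. -/
theorem Tri.exists_edge_point (h : 𝒯.Tri T v u a) {p q : ℝ} (hpq : p ^ 2 + q ^ 2 = 1) (hq : 0 ≤ q)
    (hp : 𝒯.ip v u * q ≤ p * 𝒯.rad v u) :
    ∃ z ∈ 𝒯.cell T, 𝒯.coord T z a = 0 ∧ 𝒯.ip v z = p ∧ 𝒯.dirc v u z = q := by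
  have hr := h.rad_a_pos
  have hrsq := rad_sq (𝒯 := 𝒯) (v := v) (x := u)
  set r := 𝒯.rad v u
  set k := 𝒯.ip v u with hk
  set c : X → ℝ := fun z => if z = v then p - k * q / r else if z = u then q / r else 0 with hc
  have cv : c v = p - k * q / r := by simp [hc]
  have cu : c u = q / r := by simp [hc, h.va.symm]
  have ca : c a = 0 := by simp [hc, h.vb.symm, h.ab.symm]
  have hnn : 0 ≤ p - k * q / r := by
    rw [sub_nonneg, div_le_iff₀ hr]; exact hp
  have hnorm : ‖∑ z ∈ T, c z • 𝒯.chart T z‖ = 1 := by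
    rw [h.sum_eq, cv, cu, ca, zero_smul, add_zero]
    rw [← pow_eq_one_iff_of_nonneg (norm_nonneg _) two_ne_zero, ← real_inner_self_eq_norm_sq,
      inner_add_add_self]
    simp only [inner_smul_left, inner_smul_right, RCLike.conj_to_real]
    rw [inner_chart_self h.mem h.cell_v, inner_chart_self h.mem h.cell_a,
      ← ip_eq h.mem h.mem_v h.cell_a, ← ip_eq h.mem h.mem_a h.cell_v, ip_comm h.mem h.mem_a h.mem_v,
      ← hk]
    have hk2 : k ^ 2 = 1 - r ^ 2 := by linarith
    field_simp
    linear_combination (r ^ 2) * hpq - q ^ 2 * hk2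
  obtain ⟨z, hz, -, hzc⟩ := exists_point h.mem (c := c)
    (h.forall_mem (by rw [cv]; exact hnn) (by rw [cu]; positivity) (by rw [ca])) hnorm
  have zv := hzc v h.mem_v
  have zu := hzc u h.mem_a
  have za := hzc a h.mem_b
  rw [cv] at zv; rw [cu] at zu; rw [ca] at za
  refine ⟨z, hz, za, ?_, ?_⟩
  · rw [h.ip_eq_coord hz, zv, zu, za]; ring
  · rw [h.dirc_eq_coord hz, zu, za]
    change q / r * r + 0 * _ = q
    field_simp; ring

variable (𝒯) in
/-- The point of the unit sphere with the polar coordinates of `x`, relative to the angle `θ`. -/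
noncomputable def pol (v x : X) (θ : ℝ) : E3 :=
  !₂[𝒯.ip v x, 𝒯.rad v x * cos θ, 𝒯.rad v x * sin θ]

theorem inner_pol (v x y : X) (θ θ' : ℝ) : inner ℝ (𝒯.pol v x θ) (𝒯.pol v y θ') =
    𝒯.ip v x * 𝒯.ip v y + 𝒯.rad v x * 𝒯.rad v y * cos (θ' - θ) := by
  rw [inner_e3, cos_sub]
  simp [pol]
  ring

theorem norm_pol (v x : X) (θ : ℝ) : ‖𝒯.pol v x θ‖ = 1 := by
  rw [← pow_eq_one_iff_of_nonneg (norm_nonneg _) two_ne_zero, ← real_inner_self_eq_norm_sq, inner_pol,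
    sub_self, cos_zero]
  linarith [rad_sq (𝒯 := 𝒯) (v := v) (x := x)]

section

variable [MetricSpace X]

namespace LinkCycle

variable {C : 𝒯.LinkCycle v}

theorem dist_le_of_mem_face (hI : 𝒯.IsIntrinsic) {i : ℤ} (hx : x ∈ 𝒯.cell (C.face i))
    (hy : y ∈ 𝒯.cell (C.face i)) : dist x y ≤ sphericalDist
      (𝒯.pol v x (C.B i + 𝒯.pa v (C.w i) x)) (𝒯.pol v y (C.B i + 𝒯.pa v (C.w i) y)) := by
  have ht := C.tri_face i
  refine (hI.dist_le ht.mem hx hy).trans_eq ?_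
  rw [sphericalDist_eq_arccos (norm_chart ht.mem hx) (norm_chart ht.mem hy),
    sphericalDist_eq_arccos (norm_pol _ _ _) (norm_pol _ _ _), inner_pol, ht.inner_eq_cos hx hy,
    ← cos_neg]
  congr 4
  ring

/-- Induction on the number of faces between the two points. The spherical segment between the
points in polar coordinates crosses the next edge at `v`; the crossing point exists in `X`, and the
segment splits additively there, so the triangle inequality suffices. -/
theorem dist_le_aux (hI : 𝒯.IsIntrinsic) (hE : 𝒯.LongEdges) (hvy : 0 < 𝒯.ip v y) (hy : y ≠ v) (n : ℕ) :
    ∀ (i : ℤ) (x : X), x ∈ 𝒯.cell (C.face i) → y ∈ 𝒯.cell (C.face (i + n)) → 0 < 𝒯.ip v x → x ≠ v →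
      C.B (i + n) + 𝒯.pa v (C.w (i + n)) y < C.B i + 𝒯.pa v (C.w i) x + π →
      dist x y ≤ sphericalDist (𝒯.pol v x (C.B i + 𝒯.pa v (C.w i) x))
        (𝒯.pol v y (C.B (i + n) + 𝒯.pa v (C.w (i + n)) y)) := by
  induction n with
  | zero =>
    intro i x hx hy' _ _ _
    simp only [Nat.cast_zero, add_zero] at hy' ⊢
    exact dist_le_of_mem_face hI hx hy'
  | succ n ih =>
    intro i x hx hy' hvx hxv hlt
    have hcast : i + ((n + 1 : ℕ) : ℤ) = i + 1 + n := by push_cast; ring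
    rw [hcast] at hy' hlt ⊢
    have ht := C.tri_face i
    have ht1 := C.tri_face (i + 1)
    have hnext : ∀ z ∈ 𝒯.cell (C.face i), 𝒯.coord (C.face i) z (C.w i) = 0 →
        z ∈ 𝒯.cell (C.face (i + 1)) := fun z hz h0 =>
      mem_cell_of_coord ht.mem hz ht1.mem (ht.forall_mem (fun h => absurd ht1.mem_v h) (fun _ => h0)
        (fun h => absurd ht1.mem_a h))
    have hBle : C.B (i + 1) ≤ C.B (i + 1 + n) := (C.B_strictMono hE).monotone (by omega)
    set θ := C.B i + 𝒯.pa v (C.w i) x with hθ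
    set θ' := C.B (i + 1 + n) + 𝒯.pa v (C.w (i + 1 + n)) y with hθ'
    have hxB : θ ≤ C.B (i + 1) := by
      rw [C.B_succ, hθ]; linarith [ht.pa_le_angle hE hx hxv]
    have hBy : C.B (i + 1) ≤ θ' := by
      rw [hθ']; linarith [pa_nonneg (𝒯 := 𝒯) (v := v) (a := C.w (i + 1 + n)) (x := y)]
    have epa := ht.pa_swap hE hx hxv
    rcases hxB.eq_or_lt with heq | hxB
    · have h0 : 𝒯.pa v (C.w (i + 1)) x = 0 := by
        rw [C.B_succ, hθ] at heq; linarith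
      have hx1 := hnext x hx ((ht.swap.pa_eq_zero_iff hx hxv hE).1 h0)
      have := ih (i + 1) x hx1 hy' hvx hxv (by rw [h0, add_zero, ← heq]; exact hlt)
      rw [h0, add_zero, ← heq] at this
      exact this
    rcases hBy.eq_or_lt with heq | hBy
    · have hn : n = 0 := by
        by_contra hn
        have := C.B_strictMono hE (show i + 1 < i + 1 + n by omega)
        linarith [pa_nonneg (𝒯 := 𝒯) (v := v) (a := C.w (i + 1 + n)) (x := y)]
      subst hn
      simp only [Nat.cast_zero, add_zero] at hy' hθ'
      have h0 : 𝒯.pa v (C.w (i + 1)) y = 0 := by linarith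
      have h1 := (ht1.pa_eq_zero_iff hy' hy hE).1 h0
      have hyi : y ∈ 𝒯.cell (C.face i) :=
        mem_cell_of_coord ht1.mem hy' ht.mem (ht1.forall_mem (fun h => absurd ht.mem_v h)
          (fun h => absurd ht.mem_b h) (fun _ => h1))
      have h2 := ht.pa_swap hE hyi hy
      have := dist_le_of_mem_face hI hx hyi
      rwa [show C.B i + 𝒯.pa v (C.w i) y = θ' by rw [← heq, C.B_succ]; linarith] at this
    -- the crossing point
    set τ := C.B (i + 1) with hτ
    have hxr := ht.rad_pos hx hxv
    have hyr := (C.tri_face (i + 1 + n)).rad_pos hy' hy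
    have s1 : 0 < sin (τ - θ) := sin_pos_of_pos_of_lt_pi (by linarith) (by linarith)
    have s2 : 0 < sin (θ' - τ) := sin_pos_of_pos_of_lt_pi (by linarith) (by linarith)
    have s3 : 0 < sin (θ' - θ) := sin_pos_of_pos_of_lt_pi (by linarith) (by linarith)
    -- The weights for which the combination of the two points has direction angle `τ`; all sines
    -- are positive because the total angle is less than `π`.
    set lam := 𝒯.rad v y * sin (θ' - τ) with hlam
    set mu := 𝒯.rad v x * sin (τ - θ) with hmu
    have hlam0 : 0 < lam := by positivity
    have hmu0 : 0 < mu := by positivity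
    set Z₀ := lam * 𝒯.ip v x + mu * 𝒯.ip v y with hZ₀
    set Z₁ := 𝒯.rad v x * 𝒯.rad v y * sin (θ' - θ) with hZ₁
    have hZ₀p : 0 < Z₀ := by positivity
    have hZ₁p : 0 < Z₁ := by positivity
    set N := √(Z₀ ^ 2 + Z₁ ^ 2) with hN
    have hNp : 0 < N := by positivity
    have hN2 : N ^ 2 = Z₀ ^ 2 + Z₁ ^ 2 := sq_sqrt (by positivity)
    have hneg := hE.ip_nonpos ht.mem ht.mem_v ht.mem_b ht.vb
    -- The crossing point is nearer to `v` than `π / 2`, while the edge is at least that long, so it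
    -- does not overshoot the edge.
    obtain ⟨z, hz, hz0, hzp, hzq⟩ := ht.swap.exists_edge_point (p := Z₀ / N) (q := Z₁ / N)
      (by field_simp; exact hN2.symm) (by positivity) (by
        have h1 : 0 ≤ Z₁ / N := by positivity
        have h2 : 0 ≤ Z₀ / N * 𝒯.rad v (C.w (i + 1)) := mul_nonneg (by positivity) rad_nonneg
        nlinarith)
    have hzv : z ≠ v := by
      rintro rfl
      have : 𝒯.dirc z (C.w (i + 1)) z = 0 := by
        rw [dirc, ip_self ht.mem ht.mem_v, mul_one, ip_comm ht.mem ht.mem_b ht.mem_v, sub_self,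
          zero_div]
      rw [this] at hzq
      exact (show Z₁ / N ≠ 0 by positivity) hzq.symm
    have hz1 := hnext z hz hz0
    have hpa : 𝒯.pa v (C.w (i + 1)) z = 0 := (ht.swap.pa_eq_zero_iff hz hzv hE).2 hz0
    have hpa' : C.B i + 𝒯.pa v (C.w i) z = τ := by
      have := ht.pa_swap hE hz hzv
      rw [hτ, C.B_succ]; linarith
    have hrz : 𝒯.rad v z = Z₁ / N := by
      have := ht.swap.dirc_eq hz
      rw [hpa, cos_zero, mul_one, hzq] at this
      exact this.symm
    have d1 := dist_le_of_mem_face hI hx hz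
    rw [hpa'] at d1
    have d2 := ih (i + 1) z hz1 hy' (by rw [hzp]; positivity) hzv
      (by rw [hpa, add_zero, ← hτ]; linarith)
    rw [hpa, add_zero] at d2
    refine (dist_triangle x z y).trans ((add_le_add d1 d2).trans_eq ?_)
    symm
    refine InnerProductGeometry.angle_eq_angle_add_add_angle_add_of_mem_span ?_ ?_
    · rw [← norm_ne_zero_iff, norm_pol]; norm_num
    · rw [Submodule.mem_span_pair]
      refine ⟨⟨lam / N, by positivity⟩, ⟨mu / N, by positivity⟩, ?_⟩
      ext j
      fin_cases j
      · change lam / N * 𝒯.ip v x + mu / N * 𝒯.ip v y = 𝒯.ip v z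
        rw [hzp, hZ₀]; ring
      · change lam / N * (𝒯.rad v x * cos θ) + mu / N * (𝒯.rad v y * cos θ') = 𝒯.rad v z * cos τ
        rw [hrz, hZ₁, hlam, hmu, show θ' - θ = (θ' - τ) + (τ - θ) by ring, sin_add (θ' - τ) (τ - θ)]
        have e1 : cos θ = cos τ * cos (τ - θ) + sin τ * sin (τ - θ) := by
          rw [← cos_sub]; ring_nf
        have e2 : cos θ' = cos τ * cos (θ' - τ) - sin τ * sin (θ' - τ) := by
          rw [← cos_add]; ring_nf
        rw [e1, e2]
        ring
      · change lam / N * (𝒯.rad v x * sin θ) + mu / N * (𝒯.rad v y * sin θ') = 𝒯.rad v z * sin τ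
        rw [hrz, hZ₁, hlam, hmu, show θ' - θ = (θ' - τ) + (τ - θ) by ring, sin_add (θ' - τ) (τ - θ)]
        have e1 : sin θ = sin τ * cos (τ - θ) - cos τ * sin (τ - θ) := by
          rw [← sin_sub]; ring_nf
        have e2 : sin θ' = sin τ * cos (θ' - τ) + cos τ * sin (θ' - τ) := by
          rw [← sin_add]; ring_nf
        rw [e1, e2]
        ring

/-- The hinge inequality: two points that are seen from `v` under an angle less than `π` are not
farther apart than on the sphere. -/
theorem Lift.dist_le (hI : 𝒯.IsIntrinsic) (hE : 𝒯.LongEdges) {θ θ' : ℝ} (hx : C.Lift x θ)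
    (hy : C.Lift y θ') (hvx : 0 < 𝒯.ip v x) (hvy : 0 < 𝒯.ip v y) (hxv : x ≠ v) (hyv : y ≠ v)
    (hlt : |θ' - θ| < π) :
    dist x y ≤ arccos (𝒯.ip v x * 𝒯.ip v y + 𝒯.rad v x * 𝒯.rad v y * cos (θ' - θ)) := by
  have key : ∀ {x y : X} {i j : ℤ}, x ∈ 𝒯.cell (C.face i) → y ∈ 𝒯.cell (C.face j) → 0 < 𝒯.ip v x →
      0 < 𝒯.ip v y → x ≠ v → y ≠ v → i ≤ j →
      |(C.B j + 𝒯.pa v (C.w j) y) - (C.B i + 𝒯.pa v (C.w i) x)| < π →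
      dist x y ≤ arccos (𝒯.ip v x * 𝒯.ip v y + 𝒯.rad v x * 𝒯.rad v y *
        cos ((C.B j + 𝒯.pa v (C.w j) y) - (C.B i + 𝒯.pa v (C.w i) x))) := by
    intro x y i j hx hy hvx hvy hxv hyv hij hlt
    have hj : j = i + (j - i).toNat := by omega
    have := dist_le_aux (C := C) hI hE hvy hyv (j - i).toNat i x hx (by rwa [← hj]) hvx hxv
      (by rw [← hj]; linarith [(abs_lt.1 hlt).2])
    rwa [← hj, sphericalDist_eq_arccos (norm_pol _ _ _) (norm_pol _ _ _), inner_pol] at this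
  obtain ⟨i, hi, rfl⟩ := hx
  obtain ⟨j, hj, rfl⟩ := hy
  rcases le_total i j with hij | hij
  · exact key hi hj hvx hvy hxv hyv hij hlt
  · rw [abs_sub_comm] at hlt
    have := key hj hi hvy hvx hyv hxv hij hlt
    rw [dist_comm, ← cos_neg, neg_sub, mul_comm (𝒯.ip v x), mul_comm (𝒯.rad v x)]
    exact this

end LinkCycle

end

end SphericalGluing

namespace SphericalGluing

/-! ### Geodesics near a vertex -/

variable {X : Type*} [MetricSpace X] {𝒯 : SphericalGluing X} {T T' : Finset X} {v w a b u x y : X}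
  {γ : ℝ → X}

/-- The development is a local isometry onto its image in the sphere, so the inner products of the
developed points are `cos (s - s')`, and such a curve is a great circle. -/
theorem IsIntrinsic.eventually_great_circle (hI : 𝒯.IsIntrinsic) (hE : 𝒯.LongEdges)
    (hγ : IsLocalGeodesic γ) {t : ℝ} (ht : 0 < 𝒯.ip v (γ t)) (hne : γ t ≠ v)
    (h : 𝒯.Tri T v u a) (h' : 𝒯.Tri T' v u b) (hab : a ≠ b) (hmem : γ t ∈ 𝒯.edgeStar v u) (m : ℝ) :
    ∃ P Q : E3, inner ℝ P P = (1 : ℝ) ∧ inner ℝ Q Q = (1 : ℝ) ∧ inner ℝ P Q = (0 : ℝ) ∧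
      ∀ᶠ s in 𝓝 t, γ s ∈ 𝒯.edgeStar v u ∧
        𝒯.dev T v u (γ s) = cos (s - m) • P + sin (s - m) • Q := by
  obtain ⟨r, hr, hsub, hdist⟩ := h.eventually_dist_eq h' hab hI hE hmem ht hne
  obtain ⟨ε, hε, hgeo⟩ := hγ t
  have hball : ∀ᶠ s in 𝓝 t, γ s ∈ Metric.ball (γ t) r :=
    hγ.continuous.continuousAt.eventually (Metric.ball_mem_nhds _ hr)
  obtain ⟨δ, hδ, hδs⟩ := Metric.eventually_nhds_iff_ball.1 hball
  set η := min (min δ ε) (π / 2) with hη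
  have hη0 : 0 < η := by positivity
  have hηδ : η ≤ δ := (min_le_left _ _).trans (min_le_left _ _)
  have hηε : η ≤ ε := (min_le_left _ _).trans (min_le_right _ _)
  have hηπ : η ≤ π / 2 := min_le_right _ _
  have hb : ∀ s ∈ Ioo (t - η) (t + η), γ s ∈ Metric.ball (γ t) r := fun s hs => hδs s (by
    rw [Metric.mem_ball, dist_eq, abs_lt]; exact ⟨by linarith [hs.1], by linarith [hs.2]⟩)
  have hin : ∀ s ∈ Ioo (t - η) (t + η), ∀ s' ∈ Ioo (t - η) (t + η),
      inner ℝ (𝒯.dev T v u (γ s)) (𝒯.dev T v u (γ s')) = cos (s - s') := by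
    intro s hs s' hs'
    have h1 := hdist _ (hb s hs) _ (hb s' hs')
    rw [hgeo s ⟨by linarith [hs.1], by linarith [hs.2]⟩ s' ⟨by linarith [hs'.1], by linarith [hs'.2]⟩] at h1
    rw [← cos_sphericalDist (h.norm_dev h' hab (h.mem_or_mem h' hab (hsub (hb s hs))))
      (h.norm_dev h' hab (h.mem_or_mem h' hab (hsub (hb s' hs')))), ← h1, cos_abs]
  obtain ⟨P, Q, h1, h2, h3, h4⟩ := exists_great_circle (X := fun s => 𝒯.dev T v u (γ s))
    (show t - η < t + η by linarith) hin m
  refine ⟨P, Q, h1, h2, h3, ?_⟩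
  filter_upwards [Ioo_mem_nhds (show t - η < t by linarith) (show t < t + η by linarith)] with s hs
  exact ⟨hsub (hb s hs), h4 s hs⟩

theorem LongEdges.exists_face (hE : 𝒯.LongEdges) (h : 0 < 𝒯.ip v x) :
    ∃ T ∈ 𝒯.faces, v ∈ T ∧ x ∈ 𝒯.cell T := by
  obtain ⟨T, hT, hx⟩ := 𝒯.cover x
  exact ⟨T, hT, hE.mem_of_ip_pos hT hx h, hx⟩

theorem IsIntrinsic.eventually_ip_pos (hI : 𝒯.IsIntrinsic) (hE : 𝒯.LongEdges)
    (hγ : IsLocalGeodesic γ) {t : ℝ} (ht : 0 < 𝒯.ip v (γ t)) : ∀ᶠ s in 𝓝 t, 0 < 𝒯.ip v (γ s) := by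
  obtain ⟨T, hT, hv, -⟩ := hE.exists_face ht
  have hc : Continuous fun s => max 0 (𝒯.ip v (γ s)) :=
    (hI.continuous_max_ip hE hT hv).comp hγ.continuous
  have : ∀ᶠ s in 𝓝 t, 0 < max 0 (𝒯.ip v (γ s)) :=
    hc.continuousAt.eventually (lt_mem_nhds (lt_max_of_lt_right ht))
  filter_upwards [this] with s hs
  exact (lt_max_iff.1 hs).resolve_left (lt_irrefl _)

/-- Away from `v` this is the component along `v` of a developed great circle. At `v` itself the
distance to `v` equals the elapsed parameter. -/
theorem IsIntrinsic.eventually_sinusoid (hI : 𝒯.IsIntrinsic) (hE : 𝒯.LongEdges)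
    (hγ : IsLocalGeodesic γ) {t : ℝ} (ht : 0 < 𝒯.ip v (γ t)) :
    ∃ A B : ℝ, ∀ᶠ s in 𝓝 t, 𝒯.ip v (γ s) = A * cos s + B * sin s := by
  by_cases hne : γ t = v
  · obtain ⟨T, hT, hv, -⟩ := hE.exists_face ht
    obtain ⟨ε, hε, hgeo⟩ := hγ t
    refine ⟨cos t, sin t, ?_⟩
    filter_upwards [hI.eventually_ip_pos hE hγ ht,
      Ioo_mem_nhds (show t - ε < t by linarith) (show t < t + ε by linarith)] with s hs hs'
    have h1 := hI.dist_eq_arccos hE hT hv hs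
    have h2 := hgeo t ⟨by linarith, by linarith⟩ s hs'
    rw [hne, h1] at h2
    rw [← cos_arccos (neg_one_le_ip (𝒯 := 𝒯) v (γ s)) (ip_le_one _ _), h2, cos_abs, cos_sub]
  · obtain ⟨u, huv, hu⟩ := hE.exists_mem_edgeStar ht hne
    obtain ⟨T, T', a, b, h, h', hab⟩ := exists_tri_pair hu huv
    obtain ⟨P, Q, -, -, -, hev⟩ := hI.eventually_great_circle hE hγ ht hne h h' hab hu 0
    refine ⟨P 0, Q 0, ?_⟩
    filter_upwards [hev] with s hs
    have := congrArg (fun p : E3 => p 0) hs.2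
    simp only [sub_zero, PiLp.add_apply, PiLp.smul_apply, smul_eq_mul] at this
    change 𝒯.ip v (γ s) = _ at this
    rw [this]; ring

variable (𝒯) in
/-- On the interval of length `π` around `m` the curve `γ` runs in the hemisphere around the vertex
`v`, and the cosine of the distance is `c * cos (s - m)`. -/
structure Arc (γ : ℝ → X) (v : X) (m c : ℝ) : Prop where
  pos : 0 < c
  le_one : c ≤ 1
  eq : ∀ s ∈ Icc (m - π / 2) (m + π / 2), max 0 (𝒯.ip v (γ s)) = c * cos (s - m)

theorem IsIntrinsic.exists_arc (hI : 𝒯.IsIntrinsic) (hE : 𝒯.LongEdges)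
    (hγ : IsLocalGeodesic γ) {t : ℝ} (ht : 0 < 𝒯.ip v (γ t)) :
    ∃ c m, 𝒯.Arc γ v m c ∧ |t - m| < π / 2 := by
  obtain ⟨T, hT, hv, -⟩ := hE.exists_face ht
  have hc : Continuous fun s => max 0 (𝒯.ip v (γ s)) :=
    (hI.continuous_max_ip hE hT hv).comp hγ.continuous
  obtain ⟨c, m, hc0, hm, heq⟩ := exists_bump hc (fun s hs => by
    have hs' : 0 < 𝒯.ip v (γ s) := (lt_max_iff.1 hs).resolve_left (lt_irrefl _)
    obtain ⟨A, B, hAB⟩ := hI.eventually_sinusoid hE hγ hs'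
    refine ⟨A, B, ?_⟩
    filter_upwards [hAB, hI.eventually_ip_pos hE hγ hs'] with r hr hr'
    rw [max_eq_right hr'.le, hr]) (t := t) (lt_max_of_lt_right ht)
  refine ⟨c, m, ⟨hc0, ?_, heq⟩, hm⟩
  have := heq m ⟨by linarith [pi_pos], by linarith [pi_pos]⟩
  rw [sub_self, cos_zero, mul_one] at this
  rw [← this]
  exact max_le zero_le_one (ip_le_one _ _)

namespace Arc

variable {m c : ℝ} (hA : 𝒯.Arc γ v m c)
include hA

theorem ip_eq {s : ℝ} (hs : s ∈ Ioo (m - π / 2) (m + π / 2)) : 𝒯.ip v (γ s) = c * cos (s - m) := by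
  have h1 := hA.eq s ⟨hs.1.le, hs.2.le⟩
  have h2 : 0 < c * cos (s - m) :=
    mul_pos hA.pos (cos_pos_of_mem_Ioo ⟨by linarith [hs.1], by linarith [hs.2]⟩)
  rw [← h1] at h2 ⊢
  exact (max_eq_right ((lt_max_iff.1 h2).resolve_left (lt_irrefl _)).le).symm

theorem ip_pos {s : ℝ} (hs : s ∈ Ioo (m - π / 2) (m + π / 2)) : 0 < 𝒯.ip v (γ s) := by
  rw [hA.ip_eq hs]
  exact mul_pos hA.pos (cos_pos_of_mem_Ioo ⟨by linarith [hs.1], by linarith [hs.2]⟩)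

theorem rad_eq {s : ℝ} (hs : s ∈ Ioo (m - π / 2) (m + π / 2)) :
    𝒯.rad v (γ s) = √(1 - (c * cos (s - m)) ^ 2) := by
  rw [rad, hA.ip_eq hs]

theorem ne_of_lt {s : ℝ} (hs : s ∈ Ioo (m - π / 2) (m + π / 2)) (hE : 𝒯.LongEdges)
    (h : c < 1 ∨ s ≠ m) : γ s ≠ v := by
  intro he
  obtain ⟨T, hT, hv, -⟩ := hE.exists_face (hA.ip_pos hs)
  have h1 := hA.ip_eq hs
  rw [he, ip_self hT hv] at h1
  have h2 := cos_le_one (s - m)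
  have h3 := hA.pos
  have h4 := hA.le_one
  have h5 : c = 1 := le_antisymm h4 (by nlinarith)
  rcases h with h | h
  · exact h.ne h5
  · rw [h5, one_mul] at h1
    have := eq_zero_of_cos_eq_one (x := s - m) (by
      rw [abs_lt]; constructor <;> linarith [hs.1, hs.2, pi_pos]) h1.symm
    exact h (sub_eq_zero.1 this)

theorem shift {L : ℝ} (hL : Function.Periodic γ L) (n : ℤ) : 𝒯.Arc γ v (m + n * L) c := by
  refine ⟨hA.pos, hA.le_one, fun s hs => ?_⟩
  have := hA.eq (s - n * L) ⟨by linarith [hs.1], by linarith [hs.2]⟩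
  rw [show s - n * L - m = s - (m + n * L) by ring] at this
  rw [← this, hL.sub_int_mul_eq]

/-- Locally an arc is described by `sweep`. -/
theorem eventually_lift (hI : 𝒯.IsIntrinsic) (hE : 𝒯.LongEdges) (hγ : IsLocalGeodesic γ)
    (C : 𝒯.LinkCycle v) {s₀ θ₀ : ℝ} (hs₀ : s₀ ∈ Ioo (m - π / 2) (m + π / 2)) (hne : γ s₀ ≠ v)
    (hθ₀ : C.Lift (γ s₀) θ₀) : ∃ ε : ℝ, (ε = 1 ∨ ε = -1) ∧ ∀ᶠ s in 𝓝 s₀, C.Lift (γ s)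
      (θ₀ + ε * (sweep √(1 - c ^ 2) (s - m) - sweep √(1 - c ^ 2) (s₀ - m))) := by
  have hpos := hA.ip_pos hs₀
  obtain ⟨u, huv, hu⟩ := hE.exists_mem_edgeStar hpos hne
  obtain ⟨i, rfl, hpa, hge, hle⟩ := hθ₀.edge hE hne huv
    fun i hi => (hu _ (C.tri_face i).mem hi).2
  have h := C.tri_face i
  have h' := C.tri_face_sub_one i
  have hab : C.w (i + 1) ≠ C.w (i - 1) := by
    have := C.ne (i - 1); rw [show i - 1 + 2 = i + 1 by ring] at this; exact this.symm
  obtain ⟨P, Q, hPP, hQQ, hPQ, hev⟩ := hI.eventually_great_circle hE hγ hpos hne h h' hab hu m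
  rw [inner_e3] at hPP hQQ hPQ
  have hIoo : ∀ᶠ s in 𝓝 s₀, s ∈ Ioo (m - π / 2) (m + π / 2) := Ioo_mem_nhds hs₀.1 hs₀.2
  have hP0 : P 0 - c = 0 ∧ Q 0 = 0 := by
    apply eq_zero_of_sinusoid_eventually_zero (m := m) (t := s₀)
    filter_upwards [hev, hIoo] with s hs hs'
    have e1 := congrArg (fun p : E3 => p 0) hs.2
    simp only [PiLp.add_apply, PiLp.smul_apply, smul_eq_mul] at e1
    change 𝒯.ip v (γ s) = _ at e1
    rw [hA.ip_eq hs'] at e1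
    linarith
  have hP0' : P 0 = c := by linarith [hP0.1]
  rw [hP0.2] at hQQ hPQ
  rw [hP0'] at hPP
  set σ := √(1 - c ^ 2) with hσ
  have hσ2 : σ ^ 2 = 1 - c ^ 2 := sq_sqrt (by nlinarith [hA.pos, hA.le_one])
  -- The signed angle from the edge `v w i`, positive on the side of `face i`; adding `C.B i` makes
  -- it a lift on both sides.
  set φ : ℝ → ℝ := fun s => if γ s ∈ 𝒯.cell (C.face i) then 𝒯.pa v (C.w i) (γ s)
    else - 𝒯.pa v (C.w i) (γ s) with hφ
  have hnev : ∀ᶠ s in 𝓝 s₀, γ s ≠ v := hγ.continuous.continuousAt.eventually_ne hne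
  have hφ₀ : φ s₀ = θ₀ - C.B i := by
    rcases le_or_gt (C.B i) θ₀ with hc | hc
    · simp only [hφ, if_pos (hge hc)]
      rw [← hpa, abs_of_nonneg (by linarith)]
    · by_cases hm : γ s₀ ∈ 𝒯.cell (C.face i)
      · have h0 := h.ht_eq_zero_of_mem h' hab hm (hle hc.le)
        rw [h.ht_eq hm] at h0
        have h1 := (mul_eq_zero.1 h0).resolve_left (h.rad_pos hm hne).ne'
        have h2 : 𝒯.pa v (C.w i) (γ s₀) = 0 := by
          by_contra h3
          exact (sin_pos_of_pos_of_lt_pi (lt_of_le_of_ne pa_nonneg (Ne.symm h3))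
            (h.pa_lt_pi hE hm hne)).ne' h1
        rw [h2, abs_eq_zero] at hpa
        linarith
      · simp only [hφ, if_neg hm]
        rw [← hpa, abs_of_neg (by linarith)]; ring
  have hlift : ∀ᶠ s in 𝓝 s₀, C.Lift (γ s) (C.B i + φ s) := by
    filter_upwards [hev, hnev] with s hs hs'
    by_cases hm : γ s ∈ 𝒯.cell (C.face i)
    · exact ⟨i, hm, by simp only [hφ, if_pos hm]⟩
    · have hm' := (h.mem_or_mem h' hab hs.1).resolve_left hm
      refine ⟨i - 1, hm', ?_⟩
      have e := h'.pa_swap hE hm' hs'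
      have e2 := C.B_succ (i - 1)
      rw [sub_add_cancel] at e2
      simp only [hφ, if_neg hm]
      rw [e2, e, ← h'.angle_comm hE]
      ring
  obtain ⟨ε, hε, hsw⟩ := eventually_angle_eq_sweep (c := c) (σ := σ) (m := m) (s₀ := s₀) (p₁ := P 1)
    (p₂ := P 2) (q₁ := Q 1) (q₂ := Q 2) (φ := φ) (by rw [hσ2]; ring) (sqrt_nonneg _)
    (by rw [abs_lt]; constructor <;> linarith [hs₀.1, hs₀.2])
    (by
      rw [← sqrt_pos, ← hA.rad_eq hs₀]
      rcases h.mem_or_mem h' hab hu with hm | hm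
      · exact h.rad_pos hm hne
      · exact h'.rad_pos hm hne)
    (by linarith) (by linarith) (by rw [hσ2]; linarith)
    (by
      filter_upwards [hev, hnev] with s hs hs'
      have h0 := pa_nonneg (𝒯 := 𝒯) (v := v) (a := C.w i) (x := γ s)
      by_cases hm : γ s ∈ 𝒯.cell (C.face i)
      · have := h.pa_lt_pi hE hm hs'
        simp only [hφ, if_pos hm]
        exact ⟨by linarith [pi_pos], this⟩
      · have := h'.pa_lt_pi hE ((h.mem_or_mem h' hab hs.1).resolve_left hm) hs'
        simp only [hφ, if_neg hm]
        exact ⟨by linarith, by linarith [pi_pos]⟩)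
    (by
      filter_upwards [hev, hIoo] with s hs hs'
      have e1 := congrArg (fun p : E3 => p 1) hs.2
      simp only [PiLp.add_apply, PiLp.smul_apply, smul_eq_mul] at e1
      change 𝒯.dirc v (C.w i) (γ s) = _ at e1
      rw [← e1, ← hA.rad_eq hs']
      by_cases hm : γ s ∈ 𝒯.cell (C.face i)
      · simp only [hφ, if_pos hm]
        rw [h.dirc_eq hm]
      · simp only [hφ, if_neg hm]
        rw [cos_neg, h'.dirc_eq ((h.mem_or_mem h' hab hs.1).resolve_left hm)])
    (by
      filter_upwards [hev, hIoo] with s hs hs'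
      have e1 := congrArg (fun p : E3 => p 2) hs.2
      simp only [PiLp.add_apply, PiLp.smul_apply, smul_eq_mul] at e1
      change (if γ s ∈ 𝒯.cell (C.face i) then 𝒯.ht v (C.w i) (γ s) else - 𝒯.ht v (C.w i) (γ s)) = _ at e1
      rw [← e1, ← hA.rad_eq hs']
      by_cases hm : γ s ∈ 𝒯.cell (C.face i)
      · simp only [hφ, if_pos hm]
        rw [h.ht_eq hm]
      · simp only [hφ, if_neg hm]
        rw [sin_neg, h'.ht_eq ((h.mem_or_mem h' hab hs.1).resolve_left hm)]
        ring)
  refine ⟨ε, hε, ?_⟩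
  filter_upwards [hlift, hsw] with s hs hs'
  rw [hs', hφ₀] at hs
  convert hs using 1
  ring

end Arc

end SphericalGluing

/-! ### Direction angles along a whole arc -/

namespace SphericalGluing

variable {X : Type*} [MetricSpace X] {𝒯 : SphericalGluing X} {T T' : Finset X} {v w a b u x y : X}
  {γ : ℝ → X}

namespace Arc

variable {m c : ℝ}

/-- The local descriptions by `sweep` fit together: on overlaps two of them differ by a multiple of
the total angle, which is locally constant by continuity, and the interval is connected. -/
theorem exists_lift_on (hA : 𝒯.Arc γ v m c) (hI : 𝒯.IsIntrinsic) (hE : 𝒯.LongEdges)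
    (hγ : IsLocalGeodesic γ) (C : 𝒯.LinkCycle v) {l r : ℝ} (hlr : l < r) (hl : m - π / 2 ≤ l)
    (hr : r ≤ m + π / 2) (hne : ∀ s ∈ Ioo l r, γ s ≠ v) :
    ∃ θ ε : ℝ, (ε = 1 ∨ ε = -1) ∧ ∀ s ∈ Ioo l r,
      C.Lift (γ s) (θ + ε * sweep √(1 - c ^ 2) (s - m)) := by
  have hsub : ∀ s ∈ Ioo l r, s ∈ Ioo (m - π / 2) (m + π / 2) := fun s hs =>
    ⟨hl.trans_lt hs.1, hs.2.trans_le hr⟩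
  have hlift : ∀ s ∈ Ioo l r, ∃ θ, C.Lift (γ s) θ := fun s hs => by
    obtain ⟨T, hT, hv, hx⟩ := hE.exists_face (hA.ip_pos (hsub s hs))
    exact C.exists_lift hT hv hx
  set σ := √(1 - c ^ 2) with hσ
  obtain ⟨s₀, hs₀⟩ := nonempty_Ioo.2 hlr
  obtain ⟨θ₀, hθ₀⟩ := hlift s₀ hs₀
  obtain ⟨ε, hε, hev⟩ := hA.eventually_lift hI hE hγ C (hsub s₀ hs₀) (hne s₀ hs₀) hθ₀
  refine ⟨θ₀ - ε * sweep σ (s₀ - m), ε, hε, ?_⟩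
  set θ := θ₀ - ε * sweep σ (s₀ - m) with hθ
  set S : Set ℝ := {s | ∀ᶠ s' in 𝓝 s, C.Lift (γ s') (θ + ε * sweep σ (s' - m))} with hS
  have hSo : IsOpen S := by
    rw [isOpen_iff_mem_nhds]
    exact fun s hs => eventually_eventually_nhds.2 hs
  have hs₀S : s₀ ∈ S := by
    filter_upwards [hev] with s hs
    convert hs using 1
    rw [hθ]; ring
  suffices hsubS : Ioo l r ⊆ S from fun s hs => (hsubS hs).self_of_nhds
  refine isPreconnected_Ioo.subset_of_closure_inter_subset hSo ⟨s₀, hs₀, hs₀S⟩ ?_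
  rintro s ⟨hcl, hs⟩
  obtain ⟨θ₁, hθ₁⟩ := hlift s hs
  obtain ⟨ε₁, hε₁, hev₁⟩ := hA.eventually_lift hI hE hγ C (hsub s hs) (hne s hs) hθ₁
  obtain ⟨U, hU, hUo, hsU⟩ := eventually_nhds_iff.1 (hev₁.and (Ioo_mem_nhds hs.1 hs.2))
  obtain ⟨q, hqU, hqS⟩ := mem_closure_iff.1 hcl U hUo hsU
  have hqI := (hU q hqU).2
  set g : ℝ → ℝ := fun s' => (θ₁ - ε₁ * sweep σ (s - m) - θ) + (ε₁ - ε) * sweep σ (s' - m) with hg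
  have hΘ := C.total_pos hE
  have hgn : ∀ᶠ s' in 𝓝 q, ∃ n : ℤ, g s' = n * C.total := by
    have hqS' : ∀ᶠ s' in 𝓝 q, C.Lift (γ s') (θ + ε * sweep σ (s' - m)) := hqS
    filter_upwards [hqS', hUo.mem_nhds hqU] with s' h1 h2
    obtain ⟨n, hn⟩ := h1.unique hE (hU s' h2).1 (hne s' (hU s' h2).2)
    refine ⟨n, ?_⟩
    simp only [hg]
    linarith
  have hswc : ContinuousAt (fun s' => sweep σ (s' - m)) q := by
    refine ContinuousAt.comp (f := fun s => s - m) (continuousAt_sweep ?_) (by fun_prop)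
    have := hsub q hqI
    rw [abs_lt]; exact ⟨by linarith [this.1], by linarith [this.2]⟩
  have hgc : ContinuousAt (fun s' => |g s' - g q|) q := by
    simp only [hg]
    fun_prop
  have hgs : ∀ᶠ s' in 𝓝 q, |g s' - g q| < C.total := by
    apply hgc.eventually (gt_mem_nhds _)
    simpa using hΘ
  obtain ⟨n, hn⟩ := hgn.self_of_nhds
  have hconst : ∀ᶠ s' in 𝓝 q, g s' = g q := by
    filter_upwards [hgn, hgs] with s' ⟨n', hn'⟩ h2
    rw [hn', hn, ← sub_mul, abs_mul, abs_of_pos hΘ, mul_lt_iff_lt_one_left hΘ, ← Int.cast_sub,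
      ← Int.cast_abs, ← Int.cast_one, Int.cast_lt, Int.abs_lt_one_iff, sub_eq_zero] at h2
    rw [hn', hn, h2]
  -- Only `(ε₁ - ε) * sweep` could vary. For `σ > 0` the sweep is strictly increasing, so the signs
  -- agree; for `σ = 0` it is identically zero.
  have hall : ∀ s' ∈ U, (ε₁ - ε) * sweep σ (s' - m) = (ε₁ - ε) * sweep σ (q - m) := by
    rcases (sqrt_nonneg _ : 0 ≤ σ).eq_or_lt with h0 | h0
    · have hsw : ∀ x, sweep σ x = 0 := fun x => by
        change arctan (tan x / σ) = 0
        rw [show σ = 0 from h0.symm, div_zero, arctan_zero]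
      intro s' _; rw [hsw, hsw]
    · have hee : ε₁ - ε = 0 := by
        obtain ⟨δ, hδ, hδs⟩ := Metric.eventually_nhds_iff_ball.1 (hconst.and
          (Ioo_mem_nhds hqI.1 hqI.2))
        obtain ⟨h1, h2⟩ := hδs (q + δ / 2) (by
          rw [Metric.mem_ball, dist_eq, add_sub_cancel_left, abs_of_pos (by linarith)]; linarith)
        have hlt : sweep σ (q - m) < sweep σ (q + δ / 2 - m) := by
          have a1 := hsub _ hqI
          have a2 := hsub _ h2
          apply sweep_strictMono h0 <;> first | (rw [abs_lt]; constructor <;> linarith [a1.1, a1.2, a2.1, a2.2]) | linarith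
        have h3 : (ε₁ - ε) * (sweep σ (q + δ / 2 - m) - sweep σ (q - m)) = 0 := by
          simp only [hg] at h1; linarith
        exact (mul_eq_zero.1 h3).resolve_right (by linarith)
      intro s' _; rw [hee, zero_mul, zero_mul]
  filter_upwards [hUo.mem_nhds hsU] with s' hs'
  have := (hU s' hs').1.add (-n)
  convert this using 1
  have h1 := hall s' hs'
  have h2 : θ₁ - ε₁ * sweep σ (s - m) - θ + (ε₁ - ε) * sweep σ (q - m) = n * C.total := hn
  push_cast
  linarith

/-- A geodesic through a vertex makes an angle of at least `π` there. -/
theorem pi_le_of_through (hA : 𝒯.Arc γ v m 1) (hI : 𝒯.IsIntrinsic) (hE : 𝒯.LongEdges)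
    (hγ : IsLocalGeodesic γ) (C : 𝒯.LinkCycle v) {θ₁ θ₂ : ℝ}
    (h₁ : ∀ s ∈ Ioo (m - π / 2) m, C.Lift (γ s) θ₁) (h₂ : ∀ s ∈ Ioo m (m + π / 2), C.Lift (γ s) θ₂) :
    π ≤ |θ₂ - θ₁| := by
  by_contra! hlt
  obtain ⟨ε, hε, hgeo⟩ := hγ m
  set δ := min (ε / 2) (π / 4) with hδ
  have hδ0 : 0 < δ := by positivity
  have hδε : δ < ε := lt_of_le_of_lt (min_le_left _ _) (by linarith)
  have hδπ : δ ≤ π / 4 := min_le_right _ _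
  have hpi := pi_pos
  have m1 : m - δ ∈ Ioo (m - π / 2) (m + π / 2) := ⟨by linarith, by linarith⟩
  have m2 : m + δ ∈ Ioo (m - π / 2) (m + π / 2) := ⟨by linarith, by linarith⟩
  have i1 := hA.ip_eq m1
  have i2 := hA.ip_eq m2
  have r1 := hA.rad_eq m1
  have r2 := hA.rad_eq m2
  rw [sub_sub_cancel_left, cos_neg, one_mul] at i1 r1
  rw [add_sub_cancel_left, one_mul] at i2 r2
  have hs : 0 < sin δ := sin_pos_of_pos_of_lt_pi hδ0 (by linarith)
  have hsr : √(1 - cos δ ^ 2) = sin δ := by rw [← sin_sq, sqrt_sq hs.le]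
  rw [hsr] at r1 r2
  -- Points at distance `δ` before and after the vertex have distance `2 δ` along the geodesic;
  -- under an angle less than `π` the hinge inequality makes them strictly closer.
  have hd := (h₁ (m - δ) ⟨by linarith, by linarith⟩).dist_le hI hE (h₂ (m + δ) ⟨by linarith, by linarith⟩)
    (hA.ip_pos m1) (hA.ip_pos m2) (hA.ne_of_lt m1 hE (Or.inr (by linarith)))
    (hA.ne_of_lt m2 hE (Or.inr (by linarith))) hlt
  rw [hgeo (m - δ) ⟨by linarith, by linarith⟩ (m + δ) ⟨by linarith, by linarith⟩, i1, i2, r1, r2,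
    show m - δ - (m + δ) = -(2 * δ) by ring, abs_neg, abs_of_pos (by linarith)] at hd
  have hcos : -1 < cos (θ₂ - θ₁) := by
    rw [← cos_abs, ← cos_pi]
    exact cos_lt_cos_of_nonneg_of_le_pi (abs_nonneg _) le_rfl hlt
  have h3 : cos (2 * δ) < cos δ * cos δ + sin δ * sin δ * cos (θ₂ - θ₁) := by
    rw [cos_two_mul]
    have := mul_pos hs hs
    nlinarith [sin_sq_add_cos_sq δ]
  have h4 : arccos (cos δ * cos δ + sin δ * sin δ * cos (θ₂ - θ₁)) < arccos (cos (2 * δ)) := by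
    refine arccos_lt_arccos (neg_one_le_cos _) h3 ?_
    nlinarith [sin_sq_add_cos_sq δ, cos_le_one (θ₂ - θ₁), mul_pos hs hs]
  rw [arccos_cos (by linarith) (by linarith)] at h4
  linarith

/-- The direction angles along an arc. -/
theorem exists_lifts (hA : 𝒯.Arc γ v m c) (hI : 𝒯.IsIntrinsic) (hE : 𝒯.LongEdges)
    (hγ : IsLocalGeodesic γ) (C : 𝒯.LinkCycle v) : ∃ θ₁ θ₂ ε : ℝ, (ε = 1 ∨ ε = -1) ∧
      (∀ s ∈ Ioo (m - π / 2) m, C.Lift (γ s) (θ₁ + ε * sweep √(1 - c ^ 2) (s - m))) ∧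
      (∀ s ∈ Ioo m (m + π / 2), C.Lift (γ s) (θ₂ + ε * sweep √(1 - c ^ 2) (s - m))) ∧
      (c < 1 → θ₁ = θ₂) ∧ (c = 1 → ∀ n : ℤ, π ≤ |θ₂ - θ₁ + n * C.total|) := by
  have hpi := pi_pos
  rcases hA.le_one.lt_or_eq with hc | hc
  · obtain ⟨θ, ε, hε, h⟩ := hA.exists_lift_on hI hE hγ C (l := m - π / 2) (r := m + π / 2)
      (by linarith) le_rfl le_rfl fun s hs => hA.ne_of_lt hs hE (Or.inl hc)
    exact ⟨θ, θ, ε, hε, fun s hs => h s ⟨hs.1, by linarith [hs.2]⟩,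
      fun s hs => h s ⟨by linarith [hs.1], hs.2⟩, fun _ => rfl, fun h => absurd h hc.ne⟩
  · subst hc
    obtain ⟨θ₁, ε₁, hε₁, h₁⟩ := hA.exists_lift_on hI hE hγ C (l := m - π / 2) (r := m)
      (by linarith) le_rfl (by linarith) fun s hs =>
        hA.ne_of_lt ⟨hs.1, by linarith [hs.2]⟩ hE (Or.inr hs.2.ne)
    obtain ⟨θ₂, ε₂, hε₂, h₂⟩ := hA.exists_lift_on hI hE hγ C (l := m) (r := m + π / 2)
      (by linarith) (by linarith) le_rfl fun s hs =>
        hA.ne_of_lt ⟨by linarith [hs.1], hs.2⟩ hE (Or.inr hs.1.ne')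
    -- Through the vertex itself `σ = 0` and the direction is constant on each side, so the two
    -- sides have unrelated lifts, and the sign may be taken to be `1`.
    have hsw : ∀ x, sweep √(1 - (1 : ℝ) ^ 2) x = 0 := fun x => by simp [sweep]
    simp only [hsw, mul_zero, add_zero] at h₁ h₂ ⊢
    refine ⟨θ₁, θ₂, 1, Or.inl rfl, h₁, h₂, fun h => absurd h (lt_irrefl _), fun _ n => ?_⟩
    have := hA.pi_le_of_through hI hE hγ C h₁ fun s hs => (h₂ s hs).add n
    rwa [show θ₂ + n * C.total - θ₁ = θ₂ - θ₁ + n * C.total by ring] at this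

end Arc

end SphericalGluing

/-! ### Passing from the star of a vertex into the star of the next -/

theorem eq_zero_of_sinusoid_on_Ioo {A B m l r : ℝ} (hlr : l < r)
    (h : ∀ s ∈ Ioo l r, A * cos (s - m) + B * sin (s - m) = 0) : A = 0 ∧ B = 0 := by
  obtain ⟨t, ht⟩ := nonempty_Ioo.2 hlr
  exact eq_zero_of_sinusoid_eventually_zero (m := m) (t := t)
    (by filter_upwards [Ioo_mem_nhds ht.1 ht.2] with s hs using h s hs)

theorem mem_Ioo_of_sin_pos {a : ℝ} (ha : |a| < π) (h : 0 < sin a) : a ∈ Ioo 0 π := by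
  rw [abs_lt] at ha
  refine ⟨?_, ha.2⟩
  by_contra! h0
  exact absurd h (not_lt.2 (sin_nonpos_of_nonpos_of_neg_pi_le h0 ha.1.le))

namespace SphericalGluing

variable {X : Type*} {𝒯 : SphericalGluing X} {T T' : Finset X} {v w a b u x y : X}

variable (𝒯) in
/-- The length of the edge `v w`. -/
noncomputable def len (v w : X) : ℝ := arccos (𝒯.ip v w)

theorem cos_len (v w : X) : cos (𝒯.len v w) = 𝒯.ip v w :=
  cos_arccos (neg_one_le_ip _ _) (ip_le_one _ _)

theorem sin_len (v w : X) : sin (𝒯.len v w) = 𝒯.rad v w := sin_arccos _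

variable (𝒯) in
/-- The sine of the signed distance of a point to the edge `v w` of the face `T`. -/
noncomputable def nu (T : Finset X) (v w x : X) : ℝ :=
  if x ∈ 𝒯.cell T then 𝒯.ht v w x else - 𝒯.ht v w x

theorem LinkCycle.face_add_mul_period (C : 𝒯.LinkCycle v) (i n : ℤ) :
    C.face (i + n * C.k) = C.face i := by
  rw [face, face, show i + n * (C.k : ℤ) + 1 = (i + 1) + n * C.k by ring, C.w_add_mul_period,
    C.w_add_mul_period]

theorem LinkCycle.exists_period (C : 𝒯.LinkCycle v) {i j : ℤ} (h : C.w i = C.w j) :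
    ∃ n : ℤ, C.B i = C.B j + n * C.total ∧ C.face i = C.face j ∧ C.face (i - 1) = C.face (j - 1) := by
  obtain ⟨n, hn⟩ := C.dvd_of_eq i j h
  have hi : i = j + n * C.k := by linarith
  refine ⟨n, ?_, ?_, ?_⟩
  · rw [hi, C.B_add_mul_period]
  · rw [hi, C.face_add_mul_period]
  · rw [hi, show j + n * (C.k : ℤ) - 1 = (j - 1) + n * C.k by ring, C.face_add_mul_period]

theorem LinkCycle.nu_face_sub_one (C : 𝒯.LinkCycle v) (hE : 𝒯.LongEdges) {i : ℤ} {θ : ℝ} (hxv : x ≠ v)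
    (hpa : |θ - C.B i| = 𝒯.pa v (C.w i) x) (hlt : |θ - C.B i| < π / 2)
    (hge : C.B i ≤ θ → x ∈ 𝒯.cell (C.face i)) (hle : θ ≤ C.B i → x ∈ 𝒯.cell (C.face (i - 1))) :
    𝒯.nu (C.face (i - 1)) v (C.w i) x = 𝒯.rad v x * sin (C.B i - θ) := by
  have h := C.tri_face i
  have h' := C.tri_face_sub_one i
  rcases le_or_gt θ (C.B i) with hc | hc
  · rw [nu, if_pos (hle hc), h'.ht_eq (hle hc), ← hpa, abs_of_nonpos (by linarith), neg_sub]
  · have hm := hge hc.le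
    rw [abs_of_pos (by linarith)] at hpa hlt
    have hs : 0 < sin (𝒯.pa v (C.w i) x) := sin_pos_of_pos_of_lt_pi (by linarith) (by linarith [pi_pos])
    rw [nu, if_neg, h.ht_eq hm, ← hpa, ← neg_sub θ, sin_neg, mul_neg]
    intro hm'
    have hab : C.w (i + 1) ≠ C.w (i - 1) := by
      have := C.ne (i - 1); rw [show i - 1 + 2 = i + 1 by ring] at this; exact this.symm
    have h0 := h.ht_eq_zero_of_mem h' hab hm hm'
    rw [h.ht_eq hm] at h0
    exact (mul_pos (h.rad_pos hm hxv) hs).ne' h0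

theorem LinkCycle.nu_face (C : 𝒯.LinkCycle v) (hE : 𝒯.LongEdges) {i : ℤ} {θ : ℝ} (hxv : x ≠ v)
    (hpa : |θ - C.B i| = 𝒯.pa v (C.w i) x) (hlt : |θ - C.B i| < π / 2)
    (hge : C.B i ≤ θ → x ∈ 𝒯.cell (C.face i)) (hle : θ ≤ C.B i → x ∈ 𝒯.cell (C.face (i - 1))) :
    𝒯.nu (C.face i) v (C.w i) x = 𝒯.rad v x * sin (θ - C.B i) := by
  have h := C.tri_face i
  have h' := C.tri_face_sub_one i
  rcases le_or_gt (C.B i) θ with hc | hc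
  · rw [nu, if_pos (hge hc), h.ht_eq (hge hc), ← hpa, abs_of_nonneg (by linarith)]
  · have hm := hle hc.le
    rw [abs_of_neg (by linarith)] at hpa hlt
    have hs : 0 < sin (𝒯.pa v (C.w i) x) := sin_pos_of_pos_of_lt_pi (by linarith) (by linarith [pi_pos])
    rw [nu, if_neg, h'.ht_eq hm, ← hpa, sin_neg, mul_neg, neg_neg]
    intro hm'
    have hab : C.w (i + 1) ≠ C.w (i - 1) := by
      have := C.ne (i - 1); rw [show i - 1 + 2 = i + 1 by ring] at this; exact this.symm
    have h0 := h.ht_eq_zero_of_mem h' hab hm' hm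
    rw [h'.ht_eq hm] at h0
    exact (mul_pos (h'.rad_pos hm hxv) hs).ne' h0

/-- A piece of an arc that runs in the open stars of two adjacent vertices. -/
theorem LinkCycle.junction (C : 𝒯.LinkCycle v) (hE : 𝒯.LongEdges) (hΘ : 2 * π < C.total) {γ : ℝ → X}
    {J : Set ℝ} (hJ : J.Nonempty) {θ₀ ε σ m : ℝ} (hε : ε = 1 ∨ ε = -1) (hwv : w ≠ v)
    (hlift : ∀ s ∈ J, C.Lift (γ s) (θ₀ + ε * sweep σ (s - m))) (hv : ∀ s ∈ J, 0 < 𝒯.ip v (γ s))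
    (hne : ∀ s ∈ J, γ s ≠ v) (hw : ∀ s ∈ J, 0 < 𝒯.ip w (γ s)) :
    (∃ T ∈ 𝒯.faces, v ∈ T ∧ w ∈ T) ∧ ∃ i, C.w i = w ∧ ∀ s ∈ J, |θ₀ + ε * sweep σ (s - m) - C.B i| < π / 2 ∧
      𝒯.ip w (γ s) = 𝒯.ip v w * 𝒯.ip v (γ s) +
        𝒯.rad v w * 𝒯.rad v (γ s) * cos (θ₀ + ε * sweep σ (s - m) - C.B i) ∧
      𝒯.nu (C.face (i - 1)) v w (γ s) = 𝒯.rad v (γ s) * sin (C.B i - (θ₀ + ε * sweep σ (s - m))) ∧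
      𝒯.nu (C.face i) v w (γ s) = 𝒯.rad v (γ s) * sin (θ₀ + ε * sweep σ (s - m) - C.B i) := by
  have hmem : ∀ s ∈ J, γ s ∈ 𝒯.edgeStar v w := fun s hs => hE.mem_edgeStar (hv s hs) (hw s hs)
  have key : ∀ s ∈ J, ∃ i, C.w i = w ∧ |θ₀ + ε * sweep σ (s - m) - C.B i| < π / 2 ∧
      |θ₀ + ε * sweep σ (s - m) - C.B i| = 𝒯.pa v w (γ s) ∧
      (C.B i ≤ θ₀ + ε * sweep σ (s - m) → γ s ∈ 𝒯.cell (C.face i)) ∧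
      (θ₀ + ε * sweep σ (s - m) ≤ C.B i → γ s ∈ 𝒯.cell (C.face (i - 1))) := by
    intro s hs
    obtain ⟨i, hi, hpa, hge, hle⟩ := (hlift s hs).edge hE (hne s hs) hwv
      fun i hi => (hmem s hs _ (C.tri_face i).mem hi).2
    refine ⟨i, hi, ?_, hpa, hge, hle⟩
    rw [hpa]
    obtain ⟨S, hS, hxS⟩ := 𝒯.cover (γ s)
    obtain ⟨h1, h2⟩ := hmem s hs S hS hxS
    obtain ⟨b, hb⟩ := exists_tri_of_mem_of_mem hS h1 h2 hwv.symm
    have h3 := hb.ip_a_eq_cos hxS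
    have h4 := hE.ip_nonpos hS h1 h2 hwv.symm
    have h5 := hv s hs
    have h6 := hw s hs
    have h7 : 0 < 𝒯.rad v w * 𝒯.rad v (γ s) * cos (𝒯.pa v w (γ s)) := by nlinarith
    have h8 : 0 < cos (𝒯.pa v w (γ s)) :=
      pos_of_mul_pos_right h7 (mul_nonneg rad_nonneg rad_nonneg)
    by_contra! h9
    exact absurd h8 (not_lt.2 (cos_nonpos_of_pi_div_two_le_of_le h9 (by
      linarith [pa_le_pi (𝒯 := 𝒯) (v := v) (a := w) (x := γ s), pi_pos])))
  obtain ⟨s₀, hs₀⟩ := hJ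
  obtain ⟨i, hi, hi1, -⟩ := key s₀ hs₀
  refine ⟨?_, i, hi, fun s hs => ?_⟩
  · obtain ⟨S, hS, hxS⟩ := 𝒯.cover (γ s₀)
    exact ⟨S, hS, hmem s₀ hs₀ S hS hxS⟩
  obtain ⟨j, hj, hlt, hpa, hge, hle⟩ := key s hs
  obtain ⟨n, hn, hface, hface'⟩ := C.exists_period (hi.trans hj.symm)
  -- The direction changes by less than `π` along the arc and stays within `π / 2` of the edge, so
  -- the two values of `B` differ by less than `2π`, hence by less than the total angle: the same
  -- copy of the edge is met throughout.
  have hB : C.B i = C.B j := by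
    have h1 := sweep_mem σ (s - m)
    have h2 := sweep_mem σ (s₀ - m)
    rw [abs_lt] at hi1 hlt
    have h3 : |(n : ℝ) * C.total| < C.total := by
      rw [show (n : ℝ) * C.total = C.B i - C.B j by linarith, abs_lt]
      rcases hε with h | h <;> rw [h] at hi1 hlt <;>
        constructor <;> linarith [h1.1, h1.2, h2.1, h2.2, hi1.1, hi1.2, hlt.1, hlt.2]
    have hpos := C.total_pos hE
    rw [abs_mul, abs_of_pos hpos, mul_lt_iff_lt_one_left hpos, ← Int.cast_abs, ← Int.cast_one,
      Int.cast_lt, Int.abs_lt_one_iff] at h3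
    rw [hn, h3]; simp
  have hxv := hne s hs
  rw [hB, hface, hface']
  obtain ⟨S, hS, hxS⟩ := 𝒯.cover (γ s)
  obtain ⟨h1, h2⟩ := hmem s hs S hS hxS
  obtain ⟨b, hb⟩ := exists_tri_of_mem_of_mem hS h1 h2 hwv.symm
  subst hj
  refine ⟨hlt, ?_, C.nu_face_sub_one hE hxv hpa hlt hge hle, C.nu_face hE hxv hpa hlt hge hle⟩
  rw [← cos_abs, hpa]
  exact hb.ip_a_eq_cos hxS

end SphericalGluing

/-! ### Turns at a vertex between the preceding and the following one -/

namespace SphericalGluing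

variable {X : Type*} [MetricSpace X] {𝒯 : SphericalGluing X} {T T' : Finset X} {v w a b u x y : X}
  {γ : ℝ → X}

namespace Arc

variable {m c mw cw mu cu : ℝ}

/-- On the overlap the same cosine would be given by two sinusoids whose centers differ by less than
`π`. -/
theorem ne_of_overlap (hA : 𝒯.Arc γ v m c) (hw : 𝒯.Arc γ w mw cw) (h : m < mw) (h' : mw < m + π) :
    w ≠ v := by
  rintro rfl
  have := eq_zero_of_sinusoid_on_Ioo (A := c - cw * cos (mw - m)) (B := - (cw * sin (mw - m))) (m := m)
    (l := mw - π / 2) (r := m + π / 2) (by linarith) (fun s hs => by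
      have h1 := hA.ip_eq (s := s) ⟨by linarith [hs.1], hs.2⟩
      have h2 := hw.ip_eq (s := s) ⟨hs.1, by linarith [hs.2]⟩
      rw [h1, show s - mw = (s - m) - (mw - m) by ring, cos_sub (s - m) (mw - m)] at h2
      linarith)
  have h3 := mul_pos hw.pos (sin_pos_of_pos_of_lt_pi (show 0 < mw - m by linarith) (by linarith))
  linarith [this.2]

/-- The perpendicular from `v` meets the geodesic at parameter `m`, where the direction angle is
`θ`; so `ε * (C.B i - θ)` is the signed angle from the perpendicular to the edge. On the overlap of
the two hemispheres the law of cosines for the distance to `w` is an identity of sinusoids, and its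
two coefficients are the relations of `EdgeOver`. -/
theorem junction_of_lt_one (hA : 𝒯.Arc γ v m c) (hw : 𝒯.Arc γ w mw cw) (hc : c < 1)
    (hE : 𝒯.LongEdges) (C : 𝒯.LinkCycle v) (hΘ : 2 * π < C.total) {l r : ℝ} (hlr : l < r)
    (hJ : Ioo l r ⊆ Ioo (m - π / 2) (m + π / 2)) (hJw : Ioo l r ⊆ Ioo (mw - π / 2) (mw + π / 2))
    {θ ε : ℝ} (hε : ε = 1 ∨ ε = -1) (hwv : w ≠ v)
    (hlift : ∀ s ∈ Ioo l r, C.Lift (γ s) (θ + ε * sweep √(1 - c ^ 2) (s - m))) :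
    (∃ T ∈ 𝒯.faces, v ∈ T ∧ w ∈ T) ∧ ∃ i, C.w i = w ∧ |ε * (C.B i - θ)| < π ∧
      cw * sin (mw - m) = sin (𝒯.len v w) * sin (ε * (C.B i - θ)) ∧
      cw * cos (mw - m) = c * cos (𝒯.len v w) +
        √(1 - c ^ 2) * sin (𝒯.len v w) * cos (ε * (C.B i - θ)) ∧
      ∀ s ∈ Ioo l r, 𝒯.nu (C.face (i - 1)) v w (γ s) = ε * (√(1 - c ^ 2) * cos (s - m) *
          sin (ε * (C.B i - θ)) - sin (s - m) * cos (ε * (C.B i - θ))) ∧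
        𝒯.nu (C.face i) v w (γ s) = - (ε * (√(1 - c ^ 2) * cos (s - m) *
          sin (ε * (C.B i - θ)) - sin (s - m) * cos (ε * (C.B i - θ)))) := by
  set σ := √(1 - c ^ 2) with hσ
  have hσ0 : 0 < σ := sqrt_pos.2 (by nlinarith [hA.pos])
  have hσ2 : c ^ 2 + σ ^ 2 = 1 := by
    rw [hσ, sq_sqrt (by nlinarith [hA.pos])]; ring
  obtain ⟨hface, i, hi, hj⟩ := C.junction hE hΘ (nonempty_Ioo.2 hlr) hε hwv hlift
    (fun s hs => hA.ip_pos (hJ hs)) (fun s hs => hA.ne_of_lt (hJ hs) hE (Or.inl hc))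
    (fun s hs => hw.ip_pos (hJw hs))
  refine ⟨hface, i, hi, ?_⟩
  set a := ε * (C.B i - θ) with ha
  have hε2 : ε * ε = 1 := by rcases hε with h | h <;> rw [h] <;> norm_num
  have hang : ∀ x, θ + ε * sweep σ x - C.B i = ε * (sweep σ x - a) := fun x => by
    rw [ha]; linear_combination (C.B i - θ) * hε2
  have hpol : ∀ s ∈ Ioo l r, 𝒯.rad v (γ s) * cos (sweep σ (s - m)) = σ * cos (s - m) ∧
      𝒯.rad v (γ s) * sin (sweep σ (s - m)) = sin (s - m) := fun s hs => by
    rw [hA.rad_eq (hJ hs)]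
    exact sweep_polar hσ2 hσ0 (by rw [abs_lt]; constructor <;> linarith [(hJ hs).1, (hJ hs).2])
  have hcosε : ∀ x, cos (ε * x) = cos x := fun x => by rcases hε with h | h <;> rw [h] <;> simp
  have hsinε : ∀ x, sin (ε * x) = ε * sin x := fun x => by rcases hε with h | h <;> rw [h] <;> simp
  have hcoef : cw * cos (mw - m) - c * 𝒯.ip v w - σ * 𝒯.rad v w * cos a = 0 ∧
      cw * sin (mw - m) - 𝒯.rad v w * sin a = 0 := by
    refine eq_zero_of_sinusoid_on_Ioo (m := m) hlr fun s hs => ?_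
    have h1 := (hj s hs).2.1
    obtain ⟨p1, p2⟩ := hpol s hs
    rw [hang, hcosε, cos_sub, hw.ip_eq (hJw hs), hA.ip_eq (hJ hs),
      show s - mw = (s - m) - (mw - m) by ring, cos_sub (s - m) (mw - m)] at h1
    linear_combination h1 + 𝒯.rad v w * cos a * p1 + 𝒯.rad v w * sin a * p2
  rw [cos_len, sin_len]
  refine ⟨?_, by linarith [hcoef.2], by linarith [hcoef.1], fun s hs => ?_⟩
  · obtain ⟨s, hs⟩ := nonempty_Ioo.2 hlr
    have h1 := (hj s hs).1
    rw [hang, abs_mul] at h1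
    have h2 : |ε| = 1 := by rcases hε with h | h <;> rw [h] <;> simp
    rw [h2, one_mul] at h1
    have h3 := sweep_mem σ (s - m)
    rw [abs_lt] at h1 ⊢
    constructor <;> linarith [h1.1, h1.2, h3.1, h3.2]
  · obtain ⟨-, -, n1, n2⟩ := hj s hs
    obtain ⟨p1, p2⟩ := hpol s hs
    rw [n1, n2, ← neg_sub (θ + ε * sweep σ (s - m)), sin_neg, hang, hsinε, sin_sub]
    constructor
    · linear_combination ε * sin a * p1 - ε * cos a * p2
    · linear_combination ε * cos a * p2 - ε * sin a * p1

/-- The same comparison of coefficients for a geodesic through `v`. There is no perpendicular; `η`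
tells the side of `v`, and the angle is measured from the geodesic itself. -/
theorem junction_of_eq_one (hA : 𝒯.Arc γ v m 1) (hw : 𝒯.Arc γ w mw cw)
    (hE : 𝒯.LongEdges) (C : 𝒯.LinkCycle v) (hΘ : 2 * π < C.total) {l r : ℝ} (hlr : l < r)
    (hJ : Ioo l r ⊆ Ioo (m - π / 2) (m + π / 2)) (hJw : Ioo l r ⊆ Ioo (mw - π / 2) (mw + π / 2))
    {η : ℝ} (hη : η = 1 ∨ η = -1) (hJη : ∀ s ∈ Ioo l r, 0 < η * (s - m))
    {θ : ℝ} (hwv : w ≠ v) (hlift : ∀ s ∈ Ioo l r, C.Lift (γ s) θ) :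
    (∃ T ∈ 𝒯.faces, v ∈ T ∧ w ∈ T) ∧ ∃ i, C.w i = w ∧ |θ - C.B i| < π / 2 ∧
      cw * sin (mw - m) = η * (sin (𝒯.len v w) * cos (θ - C.B i)) ∧
      cw * cos (mw - m) = cos (𝒯.len v w) ∧
      ∀ s ∈ Ioo l r, 𝒯.nu (C.face (i - 1)) v w (γ s) = - (η * (sin (s - m) * sin (θ - C.B i))) ∧
        𝒯.nu (C.face i) v w (γ s) = η * (sin (s - m) * sin (θ - C.B i)) := by
  have hsw : ∀ x, sweep 0 x = 0 := fun x => by simp [sweep]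
  obtain ⟨hface, i, hi, hj⟩ := C.junction hE hΘ (θ₀ := θ) (ε := 1) (σ := 0) (m := m)
    (nonempty_Ioo.2 hlr) (Or.inl rfl) hwv
    (fun s hs => by rw [hsw, mul_zero, add_zero]; exact hlift s hs)
    (fun s hs => hA.ip_pos (hJ hs)) (fun s hs => hA.ne_of_lt (hJ hs) hE (Or.inr (by
      rintro rfl
      have := hJη _ hs
      simp at this)))
    (fun s hs => hw.ip_pos (hJw hs))
  simp only [hsw, mul_zero, add_zero] at hj
  refine ⟨hface, i, hi, ?_⟩
  have hrad : ∀ s ∈ Ioo l r, 𝒯.rad v (γ s) = η * sin (s - m) := fun s hs => by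
    have h1 : 0 ≤ η * sin (s - m) := by
      have h2 := hJη s hs
      have h3 := hJ hs
      rcases hη with h | h <;> rw [h] at h2 ⊢
      · rw [one_mul] at h2 ⊢
        exact (sin_pos_of_pos_of_lt_pi h2 (by linarith [h3.2, pi_pos])).le
      · have := sin_pos_of_pos_of_lt_pi (x := -(s - m)) (by linarith) (by linarith [h3.1, pi_pos])
        rw [sin_neg] at this
        linarith
    rw [hA.rad_eq (hJ hs), one_mul, ← sin_sq, ← sqrt_sq h1]
    congr 1
    rcases hη with h | h <;> rw [h] <;> ring
  have hcoef : cw * cos (mw - m) - 𝒯.ip v w = 0 ∧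
      cw * sin (mw - m) - η * (𝒯.rad v w * cos (θ - C.B i)) = 0 := by
    refine eq_zero_of_sinusoid_on_Ioo (m := m) hlr fun s hs => ?_
    have h1 := (hj s hs).2.1
    rw [hrad s hs, hw.ip_eq (hJw hs), hA.ip_eq (hJ hs), one_mul,
      show s - mw = (s - m) - (mw - m) by ring, cos_sub (s - m) (mw - m)] at h1
    linear_combination h1
  rw [cos_len, sin_len]
  refine ⟨?_, by linarith [hcoef.2], by linarith [hcoef.1], fun s hs => ?_⟩
  · obtain ⟨s, hs⟩ := nonempty_Ioo.2 hlr
    exact (hj s hs).1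
  · obtain ⟨-, -, n1, n2⟩ := hj s hs
    rw [n1, n2, ← neg_sub θ, sin_neg, hrad s hs]
    constructor <;> ring

/-- The behaviour of a geodesic at a vertex `v`, between two further vertices `u` and `w` that it
passes before and after `v`. -/
theorem turn_cases (hA : 𝒯.Arc γ v m c) (hw : 𝒯.Arc γ w mw cw) (hu : 𝒯.Arc γ u mu cu)
    (hI : 𝒯.IsIntrinsic) (hE : 𝒯.LongEdges) (hγ : IsLocalGeodesic γ) (C : 𝒯.LinkCycle v)
    (hΘ : 2 * π < C.total) (h₁ : m < mw) (h₂ : mw < m + π) (h₃ : mu < m) (h₄ : m < mu + π)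
    (hwv : w ≠ v) (huv : u ≠ v) :
    (∃ T ∈ 𝒯.faces, v ∈ T ∧ w ∈ T) ∧ (∃ T ∈ 𝒯.faces, v ∈ T ∧ u ∈ T) ∧
    ∃ i j, C.w i = w ∧ C.w j = u ∧
    ((c < 1 ∧ ∃ ε a a' : ℝ, (ε = 1 ∨ ε = -1) ∧ a ∈ Ioo 0 π ∧ a' ∈ Ioo 0 π ∧ a + a' = ε * (C.B i - C.B j) ∧
      EdgeOver c √(1 - c ^ 2) (𝒯.len v w) a (mw - m) cw ∧
      EdgeOver c √(1 - c ^ 2) (𝒯.len v u) a' (m - mu) cu ∧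
      (∀ s ∈ Ioo (max m (mw - π / 2)) (m + π / 2), 𝒯.nu (C.face (i - 1)) v w (γ s) =
        ε * (√(1 - c ^ 2) * cos (s - m) * sin a - sin (s - m) * cos a)) ∧
      (∀ s ∈ Ioo (m - π / 2) (min m (mu + π / 2)), 𝒯.nu (C.face j) v u (γ s) =
        ε * (√(1 - c ^ 2) * cos (s - m) * sin a' + sin (s - m) * cos a'))) ∨
    (c = 1 ∧ ∃ δ δ' : ℝ, |δ| < π / 2 ∧ |δ'| < π / 2 ∧
      (∀ n : ℤ, π ≤ |C.B i + δ - (C.B j + δ') + n * C.total|) ∧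
      EdgeOver c 0 (𝒯.len v w) (π / 2 + δ) (mw - m) cw ∧
      EdgeOver c 0 (𝒯.len v u) (π / 2 - δ') (m - mu) cu ∧
      (∀ s ∈ Ioo (max m (mw - π / 2)) (m + π / 2), 𝒯.nu (C.face (i - 1)) v w (γ s) =
        - (sin (s - m) * sin δ)) ∧
      (∀ s ∈ Ioo (m - π / 2) (min m (mu + π / 2)), 𝒯.nu (C.face j) v u (γ s) =
        - (sin (s - m) * sin δ')))) := by
  have hpi := pi_pos
  obtain ⟨θ₁, θ₂, ε, hε, hL, hR, hlt, heq⟩ := hA.exists_lifts hI hE hγ C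
  have hlrR : max m (mw - π / 2) < m + π / 2 := max_lt (by linarith) (by linarith)
  have hlrL : m - π / 2 < min m (mu + π / 2) := lt_min (by linarith) (by linarith)
  have sR : Ioo (max m (mw - π / 2)) (m + π / 2) ⊆ Ioo m (m + π / 2) :=
    Ioo_subset_Ioo_left (le_max_left _ _)
  have sL : Ioo (m - π / 2) (min m (mu + π / 2)) ⊆ Ioo (m - π / 2) m :=
    Ioo_subset_Ioo_right (min_le_left _ _)
  have sR1 := sR.trans (Ioo_subset_Ioo_left (show m - π / 2 ≤ m by linarith))
  have sL1 := sL.trans (Ioo_subset_Ioo_right (show m ≤ m + π / 2 by linarith))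
  have sRw : Ioo (max m (mw - π / 2)) (m + π / 2) ⊆ Ioo (mw - π / 2) (mw + π / 2) :=
    Ioo_subset_Ioo (le_max_right _ _) (by linarith)
  have sLu : Ioo (m - π / 2) (min m (mu + π / 2)) ⊆ Ioo (mu - π / 2) (mu + π / 2) :=
    Ioo_subset_Ioo (by linarith) (min_le_right _ _)
  rcases hA.le_one.lt_or_eq with hc | hc
  · obtain ⟨f1, i, hi, ai, si, ci, ni⟩ := hA.junction_of_lt_one hw hc hE C hΘ hlrR sR1 sRw hε hwv
      fun s hs => hR s (sR hs)
    obtain ⟨f2, j, hj, aj, sj, cj, nj⟩ := hA.junction_of_lt_one hu hc hE C hΘ hlrL sL1 sLu hε huv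
      fun s hs => hL s (sL hs)
    refine ⟨f1, f2, i, j, hi, hj, Or.inl ⟨hc, ε, ε * (C.B i - θ₂), -(ε * (C.B j - θ₁)), hε, ?_, ?_, ?_,
      ⟨si, ci⟩, ⟨?_, ?_⟩, fun s hs => (ni s hs).1, fun s hs => ?_⟩⟩
    · refine mem_Ioo_of_sin_pos ai ?_
      refine pos_of_mul_pos_right (a := sin (𝒯.len v w)) ?_ (by rw [sin_len]; exact rad_nonneg)
      rw [← si]
      exact mul_pos hw.pos (sin_pos_of_pos_of_lt_pi (by linarith) (by linarith))
    · refine mem_Ioo_of_sin_pos (by rwa [abs_neg]) ?_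
      refine pos_of_mul_pos_right (a := sin (𝒯.len v u)) ?_ (by rw [sin_len]; exact rad_nonneg)
      rw [sin_neg, mul_neg, ← sj, ← mul_neg, ← sin_neg, neg_sub]
      exact mul_pos hu.pos (sin_pos_of_pos_of_lt_pi (by linarith) (by linarith))
    · rw [hlt hc]; ring
    · rw [sin_neg, ← neg_sub mu, sin_neg]; linarith
    · rw [cos_neg, ← neg_sub mu, cos_neg]; linarith
    · rw [(nj s hs).2, sin_neg, cos_neg]; ring
  · subst hc
    have hsw : ∀ x, sweep √(1 - (1 : ℝ) ^ 2) x = 0 := fun x => by simp [sweep]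
    simp only [hsw, mul_zero, add_zero] at hL hR
    obtain ⟨f1, i, hi, ai, si, ci, ni⟩ := hA.junction_of_eq_one hw hE C hΘ hlrR sR1 sRw (Or.inl rfl)
      (fun s hs => by linarith [(sR hs).1]) hwv fun s hs => hR s (sR hs)
    obtain ⟨f2, j, hj, aj, sj, cj, nj⟩ := hA.junction_of_eq_one hu hE C hΘ hlrL sL1 sLu (Or.inr rfl)
      (fun s hs => by linarith [(sL hs).2]) huv fun s hs => hL s (sL hs)
    refine ⟨f1, f2, i, j, hi, hj, Or.inr ⟨rfl, θ₂ - C.B i, θ₁ - C.B j, ai, aj, fun n => ?_, ⟨?_, ?_⟩,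
      ⟨?_, ?_⟩, fun s hs => ?_, fun s hs => ?_⟩⟩
    · convert heq rfl n using 2; ring
    · rw [si, add_comm (π / 2), sin_add_pi_div_two]; ring
    · rw [ci]; ring
    · rw [sin_pi_div_two_sub, ← neg_sub mu, sin_neg]; linarith
    · rw [← neg_sub mu, cos_neg, cj]; ring
    · rw [(ni s hs).1]; ring
    · rw [(nj s hs).2]; ring

/-- If the two neighbours were equal, the angle between them would be a multiple of the total angle.
Off the vertex it lies strictly between `0` and `2π`, hence below the total; through the vertex a
multiple of the total would bring the two directions within less than `π`. -/
theorem turn_ne (hA : 𝒯.Arc γ v m c) (hw : 𝒯.Arc γ w mw cw) (hu : 𝒯.Arc γ u mu cu)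
    (hI : 𝒯.IsIntrinsic) (hE : 𝒯.LongEdges) (hγ : IsLocalGeodesic γ) (C : 𝒯.LinkCycle v)
    (hΘ : 2 * π < C.total) (h₁ : m < mw) (h₂ : mw < m + π) (h₃ : mu < m) (h₄ : m < mu + π) : u ≠ w := by
  have hwv := hA.ne_of_overlap hw h₁ h₂
  have huv := (hu.ne_of_overlap hA h₃ h₄).symm
  intro huw
  obtain ⟨-, -, i, j, hi, hj, h⟩ := hA.turn_cases hw hu hI hE hγ C hΘ h₁ h₂ h₃ h₄ hwv huv
  obtain ⟨n, hn⟩ := C.exists_B_eq (hi.trans (huw.symm.trans hj.symm))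
  rcases h with ⟨-, ε, a, a', hε, ha, ha', hsum, -⟩ | ⟨-, δ, δ', hδ, hδ', hgap, -⟩
  · have h0 := C.total_pos hE
    rw [hn, add_sub_cancel_left] at hsum
    have h1 : 0 < ε * n * C.total := by rw [mul_assoc, ← hsum]; linarith [ha.1, ha'.1]
    have h2 : ε * n * C.total < 1 * C.total := by
      rw [mul_assoc, ← hsum]; linarith [ha.2, ha'.2]
    have h3 := pos_of_mul_pos_left h1 h0.le
    have h4 := lt_of_mul_lt_mul_right h2 h0.le
    rcases hε with h | h <;> rw [h] at h3 h4
    · rw [one_mul] at h3 h4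
      have h5 : 0 < n := by exact_mod_cast h3
      have h6 : n < 1 := by exact_mod_cast h4
      omega
    · have h5 : (0 : ℝ) < ((-n : ℤ) : ℝ) := by push_cast; linarith
      have h6 : ((-n : ℤ) : ℝ) < ((1 : ℤ) : ℝ) := by push_cast; linarith
      rw [Int.cast_pos] at h5
      rw [Int.cast_lt] at h6
      omega
  · have := hgap (-n)
    rw [hn, show C.B j + n * C.total + δ - (C.B j + δ') + ((-n : ℤ) : ℝ) * C.total = δ - δ' by
      push_cast; ring] at this
    rw [abs_lt] at hδ hδ'
    rcases abs_cases (δ - δ') with ⟨h1, -⟩ | ⟨h1, -⟩ <;> rw [h1] at this <;>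
      linarith [hδ.1, hδ.2, hδ'.1, hδ'.2]

/-- A turn at a vertex when its two neighbours are not in a common face with it. -/
theorem turn_of_not_face (hA : 𝒯.Arc γ v m c) (hw : 𝒯.Arc γ w mw cw) (hu : 𝒯.Arc γ u mu cu)
    (hI : 𝒯.IsIntrinsic) (hE : 𝒯.LongEdges) (hγ : IsLocalGeodesic γ) (C : 𝒯.LinkCycle v)
    (hΘ : 2 * π < C.total) (h₁ : m < mw) (h₂ : mw < m + π) (h₃ : mu < m) (h₄ : m < mu + π)
    (hface : ∀ T ∈ 𝒯.faces, v ∈ T → u ∈ T → w ∈ T → False) :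
    ∃ a a' : ℝ, a ∈ Ioo 0 π ∧ a' ∈ Ioo 0 π ∧ EdgeOver c √(1 - c ^ 2) (𝒯.len v w) a (mw - m) cw ∧
      EdgeOver c √(1 - c ^ 2) (𝒯.len v u) a' (m - mu) cu ∧ (0 < √(1 - c ^ 2) → π ≤ a + a') := by
  have hwv := hA.ne_of_overlap hw h₁ h₂
  have huv := (hu.ne_of_overlap hA h₃ h₄).symm
  have hne := hA.turn_ne hw hu hI hE hγ C hΘ h₁ h₂ h₃ h₄
  obtain ⟨-, -, i, j, hi, hj, h⟩ := hA.turn_cases hw hu hI hE hγ C hΘ h₁ h₂ h₃ h₄ hwv huv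
  rcases h with ⟨hc, ε, a, a', hε, ha, ha', hsum, e1, e2, -⟩ | ⟨hc, δ, δ', hδ, hδ', hgap, e1, e2, -⟩
  · refine ⟨a, a', ha, ha', e1, e2, fun _ => ?_⟩
    have key : ∀ p q : ℤ, C.B p < C.B q → (C.w p = u ∧ C.w q = w ∨ C.w p = w ∧ C.w q = u) →
        π ≤ C.B q - C.B p := by
      intro p q hpq hor
      have h5 : p < q := (C.B_strictMono hE).lt_iff_lt.1 hpq
      have h6 : q ≠ p + 1 := by
        rintro rfl
        have ht := C.tri_face p
        rcases hor with ⟨rfl, rfl⟩ | ⟨rfl, rfl⟩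
        · exact hface _ ht.mem ht.mem_v ht.mem_a ht.mem_b
        · exact hface _ ht.mem ht.mem_v ht.mem_b ht.mem_a
      have h7 := C.B_sub_B_ge hE p 2
      have h8 : C.B (p + (2 : ℕ)) ≤ C.B q := (C.B_strictMono hE).monotone (by push_cast; omega)
      push_cast at h7 h8
      linarith
    have hpos : 0 < a + a' := by linarith [ha.1, ha'.1]
    rcases hε with h | h <;> rw [h] at hsum
    · have := key j i (by linarith) (Or.inl ⟨hj, hi⟩); linarith
    · have := key i j (by linarith) (Or.inr ⟨hi, hj⟩); linarith
  · rw [abs_lt] at hδ hδ'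
    subst hc
    have h0 : √(1 - (1 : ℝ) ^ 2) = 0 := by simp
    rw [h0]
    exact ⟨_, _, ⟨by linarith, by linarith⟩, ⟨by linarith, by linarith⟩, e1, e2,
      fun h => absurd h (lt_irrefl _)⟩

/-- A turn at a vertex, where `n` faces lie between the two neighbours on one side. -/
theorem turn_oriented (hA : 𝒯.Arc γ v m c) (hw : 𝒯.Arc γ w mw cw) (hu : 𝒯.Arc γ u mu cu)
    (hI : 𝒯.IsIntrinsic) (hE : 𝒯.LongEdges) (hγ : IsLocalGeodesic γ) (C : 𝒯.LinkCycle v)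
    (hΘ : 2 * π < C.total) (h₁ : m < mw) (h₂ : mw < m + π) (h₃ : mu < m) (h₄ : m < mu + π)
    {n : ℤ} (hn : 0 < n) (hnk : n < C.k) (h0 : C.w 0 = u) (hwn : C.w n = w) :
    ∃ s a a' : ℝ, c ^ 2 + s ^ 2 = 1 ∧ a ∈ Ioo 0 π ∧ a' ∈ Ioo 0 π ∧
      EdgeOver c s (𝒯.len v w) a (mw - m) cw ∧ EdgeOver c s (𝒯.len v u) a' (m - mu) cu ∧
      2 * π ≤ C.B n + (a + a') ∧ (0 < s → 2 * π < C.B n + (a + a')) ∧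
      (s < 0 → 2 * π = C.B n + (a + a')) ∧
      (∀ t ∈ Ioo (max m (mw - π / 2)) (m + π / 2), 𝒯.nu (C.face (n - 1)) v w (γ t) =
        sin (t - m) * cos a - s * cos (t - m) * sin a) ∧
      (∀ t ∈ Ioo (m - π / 2) (min m (mu + π / 2)), 𝒯.nu (C.face 0) v u (γ t) =
        - (sin (t - m) * cos a') - s * cos (t - m) * sin a') := by
  have hwv := hA.ne_of_overlap hw h₁ h₂
  have huv := (hu.ne_of_overlap hA h₃ h₄).symm
  obtain ⟨-, -, i, j, hi, hj, h⟩ := hA.turn_cases hw hu hI hE hγ C hΘ h₁ h₂ h₃ h₄ hwv huv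
  obtain ⟨p, hp, hpf, hpf'⟩ := C.exists_period (hi.trans hwn.symm)
  obtain ⟨q, hq, hqf, hqf'⟩ := C.exists_period (hj.trans h0.symm)
  rw [C.B_zero, zero_add] at hq
  have hαpos : 0 < C.B n := by have := C.B_strictMono hE hn; rwa [C.B_zero] at this
  have hαlt : C.B n < C.total := C.B_strictMono hE hnk
  have hT := C.total_pos hE
  have hc2 : c ^ 2 + √(1 - c ^ 2) ^ 2 = 1 := by
    rw [sq_sqrt (by nlinarith [hA.pos, hA.le_one])]; ring
  rcases h with ⟨hc, ε, a, a', hε, ha, ha', hsum, e1, e2, n1, n2⟩ |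
    ⟨hc, δ, δ', hδ, hδ', hgap, e1, e2, n1, n2⟩
  · have hσ : 0 < √(1 - c ^ 2) := sqrt_pos.2 (by nlinarith [hA.pos])
    rw [hpf'] at n1
    rw [hqf] at n2
    rw [hp, hq] at hsum
    have hpos : 0 < a + a' := by linarith [ha.1, ha'.1]
    have hlt : a + a' < C.total := by linarith [ha.2, ha'.2]
    rcases hε with h | h <;> rw [h] at hsum n1 n2
    -- The geodesic passes `v` on the side of the `n` faces: there `a + a' = C.B n`. The height is
    -- counted negative and the angles are replaced by their supplements, so that the sum is exactly
    -- `2π`.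
    · have hpq : p - q = 0 := by
        have h5 : (-1 : ℝ) * C.total < ((p - q : ℤ) : ℝ) * C.total := by push_cast; linarith
        have h6 : ((p - q : ℤ) : ℝ) * C.total < 1 * C.total := by push_cast; linarith
        have h7 := lt_of_mul_lt_mul_right h5 hT.le
        have h8 := lt_of_mul_lt_mul_right h6 hT.le
        have h9 : -1 < p - q := by exact_mod_cast h7
        have h10 : p - q < 1 := by exact_mod_cast h8
        omega
      have hpq' : p = q := by omega
      subst hpq'
      refine ⟨-√(1 - c ^ 2), π - a, π - a', by rw [neg_sq]; exact hc2, ⟨by linarith [ha.2], by linarith [ha.1]⟩,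
        ⟨by linarith [ha'.2], by linarith [ha'.1]⟩, ⟨?_, ?_⟩, ⟨?_, ?_⟩, by linarith, fun h => by linarith,
        fun _ => by linarith, fun t ht => ?_, fun t ht => ?_⟩
      · rw [sin_pi_sub]; exact e1.sin_eq
      · rw [cos_pi_sub, e1.cos_eq]; ring
      · rw [sin_pi_sub]; exact e2.sin_eq
      · rw [cos_pi_sub, e2.cos_eq]; ring
      · rw [n1 t ht, sin_pi_sub, cos_pi_sub]; ring
      · rw [n2 t ht, sin_pi_sub, cos_pi_sub]; ring
    -- The geodesic passes on the other side, where `a + a'` is the total angle minus `C.B n`; the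
    -- sum exceeds `2π` strictly.
    · have hpq : q - p = 1 := by
        have h5 : (0 : ℝ) * C.total < ((q - p : ℤ) : ℝ) * C.total := by push_cast; linarith
        have h6 : ((q - p : ℤ) : ℝ) * C.total < 2 * C.total := by push_cast; linarith
        have h7 := lt_of_mul_lt_mul_right h5 hT.le
        have h8 := lt_of_mul_lt_mul_right h6 hT.le
        have h9 : 0 < q - p := by exact_mod_cast h7
        have h10 : q - p < 2 := by exact_mod_cast h8
        omega
      have hq' : (q : ℝ) = p + 1 := by
        have : q = p + 1 := by omega
        rw [this]; push_cast; ring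
      rw [hq'] at hsum
      refine ⟨√(1 - c ^ 2), a, a', hc2, ha, ha', e1, e2, by linarith, fun _ => by linarith,
        fun h => by linarith, fun t ht => ?_, fun t ht => ?_⟩
      · rw [n1 t ht]; ring
      · rw [n2 t ht]; ring
  · rw [hpf'] at n1
    rw [hqf] at n2
    have hg := hgap (q - p)
    rw [hp, hq, show C.B n + p * C.total + δ - (q * C.total + δ') + ((q - p : ℤ) : ℝ) * C.total =
      C.B n + δ - δ' by push_cast; ring] at hg
    -- This excludes the negative sign in the gap condition at the vertex, so that the angle on the
    -- side of the faces is at least `π`.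
    have hα : π / 2 ≤ C.B n := by
      have h5 := C.B_sub_B_ge hE 0 1
      have h6 : C.B (0 + (1 : ℕ)) ≤ C.B n := (C.B_strictMono hE).monotone (by push_cast; omega)
      rw [C.B_zero] at h5
      push_cast at h5 h6
      linarith
    rw [abs_lt] at hδ hδ'
    rw [abs_of_nonneg (by
      by_contra! hneg
      rw [abs_of_neg hneg] at hg
      linarith)] at hg
    refine ⟨0, π / 2 + δ, π / 2 - δ', by rw [hc]; norm_num, ⟨by linarith, by linarith⟩,
      ⟨by linarith, by linarith⟩, e1, e2, by linarith, fun h => absurd h (lt_irrefl _),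
      fun h => absurd h (lt_irrefl _), fun t ht => ?_, fun t ht => ?_⟩
    · rw [n1 t ht, add_comm (π / 2), cos_add_pi_div_two]; ring
    · rw [n2 t ht, cos_pi_div_two_sub]; ring

end Arc

end SphericalGluing

/-! ### Signed heights of adjacent vertices -/

theorem EdgeOver.height_eq {c s d a b cw sw a' : ℝ} (h : EdgeOver c s d a b cw)
    (h' : EdgeOver cw sw d a' b c) (hcs : c ^ 2 + s ^ 2 = 1) (hc : 0 < c) (hb : b ∈ Ioo 0 π)
    (e : sw * sin a' = s * sin a * cos b - cos a * sin b) :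
    sw = s * cos d - c * sin d * cos a := by
  have hb' := sin_pos_of_pos_of_lt_pi hb.1 hb.2
  have h1 : sin b * c * sw = sin b * c * (s * cos d - c * sin d * cos a) := by
    linear_combination sin d * e + sw * h'.sin_eq - s * cos b * h.sin_eq
      + s * sin b * h.cos_eq + (sin b * sin d * cos a) * hcs
  exact mul_left_cancel₀ (mul_pos hb' hc).ne' h1

namespace SphericalGluing

variable {X : Type*} {𝒯 : SphericalGluing X} {S T T' : Finset X} {v w a b c d u x y : X}

theorem len_comm (hT : T ∈ 𝒯.faces) (hv : v ∈ T) (hw : w ∈ T) : 𝒯.len v w = 𝒯.len w v := by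
  rw [len, len, ip_comm hT hv hw]

theorem Tri.nu_comm (h : 𝒯.Tri T v a b) (x : X) : 𝒯.nu S v a x = 𝒯.nu S a v x := by
  rw [nu, nu, h.ht_comm]

/-- The signed heights of two adjacent vertices over a geodesic running through their stars. -/
theorem Tri.height_eq (h : 𝒯.Tri T v a b) {γ : ℝ → X} {m mw p q s sw α β : ℝ}
    (h₁ : m < mw) (h₂ : mw < m + π) (hp : 0 < p) (hq : 0 < q) (hs : p ^ 2 + s ^ 2 = 1)
    (hsw : q ^ 2 + sw ^ 2 = 1)
    (r : EdgeOver p s (𝒯.len v a) α (mw - m) q) (r' : EdgeOver q sw (𝒯.len a v) β (mw - m) p)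
    (e : ∀ t ∈ Ioo (max m (mw - π / 2)) (m + π / 2),
      𝒯.nu S v a (γ t) = sin (t - m) * cos α - s * cos (t - m) * sin α)
    (e' : ∀ t ∈ Ioo (mw - π / 2) (min mw (m + π / 2)),
      𝒯.nu S a v (γ t) = - (sin (t - mw) * cos β) - sw * cos (t - mw) * sin β) :
    sw = s * cos (𝒯.len v a) - p * sin (𝒯.len v a) * cos α ∧
      s = sw * cos (𝒯.len v a) - q * sin (𝒯.len v a) * cos β := by
  rw [len_comm h.mem h.mem_a h.mem_v] at r'
  have hb : mw - m ∈ Ioo 0 π := ⟨by linarith, by linarith⟩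
  have hlr : max m (mw - π / 2) < min mw (m + π / 2) := by
    rw [max_lt_iff, lt_min_iff, lt_min_iff]
    refine ⟨⟨?_, ?_⟩, ?_, ?_⟩ <;> linarith [pi_pos]
  -- On the overlap of the two arcs both expansions give the signed distance to the same edge, once
  -- seen from each endpoint. Comparing coefficients fixes the sign of the height, which `EdgeOver`
  -- alone leaves open.
  obtain ⟨h1, h2⟩ := eq_zero_of_sinusoid_on_Ioo (m := m)
      (A := - (s * sin α) - sin (mw - m) * cos β + sw * cos (mw - m) * sin β)
      (B := cos α + cos (mw - m) * cos β + sw * sin (mw - m) * sin β) hlr (by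
    intro t ht
    have h1 := e t ⟨ht.1, ht.2.trans_le (min_le_right _ _)⟩
    have h2 := e' t ⟨(le_max_right _ _).trans_lt ht.1, ht.2⟩
    rw [h.nu_comm, h2, show t - mw = (t - m) - (mw - m) by ring, sin_sub (t - m), cos_sub (t - m)] at h1
    linear_combination -h1)
  have h3 := sin_sq_add_cos_sq (mw - m)
  refine ⟨r.height_eq r' hs hp hb ?_, r'.height_eq r hsw hq hb ?_⟩
  · linear_combination cos (mw - m) * h1 + sin (mw - m) * h2 - sw * sin β * h3
  · linear_combination (-1) * h1

end SphericalGluing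

/-! ### Points on edges and corners between edges -/

theorem exists_mem_Ico_of_add_one_le {D : ℤ → ℝ} (hD : ∀ i, D i + 1 ≤ D (i + 1)) (t : ℝ) :
    ∃ i, D i ≤ t ∧ t < D (i + 1) := by
  have hn : ∀ (i : ℤ) (n : ℕ), D i + n ≤ D (i + n) := by
    intro i n
    induction n with
    | zero => simp
    | succ n ih => have := hD (i + n); push_cast; rw [← add_assoc i]; linarith
  have hmono : ∀ i j : ℤ, i ≤ j → D i + (j - i) ≤ D j := by
    intro i j hij
    obtain ⟨n, rfl⟩ := Int.le.dest hij
    have := hn i n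
    push_cast; linarith
  obtain ⟨n, hn1⟩ := exists_nat_ge |t - D 0|
  have h1 := abs_le.1 (hn1 : |t - D 0| ≤ n)
  obtain ⟨i, hi, hi'⟩ := Int.exists_greatest_of_bdd (P := fun i => D i ≤ t)
    ⟨n + 1, fun z hz => by
      by_contra! h
      have := hmono (n + 1) z h.le
      have h2 := hmono 0 (n + 1) (by positivity)
      have h3 : ((n + 1 : ℤ) : ℝ) ≤ z := by exact_mod_cast h.le
      push_cast at *
      linarith⟩
    ⟨-n, by
      have := hmono (-n) 0 (by simp)
      push_cast at this
      linarith⟩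
  refine ⟨i, hi, ?_⟩
  by_contra! h
  have := hi' (i + 1) h
  lia

namespace SphericalGluing

variable {X : Type*} {𝒯 : SphericalGluing X} {S T T' : Finset X} {v w a b c d u x y z z' : X}
  {s t t' : ℝ}

theorem LongEdges.len_mem (hE : 𝒯.LongEdges) (h : 𝒯.Tri T v a b) :
    𝒯.len v a ∈ Ico (π / 2) π := hE.arccos_mem h.mem h.mem_v h.mem_a h.va

/-- `z` lies on the edge `v w`, at distance `t` from `v`. -/
structure OnEdge (𝒯 : SphericalGluing X) (v w : X) (t : ℝ) (z : X) : Prop where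
  mem : t ∈ Icc 0 (𝒯.len v w)
  cell : ∃ T ∈ 𝒯.faces, v ∈ T ∧ w ∈ T ∧ z ∈ 𝒯.cell T
  ip_eq : 𝒯.ip v z = cos t
  dirc_eq : 𝒯.dirc v w z = sin t

theorem OnEdge.ht_eq (h : 𝒯.OnEdge v w t z) : 𝒯.ht v w z = 0 := by
  rw [ht, h.ip_eq, h.dirc_eq, cos_sq']; simp

theorem OnEdge.coord_eq (h : 𝒯.OnEdge v w t z) (hT : 𝒯.Tri T v w b) (hz : z ∈ 𝒯.cell T) :
    𝒯.coord T z b = 0 := by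
  have := hT.ht_eq_coord hz
  rw [h.ht_eq] at this
  exact (mul_eq_zero.1 this.symm).resolve_right hT.ht_b_pos.ne'

theorem OnEdge.mem_cell (h : 𝒯.OnEdge v w t z) (hvw : v ≠ w) (hT : T ∈ 𝒯.faces) (hv : v ∈ T)
    (hw : w ∈ T) : z ∈ 𝒯.cell T := by
  obtain ⟨S, hS, hvS, hwS, hz⟩ := h.cell
  obtain ⟨b, hb⟩ := exists_tri_of_mem_of_mem hS hvS hwS hvw
  refine mem_cell_of_coord hS hz hT ?_
  exact hb.forall_mem (fun h => absurd hv h) (fun h => absurd hw h) fun _ => h.coord_eq hb hz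

theorem Tri.exists_onEdge (h : 𝒯.Tri T v w b) (hE : 𝒯.LongEdges) (ht : t ∈ Icc 0 (𝒯.len v w)) :
    ∃ z, 𝒯.OnEdge v w t z := by
  have hd := (hE.len_mem h).2
  obtain ⟨z, hz, -, h1, h2⟩ := h.exists_edge_point (p := cos t) (q := sin t)
    (by rw [add_comm]; exact sin_sq_add_cos_sq t)
    (sin_nonneg_of_nonneg_of_le_pi ht.1 (ht.2.trans hd.le)) (by
      rw [← cos_len, ← sin_len]
      have := sin_nonneg_of_nonneg_of_le_pi (x := 𝒯.len v w - t) (by linarith [ht.2])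
        (by linarith [ht.1])
      rw [sin_sub] at this
      linarith)
  exact ⟨z, ht, ⟨T, h.mem, h.mem_v, h.mem_a, hz⟩, h1, h2⟩

theorem Tri.onEdge_zero (h : 𝒯.Tri T v w b) : 𝒯.OnEdge v w 0 v :=
  ⟨⟨le_rfl, arccos_nonneg _⟩, ⟨T, h.mem, h.mem_v, h.mem_a, h.cell_v⟩,
    by rw [ip_self h.mem h.mem_v, cos_zero],
    by rw [dirc, ip_self h.mem h.mem_v, ip_comm h.mem h.mem_a h.mem_v]; simp⟩

theorem Tri.onEdge_symm (h : 𝒯.Tri T v w b) (hz : 𝒯.OnEdge v w t z) :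
    𝒯.OnEdge w v (𝒯.len v w - t) z := by
  have e := len_comm h.mem h.mem_v h.mem_a
  have hr := h.rad_a_pos
  have hw : 𝒯.ip w z = cos (𝒯.len v w - t) := by
    rw [h.ip_a_eq, hz.ip_eq, hz.dirc_eq, ← cos_len, ← sin_len, cos_sub]
  refine ⟨⟨by linarith [hz.mem.2], by rw [← e]; linarith [hz.mem.1]⟩, ?_, hw, ?_⟩
  · obtain ⟨S, hS, h1, h2, h3⟩ := hz.cell
    exact ⟨S, hS, h2, h1, h3⟩
  · have h1 := h.rotate.swap.ip_a_eq z
    rw [hz.ip_eq, hw, ip_comm h.mem h.mem_a h.mem_v, ← cos_len, ← h.rad_comm, ← sin_len] at h1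
    rw [← sin_len] at hr
    have h2 : sin (𝒯.len v w) * 𝒯.dirc w v z = sin (𝒯.len v w) * sin (𝒯.len v w - t) := by
      rw [cos_sub] at h1
      rw [sin_sub]
      have := sin_sq_add_cos_sq (𝒯.len v w)
      linear_combination -h1 - cos t * this
    exact mul_left_cancel₀ hr.ne' h2

theorem Tri.onEdge_len (h : 𝒯.Tri T v w b) : 𝒯.OnEdge v w (𝒯.len v w) w := by
  have h' : 𝒯.Tri T w v b := h.rotate.swap
  have := h'.onEdge_symm h'.onEdge_zero
  rwa [sub_zero, len_comm h.mem h.mem_a h.mem_v] at this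

theorem Tri.mem_edge_iff (h : 𝒯.Tri T v w b) : x ∈ 𝒯.edge T v w ↔ ∃ t, 𝒯.OnEdge v w t x := by
  have hr := h.rad_a_pos
  have hpair : {𝒯.chart T v, 𝒯.chart T w} = 𝒯.chart T '' ({v, w} : Set X) := by
    rw [image_pair]
  have hsub : ({v, w} : Set X) ⊆ (T : Set X) := by
    rintro u (rfl | rfl)
    exacts [h.mem_v, h.mem_a]
  constructor
  · rintro ⟨hx, -, hx'⟩
    rw [hpair] at hx'
    obtain ⟨c, -, h2, h3⟩ := exists_sum_of_mem_span hsub hx'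
    have hb : 𝒯.coord T x b = 0 := by
      rw [chart_eq_sum h.mem hx] at h3
      rw [eq_of_sum_eq h.mem h3 b h.mem_b]
      exact h2 b (by simp [h.vb.symm, h.ab.symm])
    have e1 := h.ip_eq_coord hx
    have e2 := h.dirc_eq_coord hx
    have e3 := h.ht_sq hx
    rw [h.ht_eq_coord hx] at e3
    rw [hb] at e1 e2 e3
    have hdn : 0 ≤ 𝒯.dirc v w x := by
      rw [e2]; have := mul_nonneg (coord_nonneg h.mem hx w) hr.le; linarith
    have hd : 𝒯.dirc v w x = 𝒯.rad v x := by
      rw [← abs_of_nonneg hdn, ← abs_of_nonneg (rad_nonneg (𝒯 := 𝒯) (v := v) (x := x)),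
        ← sq_eq_sq_iff_abs_eq_abs]
      linarith
    refine ⟨𝒯.len v x, ⟨arccos_nonneg _, ?_⟩, ⟨T, h.mem, h.mem_v, h.mem_a, hx⟩, (cos_len _ _).symm,
      by rw [sin_len, hd]⟩
    by_contra! hlt
    have h1 : sin (𝒯.len v w - 𝒯.len v x) < 0 := by
      refine sin_neg_of_neg_of_neg_pi_lt (by linarith) ?_
      have h2 : 𝒯.len v x ≤ π := arccos_le_pi _
      have h3 : 0 < 𝒯.len v w := by
        refine lt_of_le_of_ne (arccos_nonneg _) fun h0 => ?_
        rw [← sin_len, ← h0, sin_zero] at hr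
        exact lt_irrefl _ hr
      linarith
    rw [sin_sub, cos_len, cos_len, sin_len, sin_len, ← hd, e1, e2] at h1
    have := mul_nonneg (coord_nonneg h.mem hx v) hr.le
    nlinarith
  · rintro ⟨t, ht⟩
    have hx := ht.mem_cell h.va h.mem h.mem_v h.mem_a
    refine ⟨hx, norm_chart h.mem hx, ?_⟩
    rw [hpair, chart_eq_sum h.mem hx]
    refine sum_mem_span (fun u _ => coord_nonneg h.mem hx u) ?_
    exact h.forall_mem (fun h => by simp at h) (fun h => by simp at h) fun _ => ht.coord_eq h hx

/-- A function that measures the distance from `v` in the direction of `a`. -/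
noncomputable def push (𝒯 : SphericalGluing X) (v a x : X) : ℝ :=
  max 0 (min (arcsin (𝒯.dirc v a x)) (arcsin (𝒯.ip v x)))

theorem push_eq_zero_of_ip (h : 𝒯.ip v x ≤ 0) : 𝒯.push v a x = 0 :=
  max_eq_left ((min_le_right _ _).trans (arcsin_nonpos.2 h))

theorem push_eq_zero_of_dirc (h : 𝒯.dirc v a x ≤ 0) : 𝒯.push v a x = 0 :=
  max_eq_left ((min_le_left _ _).trans (arcsin_nonpos.2 h))

/-- Face angles at `v` are at least `π / 2`, so at points of triangles not containing the edge `v a`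
the component in the direction of `a` is nonpositive. `push v a` therefore lives only on the two
triangles at this edge. -/
theorem LongEdges.push_eq_zero (hE : 𝒯.LongEdges) (hva : v ≠ a) (hS : S ∈ 𝒯.faces)
    (hx : x ∈ 𝒯.cell S) (h : v ∈ S → a ∈ S → False) : 𝒯.push v a x = 0 := by
  rcases le_or_gt (𝒯.ip v x) 0 with h0 | h0
  · exact push_eq_zero_of_ip h0
  have hvS := hE.mem_of_ip_pos hS hx h0
  apply push_eq_zero_of_dirc
  by_cases hT : ∃ T ∈ 𝒯.faces, a ∈ T ∧ x ∈ 𝒯.cell T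
  · obtain ⟨T, hT, haT, hxT⟩ := hT
    obtain ⟨b, hb⟩ := exists_tri_of_mem_of_mem hT (hE.mem_of_ip_pos hT hxT h0) haT hva
    rw [hb.dirc_eq_coord hxT, coord_eq_zero hT hxT hS hx haT (h hvS), zero_mul, zero_add,
      hb.dirc_eq hb.cell_b]
    have hm := hb.angle_mem hE
    have := cos_nonpos_of_edge hm.1 hm.2
    exact mul_nonpos_of_nonneg_of_nonpos (coord_nonneg hT hxT _)
      (mul_nonpos_of_nonneg_of_nonpos rad_nonneg this)
  · have h1 : 𝒯.ip a x = -1 := by rw [ip, dif_neg hT]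
    rw [dirc, h1]
    refine div_nonpos_of_nonpos_of_nonneg ?_ (sqrt_nonneg _)
    have h2 := neg_one_le_ip (𝒯 := 𝒯) v a
    have h3 := ip_le_one (𝒯 := 𝒯) v x
    nlinarith

theorem arcsin_inner_sub_le {e p q : E3} (he : ‖e‖ = 1) (hp : ‖p‖ = 1) (hq : ‖q‖ = 1) :
    arcsin (inner ℝ e p) - arcsin (inner ℝ e q) ≤ sphericalDist p q := by
  have h := sphericalDist_triangle e p q
  rw [sphericalDist_eq_arccos he hp, sphericalDist_eq_arccos he hq, arccos, arccos] at h
  linarith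

/-- Inside a triangle both arcsines are signed distances to great circles, hence 1-Lipschitz; taking
the minimum and the positive part preserves this. -/
theorem Tri.push_sub_le (h : 𝒯.Tri T v a b) (hx : x ∈ 𝒯.cell T) (hy : y ∈ 𝒯.cell T) :
    𝒯.push v a x - 𝒯.push v a y ≤ sphericalDist (𝒯.chart T x) (𝒯.chart T y) := by
  have h0 : 0 ≤ sphericalDist (𝒯.chart T x) (𝒯.chart T y) :=
    InnerProductGeometry.angle_nonneg _ _
  have h1 : arcsin (𝒯.ip v x) - arcsin (𝒯.ip v y) ≤ sphericalDist (𝒯.chart T x) (𝒯.chart T y) := by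
    rw [ip_eq h.mem h.mem_v hx, ip_eq h.mem h.mem_v hy]
    exact arcsin_inner_sub_le (norm_chart h.mem h.cell_v) (norm_chart h.mem hx) (norm_chart h.mem hy)
  have h2 : arcsin (𝒯.dirc v a x) - arcsin (𝒯.dirc v a y) ≤
      sphericalDist (𝒯.chart T x) (𝒯.chart T y) := by
    have hr := h.rad_a_pos
    have hrsq := rad_sq (𝒯 := 𝒯) (v := v) (x := a)
    set e : E3 := (𝒯.rad v a)⁻¹ • (𝒯.chart T a - 𝒯.ip v a • 𝒯.chart T v) with he
    have hin : ∀ z ∈ 𝒯.cell T, 𝒯.dirc v a z = inner ℝ e (𝒯.chart T z) := by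
      intro z hz
      rw [he, real_inner_smul_left, inner_sub_left, real_inner_smul_left, ← ip_eq h.mem h.mem_a hz,
        ← ip_eq h.mem h.mem_v hz, dirc, ← rad, div_eq_inv_mul]
    have hne : ‖e‖ = 1 := by
      have : ‖e‖ ^ 2 = 1 := by
        rw [← real_inner_self_eq_norm_sq]
        conv_lhs => rw [he, inner_smul_right, inner_sub_right, inner_smul_right]
        rw [← he, ← hin a h.cell_a, ← hin v h.cell_v, dirc, dirc, ← rad, ip_self h.mem h.mem_a,
          ip_self h.mem h.mem_v, ip_comm h.mem h.mem_a h.mem_v]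
        field_simp
        linarith
      nlinarith [norm_nonneg e]
    rw [hin x hx, hin y hy]
    exact arcsin_inner_sub_le hne (norm_chart h.mem hx) (norm_chart h.mem hy)
  have h3 : 𝒯.push v a x ≤ 𝒯.push v a y + sphericalDist (𝒯.chart T x) (𝒯.chart T y) := by
    rw [push, push]
    refine max_le (by positivity) ?_
    have h4 := le_max_right 0 (min (arcsin (𝒯.dirc v a y)) (arcsin (𝒯.ip v y)))
    rcases min_cases (arcsin (𝒯.dirc v a y)) (arcsin (𝒯.ip v y)) with ⟨h5, -⟩ | ⟨h5, -⟩
    · exact (min_le_left _ _).trans (by linarith)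
    · exact (min_le_right _ _).trans (by linarith)
  linarith

theorem OnEdge.push_eq (h : 𝒯.OnEdge v a t z) (ht : t ≤ π / 4) : 𝒯.push v a z = t := by
  have h0 := h.mem.1
  rw [push, h.ip_eq, h.dirc_eq, ← sin_pi_div_two_sub, arcsin_sin, arcsin_sin, min_eq_left,
    max_eq_right h0] <;> linarith [pi_pos]

variable [MetricSpace X]

theorem Tri.onEdge_dist_le (h : 𝒯.Tri T v w b) (hI : 𝒯.IsIntrinsic) (hE : 𝒯.LongEdges)
    (hz : 𝒯.OnEdge v w t z) (hz' : 𝒯.OnEdge v w t' z') : dist z z' ≤ |t - t'| := by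
  have h1 := hz.mem_cell h.va h.mem h.mem_v h.mem_a
  have h2 := hz'.mem_cell h.va h.mem h.mem_v h.mem_a
  have hd := (hE.len_mem h).2
  refine (hI.dist_le h.mem h1 h2).trans_eq ?_
  rw [sphericalDist_eq_arccos (norm_chart h.mem h1) (norm_chart h.mem h2), h.inner_eq h1 h2,
    hz.ip_eq, hz'.ip_eq, hz.dirc_eq, hz'.dirc_eq, hz.ht_eq, zero_mul, add_zero, ← cos_sub, ← cos_abs,
    arccos_cos (abs_nonneg _)]
  rw [abs_le]
  constructor <;> linarith [hz.mem.1, hz.mem.2, hz'.mem.1, hz'.mem.2]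

theorem Tri.onEdge_unique (h : 𝒯.Tri T v w b) (hI : 𝒯.IsIntrinsic) (hE : 𝒯.LongEdges)
    (hz : 𝒯.OnEdge v w t z) (hz' : 𝒯.OnEdge v w t z') : z = z' := by
  have := h.onEdge_dist_le hI hE hz hz'
  rw [sub_self, abs_zero] at this
  exact dist_le_zero.1 this

theorem Tri.onEdge_dist_eq (h : 𝒯.Tri T v w b) (hI : 𝒯.IsIntrinsic) (hE : 𝒯.LongEdges)
    (hz : 𝒯.OnEdge v w t z) (hz' : 𝒯.OnEdge v w t' z') (ht : t < π / 2) (ht' : t' < π / 2) :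
    dist z z' = |t - t'| := by
  refine le_antisymm (h.onEdge_dist_le hI hE hz hz') ?_
  have key : ∀ {t z}, 𝒯.OnEdge v w t z → t < π / 2 → dist v z = t := by
    intro t z hz ht
    rw [hI.dist_eq_arccos hE h.mem h.mem_v, hz.ip_eq, arccos_cos hz.mem.1 (by linarith [pi_pos])]
    rw [hz.ip_eq]
    exact cos_pos_of_mem_Ioo ⟨by linarith [hz.mem.1, pi_pos], ht⟩
  rw [← key hz ht, ← key hz' ht', dist_comm v, dist_comm v]
  exact abs_dist_sub_le _ _ _

/-- Two consecutive edges that do not belong to a common face form a geodesic. -/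
theorem Tri.onEdge_dist_corner (h : 𝒯.Tri T v a b) (h' : 𝒯.Tri T' v c d) (hI : 𝒯.IsIntrinsic)
    (hE : 𝒯.LongEdges) (hface : ∀ S ∈ 𝒯.faces, v ∈ S → a ∈ S → c ∈ S → False)
    (hz : 𝒯.OnEdge v a t z) (hz' : 𝒯.OnEdge v c t' z') (ht : t ≤ π / 4) (ht' : t' ≤ π / 4) :
    dist z z' = t + t' := by
  have hpi := pi_pos
  apply le_antisymm
  · refine (dist_triangle z v z').trans ?_
    have h1 := h.onEdge_dist_le hI hE hz h.onEdge_zero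
    have h2 := h'.onEdge_dist_le hI hE h'.onEdge_zero hz'
    rw [sub_zero, abs_of_nonneg hz.mem.1] at h1
    rw [zero_sub, abs_neg, abs_of_nonneg hz'.mem.1] at h2
    linarith
  -- No face contains both edges, so on each triangle at least one of the two functions vanishes and
  -- the difference is 1-Lipschitz. Its values at the two points are `t` and `-t'`.
  · have h1 := hI.sub_le_dist (f := fun x => 𝒯.push v a x - 𝒯.push v c x) ?_ z z'
    · have h2 := hE.push_eq_zero h'.va h.mem (hz.mem_cell h.va h.mem h.mem_v h.mem_a)
        fun _ hc => hface T h.mem h.mem_v h.mem_a hc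
      have h3 := hE.push_eq_zero h.va h'.mem (hz'.mem_cell h'.va h'.mem h'.mem_v h'.mem_a)
        fun _ hc => hface T' h'.mem h'.mem_v hc h'.mem_a
      simp only [h2, h3, hz.push_eq ht, hz'.push_eq ht'] at h1
      linarith
    · intro S hS x hx y hy
      by_cases h1 : v ∈ S ∧ a ∈ S
      · have hc : v ∈ S → c ∈ S → False := fun _ hc => hface S hS h1.1 h1.2 hc
        rw [hE.push_eq_zero h'.va hS hx hc, hE.push_eq_zero h'.va hS hy hc]
        obtain ⟨b, hb⟩ := exists_tri_of_mem_of_mem hS h1.1 h1.2 h.va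
        linarith [hb.push_sub_le hx hy]
      · have hc : v ∈ S → a ∈ S → False := fun h2 h3 => h1 ⟨h2, h3⟩
        rw [hE.push_eq_zero h.va hS hx hc, hE.push_eq_zero h.va hS hy hc]
        by_cases h2 : v ∈ S ∧ c ∈ S
        · obtain ⟨b, hb⟩ := exists_tri_of_mem_of_mem hS h2.1 h2.2 h'.va
          have := hb.push_sub_le hy hx
          rw [sphericalDist_comm] at this
          linarith
        · have hc : v ∈ S → c ∈ S → False := fun h3 h4 => h2 ⟨h3, h4⟩
          rw [hE.push_eq_zero h'.va hS hx hc, hE.push_eq_zero h'.va hS hy hc]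
          rw [sub_self]
          exact InnerProductGeometry.angle_nonneg _ _

end SphericalGluing

/-! ### Cycles of edges as closed geodesics -/

namespace SphericalGluing

variable {X : Type*} {𝒯 : SphericalGluing X} {S T T' : Finset X} {v w a b c d u x y z z' : X}
  {s t t' : ℝ}

variable [MetricSpace X]

variable (𝒯) in
/-- Closed geodesics composed of three or four edges are longer than a great circle. -/
def LongEdgeCycles : Prop :=
  ∀ k : ℕ, k = 3 ∨ k = 4 → ∀ (γ : ℝ → X) (L : ℝ),
    IsClosedGeodesic γ L → 𝒯.IsComposedOfEdges k γ L → 2 * π < L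

/-- The edges are traversed one after the other by arc length, `D` being the parameters of the
vertices. The curve is geodesic at its corners by `Tri.onEdge_dist_corner`, so the hypothesis on
geodesics composed of edges applies. -/
theorem LongEdgeCycles.two_pi_lt (hG : 𝒯.LongEdgeCycles) (hI : 𝒯.IsIntrinsic) (hE : 𝒯.LongEdges)
    {k : ℕ} (hk : k = 3 ∨ k = 4) {v : ℤ → X} (hper : ∀ i, v (i + k) = v i)
    (hadj : ∀ i, ∃ T b, 𝒯.Tri T (v i) (v (i + 1)) b)
    (hface : ∀ i, ∀ T ∈ 𝒯.faces, v i ∈ T → v (i + 1) ∈ T → v (i + 2) ∈ T → False) :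
    2 * π < ∑ i ∈ Finset.range k, 𝒯.len (v i) (v (i + 1)) := by
  have hpi := pi_gt_three
  choose F o hF using hadj
  obtain ⟨D, hD0, hD⟩ := exists_partial_sums fun i => 𝒯.len (v i) (v (i + 1))
  have hd : ∀ i, 𝒯.len (v i) (v (i + 1)) ∈ Ico (π / 2) π := fun i => hE.len_mem (hF i)
  have hD1 : ∀ i, D i + 1 ≤ D (i + 1) := fun i => by rw [hD]; linarith [(hd i).1]
  have hmono : StrictMono D := strictMono_int_of_lt_succ fun i => by linarith [hD1 i]
  set L := D k with hL
  have hsum : ∀ n : ℕ, D n = ∑ i ∈ Finset.range n, 𝒯.len (v i) (v (i + 1)) := by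
    intro n
    induction n with
    | zero => simpa using hD0
    | succ n ih => rw [Finset.sum_range_succ, ← ih]; push_cast; exact hD n
  have hDk : ∀ i, D (i + k) = D i + L := by
    intro i
    induction i using Int.induction_on with
    | zero => rw [zero_add, hD0, zero_add]
    | succ i ih =>
      rw [show (i : ℤ) + 1 + k = (i + k) + 1 by ring, hD, hD, ih, add_assoc (i : ℤ) k 1,
        add_comm (k : ℤ) 1, ← add_assoc, hper, hper]
      ring
    | pred i ih =>
      have h1 := hD (-(i : ℤ) - 1)
      have h2 := hD (-(i : ℤ) - 1 + k)
      have h3 := hper (-(i : ℤ) - 1)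
      have h4 := hper (-(i : ℤ))
      rw [show -(i : ℤ) - 1 + k + 1 = -i + k by ring, h3, h4, ih] at h2
      rw [show -(i : ℤ) - 1 + 1 = -i by ring] at h1
      linarith
  have hex : ∀ t, ∃ z i, D i ≤ t ∧ t < D (i + 1) ∧ 𝒯.OnEdge (v i) (v (i + 1)) (t - D i) z := by
    intro t
    obtain ⟨i, h1, h2⟩ := exists_mem_Ico_of_add_one_le hD1 t
    obtain ⟨z, hz⟩ := (hF i).exists_onEdge hE (t := t - D i)
      ⟨by linarith, by linarith [hD i]⟩
    exact ⟨z, i, h1, h2, hz⟩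
  choose γ J hJ1 hJ2 hJ using hex
  have hγ : ∀ i t, D i ≤ t → t ≤ D (i + 1) → 𝒯.OnEdge (v i) (v (i + 1)) (t - D i) (γ t) := by
    intro i t h1 h2
    have h3 : i < J t + 1 := hmono.lt_iff_lt.1 (h1.trans_lt (hJ2 t))
    have h4 : J t ≤ i + 1 := hmono.le_iff_le.1 ((hJ1 t).trans h2)
    have h5 := hJ t
    rcases (show J t = i ∨ J t = i + 1 by lia) with h | h
    · rwa [h] at h5
    · have h6 := hJ1 t
      rw [h] at h5 h6
      have h7 : t = D (i + 1) := le_antisymm h2 h6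
      rw [h7, sub_self] at h5
      have h8 := (hF (i + 1)).onEdge_unique hI hE h5 (hF (i + 1)).onEdge_zero
      rw [h7, h8, hD, add_sub_cancel_left]
      exact (hF i).onEdge_len
  have hγv : ∀ i, γ (D i) = v i := fun i => (hF i).onEdge_unique hI hE
    (by simpa using hγ i (D i) le_rfl (by linarith [hD1 i])) (hF i).onEdge_zero
  rw [← hsum]
  refine hG k hk γ L ⟨?_, ?_, ?_⟩ ?_
  · rw [← hD0]; exact hmono (by lia)
  · intro t
    have h1 := hγ (J t + k) (t + L) (by rw [hDk]; linarith [hJ1 t])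
      (by rw [add_right_comm, hDk]; linarith [hJ2 t])
    rw [hDk, hper, add_right_comm, hper, add_sub_add_right_eq_sub] at h1
    exact (hF (J t)).onEdge_unique hI hE h1 (hJ t)
  · intro t
    have hrev : ∀ i s, D i ≤ s → s ≤ D (i + 1) → 𝒯.OnEdge (v (i + 1)) (v i) (D (i + 1) - s) (γ s) := by
      intro i s h1 h2
      have := (hF i).onEdge_symm (hγ i s h1 h2)
      rwa [show 𝒯.len (v i) (v (i + 1)) - (s - D i) = D (i + 1) - s by rw [hD]; ring] at this
    rcases (hJ1 t).eq_or_lt with h0 | h0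
    · obtain ⟨i, hi⟩ : ∃ i, J t = i + 1 := ⟨J t - 1, by ring⟩
      rw [hi] at h0
      have hd1 := hD i
      have hd2 := hD (i + 1)
      have hl1 := (hd i).1
      have hl2 := (hd (i + 1)).1
      have hF' := (hF i).rotate.swap
      have hfc : ∀ S ∈ 𝒯.faces, v (i + 1) ∈ S → v (i + 1 + 1) ∈ S → v i ∈ S → False := by
        intro S hS h1 h2 h3
        exact hface i S hS h3 h1 (by rwa [show i + 2 = i + 1 + 1 by ring])
      have key : ∀ s ∈ Ioo (t - π / 4) (t + π / 4), ∀ s' ∈ Ioo (t - π / 4) (t + π / 4), s ≤ s' →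
          dist (γ s) (γ s') = |s - s'| := by
        intro s hs s' hs' hss
        rcases le_total t s with h1 | h1
        · rw [(hF (i + 1)).onEdge_dist_eq hI hE
            (hγ (i + 1) s (by linarith) (by linarith [hs.2]))
            (hγ (i + 1) s' (by linarith) (by linarith [hs'.2])) (by linarith [hs.2])
            (by linarith [hs'.2]), sub_sub_sub_cancel_right]
        rcases le_total s' t with h2 | h2
        · rw [hF'.onEdge_dist_eq hI hE (hrev i s (by linarith [hs.1]) (by linarith))
            (hrev i s' (by linarith [hs'.1]) (by linarith)) (by linarith [hs.1])
            (by linarith [hs'.1]), sub_sub_sub_cancel_left, abs_sub_comm]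
        · rw [dist_comm, (hF (i + 1)).onEdge_dist_corner hF' hI hE hfc
            (hγ (i + 1) s' (by linarith) (by linarith [hs'.2]))
            (hrev i s (by linarith [hs.1]) (by linarith)) (by linarith [hs'.2])
            (by linarith [hs.1]), abs_of_nonpos (by linarith)]
          ring
      refine ⟨π / 4, by linarith, fun s hs s' hs' => ?_⟩
      rcases le_total s s' with h | h
      · exact key s hs s' hs' h
      · rw [dist_comm, abs_sub_comm]; exact key s' hs' s hs h
    · have h1 := hJ2 t
      have hd1 := hD (J t)
      have hl := (hd (J t)).2
      -- An edge is shorter than `π`, so an interior point is closer than `π / 2` to one of its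
      -- endpoints, and distances along the edge are realized near that endpoint.
      rcases lt_or_ge (t - D (J t)) (π / 2) with h2 | h2
      · refine ⟨min (t - D (J t)) (min (D (J t + 1) - t) (π / 2 - (t - D (J t)))),
          lt_min (by linarith) (lt_min (by linarith) (by linarith)), fun s hs s' hs' => ?_⟩
        set ε := min (t - D (J t)) (min (D (J t + 1) - t) (π / 2 - (t - D (J t)))) with hε
        have e1 : ε ≤ t - D (J t) := min_le_left _ _
        have e2 : ε ≤ D (J t + 1) - t := (min_le_right _ _).trans (min_le_left _ _)
        have e3 : ε ≤ π / 2 - (t - D (J t)) := (min_le_right _ _).trans (min_le_right _ _)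
        rw [(hF (J t)).onEdge_dist_eq hI hE (hγ (J t) s (by linarith [hs.1]) (by linarith [hs.2]))
          (hγ (J t) s' (by linarith [hs'.1]) (by linarith [hs'.2])) (by linarith [hs.2])
          (by linarith [hs'.2]), sub_sub_sub_cancel_right]
      · have h3 : D (J t + 1) - t < π / 2 := by linarith
        refine ⟨min (t - D (J t)) (min (D (J t + 1) - t) (π / 2 - (D (J t + 1) - t))),
          lt_min (by linarith) (lt_min (by linarith) (by linarith)), fun s hs s' hs' => ?_⟩
        set ε := min (t - D (J t)) (min (D (J t + 1) - t) (π / 2 - (D (J t + 1) - t))) with hε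
        have e1 : ε ≤ t - D (J t) := min_le_left _ _
        have e2 : ε ≤ D (J t + 1) - t := (min_le_right _ _).trans (min_le_left _ _)
        have e3 : ε ≤ π / 2 - (D (J t + 1) - t) := (min_le_right _ _).trans (min_le_right _ _)
        rw [(hF (J t)).rotate.swap.onEdge_dist_eq hI hE
          (hrev (J t) s (by linarith [hs.1]) (by linarith [hs.2]))
          (hrev (J t) s' (by linarith [hs'.1]) (by linarith [hs'.2])) (by linarith [hs.1])
          (by linarith [hs'.1]), sub_sub_sub_cancel_left, abs_sub_comm]
  · refine ⟨fun n => D n, by simp [hD0, hL], fun i _ => ⟨hmono (by simp), ?_⟩⟩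
    refine ⟨F i, (hF i).mem, v i, (hF i).mem_v, v (i + 1), (hF i).mem_a, (hF i).va, hγv i,
      by push_cast; exact hγv _, ?_⟩
    ext x
    rw [(hF i).mem_edge_iff]
    push_cast
    constructor
    · rintro ⟨t, ht, rfl⟩
      exact ⟨_, hγ i t ht.1 ht.2⟩
    · rintro ⟨t, ht⟩
      have h1 := hγ i (D i + t) (by linarith [ht.mem.1]) (by rw [hD]; linarith [ht.mem.2])
      rw [add_sub_cancel_left] at h1
      exact ⟨D i + t, ⟨by linarith [ht.mem.1], by rw [hD]; linarith [ht.mem.2]⟩,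
        (hF i).onEdge_unique hI hE h1 ht⟩

end SphericalGluing

/-! ### Tetrahedra, short cycles, and the total angle at a vertex -/

namespace SphericalGluing

variable {X : Type*} {𝒯 : SphericalGluing X} {S T T' T'' T''' : Finset X}
  {v w a b c d p q r s u x y z z' : X}

/-- A nonempty set of faces that is closed under adjacency contains all faces. -/
theorem IsIntrinsic.forall_face [MetricSpace X] (hI : 𝒯.IsIntrinsic) {P : Finset X → Prop}
    (h₀ : T ∈ 𝒯.faces) (hP₀ : P T)
    (hP : ∀ S ∈ 𝒯.faces, ∀ S' ∈ 𝒯.faces, P S → (S ∩ S').card = 2 → P S') :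
    ∀ S ∈ 𝒯.faces, P S := by
  have hvert : ∀ S ∈ 𝒯.faces, ∀ S' ∈ 𝒯.faces, ∀ u ∈ S, u ∈ S' → P S → P S' := by
    intro S hS S' hS' u hu hu' hPS
    have := 𝒯.star_connected u S hS S' hS' hu hu'
    have h : S' ∈ 𝒯.faces ∧ P S' := by
      clear hS' hu'
      induction this with
      | refl => exact ⟨hS, hPS⟩
      | tail _ h ih =>
        exact ⟨h.1, hP _ ih.1 _ h.1 ih.2 h.2.2⟩
    exact h.2
  have hcell : ∀ S ∈ 𝒯.faces, ∀ S' ∈ 𝒯.faces, ∀ x ∈ 𝒯.cell S, x ∈ 𝒯.cell S' → P S → P S' := by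
    intro S hS S' hS' x hx hx' hPS
    obtain ⟨u, hu, hu0⟩ : ∃ u ∈ S, 𝒯.coord S x u ≠ 0 := by
      by_contra! h
      have h1 := inner_chart_self hS hx
      rw [inner_chart_eq_sum hS hx hx, Finset.sum_eq_zero fun u hu => by rw [h u hu, zero_mul]] at h1
      exact zero_ne_one h1
    refine hvert S hS S' hS' u hu ?_ hPS
    by_contra h
    exact hu0 (coord_eq_zero hS hx hS' hx' hu h)
  have hchain : ∀ x y ℓ, 𝒯.IsChain x y ℓ → (∃ S ∈ 𝒯.faces, P S ∧ x ∈ 𝒯.cell S) →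
      ∃ S ∈ 𝒯.faces, P S ∧ y ∈ 𝒯.cell S := by
    intro x y ℓ h
    induction h with
    | nil x => exact id
    | cons T x y z ℓ hT hx hy _ ih =>
      rintro ⟨S, hS, hPS, hxS⟩
      exact ih ⟨T, hT, hcell S hS T hT x hxS hx hPS, hy⟩
  intro S hS
  obtain ⟨x, hx⟩ : T.Nonempty := by rw [← Finset.card_pos, 𝒯.card_face T h₀]; norm_num
  obtain ⟨y, hy⟩ : S.Nonempty := by rw [← Finset.card_pos, 𝒯.card_face S hS]; norm_num
  obtain ⟨ℓ, hℓ⟩ : {ℓ : ℝ | 𝒯.IsChain x y ℓ}.Nonempty := (hI x y).nonempty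
  obtain ⟨S', hS', hPS', hy'⟩ := hchain x y ℓ hℓ ⟨T, h₀, hP₀, mem_cell_of_mem h₀ hx⟩
  exact hcell S' hS' S hS y hy' (mem_cell_of_mem hS hy) hPS'

/-- Each edge on the four vertices already has both of its faces among them, so these faces are
closed under adjacency and, by connectedness, are all the faces. -/
theorem isSimplex_of_tri [MetricSpace X] (hI : 𝒯.IsIntrinsic) (h₁ : 𝒯.Tri T v a b)
    (h₂ : 𝒯.Tri T' v b c) (h₃ : 𝒯.Tri T'' v c a) (h₄ : 𝒯.Tri T''' a b c) : 𝒯.IsSimplex := by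
  have hcard : ({v, a, b, c} : Finset X).card = 4 := by
    rw [Finset.card_insert_of_notMem (by simp [h₁.va, h₁.vb, h₂.vb]),
      Finset.card_insert_of_notMem (by simp [h₁.ab, h₄.vb]), Finset.card_pair h₂.ab]
  set s : Finset X := {v, a, b, c} with hs
  have hv : v ∈ s := by simp [hs]
  have ha : a ∈ s := by simp [hs]
  have hb : b ∈ s := by simp [hs]
  have hc : c ∈ s := by simp [hs]
  let Q : X → X → Prop := fun p q => ∃ r ∈ s, ∃ r' ∈ s, r ≠ r' ∧ ∃ R ⊆ s, ∃ R' ⊆ s,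
    𝒯.Tri R p q r ∧ 𝒯.Tri R' p q r'
  have hQs : ∀ {p q}, Q p q → Q q p := by
    rintro p q ⟨r, hr, r', hr', hne, R, hR, R', hR', h, h'⟩
    exact ⟨r, hr, r', hr', hne, R, hR, R', hR', h.rotate.swap, h'.rotate.swap⟩
  have hsub : ∀ {R p q r}, 𝒯.Tri R p q r → p ∈ s → q ∈ s → r ∈ s → R ⊆ s := by
    intro R p q r h hp hq hr x hx
    rcases h.mem_iff.1 hx with rfl | rfl | rfl <;> assumption
  have k₁ := hsub h₁ hv ha hb
  have k₂ := hsub h₂ hv hb hc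
  have k₃ := hsub h₃ hv hc ha
  have k₄ := hsub h₄ ha hb hc
  have q₁ : Q v a := ⟨b, hb, c, hc, h₂.ab, T, k₁, T'', k₃, h₁, h₃.swap⟩
  have q₂ : Q v b := ⟨a, ha, c, hc, h₄.vb, T, k₁, T', k₂, h₁.swap, h₂⟩
  have q₃ : Q v c := ⟨b, hb, a, ha, h₁.ab.symm, T', k₂, T'', k₃, h₂.swap, h₃⟩
  have q₄ : Q a b := ⟨v, hv, c, hc, h₂.vb, T, k₁, T''', k₄, h₁.rotate, h₄⟩
  have q₅ : Q b c := ⟨v, hv, a, ha, h₁.va, T', k₂, T''', k₄, h₂.rotate, h₄.rotate⟩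
  have q₆ : Q a c := ⟨v, hv, b, hb, h₁.vb, T'', k₃, T''', k₄, h₃.swap.rotate.rotate.swap.rotate.swap, h₄.swap⟩
  have hQ : ∀ p ∈ s, ∀ q ∈ s, p ≠ q → Q p q := by
    intro p hp q hq hpq
    simp only [hs, Finset.mem_insert, Finset.mem_singleton] at hp hq
    rcases hp with rfl | rfl | rfl | rfl <;> rcases hq with rfl | rfl | rfl | rfl <;>
      first
        | exact absurd rfl hpq
        | assumption
        | exact hQs (by assumption)
  refine ⟨s, hcard, ?_⟩
  ext R
  rw [Finset.mem_powersetCard]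
  constructor
  · intro hR
    refine ⟨?_, 𝒯.card_face R hR⟩
    refine hI.forall_face (P := fun R => R ⊆ s) h₁.mem k₁ ?_ R hR
    intro S _ S' hS' hSs hc2
    obtain ⟨p, q, hpq, he⟩ := Finset.card_eq_two.1 hc2
    have hp : p ∈ S ∩ S' := by rw [he]; simp
    have hq : q ∈ S ∩ S' := by rw [he]; simp
    rw [Finset.mem_inter] at hp hq
    obtain ⟨r, hr, r', hr', hne, R, -, R', -, h, h'⟩ := hQ p (hSs hp.1) q (hSs hq.1) hpq
    obtain ⟨x, hx⟩ := exists_tri_of_mem_of_mem hS' hp.2 hq.2 hpq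
    refine hsub hx (hSs hp.1) (hSs hq.1) ?_
    rcases h.eq_or_eq' h' hne hx with rfl | rfl <;> assumption
  · rintro ⟨hR, hR3⟩
    obtain ⟨p, q, r, hpq, hpr, hqr, rfl⟩ := Finset.card_eq_three.1 hR3
    have hp : p ∈ s := hR (by simp)
    have hq : q ∈ s := hR (by simp)
    have hr : r ∈ s := hR (by simp)
    obtain ⟨x, hx, x', hx', hne, R, hRs, R', hRs', h, h'⟩ := hQ p hp q hq hpq
    have hfin : ∀ {x x' R R'}, x ∈ s → x' ∈ s → x ≠ x' → 𝒯.Tri R p q x → 𝒯.Tri R' p q x' →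
        r = x ∨ r = x' := by
      intro x x' R R' hx hx' hne h h'
      by_contra! hcon
      have h5 : ({p, q, r, x, x'} : Finset X).card = 5 := by
        rw [Finset.card_insert_of_notMem (by simp [hpq, hpr, h.vb, h'.vb]),
          Finset.card_insert_of_notMem (by simp [hqr, h.ab, h'.ab]),
          Finset.card_insert_of_notMem (by simp [hcon.1, hcon.2]), Finset.card_pair hne]
      have h6 : ({p, q, r, x, x'} : Finset X) ⊆ s := by
        intro y hy
        simp only [Finset.mem_insert, Finset.mem_singleton] at hy
        rcases hy with rfl | rfl | rfl | rfl | rfl <;> assumption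
      have := Finset.card_le_card h6
      lia
    rcases hfin hx hx' hne h h' with rfl | rfl
    · rw [← h.eq]; exact h.mem
    · rw [← h'.eq]; exact h'.mem

theorem edgeLengthEq_of_ip_eq_zero (h : 𝒯.Tri T v a b) (h0 : 𝒯.ip v a = 0) :
    𝒯.EdgeLengthEq v a (π / 2) :=
  ⟨h.va, T, h.mem, h.mem_v, h.mem_a, by
    rw [sphericalDist_chart h.mem h.mem_v h.cell_a, h0, arccos_zero]⟩

variable [MetricSpace X]

theorem LongEdgeCycles.two_pi_lt_three (hG : 𝒯.LongEdgeCycles) (hI : 𝒯.IsIntrinsic)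
    (hE : 𝒯.LongEdges) (h₁ : 𝒯.Tri T a b p) (h₂ : 𝒯.Tri T' b c q) (h₃ : 𝒯.Tri T'' c a r)
    (h : ∀ S ∈ 𝒯.faces, a ∈ S → b ∈ S → c ∈ S → False) :
    2 * π < 𝒯.len a b + 𝒯.len b c + 𝒯.len c a := by
  let f : ZMod 3 → X := ![a, b, c]
  have := hG.two_pi_lt hI hE (k := 3) (Or.inl rfl) (v := fun i => f i) (fun i => by
    push_cast; rw [show (3 : ZMod 3) = 0 from rfl, add_zero]) ?_ ?_
  · simpa [Finset.sum_range_succ, f, show (1 + 1 : ZMod 3) = 2 from rfl,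
      show (2 + 1 : ZMod 3) = 0 from rfl] using this
  · intro i
    push_cast
    generalize (i : ZMod 3) = j
    fin_cases j
    exacts [⟨_, _, h₁⟩, ⟨_, _, h₂⟩, ⟨_, _, h₃⟩]
  · intro i S hS
    push_cast
    generalize (i : ZMod 3) = j
    fin_cases j
    exacts [fun h1 h2 h3 => h S hS h1 h2 h3, fun h1 h2 h3 => h S hS h3 h1 h2,
      fun h1 h2 h3 => h S hS h2 h3 h1]

theorem LongEdgeCycles.two_pi_lt_four (hG : 𝒯.LongEdgeCycles) (hI : 𝒯.IsIntrinsic)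
    (hE : 𝒯.LongEdges) (h₁ : 𝒯.Tri T a b p) (h₂ : 𝒯.Tri T' b c q) (h₃ : 𝒯.Tri T'' c d r)
    (h₄ : 𝒯.Tri T''' d a s)
    (k₁ : ∀ S ∈ 𝒯.faces, a ∈ S → b ∈ S → c ∈ S → False)
    (k₂ : ∀ S ∈ 𝒯.faces, b ∈ S → c ∈ S → d ∈ S → False)
    (k₃ : ∀ S ∈ 𝒯.faces, c ∈ S → d ∈ S → a ∈ S → False)
    (k₄ : ∀ S ∈ 𝒯.faces, d ∈ S → a ∈ S → b ∈ S → False) :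
    2 * π < 𝒯.len a b + 𝒯.len b c + 𝒯.len c d + 𝒯.len d a := by
  let f : ZMod 4 → X := ![a, b, c, d]
  have := hG.two_pi_lt hI hE (k := 4) (Or.inr rfl) (v := fun i => f i) (fun i => by
    push_cast; rw [show (4 : ZMod 4) = 0 from rfl, add_zero]) ?_ ?_
  · simpa [Finset.sum_range_succ, f, show (1 + 1 : ZMod 4) = 2 from rfl,
      show (2 + 1 : ZMod 4) = 3 from rfl, show (3 + 1 : ZMod 4) = 0 from rfl] using this
  · intro i
    push_cast
    generalize (i : ZMod 4) = j
    fin_cases j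
    exacts [⟨_, _, h₁⟩, ⟨_, _, h₂⟩, ⟨_, _, h₃⟩, ⟨_, _, h₄⟩]
  · intro i S hS
    push_cast
    generalize (i : ZMod 4) = j
    fin_cases j
    exacts [k₁ S hS, k₂ S hS, k₃ S hS, k₄ S hS]

theorem LinkCycle.hasForbiddenConfiguration (C : 𝒯.LinkCycle v) (hk : C.k = 4) (j : ℤ)
    (h : ∀ i, 𝒯.ip (C.w i) (C.w (i + 1)) = 0) (h₀ : 𝒯.ip v (C.w j) = 0)
    (h₂ : 𝒯.ip v (C.w (j + 2)) = 0) : 𝒯.HasForbiddenConfiguration := by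
  have h4 : C.w (j + 4) = C.w j := by have := C.periodic j; rwa [hk] at this
  have hl : ∀ i, 𝒯.EdgeLengthEq (C.w i) (C.w (i + 1)) (π / 2) := fun i =>
    edgeLengthEq_of_ip_eq_zero (C.tri_face i).rotate (h i)
  refine ⟨v, C.w j, C.w (j + 1), C.w (j + 2), C.w (j + 3), C.ne j, ?_, ?_, hl j, ?_, ?_, ?_,
    edgeLengthEq_of_ip_eq_zero (C.tri_face j) h₀, edgeLengthEq_of_ip_eq_zero (C.tri_face (j + 2)) h₂⟩
  · have := C.ne (j + 1); rwa [show j + 1 + 2 = j + 3 by ring] at this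
  · have e : ∀ i n : ℤ, C.face i = {v, C.w (i + n * 4), C.w (i + n * 4 + 1)} := by
      intro i n
      rw [← C.face_add_mul_period i n, hk]; rfl
    have f0 : C.face j = {v, C.w j, C.w (j + 1)} := rfl
    have f1 : C.face (j + 1) = {v, C.w (j + 1), C.w (j + 2)} := by
      rw [face, show j + 1 + 1 = j + 2 by ring]
    have f2 : C.face (j + 2) = {v, C.w (j + 2), C.w (j + 3)} := by
      rw [face, show j + 2 + 1 = j + 3 by ring]
    have f3 : C.face (j + 3) = {v, C.w (j + 3), C.w j} := by
      rw [face, show j + 3 + 1 = j + 4 by ring, h4]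
    rw [← f0, ← f1, ← f2, ← f3]
    ext R
    simp only [Finset.mem_filter, Finset.mem_insert, Finset.mem_singleton]
    constructor
    · rintro ⟨hR, hv⟩
      obtain ⟨i, hi⟩ := C.complete R hR hv
      have hi' : R = C.face i := hi
      have h5 := C.face_add_mul_period (j + (i - j) % 4) ((i - j) / 4)
      have h6 := Int.emod_add_mul_ediv (i - j) 4
      rw [hk, show j + (i - j) % 4 + (i - j) / 4 * ((4 : ℕ) : ℤ) = i by push_cast; linarith, ← hi'] at h5
      have h7 := Int.emod_nonneg (i - j) (show (4 : ℤ) ≠ 0 by norm_num)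
      have h8 := Int.emod_lt_of_pos (i - j) (show (0 : ℤ) < 4 by norm_num)
      rcases (show (i - j) % 4 = 0 ∨ (i - j) % 4 = 1 ∨ (i - j) % 4 = 2 ∨ (i - j) % 4 = 3 by lia)
        with h | h | h | h <;> rw [h] at h5
      · rw [add_zero] at h5; exact Or.inl h5
      · exact Or.inr (Or.inl h5)
      · exact Or.inr (Or.inr (Or.inl h5))
      · exact Or.inr (Or.inr (Or.inr h5))
    · rintro (rfl | rfl | rfl | rfl) <;> exact ⟨(C.tri_face _).mem, (C.tri_face _).mem_v⟩
  · have := hl (j + 1); rwa [show j + 1 + 1 = j + 2 by ring] at this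
  · have := hl (j + 2); rwa [show j + 2 + 1 = j + 3 by ring] at this
  · have := hl (j + 3); rwa [show j + 3 + 1 = j + 4 by ring, h4] at this

/-- Case distinction on the degree. Degree three gives a tetrahedron or contradicts the perimeter
estimate, degree four gives the forbidden configuration, and from degree five on the right angles
alone suffice. -/
theorem LinkCycle.two_pi_lt_total (C : 𝒯.LinkCycle v) (hI : 𝒯.IsIntrinsic) (hE : 𝒯.LongEdges)
    (hG : 𝒯.LongEdgeCycles) (hS : ¬ 𝒯.IsSimplex) (hF : ¬ 𝒯.HasForbiddenConfiguration) :
    2 * π < C.total := by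
  by_contra! hle
  have hpi := pi_pos
  have hcos : ∀ i, 𝒯.ip (C.w i) (C.w (i + 1)) = 𝒯.ip v (C.w i) * 𝒯.ip v (C.w (i + 1)) +
      𝒯.rad v (C.w i) * 𝒯.rad v (C.w (i + 1)) * cos (𝒯.pa v (C.w i) (C.w (i + 1))) := fun i =>
    (C.tri_face i).ip_a_eq_cos (C.tri_face i).cell_b
  have hang : ∀ i, 𝒯.pa v (C.w i) (C.w (i + 1)) ∈ Ico (π / 2) π := fun i => (C.tri_face i).angle_mem hE
  have hlen : ∀ i, 𝒯.len (C.w i) (C.w (i + 1)) ∈ Ico (π / 2) π := fun i =>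
    hE.len_mem (C.tri_face i).rotate
  have s0 := C.B_succ 0
  have s1 := C.B_succ 1
  have s2 := C.B_succ 2
  have s3 := C.B_succ 3
  rw [C.B_zero] at s0
  norm_num at s0 s1 s2 s3
  have a0 := hang 0
  have a1 := hang 1
  have a2 := hang 2
  have a3 := hang 3
  norm_num at a0 a1 a2 a3
  rcases (show C.k = 3 ∨ C.k = 4 ∨ 5 ≤ C.k by have := C.three_le; lia) with hk | hk | hk
  · have h3 : C.w 3 = C.w 0 := by have := C.periodic 0; rwa [hk] at this
    have ht : C.total = C.B 3 := by rw [total, hk]; rfl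
    have t0 := C.tri_face 0
    have t1 := C.tri_face 1
    have t2 := C.tri_face 2
    have c0 := hcos 0
    have c1 := hcos 1
    have c2 := hcos 2
    have l0 := hlen 0
    have l1 := hlen 1
    have l2 := hlen 2
    norm_num at t0 t1 t2 c0 c1 c2 l0 l1 l2
    rw [h3] at t2 c2 s2 a2 l2
    by_cases hf : ∃ R ∈ 𝒯.faces, C.w 0 ∈ R ∧ C.w 1 ∈ R ∧ C.w 2 ∈ R
    · obtain ⟨R, hR, m0, m1, m2⟩ := hf
      obtain ⟨x, hx⟩ := exists_tri_of_mem_of_mem hR m0 m1 t0.ab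
      have : C.w 2 = x := by
        rcases hx.mem_iff.1 m2 with h | h | h
        exacts [absurd h t2.ab, absurd h.symm t1.ab, h]
      exact hS (isSimplex_of_tri hI t0 t1 t2 (this ▸ hx))
    · push Not at hf
      have hp := hG.two_pi_lt_three hI hE t0.rotate t1.rotate t2.rotate hf
      refine absurd (perimeter_le_of_angles_le (c₁ := 𝒯.rad v (C.w 0)) (c₂ := 𝒯.rad v (C.w 1))
        (c₃ := 𝒯.rad v (C.w 2)) (k₁₂ := 𝒯.ip v (C.w 0) * 𝒯.ip v (C.w 1))
        (k₂₃ := 𝒯.ip v (C.w 1) * 𝒯.ip v (C.w 2)) (k₃₁ := 𝒯.ip v (C.w 2) * 𝒯.ip v (C.w 0))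
        (t₁₂ := 𝒯.pa v (C.w 0) (C.w 1)) (t₂₃ := 𝒯.pa v (C.w 1) (C.w 2))
        (t₃₁ := 𝒯.pa v (C.w 2) (C.w 0))
        rad_nonneg rad_nonneg ?_ ?_ ?_ ?_ (by linarith [a0.1]) a0.2.le (by linarith [a1.1, a2.1])
        (by linarith) l0.2.le l1.1 l1.2 l2.1 l2.2) (not_le.2 hp)
      -- Since `1 - rad ^ 2 = ip ^ 2`, the form is the square of one linear form.
      · intro x₁ x₂ x₃ _ _ _
        rw [rad_sq, rad_sq, rad_sq]
        nlinarith [sq_nonneg (𝒯.ip v (C.w 0) * x₁ + 𝒯.ip v (C.w 1) * x₂ + 𝒯.ip v (C.w 2) * x₃)]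
      · rw [cos_len]; linarith
      · rw [cos_len]; linarith
      · rw [cos_len]; linarith
  · have h4 : C.w 4 = C.w 0 := by have := C.periodic 0; rwa [hk] at this
    have ht : C.total = C.B 4 := by rw [total, hk]; rfl
    have hang' : ∀ i, 𝒯.pa v (C.w i) (C.w (i + 1)) = π / 2 := by
      intro i
      have e0 := C.B_add_period i
      have e1 := C.B_sub_B_ge hE (i + 1) 3
      rw [hk] at e0
      push_cast at e0 e1
      rw [show i + 1 + 3 = i + 4 by ring, e0, C.B_succ] at e1
      linarith [(hang i).1]
    -- With right angles the law of cosines equates a nonpositive number with a product of two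
    -- nonpositive ones, so both sides vanish. One of any two consecutive edges at `v` is then a
    -- quarter circle, hence so are two opposite ones.
    have hz : ∀ i, 𝒯.ip (C.w i) (C.w (i + 1)) = 0 ∧ (𝒯.ip v (C.w i) = 0 ∨ 𝒯.ip v (C.w (i + 1)) = 0) := by
      intro i
      have e0 := hcos i
      rw [hang', cos_pi_div_two, mul_zero, add_zero] at e0
      have t := C.tri_face i
      have e1 := hE.ip_nonpos t.mem t.mem_a t.mem_b t.ab
      have e2 := hE.ip_nonpos t.mem t.mem_v t.mem_a t.va
      have e3 := hE.ip_nonpos t.mem t.mem_v t.mem_b t.vb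
      have e4 := mul_nonneg_of_nonpos_of_nonpos e2 e3
      exact ⟨by linarith, mul_eq_zero.1 (by linarith)⟩
    have z0 := (hz 0).2
    have z1 := (hz 1).2
    have z2 := (hz 2).2
    have z3 := (hz 3).2
    norm_num at z0 z1 z2 z3
    rw [h4] at z3
    have hf := fun j => C.hasForbiddenConfiguration hk j fun i => (hz i).1
    have f0 := hf 0
    have f1 := hf 1
    norm_num at f0 f1
    tauto
  · have := C.B_sub_B_ge hE 0 C.k
    rw [C.B_zero, zero_add, zero_add] at this
    have h5 : (5 : ℝ) ≤ C.k := by exact_mod_cast hk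
    have h6 : C.B C.k = C.total := rfl
    nlinarith

end SphericalGluing

/-! ### Closed geodesics covered by three stars -/

namespace SphericalGluing

variable {X : Type*} {𝒯 : SphericalGluing X} {S S' S'' T T' R R' : Finset X}
  {v w a b c d u x y z v₁ v₂ v₃ v₄ : X} {γ : ℝ → X}

theorem Tri.cos_len_eq (h : 𝒯.Tri T v a b) : cos (𝒯.len a b) =
    cos (𝒯.len v a) * cos (𝒯.len v b) + sin (𝒯.len v a) * sin (𝒯.len v b) * cos (𝒯.pa v a b) := by
  rw [cos_len, cos_len, cos_len, sin_len, sin_len]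
  exact h.ip_a_eq_cos h.cell_b

variable (𝒯) in
/-- The data of a geodesic that runs through the star of `u`, then of `v`, then of `w`: `s` is the
signed height of `v` over the geodesic, `a` and `a'` are the angles of the edges `v w` and `v u` with
the perpendicular. -/
structure Turn (γ : ℝ → X) (S S' : Finset X) (v w u : X) (m mw mu c cw cu s a a' : ℝ) : Prop where
  sq : c ^ 2 + s ^ 2 = 1
  mem : a ∈ Ioo 0 π
  mem' : a' ∈ Ioo 0 π
  edge : EdgeOver c s (𝒯.len v w) a (mw - m) cw
  edge' : EdgeOver c s (𝒯.len v u) a' (m - mu) cu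
  nu_eq : ∀ t ∈ Ioo (max m (mw - π / 2)) (m + π / 2),
    𝒯.nu S v w (γ t) = sin (t - m) * cos a - s * cos (t - m) * sin a
  nu_eq' : ∀ t ∈ Ioo (m - π / 2) (min m (mu + π / 2)),
    𝒯.nu S' v u (γ t) = - (sin (t - m) * cos a') - s * cos (t - m) * sin a'

theorem Turn.height_eq {m mw mu c cw cu s α α' m' mw' mx cx s' β β' L : ℝ} {n : ℤ}
    (h : 𝒯.Turn γ S S' v w u m mw mu c cw cu s α α')
    (h' : 𝒯.Turn γ S'' S w x v mw' mx m' cw cx c s' β β') (hT : 𝒯.Tri T v w z)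
    (hL : Function.Periodic γ L) (hm : m' = m + n * L) (hmw : mw' = mw + n * L)
    (h₁ : m < mw) (h₂ : mw < m + π) (hc : 0 < c) (hcw : 0 < cw) :
    s' = s * cos (𝒯.len v w) - c * sin (𝒯.len v w) * cos α ∧
      s = s' * cos (𝒯.len v w) - cw * sin (𝒯.len v w) * cos β' := by
  refine hT.height_eq h₁ h₂ hc hcw h.sq h'.sq h.edge ?_ h.nu_eq fun t ht => ?_
  · have := h'.edge'
    rwa [hm, hmw, add_sub_add_right_eq_sub] at this
  · have h1 := h'.nu_eq' (t + n * L) (by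
      rw [hm, hmw]
      rw [mem_Ioo, lt_min_iff] at ht ⊢
      refine ⟨by linarith [ht.1], by linarith [ht.2.1], by linarith [ht.2.2]⟩)
    rwa [hmw, add_sub_add_right_eq_sub, hL.int_mul n t] at h1

theorem tri_of_mem (hT : T ∈ 𝒯.faces) (hv : v ∈ T) (ha : a ∈ T) (hb : b ∈ T) (hva : v ≠ a)
    (hvb : v ≠ b) (hab : a ≠ b) : 𝒯.Tri T v a b := by
  obtain ⟨x, hx⟩ := exists_tri_of_mem_of_mem hT hv ha hva
  rcases hx.mem_iff.1 hb with h1 | h1 | rfl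
  exacts [absurd h1.symm hvb, absurd h1.symm hab, hx]

variable [MetricSpace X]

namespace Arc

variable {m c mw cw mu cu : ℝ}

theorem exists_tri (hA : 𝒯.Arc γ v m c) (hE : 𝒯.LongEdges) : ∃ T a b, 𝒯.Tri T v a b := by
  obtain ⟨T, hT, hv, -⟩ := hE.exists_face (hA.ip_pos (s := m)
    ⟨by linarith [pi_pos], by linarith [pi_pos]⟩)
  obtain ⟨a, b, h⟩ := exists_tri_of_mem hT hv
  exact ⟨T, a, b, h⟩

theorem nonempty_linkCycle (hA : 𝒯.Arc γ v m c) (hE : 𝒯.LongEdges) : Nonempty (𝒯.LinkCycle v) := by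
  obtain ⟨T, a, b, h⟩ := hA.exists_tri hE
  obtain ⟨C, -⟩ := h.exists_linkCycle
  exact ⟨C⟩

/-- A geodesic that runs along a single face at `v`. -/
theorem turn_face (hA : 𝒯.Arc γ v m c) (hw : 𝒯.Arc γ w mw cw) (hu : 𝒯.Arc γ u mu cu)
    (hI : 𝒯.IsIntrinsic) (hE : 𝒯.LongEdges) (hγ : IsLocalGeodesic γ)
    (hΘ : ∀ v, ∀ C : 𝒯.LinkCycle v, 2 * π < C.total) (h₁ : m < mw) (h₂ : mw < m + π) (h₃ : mu < m)
    (h₄ : m < mu + π) (hR : 𝒯.Tri R v u w) :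
    ∃ s a a', 𝒯.Turn γ R R v w u m mw mu c cw cu s a a' ∧ 2 * π ≤ 𝒯.pa v u w + (a + a') ∧
      (0 < s → 2 * π < 𝒯.pa v u w + (a + a')) ∧ (s < 0 → 2 * π = 𝒯.pa v u w + (a + a')) := by
  obtain ⟨C, h0, h1⟩ := hR.exists_linkCycle
  have hB := C.B_succ 0
  rw [C.B_zero, zero_add, zero_add, h0, h1] at hB
  obtain ⟨s, a, a', e1, e2, e3, e4, e5, e6, e7, e8, e9, e10⟩ := hA.turn_oriented hw hu hI hE hγ C
    (hΘ v C) h₁ h₂ h₃ h₄ one_pos (by have := C.three_le; lia) h0 h1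
  have hf : C.face 0 = R := by rw [LinkCycle.face, h0, zero_add, h1, hR.eq]
  rw [sub_self, hf] at e9
  rw [hf] at e10
  rw [hB] at e6 e7 e8
  exact ⟨s, a, a', ⟨e1, e2, e3, e4, e5, e9, e10⟩, e6, e7, e8⟩

/-- A geodesic that runs along two adjacent faces at `v`. -/
theorem turn_two_faces (hA : 𝒯.Arc γ v m c) (hw : 𝒯.Arc γ w mw cw) (hu : 𝒯.Arc γ u mu cu)
    (hI : 𝒯.IsIntrinsic) (hE : 𝒯.LongEdges) (hγ : IsLocalGeodesic γ)
    (hΘ : ∀ v, ∀ C : 𝒯.LinkCycle v, 2 * π < C.total) (h₁ : m < mw) (h₂ : mw < m + π) (h₃ : mu < m)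
    (h₄ : m < mu + π) (hR : 𝒯.Tri R v u x) (hR' : 𝒯.Tri R' v x w) (huw : u ≠ w) :
    ∃ s a a', 𝒯.Turn γ R' R v w u m mw mu c cw cu s a a' ∧
      (0 < s → 2 * π < 𝒯.pa v u x + 𝒯.pa v x w + (a + a')) := by
  obtain ⟨C, h0, h1⟩ := hR.exists_linkCycle
  have h2 : C.w 2 = w := by
    have ht := C.tri_face 1
    rw [show (1 : ℤ) + 1 = 2 by norm_num, h1] at ht
    refine (hR.swap.eq_or_eq' hR' huw ht).resolve_left fun h => ?_
    have := C.ne 0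
    rw [h0, zero_add, h] at this
    exact this rfl
  have hB := C.B_succ 0
  have hB' := C.B_succ 1
  rw [C.B_zero, zero_add, zero_add, h0, h1] at hB
  rw [hB, show (1 : ℤ) + 1 = 2 by norm_num, h1, h2] at hB'
  obtain ⟨s, a, a', e1, e2, e3, e4, e5, -, e7, -, e9, e10⟩ := hA.turn_oriented hw hu hI hE hγ C
    (hΘ v C) h₁ h₂ h₃ h₄ two_pos (by have := C.three_le; lia) h0 h2
  have hf : C.face 0 = R := by rw [LinkCycle.face, h0, zero_add, h1, hR.eq]
  have hf' : C.face 1 = R' := by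
    rw [LinkCycle.face, h1, show (1 : ℤ) + 1 = 2 by norm_num, h2, hR'.eq]
  rw [show (2 : ℤ) - 1 = 1 by norm_num, hf'] at e9
  rw [hf] at e10
  rw [hB'] at e7
  exact ⟨s, a, a', ⟨e1, e2, e3, e4, e5, e9, e10⟩, e7⟩

end Arc

variable {m₁ m₂ m₃ m₄ c₁ c₂ c₃ c₄ L : ℝ}

theorem Arc.sqrt_sq_add {m c : ℝ} (hA : 𝒯.Arc γ v m c) : c ^ 2 + √(1 - c ^ 2) ^ 2 = 1 := by
  rw [sq_sqrt (by nlinarith [hA.pos, hA.le_one])]; ring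

/-- The stars of three vertices do not cover a closed geodesic of length at most `2 π`. -/
theorem two_pi_lt_of_three_arcs (hI : 𝒯.IsIntrinsic) (hE : 𝒯.LongEdges) (hG : 𝒯.LongEdgeCycles)
    (hΘ : ∀ v, ∀ C : 𝒯.LinkCycle v, 2 * π < C.total) (hγ : IsLocalGeodesic γ)
    (hL : Function.Periodic γ L) (A₁ : 𝒯.Arc γ v₁ m₁ c₁) (A₂ : 𝒯.Arc γ v₂ m₂ c₂)
    (A₃ : 𝒯.Arc γ v₃ m₃ c₃) (h₁₂ : m₁ < m₂) (h₁₂' : m₂ < m₁ + π) (h₂₃ : m₂ < m₃)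
    (h₂₃' : m₃ < m₂ + π) (h₃₁ : m₃ < m₁ + L) (h₃₁' : m₁ + L < m₃ + π) : 2 * π < L := by
  have A₁' : 𝒯.Arc γ v₁ (m₁ + L) c₁ := by simpa using A₁.shift hL 1
  have A₃' : 𝒯.Arc γ v₃ (m₃ - L) c₃ := by simpa [sub_eq_add_neg] using A₃.shift hL (-1)
  have n₁₂ := (A₁.ne_of_overlap A₂ h₁₂ h₁₂').symm
  have n₂₃ := (A₂.ne_of_overlap A₃ h₂₃ h₂₃').symm
  have n₃₁ := (A₃.ne_of_overlap A₁' h₃₁ h₃₁').symm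
  obtain ⟨C₁⟩ := A₁.nonempty_linkCycle hE
  obtain ⟨C₂⟩ := A₂.nonempty_linkCycle hE
  obtain ⟨C₃⟩ := A₃.nonempty_linkCycle hE
  obtain ⟨⟨F₁, hF₁, f₁, f₁'⟩, -⟩ := A₁.turn_cases A₂ A₃' hI hE hγ C₁ (hΘ _ _) h₁₂ h₁₂' (by linarith)
    (by linarith) n₁₂.symm n₃₁
  obtain ⟨⟨F₂, hF₂, f₂, f₂'⟩, -⟩ := A₂.turn_cases A₃ A₁ hI hE hγ C₂ (hΘ _ _) h₂₃ h₂₃' (by linarith)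
    (by linarith) n₂₃.symm n₁₂
  obtain ⟨⟨F₃, hF₃, f₃, f₃'⟩, -⟩ := A₃.turn_cases A₁' A₂ hI hE hγ C₃ (hΘ _ _) h₃₁ h₃₁' (by linarith)
    (by linarith) n₃₁.symm n₂₃
  obtain ⟨p₁, t₁⟩ := exists_tri_of_mem_of_mem hF₁ f₁ f₁' n₁₂
  obtain ⟨p₂, t₂⟩ := exists_tri_of_mem_of_mem hF₂ f₂ f₂' n₂₃
  obtain ⟨p₃, t₃⟩ := exists_tri_of_mem_of_mem hF₃ f₃ f₃' n₃₁
  have d₁ := hE.len_mem t₁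
  have d₂ := hE.len_mem t₂
  have d₃ := hE.len_mem t₃
  have l₁ := len_comm hF₁ f₁' f₁
  have l₂ := len_comm hF₂ f₂' f₂
  have l₃ := len_comm hF₃ f₃' f₃
  have hb : L = (m₂ - m₁) + (m₃ - m₂) + (m₁ + L - m₃) := by ring
  have e₃ : m₁ - (m₃ - L) = m₁ + L - m₃ := by ring
  rw [hb]
  by_cases hf : ∃ R ∈ 𝒯.faces, v₁ ∈ R ∧ v₂ ∈ R ∧ v₃ ∈ R
  · obtain ⟨R, hR, r₁, r₂, r₃⟩ := hf
    have R₁ : 𝒯.Tri R v₁ v₃ v₂ := tri_of_mem hR r₁ r₃ r₂ n₃₁.symm n₁₂ n₂₃.symm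
    have R₂ : 𝒯.Tri R v₂ v₁ v₃ := R₁.rotate.rotate
    have R₃ : 𝒯.Tri R v₃ v₂ v₁ := R₂.rotate.rotate
    obtain ⟨s₁, a₁, a₁', T₁, k₁, k₁', -⟩ := A₁.turn_face A₂ A₃' hI hE hγ hΘ h₁₂ h₁₂' (by linarith)
      (by linarith) R₁
    obtain ⟨s₂, a₂, a₂', T₂, k₂, k₂', -⟩ := A₂.turn_face A₃ A₁ hI hE hγ hΘ h₂₃ h₂₃' (by linarith)
      (by linarith) R₂
    obtain ⟨s₃, a₃, a₃', T₃, k₃, k₃', -⟩ := A₃.turn_face A₁' A₂ hI hE hγ hΘ h₃₁ h₃₁' (by linarith)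
      (by linarith) R₃
    obtain ⟨o₁₂, o₂₁⟩ := T₁.height_eq (n := 0) T₂ R₁.swap hL (by simp) (by simp) h₁₂ h₁₂' A₁.pos A₂.pos
    obtain ⟨o₂₃, o₃₂⟩ := T₂.height_eq (n := 0) T₃ R₂.swap hL (by simp) (by simp) h₂₃ h₂₃' A₂.pos A₃.pos
    obtain ⟨o₃₁, o₁₃⟩ := T₃.height_eq (n := -1) T₁ R₃.swap hL (by push_cast; ring) (by push_cast; ring)
      h₃₁ h₃₁' A₃.pos A₁.pos
    have w₁ := T₁.edge'
    have w₂ := T₂.edge'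
    have w₃ := T₃.edge'
    have q₁ := R₁.cos_len_eq
    have q₂ := R₂.cos_len_eq
    have q₃ := R₃.cos_len_eq
    rw [e₃, l₃] at w₁
    rw [l₁] at w₂
    rw [l₂] at w₃
    rw [l₂, l₃] at q₁
    rw [l₁, l₃] at q₂
    rw [l₁, l₂] at q₃
    have hang : ∀ {v a b}, 𝒯.Tri R v a b → 𝒯.pa v a b ∈ Ioo 0 π := fun h =>
      ⟨h.angle_pos hE, (h.angle_mem hE).2⟩
    exact two_pi_lt_of_face A₁.pos A₂.pos A₃.pos T₁.sq T₂.sq T₃.sq d₁ d₂ d₃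
      ⟨by linarith, by linarith⟩ ⟨by linarith, by linarith⟩ ⟨by linarith, by linarith⟩
      T₁.mem T₁.mem' T₂.mem' T₂.mem T₃.mem T₃.mem' T₁.edge w₁ w₂ T₂.edge T₃.edge w₃
      o₁₂ o₁₃ o₂₁ o₂₃ o₃₁ o₃₂ (hang R₁) (hang R₂) (hang R₃) (by linarith) (by linarith) (by linarith)
      k₁ k₁' (by linarith) (fun h => by linarith [k₂' h]) k₃ k₃'
  · push Not at hf
    have hp := hG.two_pi_lt_three hI hE t₁ t₂ t₃ hf
    obtain ⟨a₁, a₁', m, m', w, w', k⟩ := A₁.turn_of_not_face A₂ A₃' hI hE hγ C₁ (hΘ _ _) h₁₂ h₁₂'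
      (by linarith) (by linarith) fun T hT x y z => hf T hT x z y
    obtain ⟨a₂, a₂', n, n', x, x', l⟩ := A₂.turn_of_not_face A₃ A₁ hI hE hγ C₂ (hΘ _ _) h₂₃ h₂₃'
      (by linarith) (by linarith) fun T hT x y z => hf T hT y x z
    obtain ⟨a₃, a₃', o, o', y, y', j⟩ := A₃.turn_of_not_face A₁' A₂ hI hE hγ C₃ (hΘ _ _) h₃₁ h₃₁'
      (by linarith) (by linarith) fun T hT x y z => hf T hT z y x
    rw [e₃, l₃] at w'
    rw [l₁] at x'
    rw [l₂] at y'
    exact two_pi_lt_of_not_face A₁.pos A₂.pos A₃.pos (sqrt_nonneg _) (sqrt_nonneg _) (sqrt_nonneg _)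
      A₁.sqrt_sq_add A₂.sqrt_sq_add A₃.sqrt_sq_add d₁ d₂ d₃
      ⟨by linarith, by linarith⟩ ⟨by linarith, by linarith⟩ ⟨by linarith, by linarith⟩
      m m' n' n o o' w w' x' x y y' k (fun h => by linarith [l h]) j hp

end SphericalGluing

/-! ### Closed geodesics covered by four stars -/

namespace SphericalGluing

variable {X : Type*} [MetricSpace X] {𝒯 : SphericalGluing X} {S S' S'' T T' R R' : Finset X}
  {v w a b c d u x y z v₁ v₂ v₃ v₄ : X} {γ : ℝ → X}

namespace Arc

variable {m c mw cw mu cu : ℝ}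

theorem exists_face_of_overlap (hA : 𝒯.Arc γ v m c) (hw : 𝒯.Arc γ w mw cw) (hu : 𝒯.Arc γ u mu cu)
    (hI : 𝒯.IsIntrinsic) (hE : 𝒯.LongEdges) (hγ : IsLocalGeodesic γ)
    (hΘ : ∀ v, ∀ C : 𝒯.LinkCycle v, 2 * π < C.total) (h₁ : m < mw) (h₂ : mw < m + π) (h₃ : mu < m)
    (h₄ : m < mu + π) : (∃ T ∈ 𝒯.faces, v ∈ T ∧ w ∈ T) ∧ ∃ T ∈ 𝒯.faces, v ∈ T ∧ u ∈ T := by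
  obtain ⟨C⟩ := hA.nonempty_linkCycle hE
  obtain ⟨h, h', -⟩ := hA.turn_cases hw hu hI hE hγ C (hΘ v C) h₁ h₂ h₃ h₄ (hA.ne_of_overlap hw h₁ h₂)
    (hu.ne_of_overlap hA h₃ h₄).symm
  exact ⟨h, h'⟩

/-- The projections of the two edges add up to exactly `π`, the equality case of
`EdgeOver.pi_le_add`. -/
theorem len_eq_of_not_face (hA : 𝒯.Arc γ v m c) (hw : 𝒯.Arc γ w mw cw) (hu : 𝒯.Arc γ u mu cu)
    (hI : 𝒯.IsIntrinsic) (hE : 𝒯.LongEdges) (hγ : IsLocalGeodesic γ)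
    (hΘ : ∀ v, ∀ C : 𝒯.LinkCycle v, 2 * π < C.total) (h₁ : m < mw) (h₂ : mw < m + π) (h₃ : mu < m)
    (h₄ : m < mu + π) (hgap : mw = mu + π) (hface : ∀ T ∈ 𝒯.faces, v ∈ T → u ∈ T → w ∈ T → False) :
    𝒯.len v w = π / 2 ∧ 𝒯.len v u = π / 2 := by
  obtain ⟨⟨T, hT, t, t'⟩, ⟨T', hT', s, s'⟩⟩ :=
    hA.exists_face_of_overlap hw hu hI hE hγ hΘ h₁ h₂ h₃ h₄
  obtain ⟨C⟩ := hA.nonempty_linkCycle hE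
  have d := hE.arccos_mem hT t t' (hA.ne_of_overlap hw h₁ h₂).symm
  have d' := hE.arccos_mem hT' s s' (hu.ne_of_overlap hA h₃ h₄)
  obtain ⟨a, a', ha, ha', e, e', h⟩ := hA.turn_of_not_face hw hu hI hE hγ C (hΘ v C) h₁ h₂ h₃ h₄ hface
  exact e.eq_pi_div_two e' hA.pos (sqrt_nonneg _) d.1 d.2 d'.1 d'.2 ha.1 ha.2 ha'.1 ha'.2
    (by linarith) h

end Arc

variable {m₁ m₂ c₁ c₂ c₃ c₄ : ℝ}

/-- The edge `v₁ v₃` is a diagonal of the quadrilateral. Either a second face lies on its other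
side, and the spherical configuration of two faces is impossible, or `v₁ v₃ v₄` is a cycle of edges
without a face. -/
theorem false_of_four_arcs_of_face (hI : 𝒯.IsIntrinsic) (hE : 𝒯.LongEdges) (hG : 𝒯.LongEdgeCycles)
    (hΘ : ∀ v, ∀ C : 𝒯.LinkCycle v, 2 * π < C.total) (hγ : IsLocalGeodesic γ)
    (hL : Function.Periodic γ (2 * π)) (A₁ : 𝒯.Arc γ v₁ m₁ c₁) (A₂ : 𝒯.Arc γ v₂ m₂ c₂)
    (A₃ : 𝒯.Arc γ v₃ (m₁ + π) c₃) (A₄ : 𝒯.Arc γ v₄ (m₂ + π) c₄) (h : m₁ < m₂) (h' : m₂ < m₁ + π)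
    (hR : R ∈ 𝒯.faces) (r₁ : v₁ ∈ R) (r₂ : v₂ ∈ R) (r₃ : v₃ ∈ R) : False := by
  have A₁' : 𝒯.Arc γ v₁ (m₁ + 2 * π) c₁ := by simpa using A₁.shift hL 1
  have A₄' : 𝒯.Arc γ v₄ (m₂ - π) c₄ := by
    have := A₄.shift hL (-1)
    rwa [show m₂ + π + ((-1 : ℤ) : ℝ) * (2 * π) = m₂ - π by push_cast; ring] at this
  have n₁₂ := (A₁.ne_of_overlap A₂ h h').symm
  have n₂₃ := (A₂.ne_of_overlap A₃ (by linarith) (by linarith)).symm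
  have n₃₄ := (A₃.ne_of_overlap A₄ (by linarith) (by linarith)).symm
  have n₄₁ := (A₄.ne_of_overlap A₁' (by linarith) (by linarith)).symm
  obtain ⟨C₂⟩ := A₂.nonempty_linkCycle hE
  obtain ⟨C₃⟩ := A₃.nonempty_linkCycle hE
  have n₁₃ := A₂.turn_ne A₃ A₁ hI hE hγ C₂ (hΘ _ _) (by linarith) (by linarith) (by linarith)
    (by linarith)
  have n₂₄ := A₃.turn_ne A₄ A₂ hI hE hγ C₃ (hΘ _ _) (by linarith) (by linarith) (by linarith)
    (by linarith)
  obtain ⟨⟨F₄, hF₄, f₄, f₄'⟩, F₃, hF₃, f₃', f₃⟩ := A₄.exists_face_of_overlap A₁' A₃ hI hE hγ hΘ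
    (by linarith) (by linarith) (by linarith) (by linarith)
  have R₁ : 𝒯.Tri R v₁ v₃ v₂ := tri_of_mem hR r₁ r₃ r₂ n₁₃ n₁₂ n₂₃.symm
  have R₃ : 𝒯.Tri R v₃ v₂ v₁ := R₁.rotate
  have R₂ : 𝒯.Tri R v₂ v₁ v₃ := R₃.rotate
  have d₁₂ := hE.len_mem R₁.swap
  have d₁₃ := hE.len_mem R₁
  have d₂₃ := hE.len_mem R₂.swap
  obtain ⟨p₃, t₃⟩ := exists_tri_of_mem_of_mem hF₃ f₃ f₃' n₃₄
  obtain ⟨p₄, t₄⟩ := exists_tri_of_mem_of_mem hF₄ f₄ f₄' n₄₁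
  have d₃₄ := hE.len_mem t₃
  have d₄₁ := hE.len_mem t₄
  have l₁₂ := len_comm hR r₁ r₂
  have l₂₃ := len_comm hR r₂ r₃
  have l₁₃ := len_comm hR r₁ r₃
  have l₃₄ := len_comm hF₃ f₃ f₃'
  have l₄₁ := len_comm hF₄ f₄ f₄'
  by_cases hf : ∃ R' ∈ 𝒯.faces, v₁ ∈ R' ∧ v₃ ∈ R' ∧ v₄ ∈ R'
  · obtain ⟨R', hR', r₁', r₃', r₄'⟩ := hf
    have Q₁ : 𝒯.Tri R' v₁ v₄ v₃ := tri_of_mem hR' r₁' r₄' r₃' n₄₁.symm n₁₃ n₃₄.symm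
    have Q₄ : 𝒯.Tri R' v₄ v₃ v₁ := Q₁.rotate
    have Q₃ : 𝒯.Tri R' v₃ v₁ v₄ := Q₄.rotate
    obtain ⟨s₁, a₁, a₁', T₁, k₁⟩ := A₁.turn_two_faces A₂ A₄' hI hE hγ hΘ h h' (by linarith)
      (by linarith) Q₁ R₁ n₂₄.symm
    obtain ⟨s₂, a₂, a₂', T₂, k₂, -, k₂'⟩ := A₂.turn_face A₃ A₁ hI hE hγ hΘ (by linarith) (by linarith)
      (by linarith) (by linarith) R₂
    obtain ⟨s₃, a₃, a₃', T₃, k₃⟩ := A₃.turn_two_faces A₄ A₂ hI hE hγ hΘ (by linarith) (by linarith)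
      (by linarith) (by linarith) R₃ Q₃ n₂₄
    obtain ⟨s₄, a₄, a₄', T₄, k₄, -, k₄'⟩ := A₄.turn_face A₁' A₃ hI hE hγ hΘ (by linarith) (by linarith)
      (by linarith) (by linarith) Q₄
    obtain ⟨o₁₂, o₂₁⟩ := T₁.height_eq (n := 0) T₂ R₁.swap hL (by simp) (by simp) h h' A₁.pos A₂.pos
    obtain ⟨o₂₃, o₃₂⟩ := T₂.height_eq (n := 0) T₃ R₂.swap hL (by simp) (by simp) (by linarith)
      (by linarith) A₂.pos A₃.pos
    obtain ⟨o₃₄, o₄₃⟩ := T₃.height_eq (n := 0) T₄ Q₃.swap hL (by simp) (by simp) (by linarith)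
      (by linarith) A₃.pos A₄.pos
    obtain ⟨o₄₁, o₁₄⟩ := T₄.height_eq (n := -1) T₁ Q₄.swap hL (by push_cast; ring) (by push_cast; ring)
      (by linarith) (by linarith) A₄.pos A₁.pos
    have g₁ : m₁ - (m₂ - π) = π - (m₂ - m₁) := by ring
    have g₂ : m₁ + π - m₂ = π - (m₂ - m₁) := by ring
    have g₃ : m₂ + π - (m₁ + π) = m₂ - m₁ := by ring
    have g₄ : m₁ + 2 * π - (m₂ + π) = π - (m₂ - m₁) := by ring
    have w₁ := T₁.edge'
    have w₂ := T₂.edge'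
    have w₃ := T₃.edge'
    have w₄ := T₄.edge'
    have x₂ := T₂.edge
    have x₃ := T₃.edge
    have x₄ := T₄.edge
    rw [g₁, ← l₄₁] at w₁
    rw [← l₁₂] at w₂
    rw [g₂, ← l₂₃] at w₃
    rw [g₃, ← l₃₄] at w₄
    rw [g₂] at x₂
    rw [g₃] at x₃
    rw [g₄] at x₄
    have q₁ := R₁.cos_len_eq
    have q₂ := R₂.cos_len_eq
    have q₃ := R₃.cos_len_eq
    have q₁' := Q₁.cos_len_eq
    have q₃' := Q₃.cos_len_eq
    have q₄ := Q₄.cos_len_eq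
    rw [← l₂₃] at q₁
    rw [← l₁₂] at q₂
    rw [← l₁₂, ← l₂₃, ← l₁₃] at q₃
    rw [← l₃₄, ← l₄₁] at q₁'
    rw [← l₄₁, ← l₁₃] at q₃'
    rw [← l₁₃, ← l₃₄] at q₄
    have hang : ∀ {R v a b}, 𝒯.Tri R v a b → 𝒯.pa v a b ∈ Ioo 0 π := fun h =>
      ⟨h.angle_pos hE, (h.angle_mem hE).2⟩
    exact false_of_two_faces A₁.pos A₂.pos A₃.pos A₄.pos T₁.sq T₂.sq T₃.sq T₄.sq d₁₂ d₂₃ d₃₄ d₄₁ d₁₃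
      T₁.mem T₁.mem' T₂.mem' T₂.mem T₃.mem' T₃.mem T₄.mem T₄.mem' T₁.edge w₁ w₂ x₂ w₃ x₃ x₄ w₄
      o₁₂ o₁₄ o₂₁ o₂₃ o₃₂ o₃₄ o₄₁ o₄₃ (hang R₁) (hang Q₁) (hang R₂) (hang Q₃) (hang R₃) (hang Q₄)
      (by linarith) (by linarith) (by linarith) (by linarith) (by linarith) (by linarith)
      (fun h => by linarith [k₁ h]) (fun h => by linarith [k₃ h]) (by linarith)
      (fun h => by linarith [k₂' h]) (by linarith) (fun h => by linarith [k₄' h])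
  · push Not at hf
    -- Both edges at `v₄` have length `π / 2`, so a cycle longer than `2π` would need a diagonal
    -- longer than `π`.
    obtain ⟨e, e'⟩ := A₄.len_eq_of_not_face A₁' A₃ hI hE hγ hΘ (by linarith) (by linarith)
      (by linarith) (by linarith) (by linarith) fun T hT x y z => hf T hT z y x
    have := hG.two_pi_lt_three hI hE R₁ t₃ t₄ hf
    linarith [d₁₃.2]

/-- The stars of four vertices that follow in distances `t`, `π - t`, `t`, `π - t` do not cover a
closed geodesic. -/
theorem false_of_four_arcs (hI : 𝒯.IsIntrinsic) (hE : 𝒯.LongEdges) (hG : 𝒯.LongEdgeCycles)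
    (hΘ : ∀ v, ∀ C : 𝒯.LinkCycle v, 2 * π < C.total) (hγ : IsLocalGeodesic γ)
    (hL : Function.Periodic γ (2 * π)) (A₁ : 𝒯.Arc γ v₁ m₁ c₁) (A₂ : 𝒯.Arc γ v₂ m₂ c₂)
    (A₃ : 𝒯.Arc γ v₃ (m₁ + π) c₃) (A₄ : 𝒯.Arc γ v₄ (m₂ + π) c₄) (h : m₁ < m₂) (h' : m₂ < m₁ + π) :
    False := by
  have A₁' : 𝒯.Arc γ v₁ (m₁ + π + π) c₁ := by
    have := A₁.shift hL 1
    rwa [show m₁ + ((1 : ℤ) : ℝ) * (2 * π) = m₁ + π + π by push_cast; ring] at this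
  have A₂' : 𝒯.Arc γ v₂ (m₂ + π + π) c₂ := by
    have := A₂.shift hL 1
    rwa [show m₂ + ((1 : ℤ) : ℝ) * (2 * π) = m₂ + π + π by push_cast; ring] at this
  have A₄' : 𝒯.Arc γ v₄ (m₂ - π) c₄ := by
    have := A₄.shift hL (-1)
    rwa [show m₂ + π + ((-1 : ℤ) : ℝ) * (2 * π) = m₂ - π by push_cast; ring] at this
  -- The configuration is invariant under rotating the four vertices, shifting centers by the
  -- period, so all triples of vertices are excluded as faces.
  have k₂ : ∀ R ∈ 𝒯.faces, v₁ ∈ R → v₂ ∈ R → v₃ ∈ R → False := fun R hR =>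
    false_of_four_arcs_of_face hI hE hG hΘ hγ hL A₁ A₂ A₃ A₄ h h' hR
  have k₃ : ∀ R ∈ 𝒯.faces, v₂ ∈ R → v₃ ∈ R → v₄ ∈ R → False := fun R hR =>
    false_of_four_arcs_of_face hI hE hG hΘ hγ hL A₂ A₃ A₄ A₁' h' (by linarith) hR
  have k₄ : ∀ R ∈ 𝒯.faces, v₃ ∈ R → v₄ ∈ R → v₁ ∈ R → False := fun R hR =>
    false_of_four_arcs_of_face hI hE hG hΘ hγ hL A₃ A₄ A₁' A₂' (by linarith) (by linarith) hR
  have k₁ : ∀ R ∈ 𝒯.faces, v₄ ∈ R → v₁ ∈ R → v₂ ∈ R → False := fun R hR =>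
    false_of_four_arcs_of_face hI hE hG hΘ hγ hL A₄' A₁ (by rwa [sub_add_cancel])
      A₃ (by linarith) (by linarith) hR
  have n₁₂ := (A₁.ne_of_overlap A₂ h h').symm
  have n₂₃ := (A₂.ne_of_overlap A₃ (by linarith) (by linarith)).symm
  have n₃₄ := (A₃.ne_of_overlap A₄ (by linarith) (by linarith)).symm
  have n₄₁ := (A₄.ne_of_overlap A₁' (by linarith) (by linarith)).symm
  obtain ⟨⟨F₂, hF₂, f₂, f₂'⟩, F₁, hF₁, f₁', f₁⟩ := A₂.exists_face_of_overlap A₃ A₁ hI hE hγ hΘ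
    (by linarith) (by linarith) (by linarith) (by linarith)
  obtain ⟨⟨F₄, hF₄, f₄, f₄'⟩, F₃, hF₃, f₃', f₃⟩ := A₄.exists_face_of_overlap A₁' A₃ hI hE hγ hΘ
    (by linarith) (by linarith) (by linarith) (by linarith)
  obtain ⟨p₁, t₁⟩ := exists_tri_of_mem_of_mem hF₁ f₁ f₁' n₁₂
  obtain ⟨p₂, t₂⟩ := exists_tri_of_mem_of_mem hF₂ f₂ f₂' n₂₃
  obtain ⟨p₃, t₃⟩ := exists_tri_of_mem_of_mem hF₃ f₃ f₃' n₃₄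
  obtain ⟨p₄, t₄⟩ := exists_tri_of_mem_of_mem hF₄ f₄ f₄' n₄₁
  have := hG.two_pi_lt_four hI hE t₁ t₂ t₃ t₄ k₂ k₃ k₄ k₁
  obtain ⟨e₁, -⟩ := A₁.len_eq_of_not_face A₂ A₄' hI hE hγ hΘ h h' (by linarith)
    (by linarith) (by linarith) fun T hT x y z => k₁ T hT y x z
  obtain ⟨e₂, -⟩ := A₂.len_eq_of_not_face A₃ A₁ hI hE hγ hΘ (by linarith) (by linarith)
    (by linarith) (by linarith) (by linarith) fun T hT x y z => k₂ T hT y x z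
  obtain ⟨e₃, -⟩ := A₃.len_eq_of_not_face A₄ A₂ hI hE hγ hΘ (by linarith) (by linarith)
    (by linarith) (by linarith) (by linarith) fun T hT x y z => k₃ T hT y x z
  obtain ⟨e₄, -⟩ := A₄.len_eq_of_not_face A₁' A₃ hI hE hγ hΘ (by linarith) (by linarith)
    (by linarith) (by linarith) (by linarith) fun T hT x y z => k₄ T hT y x z
  linarith

end SphericalGluing

/-! ### Covering a closed geodesic by arcs -/

namespace SphericalGluing

variable {X : Type*} [MetricSpace X] {𝒯 : SphericalGluing X} {γ : ℝ → X} {L : ℝ}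

/-- Among the arcs through a point there is one with the last center. -/
theorem IsIntrinsic.exists_last_arc (hI : 𝒯.IsIntrinsic) (hE : 𝒯.LongEdges)
    (hγ : IsLocalGeodesic γ) (t : ℝ) : ∃ v m c, 𝒯.Arc γ v m c ∧ |t - m| < π / 2 ∧
      ∀ v' m' c', 𝒯.Arc γ v' m' c' → |t - m'| < π / 2 → m' ≤ m := by
  let M : Set ℝ := {m | ∃ v c, 𝒯.Arc γ v m c ∧ |t - m| < π / 2}
  have huniq : ∀ {v m c m' c'}, 𝒯.Arc γ v m c → 𝒯.Arc γ v m' c' → |t - m| < π / 2 →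
      |t - m'| < π / 2 → m = m' := by
    intro v m c m' c' h h' hm hm'
    rw [abs_lt] at hm hm'
    rcases lt_trichotomy m m' with hlt | heq | hlt
    · exact absurd rfl (h.ne_of_overlap h' hlt (by linarith))
    · exact heq
    · exact absurd rfl (h'.ne_of_overlap h hlt (by linarith))
  -- A vertex contributes at most one center, since overlapping arcs of one vertex coincide, and
  -- there are finitely many vertices.
  have hfin : M.Finite := by
    let f : X → ℝ := fun v =>
      if h : ∃ m c, 𝒯.Arc γ v m c ∧ |t - m| < π / 2 then h.choose else 0
    refine ((𝒯.faces.biUnion id).finite_toSet.image f).subset ?_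
    rintro m ⟨v, c, hA, hm⟩
    obtain ⟨T, a, b, hT⟩ := hA.exists_tri hE
    refine ⟨v, by simp only [Finset.mem_coe, Finset.mem_biUnion]; exact ⟨T, hT.mem, hT.mem_v⟩, ?_⟩
    have h : ∃ m c, 𝒯.Arc γ v m c ∧ |t - m| < π / 2 := ⟨m, c, hA, hm⟩
    obtain ⟨c', hA', hm'⟩ := h.choose_spec
    change (if h : ∃ m c, 𝒯.Arc γ v m c ∧ |t - m| < π / 2 then h.choose else 0) = m
    rw [dif_pos h]
    exact huniq hA' hA hm' hm
  have hne : M.Nonempty := by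
    obtain ⟨T, -, -, v, -, hv⟩ := 𝒯.exists_ip_pos (γ t)
    obtain ⟨c, m, hA, hm⟩ := hI.exists_arc hE hγ hv
    exact ⟨m, v, c, hA, hm⟩
  obtain ⟨m, ⟨v, c, hA, hm⟩, hmax⟩ := M.exists_max_image id hfin hne
  exact ⟨v, m, c, hA, hm, fun v' m' c' h h' => hmax m' ⟨v', c', h, h'⟩⟩

theorem two_pi_lt_of_isLocalGeodesic (hI : 𝒯.IsIntrinsic) (hE : 𝒯.LongEdges) (hG : 𝒯.LongEdgeCycles)
    (hΘ : ∀ v, ∀ C : 𝒯.LinkCycle v, 2 * π < C.total) (hγ : IsLocalGeodesic γ)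
    (hL : Function.Periodic γ L) (hL0 : 0 < L) : 2 * π < L := by
  by_contra! hle
  obtain ⟨v₁, m₁, c₁, A₁, -⟩ := hI.exists_last_arc hE hγ 0
  obtain ⟨v₂, m₂, c₂, A₂, h₂, k₂⟩ := hI.exists_last_arc hE hγ (m₁ + π / 2)
  obtain ⟨v₃, m₃, c₃, A₃, h₃, k₃⟩ := hI.exists_last_arc hE hγ (m₂ + π / 2)
  rw [abs_lt] at h₂ h₃
  -- Otherwise `m₃ > m₂` would compete with `m₂` for the last center at `m₁ + π / 2`.
  have g₃ : m₁ + π ≤ m₃ := by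
    by_contra! hlt
    linarith [k₂ v₃ m₃ c₃ A₃ (by rw [abs_lt]; constructor <;> linarith)]
  -- Here one or two arcs would already close up: either `v₂` both precedes and follows `v₁`,
  -- against `turn_ne`, or the arc of `v₁` overlaps its own translate.
  rcases le_or_gt (m₁ + L) m₃ with h | h
  · rcases lt_or_ge m₂ (m₁ + L) with h' | h'
    · have A₂' : 𝒯.Arc γ v₂ (m₂ - L) c₂ := by simpa [sub_eq_add_neg] using A₂.shift hL (-1)
      obtain ⟨C⟩ := A₁.nonempty_linkCycle hE
      exact A₁.turn_ne A₂ A₂' hI hE hγ C (hΘ _ C) (by linarith) (by linarith) (by linarith)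
        (by linarith) rfl
    · have A₁' : 𝒯.Arc γ v₁ (m₁ + L) c₁ := by simpa using A₁.shift hL 1
      exact A₁.ne_of_overlap A₁' (by linarith) (by linarith) rfl
  · rcases lt_or_ge (m₁ + L) (m₃ + π) with h' | h'
    · exact absurd (two_pi_lt_of_three_arcs hI hE hG hΘ hγ hL A₁ A₂ A₃ (by linarith) (by linarith)
        (by linarith) (by linarith) h h') (not_lt.2 hle)
    -- Now `m₃ + π ≤ m₁ + L ≤ m₁ + 2π ≤ m₃ + π`, so equality holds throughout. A fourth arc at
    -- exactly `m₂ + π` gives the four-vertex case; a later one makes the last three arcs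
    -- sufficient.
    · obtain rfl : L = 2 * π := by linarith
      obtain rfl : m₃ = m₁ + π := by linarith
      obtain ⟨v₄, m₄, c₄, A₄, h₄, -⟩ := hI.exists_last_arc hE hγ (m₁ + π + π / 2)
      rw [abs_lt] at h₄
      have g₄ : m₂ + π ≤ m₄ := by
        by_contra! hlt
        linarith [k₃ v₄ m₄ c₄ A₄ (by rw [abs_lt]; constructor <;> linarith)]
      rcases g₄.eq_or_lt with rfl | g₄
      · exact false_of_four_arcs hI hE hG hΘ hγ hL A₁ A₂ A₃ A₄ (by linarith) (by linarith)
      · exact lt_irrefl _ (two_pi_lt_of_three_arcs hI hE hG hΘ hγ hL A₂ A₃ A₄ (by linarith)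
          (by linarith) (by linarith) (by linarith) (by linarith) (by linarith))

end SphericalGluing

theorem proposition5p6 (X : Type*) [MetricSpace X] (hX : SatisfiesDualAndreev X)
    (γ : ℝ → X) (L : ℝ) (hγ : IsClosedGeodesic γ L) : 2 * Real.pi < L := by
  obtain ⟨-, 𝒯, hI, hS, hE, hG, hF⟩ := hX
  exact SphericalGluing.two_pi_lt_of_isLocalGeodesic hI hE hG
    (fun v C => C.two_pi_lt_total hI hE hG hS hF) hγ.2.2 hγ.2.1 hγ.1
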